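/- **Setting.** Let $n\ge 2$ and $p_1\ge p_2\ge\dots\ge p_n>0$, $\sum_i p_i=1$, where every $p_i$ is written with $b$ binary digits, i.e. $p_i=c_i2^{-b}$ with integers $c_i\ge 1$. A coding tree is a finite binary tree (left edges $0$, right edges $1$). Some incomplete internal nodes (nodes with exactly one child) are labelled masters, the other incomplete ones are slaves. A master has only a $0$-child, this child has only a $0$-child, and the child of a master is a slave. The $n$ symbols are assigned injectively to leaves and masters (leaves and masters without a symbol are allowed). $\mathcal T_0(n)$ is the set of such trees in which every incomplete internal node has only a $0$-child. $\mathcal T_1(n)$ is the set of such trees in which the root is complete, its $0$-child is a slave having only a $1$-child, and every other incomplete internal node has only a $0$-child. For a tree $T$ let $L(T)=\sum_i p_i\cdot(\text{depth of the node of symbol } i)$, and let $q_0(T)$, $q_1(T)$ be the total probability of the symbols assigned to leaves and to masters, respectively. A binary AIFV-2 code is a pair $T_0\in\mathcal T_0(n)$, $T_1\in\mathcal T_1(n)$, of average length $$L_{AIFV}(T_0,T_1)=\frac{q_0(T_1)L(T_0)+q_1(T_0)L(T_1)}{q_1(T_0)+q_0(T_1)},$$ and $L_{AIFV}(T_0,T_1)=L(T_0)$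 if $q_1(T_0)=q_0(T_1)=0$. It is optimal if it minimizes $L_{AIFV}$ over all such pairs. For real $x$ put $$E_0(x)=\min_{T\in\mathcal T_0(n)}\bigl(L(T)+q_1(T)x\bigr),\qquad E_1(x)=\min_{T\in\mathcal T_1(n)}\bigl(L(T)-q_0(T)x\bigr),$$ and let $T_0(x)$, $T_1(x)$ denote minimizers (ties broken arbitrarily). The machine is a word RAM: all intermediate values fit into words of $O(b)$ bits, and every arithmetic operation, comparison and memory access costs one step. Trees are output in pointer form. **Theorem.** There are an absolute constant $C$ and fixed programs of the following kinds, using words of $C\cdot b$ bits. 1. For $s=0,1$, a program that, for every such source and every rational $x\in[0,1]$ given as a fraction with denominator at most $2^{2(b+1)}$, constructs a tree $T_s(x)$ together with $L(T_s(x))$ and $q_{1-s}(T_s(x))$ in at most $C n^5$ steps. 2. A program that, for every interval $[l,r]\subseteq[0,1]$ of length $2^{-2(b+1)}$ with endpoints that are multiples of $2^{-2(b+1)}$, $E_0(l)\le E_1(l)$ and $E_0(r)\ge E_1(r)$, finds in at most $C$ steps, from the lines $L(T)+q_1(T)x$, $L(T)-q_0(T)x$ belonging to trees $T_0(l),T_0(r)$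 and $T_1(l),T_1(r)$, a point $x^*\in[l,r]$ with $E_0(x^*)=E_1(x^*)$. 3. With these subroutines, the binary search algorithm is the following. Start with $[l,r]=[0,1]$. Repeat until $r-l=2^{-2(b+1)}$: let $\mathrm{mid}=(l+r)/2$, evaluate $E_0(\mathrm{mid})$ and $E_1(\mathrm{mid})$ by the programs of 1, and replace $l$ by $\mathrm{mid}$ if $E_0(\mathrm{mid})<E_1(\mathrm{mid})$, and $r$ by $\mathrm{mid}$ otherwise. Then construct $T_0(l),T_1(l),T_0(r),T_1(r)$, find $x^*\in[l,r]$ by the program of 2, and output $T_0(x^*),T_1(x^*)$. On every source as above this algorithm performs exactly $2(b+1)$ halving steps; the $x^*\in[l,r]$ found is the unique real solution of $E_0(x)=E_1(x)$; every pair of minimizers $T_0(x^*),T_1(x^*)$ is an optimal binary AIFV-2 code, in particular the one that is output; and the total running time is at most $C\,n^5\,b$ steps. -/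

import Mathlib

open Finset

noncomputable section

/-! ## Sources -/

/-- A memoryless source on `n` symbols whose probabilities are written with `b` binary digits:
`p_i = weight i / 2 ^ b`, with `p_1 ≥ p_2 ≥ ⋯ ≥ p_n > 0` and `∑ p_i = 1`. -/
structure Source (n b : ℕ) where
  weight : Fin n → ℕ
  weight_pos : ∀ i, 0 < weight i
  weight_antitone : Antitone weight
  weight_sum : ∑ i, weight i = 2 ^ b

/-- The probability of the `i`-th symbol. -/
def Source.prob {n b : ℕ} (S : Source n b) (i : Fin n) : ℝ := (S.weight i : ℝ) / 2 ^ b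

/-! ## Binary AIFV-2 code trees -/

/-- Raw data of a finite binary tree with master labels and an assignment of `n` source symbols
to nodes. A node is the word of edge labels read from the root (`false` is the left edge `0`,
`true` is the right edge `1`); `code i` is the node to which symbol `i` is assigned, that is,
its codeword. -/
structure CodeTree (n : ℕ) where
  nodes : Finset (List Bool)
  masters : Finset (List Bool)
  code : Fin n → List Bool

namespace CodeTree

variable {n : ℕ}

/-- `w` is a node without children. -/
def IsLeaf (T : CodeTree n) (w : List Bool) : Prop :=
  w ∈ T.nodes ∧ ∀ a, w ++ [a] ∉ T.nodes

/-- `w` is an internal node whose only child is its `0`-child. -/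
def IsIncomplete (T : CodeTree n) (w : List Bool) : Prop :=
  w ∈ T.nodes ∧ w ++ [false] ∈ T.nodes ∧ w ++ [true] ∉ T.nodes

/-- The rules common to both trees of a code. The slave nodes are the incomplete internal nodes
that are not masters. Leaves and masters need not carry a symbol. -/
structure IsAdmissible (T : CodeTree n) : Prop where
  root_mem : [] ∈ T.nodes
  parent_mem : ∀ w a, w ++ [a] ∈ T.nodes → w ∈ T.nodes
  /-- a master is incomplete, and so is its child -/
  master_incomplete : ∀ w ∈ T.masters, T.IsIncomplete w ∧ T.IsIncomplete (w ++ [false])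
  /-- the child of a master is a slave -/
  master_child : ∀ w ∈ T.masters, w ++ [false] ∉ T.masters
  code_injective : Function.Injective T.code
  code_mem : ∀ i, T.IsLeaf (T.code i) ∨ T.code i ∈ T.masters

end CodeTree

/-- The set of coding trees `T_s`, `s = 0, 1`, for `n` symbols. In `T_0` every incomplete
internal node has only a `0`-child. In `T_1` this holds with the exception of the left child of
the root; the root of `T_1` is complete, its left child is a slave and has only a `1`-child. -/
def treeSet (n : ℕ) (s : Fin 2) : Set (CodeTree n) :=
  if s = 0 then
    {T | T.IsAdmissible ∧ ∀ w, w ++ [true] ∈ T.nodes → w ++ [false] ∈ T.nodes}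
  else
    {T | T.IsAdmissible ∧
      (∀ w, w ≠ [false] → w ++ [true] ∈ T.nodes → w ++ [false] ∈ T.nodes) ∧
      [false] ∈ T.nodes ∧ [true] ∈ T.nodes ∧
      [false, true] ∈ T.nodes ∧ [false, false] ∉ T.nodes}

section Cost

variable {n : ℕ} (p : Fin n → ℝ)

/-- Average codeword length `L(T)`. -/
def avgLen (T : CodeTree n) : ℝ := ∑ i, ((T.code i).length : ℝ) * p i

open Classical in
/-- `q_0(T)`: probability of the symbols assigned to leaves. -/
def leafProb (T : CodeTree n) : ℝ := ∑ i with T.IsLeaf (T.code i), p i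

open Classical in
/-- `q_1(T)`: probability of the symbols assigned to masters. -/
def masterProb (T : CodeTree n) : ℝ := ∑ i with T.code i ∈ T.masters, p i

/-- `q_{1-s}(T_s)`: the probability of switching to the other tree. -/
def switchProb (s : Fin 2) (T : CodeTree n) : ℝ :=
  if s = 0 then masterProb p T else leafProb p T

/-- Stationary probability of using the first, respectively the second tree. Encoding starts with
`T_0`, so that if no switch ever happens then `T_0` is used forever. -/
def stationary (T₀ T₁ : CodeTree n) (s : Fin 2) : ℝ :=
  if masterProb p T₀ + leafProb p T₁ = 0 then (if s = 0 then 1 else 0)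
  else (if s = 0 then leafProb p T₁ else masterProb p T₀) / (masterProb p T₀ + leafProb p T₁)

/-- Asymptotic average codeword length `L_AIFV(T_0, T_1)`. -/
def aifvLen (T₀ T₁ : CodeTree n) : ℝ :=
  stationary p T₀ T₁ 0 * avgLen p T₀ + stationary p T₀ T₁ 1 * avgLen p T₁

/-- `(T_0, T_1)` is an optimal binary AIFV-2 code. -/
def IsOptimalCode (T₀ T₁ : CodeTree n) : Prop :=
  T₀ ∈ treeSet n 0 ∧ T₁ ∈ treeSet n 1 ∧
    ∀ U₀ ∈ treeSet n 0, ∀ U₁ ∈ treeSet n 1, aifvLen p T₀ T₁ ≤ aifvLen p U₀ U₁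

/-- The lines `f_T(x) = L(T) + q_1(T) x` (for `s = 0`) and `g_T(x) = L(T) - q_0(T) x`
(for `s = 1`). -/
def line (s : Fin 2) (T : CodeTree n) (x : ℝ) : ℝ :=
  if s = 0 then avgLen p T + masterProb p T * x else avgLen p T - leafProb p T * x

/-- The lower envelope `E_s(x)` of the lines of all trees in `treeSet n s`. -/
def envelope (s : Fin 2) (x : ℝ) : ℝ := ⨅ T : treeSet n s, line p s T.1 x

/-- `T` is a possible value of `T_s(x)`, the minimizer of the lines at `x`. -/
def IsArgmin (s : Fin 2) (x : ℝ) (T : CodeTree n) : Prop :=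
  T ∈ treeSet n s ∧ ∀ U ∈ treeSet n s, line p s T x ≤ line p s U x

/-- The interval `[l, r]` after `k` halving steps of the binary search started on `[0, 1]`. -/
def searchInterval : ℕ → ℝ × ℝ
  | 0 => (0, 1)
  | k + 1 =>
    let l := (searchInterval k).1
    let r := (searchInterval k).2
    let mid := (l + r) / 2
    if envelope p 0 mid < envelope p 1 mid then (mid, r) else (l, mid)

end Cost

/-! ## The machine model: a word RAM with a step count

Programs use finitely many registers (named by `R`) and finitely many arrays (named by `A`), all
holding integers. Each arithmetic operation, comparison, register or array access costs one step,
and a run is legal only if all intermediate values fit into signed words of `w` bits. -/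

/-- The word operations; comparisons return `0` or `1`. -/
inductive WordOp
  | add | sub | mul | div | lt | eq

def WordOp.eval : WordOp → ℤ → ℤ → ℤ
  | .add, x, y => x + y
  | .sub, x, y => x - y
  | .mul, x, y => x * y
  | .div, x, y => x / y
  | .lt, x, y => if x < y then 1 else 0
  | .eq, x, y => if x = y then 1 else 0

inductive Expr (R A : Type)
  | const (z : ℤ)
  | reg (r : R)
  | get (a : A) (i : Expr R A)
  | op (o : WordOp) (e₁ e₂ : Expr R A)

structure RamState (R A : Type) where
  reg : R → ℤ
  arr : A → ℤ → ℤ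

namespace Expr

variable {R A : Type}

def eval (σ : RamState R A) : Expr R A → ℤ
  | const z => z
  | reg r => σ.reg r
  | get a i => σ.arr a (i.eval σ)
  | op o e₁ e₂ => o.eval (e₁.eval σ) (e₂.eval σ)

/-- The number of steps needed to evaluate the expression. -/
def cost : Expr R A → ℕ
  | const _ => 1
  | reg _ => 1
  | get _ i => i.cost + 1
  | op _ e₁ e₂ => e₁.cost + e₂.cost + 1

/-- Every value met during the evaluation has absolute value less than `2 ^ w`. -/
def Fits (w : ℕ) (σ : RamState R A) : Expr R A → Prop
  | const z => |z| < 2 ^ w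
  | reg r => |σ.reg r| < 2 ^ w
  | get a i => i.Fits w σ ∧ |σ.arr a (i.eval σ)| < 2 ^ w
  | op o e₁ e₂ => e₁.Fits w σ ∧ e₂.Fits w σ ∧ |o.eval (e₁.eval σ) (e₂.eval σ)| < 2 ^ w

end Expr

inductive Cmd (R A : Type)
  | skip
  | assign (r : R) (e : Expr R A)
  | store (a : A) (i e : Expr R A)
  | seq (c₁ c₂ : Cmd R A)
  | ite (e : Expr R A) (c₁ c₂ : Cmd R A)
  | loop (e : Expr R A) (c : Cmd R A)

/-- Sequential composition of a list of commands. -/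
def Cmd.block {R A : Type} : List (Cmd R A) → Cmd R A
  | [] => .skip
  | c :: cs => .seq c (Cmd.block cs)

namespace RamState

variable {R A : Type}

open Classical in
def setReg (σ : RamState R A) (r : R) (v : ℤ) : RamState R A :=
  { σ with reg := Function.update σ.reg r v }

open Classical in
def setArr (σ : RamState R A) (a : A) (i v : ℤ) : RamState R A :=
  { σ with arr := Function.update σ.arr a (Function.update (σ.arr a) i v) }

end RamState

/-- `Exec w c σ t τ`: with words of `w` bits, the command `c` started in state `σ` halts after
exactly `t` steps in state `τ`. In `ite` and `loop` a condition is true if its value is nonzero. -/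
inductive Exec {R A : Type} (w : ℕ) :
    Cmd R A → RamState R A → ℕ → RamState R A → Prop
  | skip (σ) : Exec w .skip σ 1 σ
  | assign (σ r e) : e.Fits w σ →
      Exec w (.assign r e) σ (e.cost + 1) (σ.setReg r (e.eval σ))
  | store (σ a i e) : i.Fits w σ → e.Fits w σ →
      Exec w (.store a i e) σ (i.cost + e.cost + 1) (σ.setArr a (i.eval σ) (e.eval σ))
  | seq (c₁ c₂ σ τ υ t₁ t₂) : Exec w c₁ σ t₁ τ → Exec w c₂ τ t₂ υ →
      Exec w (.seq c₁ c₂) σ (t₁ + t₂) υ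
  | ite_true (e c₁ c₂ σ τ t) : e.Fits w σ → e.eval σ ≠ 0 → Exec w c₁ σ t τ →
      Exec w (.ite e c₁ c₂) σ (e.cost + 1 + t) τ
  | ite_false (e c₁ c₂ σ τ t) : e.Fits w σ → e.eval σ = 0 → Exec w c₂ σ t τ →
      Exec w (.ite e c₁ c₂) σ (e.cost + 1 + t) τ
  | loop_done (e c σ) : e.Fits w σ → e.eval σ = 0 →
      Exec w (.loop e c) σ (e.cost + 1) σ
  | loop_step (e c σ τ υ t₁ t₂) : e.Fits w σ → e.eval σ ≠ 0 →
      Exec w c σ t₁ τ → Exec w (.loop e c) τ t₂ υ →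
      Exec w (.loop e c) σ (e.cost + 1 + t₁ + t₂) υ

/-! ## Names of registers and arrays -/

inductive Reg
  /-- input: the number of symbols `n` -/
  | size
  /-- input: the number of bits `b` -/
  | bits
  /-- `2 ^ (2 * (b + 1))`; the endpoints of the search are the multiples of its inverse -/
  | grid
  /-- loop counter for the computation of `grid` -/
  | count
  /-- number of halving steps performed -/
  | steps
  /-- left end, right end and midpoint of the current interval, as multiples of `1 / grid` -/
  | lo | hi | mid
  /-- argument `x = num / den` of the tree-building subroutines -/
  | num | den
  /-- result of the subroutine for tree `s`: `2 ^ b * L(T)` -/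
  | len (s : Fin 2)
  /-- result of the subroutine for tree `s`: `2 ^ b * q_{1-s}(T)` -/
  | swt (s : Fin 2)
  /-- the values `E_s(mid)`, multiplied by `2 ^ b * grid` -/
  | val (s : Fin 2)
  /-- `len s` and `swt s` for the tree `T_s(x)` with `x` the left (`side = 0`) or the right
  (`side = 1`) end of the final interval -/
  | endLen (s side : Fin 2) | endSwt (s side : Fin 2)
  /-- the intersection point `x* = xnum / xden` -/
  | xnum | xden
  /-- working registers of the subroutines -/
  | scratch (i : ℕ)

/-- The four arrays of the pointer representation of a tree. -/
inductive TreeField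
  | left | right | master | symbol

inductive Arr
  /-- input: the numbers `2 ^ b * p_i` -/
  | weight
  /-- output: the tree `T_s` -/
  | tree (s : Fin 2) (f : TreeField)
  /-- working arrays of the subroutines -/
  | scratch (i : ℕ)

abbrev Prg := Cmd Reg Arr
abbrev St := RamState Reg Arr

/-- The input is in memory (everything else is arbitrary). -/
def Loaded {n b : ℕ} (S : Source n b) (σ : St) : Prop :=
  σ.reg .size = n ∧ σ.reg .bits = b ∧ ∀ i : Fin n, σ.arr .weight (i : ℕ) = S.weight i

/-- The arrays `tree s` hold `T` in pointer form: nodes are numbered injectively by nonnegative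
integers with the root as number `0`; `left` and `right` hold the numbers of the `0`-child and the
`1`-child (`-1` if absent), `master` marks the masters by `1` (and other nodes by `0`), and
`symbol` holds for each symbol the number of its node. -/
def Represents {n : ℕ} (σ : St) (s : Fin 2) (T : CodeTree n) : Prop :=
  ∃ φ : List Bool → ℤ,
    φ [] = 0 ∧ Set.InjOn φ (T.nodes : Set (List Bool)) ∧
    (∀ w ∈ T.nodes,
      0 ≤ φ w ∧
      σ.arr (.tree s .left) (φ w) = (if w ++ [false] ∈ T.nodes then φ (w ++ [false]) else -1) ∧
      σ.arr (.tree s .right) (φ w) = (if w ++ [true] ∈ T.nodes then φ (w ++ [true]) else -1) ∧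
      σ.arr (.tree s .master) (φ w) = (if w ∈ T.masters then 1 else 0)) ∧
    ∀ i : Fin n, σ.arr (.tree s .symbol) (i : ℕ) = φ (T.code i)

/-- The two registers hold `2 ^ b * L(T)` and `2 ^ b * q_{1-s}(T)`. -/
def HoldsLine {n b : ℕ} (S : Source n b) (σ : St) (s : Fin 2) (rLen rSwt : Reg)
    (T : CodeTree n) : Prop :=
  (σ.reg rLen : ℝ) = 2 ^ b * avgLen S.prob T ∧
  (σ.reg rSwt : ℝ) = 2 ^ b * switchProb S.prob s T

/-- `dp` constructs a tree `T_s(x)` for every source and every rational `x = num / den` in `[0, 1]`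
with `den ≤ 2 ^ (2 * (b + 1))`, in at most `C * n ^ 5` steps on words of `C * b` bits. It changes
only its result registers, the arrays `tree s` and working memory. -/
def BuildsTree (C : ℕ) (s : Fin 2) (dp : Prg) : Prop :=
  ∀ (n b : ℕ) (S : Source n b) (σ : St), 2 ≤ n → Loaded S σ →
    0 ≤ σ.reg .num → σ.reg .num ≤ σ.reg .den →
    1 ≤ σ.reg .den → σ.reg .den ≤ 2 ^ (2 * (b + 1)) →
    ∃ (t : ℕ) (τ : St), Exec (C * b) dp σ t τ ∧ t ≤ C * n ^ 5 ∧
      (∀ r : Reg, r ≠ .len s → r ≠ .swt s → (∀ i, r ≠ .scratch i) → τ.reg r = σ.reg r) ∧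
      (∀ a : Arr, (∀ f, a ≠ .tree s f) → (∀ i, a ≠ .scratch i) → τ.arr a = σ.arr a) ∧
      ∃ T : CodeTree n, IsArgmin S.prob s ((σ.reg .num : ℝ) / σ.reg .den) T ∧
        Represents τ s T ∧ HoldsLine S τ s (.len s) (.swt s) T

/-- `isect` finds, in at most `C` steps on words of `C * b` bits, the intersection of the two
envelopes in an interval `[lo, hi] / grid ⊆ [0, 1]` of length `1 / grid = 2 ^ (-2 * (b + 1))` that
contains it, from the four lines that belong to trees `T_0`, `T_1` at the two ends. It changes only
`xnum`, `xden` and working memory. -/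
def FindsIntersection (C : ℕ) (isect : Prg) : Prop :=
  ∀ (n b : ℕ) (S : Source n b) (σ : St), 2 ≤ n → Loaded S σ →
    σ.reg .grid = 2 ^ (2 * (b + 1)) →
    0 ≤ σ.reg .lo → σ.reg .hi = σ.reg .lo + 1 → σ.reg .hi ≤ σ.reg .grid →
    ∀ l r : ℝ, l = (σ.reg .lo : ℝ) / σ.reg .grid → r = (σ.reg .hi : ℝ) / σ.reg .grid →
    envelope S.prob 0 l ≤ envelope S.prob 1 l → envelope S.prob 1 r ≤ envelope S.prob 0 r →
    (∀ s : Fin 2,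
      (∃ T, IsArgmin S.prob s l T ∧ HoldsLine S σ s (.endLen s 0) (.endSwt s 0) T) ∧
      (∃ T, IsArgmin S.prob s r T ∧ HoldsLine S σ s (.endLen s 1) (.endSwt s 1) T)) →
    ∃ (t : ℕ) (τ : St), Exec (C * b) isect σ t τ ∧ t ≤ C ∧
      (∀ r : Reg, r ≠ .xnum → r ≠ .xden → (∀ i, r ≠ .scratch i) → τ.reg r = σ.reg r) ∧
      (∀ a : Arr, (∀ i, a ≠ .scratch i) → τ.arr a = σ.arr a) ∧
      0 ≤ τ.reg .xnum ∧ τ.reg .xnum ≤ τ.reg .xden ∧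
      1 ≤ τ.reg .xden ∧ τ.reg .xden ≤ 2 ^ (2 * (b + 1)) ∧
      l ≤ (τ.reg .xnum : ℝ) / τ.reg .xden ∧ (τ.reg .xnum : ℝ) / τ.reg .xden ≤ r ∧
      envelope S.prob 0 ((τ.reg .xnum : ℝ) / τ.reg .xden) =
        envelope S.prob 1 ((τ.reg .xnum : ℝ) / τ.reg .xden)

/-! ## The binary search program -/

/-- Call both tree-building subroutines at `x = e / d`. -/
def callTrees (dp : Fin 2 → Prg) (e d : Expr Reg Arr) : Prg :=
  .block [.assign .num e, .assign .den d, dp 0, dp 1]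

/-- Save the two lines found by the subroutines as those of the given end of the interval. -/
def saveLines (side : Fin 2) : Prg :=
  .block [
    .assign (.endLen 0 side) (.reg (.len 0)), .assign (.endSwt 0 side) (.reg (.swt 0)),
    .assign (.endLen 1 side) (.reg (.len 1)), .assign (.endSwt 1 side) (.reg (.swt 1))]

/-- One halving step: evaluate `E_0(mid)` and `E_1(mid)` and keep one half of `[lo, hi]`. -/
def halvingStep (dp : Fin 2 → Prg) : Prg :=
  .block [
    .assign .mid (.op .div (.op .add (.reg .lo) (.reg .hi)) (.const 2)),
    callTrees dp (.reg .mid) (.reg .grid),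
    .assign (.val 0) (.op .add (.op .mul (.reg .grid) (.reg (.len 0)))
      (.op .mul (.reg .mid) (.reg (.swt 0)))),
    .assign (.val 1) (.op .sub (.op .mul (.reg .grid) (.reg (.len 1)))
      (.op .mul (.reg .mid) (.reg (.swt 1)))),
    .ite (.op .lt (.reg (.val 0)) (.reg (.val 1)))
      (.assign .lo (.reg .mid)) (.assign .hi (.reg .mid)),
    .assign .steps (.op .add (.reg .steps) (.const 1))]

/-- The binary search algorithm with tree-building subroutines `dp 0`, `dp 1` and the subroutine
`isect` for the final intersection step: compute `grid = 2 ^ (2 * (b + 1))`; halve `[0, 1]` until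
the interval has length `1 / grid`; construct the trees at both ends; intersect; construct the
trees at the intersection point. -/
def binarySearch (dp : Fin 2 → Prg) (isect : Prg) : Prg :=
  .block [
    .assign .grid (.const 1),
    .assign .count (.const 0),
    .loop (.op .lt (.reg .count) (.op .mul (.const 2) (.op .add (.reg .bits) (.const 1))))
      (.block [
        .assign .grid (.op .mul (.const 2) (.reg .grid)),
        .assign .count (.op .add (.reg .count) (.const 1))]),
    .assign .lo (.const 0),
    .assign .hi (.reg .grid),
    .assign .steps (.const 0),
    .loop (.op .sub (.op .sub (.reg .hi) (.reg .lo)) (.const 1)) (halvingStep dp),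
    callTrees dp (.reg .lo) (.reg .grid),
    saveLines 0,
    callTrees dp (.reg .hi) (.reg .grid),
    saveLines 1,
    isect,
    callTrees dp (.reg .xnum) (.reg .xden)]

end

/-! Optimality. The stationary distribution balances `q_1(T_0)` against `q_0(T_1)`, so for every
real `x` the length of a code is the average of the values at `x` of the two lines of its trees
(`aifvLen_eq`). If the envelopes meet at `x*`, their common value therefore bounds every code from
below, and any pair of minimizers at `x*` attains it (`isOptimalCode_of_argmin`).

The crossing. `E_0` is nondecreasing. `E_1` is strictly decreasing on the nonnegative reals, because
a tree of `T_1` without symbols at leaves can be given one at no cost (`exists_leafProb_ge`).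
Contracting the exceptional edge, or passing to a subtree, shows `E_0(0) < E_1(0)`
(`exists_shorter`), and the dynamic program shows `E_1(1) ≤ E_0(1)`. So the crossing is unique, lies
in `[0, 1]`, and stays in the interval during the bisection.

The final interval. Scaled by `2 ^ b`, all lines have integer coefficients, and slopes within one
family differ by at most `2 ^ b`. On an interval of length `2 ^ (-2 * (b + 1))` a third line that
dips below the lines optimal at the two ends would force an integer strictly between `0` and `1`
(`min_line_le`). So each envelope is there the minimum of two known lines, and `x*` is one of four
explicit intersection points, with a denominator small enough to call the tree builders again.

Building trees. As `q_0 + q_1 = 1`, both minimizations at `x = a / e` concern `e * L + a * q_1`. A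
tree is described level by level by the number of symbols already placed and the numbers of free
nodes on three consecutive levels. A Kraft-type count on each level (`card_level_succ_le`) and an
exchange argument that uses `0 ≤ x ≤ 1` (`costBelow_ge`) show that the value of the dynamic program
bounds the cost of every tree from below (`opt_le_cost`). The program that follows the recorded
decisions attains this value (`buildTree_halts`), which proves at once that minimizers exist at the
rational points concerned. The table has `(n + 1) ^ 4` entries of constant cost; the construction
takes O(n^3) steps of cost O(n^2), which gives `n ^ 5`.

Machine. Loop-free fragments are executed symbolically. A fixed fragment that starts from values at
most `M = 2 ^ (8 * b)` produces values below a fixed power of `M`, so words of `C * b` bits suffice.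
-/

set_option linter.unusedSimpArgs false

section

/-! ## Reasoning about word RAM programs -/

section Machine

variable {R A : Type}

namespace RamState

@[simp] theorem setReg_reg_same (σ : RamState R A) (r : R) (v : ℤ) : (σ.setReg r v).reg r = v := by
  simp [setReg]

@[simp] theorem setReg_reg_ne (σ : RamState R A) {r r' : R} (v : ℤ) (h : r' ≠ r) :
    (σ.setReg r v).reg r' = σ.reg r' := by
  simp [setReg, h]

@[simp] theorem setReg_arr (σ : RamState R A) (r : R) (v : ℤ) : (σ.setReg r v).arr = σ.arr := rfl

@[simp] theorem setArr_reg (σ : RamState R A) (a : A) (i v : ℤ) :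
    (σ.setArr a i v).reg = σ.reg := rfl

@[simp] theorem setArr_arr_same (σ : RamState R A) (a : A) (i v : ℤ) :
    (σ.setArr a i v).arr a = Function.update (σ.arr a) i v := by
  simp [setArr]

@[simp] theorem setArr_arr_ne (σ : RamState R A) {a a' : A} (i v : ℤ) (h : a' ≠ a) :
    (σ.setArr a i v).arr a' = σ.arr a' := by
  simp [setArr, h]

end RamState

namespace Expr

/-- Only registers from `P` and constants of absolute value at most `2` occur. -/
def RegsIn (P : List R) : Expr R A → Prop
  | const z => |z| ≤ 2
  | reg r => r ∈ P
  | get _ i => i.RegsIn P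
  | op _ e₁ e₂ => e₁.RegsIn P ∧ e₂.RegsIn P

/-- All array cells read during the evaluation have absolute value at most `M`. -/
def ReadsLe (M : ℤ) (σ : RamState R A) : Expr R A → Prop
  | const _ => True
  | reg _ => True
  | get a i => i.ReadsLe M σ ∧ |σ.arr a (i.eval σ)| ≤ M
  | op _ e₁ e₂ => e₁.ReadsLe M σ ∧ e₂.ReadsLe M σ

theorem one_le_cost (e : Expr R A) : 1 ≤ e.cost := by
  cases e <;> simp [cost]

theorem ReadsLe.mono {M N : ℤ} (h : M ≤ N) {σ : RamState R A} {e : Expr R A}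
    (he : e.ReadsLe M σ) : e.ReadsLe N σ := by
  induction e with
  | const z => trivial
  | reg r => trivial
  | get a i ih => exact ⟨ih he.1, he.2.trans h⟩
  | op o e₁ e₂ ih₁ ih₂ => exact ⟨ih₁ he.1, ih₂ he.2⟩

end Expr

/-- With `N ≥ 2` one has `N ^ p + N ^ q ≤ 2 * N ^ (p + q) ≤ N ^ (p + q + 1)`. The extra `1` in the
exponent is the step that `Expr.cost` charges for the operation. -/
theorem WordOp.abs_eval_le {N : ℤ} (hN : 2 ≤ N) (o : WordOp) {x y : ℤ} {p q : ℕ}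
    (hq : 1 ≤ q) (hx : |x| ≤ N ^ p) (hy : |y| ≤ N ^ q) :
    |o.eval x y| ≤ N ^ (p + q + 1) := by
  have h1 : (1 : ℤ) ≤ N ^ p := one_le_pow₀ (by linarith)
  have h2 : (1 : ℤ) ≤ N ^ q := one_le_pow₀ (by linarith)
  have hpq : N ^ p * N ^ q ≤ N ^ (p + q + 1) := by
    rw [← pow_add]; exact pow_le_pow_right₀ (by linarith) (by omega)
  have hsum : N ^ p + N ^ q ≤ N ^ (p + q + 1) := by
    have : N ^ p + N ^ q ≤ 2 * (N ^ p * N ^ q) := by nlinarith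
    have h3 : N ^ (p + q + 1) = N * (N ^ p * N ^ q) := by ring
    have : 2 * (N ^ p * N ^ q) ≤ N * (N ^ p * N ^ q) :=
      mul_le_mul_of_nonneg_right hN (by positivity)
    linarith
  have hone : (1 : ℤ) ≤ N ^ (p + q + 1) := one_le_pow₀ (by linarith)
  cases o with
  | add => exact (abs_add_le x y).trans (by linarith)
  | sub => exact (abs_sub x y).trans (by linarith)
  | mul =>
    simp only [WordOp.eval, abs_mul]
    exact (mul_le_mul hx hy (abs_nonneg _) (by positivity)).trans hpq
  | div =>
    have : |x / y| ≤ |x| := Int.abs_ediv_le_abs x y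
    exact this.trans (hx.trans (pow_le_pow_right₀ (by linarith) (by omega)))
  | lt => simp only [WordOp.eval]; split_ifs <;> simp <;> linarith
  | eq => simp only [WordOp.eval]; split_ifs <;> simp <;> linarith

namespace Expr

/-- Time bounds size: the number of evaluation steps serves as the exponent of a bound for the
value, so a fixed expression needs only a constant multiple of the word length of its arguments. -/
theorem abs_eval_le {N : ℤ} (hN : 2 ≤ N) {P : List R} {σ : RamState R A}
    (hP : ∀ r ∈ P, |σ.reg r| ≤ N) {e : Expr R A} (hr : e.RegsIn P) (he : e.ReadsLe N σ) :
    |e.eval σ| ≤ N ^ e.cost := by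
  induction e with
  | const z => simpa [cost, eval] using le_trans hr hN
  | reg r => simpa [cost, eval] using hP r hr
  | get a i ih =>
    refine he.2.trans ?_
    exact le_self_pow₀ (by linarith) (Nat.succ_ne_zero _)
  | op o e₁ e₂ ih₁ ih₂ =>
    exact o.abs_eval_le hN e₂.one_le_cost (ih₁ hr.1 he.1) (ih₂ hr.2 he.2)

theorem fits_of_pow_cost_lt {N : ℤ} (hN : 2 ≤ N) {P : List R} {σ : RamState R A} {w : ℕ}
    (hP : ∀ r ∈ P, |σ.reg r| ≤ N) {e : Expr R A} (hr : e.RegsIn P) (he : e.ReadsLe N σ)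
    (hw : N ^ e.cost < 2 ^ w) : e.Fits w σ := by
  have hmono : ∀ {a b : ℕ}, a ≤ b → N ^ a ≤ N ^ b := fun h =>
    pow_le_pow_right₀ (by linarith) h
  induction e with
  | const z => exact (abs_eval_le hN hP (e := const z) hr he).trans_lt hw
  | reg r => exact (abs_eval_le hN hP (e := reg r) hr he).trans_lt hw
  | get a i ih =>
    exact ⟨ih hr he.1 ((hmono (by simp [cost])).trans_lt hw),
      (abs_eval_le hN hP (e := get a i) hr he).trans_lt hw⟩
  | op o e₁ e₂ ih₁ ih₂ =>
    exact ⟨ih₁ hr.1 he.1 ((hmono (by simp [cost]; omega)).trans_lt hw),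
      ih₂ hr.2 he.2 ((hmono (by simp [cost]; omega)).trans_lt hw),
      (abs_eval_le hN hP (e := op o e₁ e₂) hr he).trans_lt hw⟩

end Expr

/-- `c` halts from `σ` within `T` steps in a state that satisfies `Q`. -/
def Halts (w : ℕ) (c : Cmd R A) (σ : RamState R A) (T : ℕ) (Q : RamState R A → Prop) : Prop :=
  ∃ t τ, Exec w c σ t τ ∧ t ≤ T ∧ Q τ

namespace Halts

variable {w : ℕ} {σ : RamState R A} {T T₁ T₂ : ℕ} {Q Q' : RamState R A → Prop}

theorem mono {c : Cmd R A} (h : Halts w c σ T₁ Q) (hT : T₁ ≤ T₂) (hQ : ∀ τ, Q τ → Q' τ) :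
    Halts w c σ T₂ Q' := by
  obtain ⟨t, τ, h1, h2, h3⟩ := h
  exact ⟨t, τ, h1, h2.trans hT, hQ _ h3⟩

theorem seq {c₁ c₂ : Cmd R A} (h₁ : Halts w c₁ σ T₁ Q)
    (h₂ : ∀ τ, Q τ → Halts w c₂ τ T₂ Q') : Halts w (.seq c₁ c₂) σ (T₁ + T₂) Q' := by
  obtain ⟨t, τ, h1, h2, h3⟩ := h₁
  obtain ⟨t', υ, h1', h2', h3'⟩ := h₂ τ h3
  exact ⟨_, _, .seq _ _ _ _ _ _ _ h1 h1', by omega, h3'⟩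

theorem skip (h : Q σ) : Halts w .skip σ 1 Q := ⟨_, _, .skip _, le_rfl, h⟩

theorem block_nil (h : Q σ) : Halts w (Cmd.block []) σ 1 Q := skip h

theorem block_cons {c : Cmd R A} {cs : List (Cmd R A)} (h₁ : Halts w c σ T₁ Q)
    (h₂ : ∀ τ, Q τ → Halts w (Cmd.block cs) τ T₂ Q') :
    Halts w (Cmd.block (c :: cs)) σ (T₁ + T₂) Q' := h₁.seq h₂

/-- A loop with invariant `I`, indexed by a variant that decreases in every round. -/
theorem loop {I : ℕ → RamState R A → Prop} {e : Expr R A} {c : Cmd R A}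
    (hfit : ∀ k σ, I k σ → e.Fits w σ)
    (hstep : ∀ k σ, I k σ → e.eval σ ≠ 0 → Halts w c σ T (fun τ => ∃ j < k, I j τ)) (k : ℕ)
    (h : I k σ) :
    Halts w (.loop e c) σ ((k + 1) * (T + e.cost + 1)) (fun τ => (∃ j, I j τ) ∧ e.eval τ = 0) := by
  induction k using Nat.strong_induction_on generalizing σ with
  | _ k ih =>
    by_cases h0 : e.eval σ = 0
    · exact ⟨_, _, .loop_done _ _ _ (hfit _ _ h) h0, by nlinarith, ⟨_, h⟩, h0⟩
    · obtain ⟨t, τ, h1, h2, j, hj, h3⟩ := hstep _ _ h h0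
      obtain ⟨t', υ, h1', h2', h3'⟩ := ih j hj h3
      refine ⟨_, _, .loop_step _ _ _ _ _ _ _ (hfit _ _ h) h0 h1 h1', ?_, h3'⟩
      have : (j + 1) * (T + e.cost + 1) ≤ k * (T + e.cost + 1) :=
        Nat.mul_le_mul_right _ hj
      nlinarith

theorem ite {e : Expr R A} {c₁ c₂ : Cmd R A} (hfit : e.Fits w σ)
    (h₁ : e.eval σ ≠ 0 → Halts w c₁ σ T Q) (h₂ : e.eval σ = 0 → Halts w c₂ σ T Q) :
    Halts w (.ite e c₁ c₂) σ (e.cost + 1 + T) Q := by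
  by_cases h0 : e.eval σ = 0
  · obtain ⟨t, τ, a, b, c⟩ := h₂ h0
    exact ⟨_, _, .ite_false _ _ _ _ _ _ hfit h0 a, by omega, c⟩
  · obtain ⟨t, τ, a, b, c⟩ := h₁ h0
    exact ⟨_, _, .ite_true _ _ _ _ _ _ hfit h0 a, by omega, c⟩

end Halts

namespace Cmd

/-- Symbolic execution of a loop-free command: `P` lists the registers known to be bounded, `M`
bounds the array cells that are read, and `Q` has to hold at the end. -/
def wp (M : ℤ) : Cmd R A → List R → RamState R A → (List R → RamState R A → Prop) → Prop
  | skip, P, σ, Q => Q P σ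
  -- Whatever `r` held before, its new value is computed from bounded values, so `r` joins `P`.
  | assign r e, P, σ, Q => e.RegsIn P ∧ e.ReadsLe M σ ∧ Q (r :: P) (σ.setReg r (e.eval σ))
  | store a i e, P, σ, Q => (i.RegsIn P ∧ i.ReadsLe M σ) ∧ (e.RegsIn P ∧ e.ReadsLe M σ) ∧
      Q P (σ.setArr a (i.eval σ) (e.eval σ))
  | seq c₁ c₂, P, σ, Q => c₁.wp M P σ (fun P τ => c₂.wp M P τ Q)
  | ite e c₁ c₂, P, σ, Q => (e.RegsIn P ∧ e.ReadsLe M σ) ∧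
      (e.eval σ ≠ 0 → c₁.wp M P σ Q) ∧ (e.eval σ = 0 → c₂.wp M P σ Q)
  -- Loops are left to `Halts.loop`, which needs an invariant.
  | loop _ _, _, _, _ => False

/-- The exponent by which a loop-free command can enlarge a bound on all values. -/
def growth : Cmd R A → ℕ
  | skip => 1
  | assign _ e => e.cost
  | store _ i e => i.cost + e.cost
  | seq c₁ c₂ => c₁.growth * c₂.growth
  | ite e c₁ c₂ => e.cost * (c₁.growth * c₂.growth)
  | loop _ _ => 1

/-- The maximal number of steps of a loop-free command. -/
def maxCost : Cmd R A → ℕ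
  | skip => 1
  | assign _ e => e.cost + 1
  | store _ i e => i.cost + e.cost + 1
  | seq c₁ c₂ => c₁.maxCost + c₂.maxCost
  | ite e c₁ c₂ => e.cost + 1 + (c₁.maxCost + c₂.maxCost)
  | loop _ _ => 0

theorem one_le_growth (c : Cmd R A) : 1 ≤ c.growth := by
  induction c with
  | skip => simp [growth]
  | assign r e => exact e.one_le_cost
  | store a i e => have := e.one_le_cost; simp only [growth]; omega
  | seq c₁ c₂ h₁ h₂ => exact Nat.mul_pos h₁ h₂
  | ite e c₁ c₂ h₁ h₂ => exact Nat.mul_pos e.one_le_cost (Nat.mul_pos h₁ h₂)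
  | loop e c h => simp [growth]

/-- The register bound `N` may grow from command to command, whereas the bound `M` on the cells that
are read stays fixed. In a sequence the second command starts from the bound `N ^ growth` left by
the first, which is why growths multiply. -/
theorem wp.halts_aux {M N : ℤ} (hM : 2 ≤ M) (hMN : M ≤ N) {c : Cmd R A} {w : ℕ}
    {σ : RamState R A} {P : List R} {Q : List R → RamState R A → Prop}
    (hP : ∀ r ∈ P, |σ.reg r| ≤ N) (hwp : c.wp M P σ Q) (hw : N ^ c.growth < 2 ^ w) :
    Halts w c σ c.maxCost
      (fun τ => ∃ P', (∀ r ∈ P', |τ.reg r| ≤ N ^ c.growth) ∧ Q P' τ) := by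
  have hmono : ∀ {N : ℤ}, M ≤ N → ∀ {a b : ℕ}, a ≤ b → N ^ a ≤ N ^ b := fun h _ _ h' =>
    pow_le_pow_right₀ (by linarith) h'
  have hself : ∀ {N : ℤ}, M ≤ N → ∀ {a : ℕ}, 1 ≤ a → N ≤ N ^ a := fun h a h' => by
    simpa using hmono h h'
  induction c generalizing σ P Q N with
  | skip => exact Halts.skip ⟨P, by simpa [growth] using hP, hwp⟩
  | assign r e =>
    obtain ⟨h1, h2, h3⟩ := hwp
    have h2' := h2.mono hMN
    refine ⟨_, _, .assign _ _ _ (Expr.fits_of_pow_cost_lt (hM.trans hMN) hP h1 h2' hw),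
      le_rfl, _, ?_, h3⟩
    intro r' hr'
    by_cases hrr : r' = r
    · subst hrr
      rw [RamState.setReg_reg_same]
      exact Expr.abs_eval_le (hM.trans hMN) hP h1 h2'
    · rw [RamState.setReg_reg_ne _ _ hrr]
      exact (hP r' (by simpa [hrr] using hr')).trans (hself hMN e.one_le_cost)
  | store a i e =>
    obtain ⟨⟨h1, h2⟩, ⟨h1', h2'⟩, h3⟩ := hwp
    refine ⟨_, _, .store _ _ _ _
      (Expr.fits_of_pow_cost_lt (hM.trans hMN) hP h1 (h2.mono hMN) ((hmono hMN ?_).trans_lt hw))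
      (Expr.fits_of_pow_cost_lt (hM.trans hMN) hP h1' (h2'.mono hMN)
        ((hmono hMN ?_).trans_lt hw)), le_rfl, P, ?_, h3⟩
    · simp [growth]
    · simp [growth]
    · intro r hr
      exact (hP r hr).trans (hself hMN (one_le_growth (.store a i e)))
  | seq c₁ c₂ ih₁ ih₂ =>
    have h1 := c₁.one_le_growth
    have h2 := c₂.one_le_growth
    have hN' : N ≤ N ^ c₁.growth := hself hMN h1
    refine (ih₁ hMN hP hwp ((hmono hMN ?_).trans_lt hw)).seq ?_
    · simp only [growth]; nlinarith
    · rintro τ ⟨P', hP', hQ⟩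
      have e : N ^ (c₁.seq c₂).growth = (N ^ c₁.growth) ^ c₂.growth := by
        rw [growth, pow_mul]
      rw [e]
      exact ih₂ (hMN.trans hN') hP' hQ (by rw [← e]; exact hw)
  | ite e c₁ c₂ ih₁ ih₂ =>
    obtain ⟨⟨h1, h2⟩, h3, h4⟩ := hwp
    have g1 := c₁.one_le_growth
    have g2 := c₂.one_le_growth
    have g0 := e.one_le_cost
    have g12 : 1 ≤ c₁.growth * c₂.growth := Nat.mul_pos g1 g2
    have k1 : c₁.growth ≤ (ite e c₁ c₂).growth := by simp only [growth]; nlinarith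
    have k2 : c₂.growth ≤ (ite e c₁ c₂).growth := by simp only [growth]; nlinarith
    have k0 : e.cost ≤ (ite e c₁ c₂).growth := by simp only [growth]; nlinarith
    refine Halts.ite (Expr.fits_of_pow_cost_lt (hM.trans hMN) hP h1 (h2.mono hMN)
      ((hmono hMN k0).trans_lt hw)) (fun h0 => ?_) (fun h0 => ?_)
    · refine (ih₁ hMN hP (h3 h0) ((hmono hMN k1).trans_lt hw)).mono (by omega) ?_
      rintro τ ⟨P', a, b⟩
      exact ⟨P', fun r hr => (a r hr).trans (hmono hMN k1), b⟩
    · refine (ih₂ hMN hP (h4 h0) ((hmono hMN k2).trans_lt hw)).mono (by omega) ?_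
      rintro τ ⟨P', a, b⟩
      exact ⟨P', fun r hr => (a r hr).trans (hmono hMN k2), b⟩
  | loop e c ih => exact hwp.elim

/-- Symbolic execution is sound on words that can hold the values met. -/
theorem wp.halts {M : ℤ} (hM : 2 ≤ M) {c : Cmd R A} {w : ℕ} (P : List R) {σ : RamState R A}
    {Q : RamState R A → Prop} (hP : ∀ r ∈ P, |σ.reg r| ≤ M) (hw : M ^ c.growth < 2 ^ w)
    (hwp : c.wp M P σ (fun _ => Q)) : Halts w c σ c.maxCost Q :=
  (wp.halts_aux hM le_rfl hP hwp hw).mono le_rfl (fun _ ⟨_, _, h⟩ => h)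

/-- The command does not write to the register `r`. -/
def KeepsReg (r : R) : Cmd R A → Prop
  | skip => True
  | assign r' _ => r ≠ r'
  | store _ _ _ => True
  | seq c₁ c₂ => c₁.KeepsReg r ∧ c₂.KeepsReg r
  | ite _ c₁ c₂ => c₁.KeepsReg r ∧ c₂.KeepsReg r
  | loop _ c => c.KeepsReg r

/-- The command does not write to the array `a`. -/
def KeepsArr (a : A) : Cmd R A → Prop
  | skip => True
  | assign _ _ => True
  | store a' _ _ => a ≠ a'
  | seq c₁ c₂ => c₁.KeepsArr a ∧ c₂.KeepsArr a
  | ite _ c₁ c₂ => c₁.KeepsArr a ∧ c₂.KeepsArr a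
  | loop _ c => c.KeepsArr a

end Cmd

/-- A frame rule decided by the syntax alone: for concrete programs the hypothesis is settled by
`simp`. -/
theorem Exec.reg_eq {w : ℕ} {c : Cmd R A} {σ τ : RamState R A} {t : ℕ} (h : Exec w c σ t τ)
    {r : R} (hr : c.KeepsReg r) : τ.reg r = σ.reg r := by
  induction h with
  | skip | loop_done => rfl
  | assign σ r' e _ => exact RamState.setReg_reg_ne _ _ hr
  | store => rfl
  | seq _ _ _ _ _ _ _ _ _ ih₁ ih₂ => rw [ih₂ hr.2, ih₁ hr.1]
  | ite_true _ _ _ _ _ _ _ _ _ ih => exact ih hr.1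
  | ite_false _ _ _ _ _ _ _ _ _ ih => exact ih hr.2
  | loop_step _ _ _ _ _ _ _ _ _ _ _ ih₁ ih₂ => rw [ih₂ hr, ih₁ hr]

theorem Exec.arr_eq {w : ℕ} {c : Cmd R A} {σ τ : RamState R A} {t : ℕ} (h : Exec w c σ t τ)
    {a : A} (ha : c.KeepsArr a) : τ.arr a = σ.arr a := by
  induction h with
  | skip | loop_done | assign => rfl
  | store σ a' i e _ _ => exact RamState.setArr_arr_ne _ _ _ ha
  | seq _ _ _ _ _ _ _ _ _ ih₁ ih₂ => rw [ih₂ ha.2, ih₁ ha.1]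
  | ite_true _ _ _ _ _ _ _ _ _ ih => exact ih ha.1
  | ite_false _ _ _ _ _ _ _ _ _ ih => exact ih ha.2
  | loop_step _ _ _ _ _ _ _ _ _ _ _ ih₁ ih₂ => rw [ih₂ ha, ih₁ ha]

theorem Halts.keeping {w : ℕ} {c : Cmd R A} {σ : RamState R A} {T : ℕ}
    {Q : RamState R A → Prop} (h : Halts w c σ T Q) :
    Halts w c σ T (fun τ => Q τ ∧ (∀ r, c.KeepsReg r → τ.reg r = σ.reg r) ∧
      ∀ a, c.KeepsArr a → τ.arr a = σ.arr a) := by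
  obtain ⟨t, τ, h1, h2, h3⟩ := h
  exact ⟨t, τ, h1, h2, h3, fun _ h => h1.reg_eq h, fun _ h => h1.arr_eq h⟩

end Machine

end

section

/-! ## The dynamic program -/

namespace Source

variable {n b : ℕ} (S : Source n b)

/-- The weight of symbol `i`, and `0` beyond the last symbol. -/
def wt (i : ℕ) : ℤ := if h : i < n then S.weight ⟨i, h⟩ else 0

/-- The total weight of the symbols from `i` on. -/
def suffix (i : ℕ) : ℤ := ∑ j ∈ univ.filter (fun j : Fin n => i ≤ (j : ℕ)), (S.weight j : ℤ)

theorem wt_val (i : Fin n) : S.wt i = S.weight i := by simp [wt]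

theorem wt_nonneg (i : ℕ) : 0 ≤ S.wt i := by
  unfold wt; split_ifs <;> simp

theorem suffix_nonneg (i : ℕ) : 0 ≤ S.suffix i := by
  unfold suffix; positivity

theorem suffix_succ (i : ℕ) : S.suffix i = S.wt i + S.suffix (i + 1) := by
  unfold suffix wt
  split_ifs with h
  · have : (univ.filter fun j : Fin n => i ≤ (j : ℕ)) =
        insert ⟨i, h⟩ (univ.filter fun j : Fin n => i + 1 ≤ (j : ℕ)) := by
      ext j; simp only [mem_filter, mem_univ, true_and, mem_insert, Fin.ext_iff]; omega
    rw [this, sum_insert (by simp)]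
  · rw [zero_add]
    refine sum_congr ?_ fun _ _ => rfl
    ext j; simp only [mem_filter, mem_univ, true_and]; omega

theorem suffix_of_le {i : ℕ} (h : n ≤ i) : S.suffix i = 0 := by
  unfold suffix
  refine sum_eq_zero fun j hj => ?_
  simp only [mem_filter, mem_univ, true_and] at hj; omega

theorem suffix_zero : S.suffix 0 = 2 ^ b := by
  unfold suffix
  simp only [zero_le, filter_true]
  exact_mod_cast S.weight_sum

theorem suffix_antitone : Antitone S.suffix :=
  antitone_nat_of_succ_le fun i => by rw [S.suffix_succ i]; linarith [S.wt_nonneg i]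

theorem suffix_le (i : ℕ) : S.suffix i ≤ 2 ^ b := by
  rw [← S.suffix_zero]; exact S.suffix_antitone (Nat.zero_le i)

theorem wt_le (i : ℕ) : S.wt i ≤ 2 ^ b := by
  linarith [S.suffix_succ i, S.suffix_nonneg (i + 1), S.suffix_le i]

theorem suffix_pos {i : ℕ} (h : i < n) : 0 < S.suffix i := by
  rw [S.suffix_succ]
  have : 0 < S.wt i := by simpa [wt, h] using S.weight_pos _
  linarith [S.suffix_nonneg (i + 1)]

/-- The last symbols are the lightest ones. -/
theorem suffix_card_le (X : Finset (Fin n)) :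
    S.suffix (n - X.card) ≤ ∑ j ∈ X, (S.weight j : ℤ) := by
  have hXn : X.card ≤ n := by simpa using card_le_univ X
  rcases Nat.eq_zero_or_pos X.card with h0 | h0
  · rw [h0, S.suffix_of_le (by omega)]; positivity
  -- `Y` consists of the lightest `X.card` symbols. `Y \ X` and `X \ Y` have equally many elements,
  -- and the weight `c` at the threshold index separates their weights.
  set Y : Finset (Fin n) := univ.filter fun j : Fin n => n - X.card ≤ (j : ℕ) with hY
  have hYc : Y.card = X.card := by
    have : Y = Finset.Ici (⟨n - X.card, by omega⟩ : Fin n) := by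
      ext j; simp [hY, Fin.le_def]
    rw [this, Fin.card_Ici]; simp only []; omega
  have hd : (Y \ X).card = (X \ Y).card := card_sdiff_comm hYc
  obtain ⟨c, hc⟩ : ∃ c : ℤ, c = S.weight ⟨n - X.card, by omega⟩ := ⟨_, rfl⟩
  have h1 : ∑ j ∈ Y \ X, (S.weight j : ℤ) ≤ (Y \ X).card • c := by
    refine sum_le_card_nsmul _ _ _ fun j hj => ?_
    simp only [hY, mem_sdiff, mem_filter, mem_univ, true_and] at hj
    rw [hc]
    exact_mod_cast S.weight_antitone (show (⟨n - X.card, by omega⟩ : Fin n) ≤ j from hj.1)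
  have h2 : (X \ Y).card • c ≤ ∑ j ∈ X \ Y, (S.weight j : ℤ) := by
    refine card_nsmul_le_sum _ _ _ fun j hj => ?_
    simp only [hY, mem_sdiff, mem_filter, mem_univ, true_and, not_le] at hj
    rw [hc]
    exact_mod_cast S.weight_antitone (show j ≤ (⟨n - X.card, by omega⟩ : Fin n) from hj.2.le)
  have h3 := sum_inter_add_sum_sdiff Y X (fun j => (S.weight j : ℤ))
  have h4 := sum_inter_add_sum_sdiff X Y (fun j => (S.weight j : ℤ))
  rw [inter_comm] at h4
  rw [hd] at h1
  change ∑ j ∈ Y, (S.weight j : ℤ) ≤ _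
  linarith

/-- Minimal cost, in multiples of `1 / (2 ^ b * e)` and for `x = a / e`, of completing a tree of
which the levels above the current one are finished. Symbols `i, i + 1, …` remain, `k` nodes of the
current level are undecided, `v` nodes of the next and `m` nodes of the one after the next exist
because of masters. A free node can become a leaf or a master with symbol `i`; or all `k` free
nodes become complete and the next level begins. Once `n ≤ i + k` all remaining symbols fit. -/
def opt (S : Source n b) (a e : ℤ) (i k v m : ℕ) : ℤ :=
  if _h : i + k < n ∧ 0 < k + v + m then
    min (e * S.suffix i + S.opt a e i (min (2 * k + v) n) m 0)
      -- A forbidden choice receives the value of a new level, which leaves the minimum unchanged. A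
      -- leaf must not use up the last node, because more symbols than free nodes remain.
      (min (if 0 < k ∧ m < n then a * S.wt i + S.opt a e (i + 1) (k - 1) v (m + 1)
          else e * S.suffix i + S.opt a e i (min (2 * k + v) n) m 0)
        (if 0 < k ∧ 1 < k + v + m then S.opt a e (i + 1) (k - 1) v m
          else e * S.suffix i + S.opt a e i (min (2 * k + v) n) m 0))
  else 0
-- Placing a symbol raises `i`. A new level raises `k`, unless `k = v = 0`; in that case `v` rises
-- to `m > 0`.
termination_by (n - i, n - k, n - v)
decreasing_by
  all_goals
    simp only [Prod.lex_def, true_and, lt_self_iff_false, false_or]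
    omega

variable {S} {a e : ℤ} {i k v m : ℕ}

theorem opt_of_le (h : n ≤ i + k) : S.opt a e i k v m = 0 := by
  rw [opt, dif_neg (by omega)]

/-- With `n` or more free nodes the value is zero, so the table may cap its index `k` at `n`. -/
theorem opt_min : S.opt a e i (min k n) v m = S.opt a e i k v m := by
  rcases le_total k n with h | h
  · rw [min_eq_left h]
  · rw [opt_of_le (by omega), opt_of_le (by omega)]

theorem opt_nonneg (ha : 0 ≤ a) (he : 0 ≤ e) : 0 ≤ S.opt a e i k v m := by
  fun_induction S.opt a e i k v m with
  | case1 i k v m h ih1 ih2 ih3 =>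
    have := mul_nonneg he (S.suffix_nonneg i)
    have := mul_nonneg ha (S.wt_nonneg i)
    refine le_min (by linarith) (le_min ?_ ?_) <;> split_ifs with hc
    exacts [by linarith [ih2 hc], by linarith, ih3 hc, by linarith]
  | case2 => exact le_rfl

theorem opt_le_level (he : 0 ≤ e) (ha : 0 ≤ a) :
    S.opt a e i k v m ≤ e * S.suffix i + S.opt a e i (2 * k + v) m 0 := by
  rw [← opt_min (k := 2 * k + v)]
  have h0 : 0 ≤ e * S.suffix i + S.opt a e i (min (2 * k + v) n) m 0 :=
    add_nonneg (mul_nonneg he (S.suffix_nonneg i)) (opt_nonneg ha he)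
  conv_lhs => rw [opt]
  split_ifs
  all_goals first | exact min_le_left _ _ | exact h0

theorem opt_le_master (he : 0 ≤ e) (ha : 0 ≤ a) (hk : 0 < k) (hm : m < n) :
    S.opt a e i k v m ≤ a * S.wt i + S.opt a e (i + 1) (k - 1) v (m + 1) := by
  have h0 : 0 ≤ a * S.wt i + S.opt a e (i + 1) (k - 1) v (m + 1) :=
    add_nonneg (mul_nonneg ha (S.wt_nonneg i)) (opt_nonneg ha he)
  conv_lhs => rw [opt, if_pos ⟨hk, hm⟩]
  by_cases h : i + k < n ∧ 0 < k + v + m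
  · rw [dif_pos h]; exact (min_le_right _ _).trans (min_le_left _ _)
  · rw [dif_neg h]; exact h0

theorem opt_le_leaf (he : 0 ≤ e) (ha : 0 ≤ a) (hk : 0 < k) (h1 : 1 < k + v + m) :
    S.opt a e i k v m ≤ S.opt a e (i + 1) (k - 1) v m := by
  have h0 : 0 ≤ S.opt a e (i + 1) (k - 1) v m := opt_nonneg ha he
  conv_lhs => rw [opt, if_pos (show 0 < k ∧ 1 < k + v + m from ⟨hk, h1⟩)]
  by_cases h : i + k < n ∧ 0 < k + v + m
  · rw [dif_pos h]; exact (min_le_right _ _).trans (min_le_right _ _)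
  · rw [dif_neg h]; exact h0

/-- The decisions that attain the minimum. -/
inductive IsChoice (S : Source n b) (a e : ℤ) (i k v m : ℕ) : ℤ → Prop
  | level : S.opt a e i k v m = e * S.suffix i + S.opt a e i (2 * k + v) m 0 →
      IsChoice S a e i k v m 0
  | master : 0 < k → m < n →
      S.opt a e i k v m = a * S.wt i + S.opt a e (i + 1) (k - 1) v (m + 1) →
      IsChoice S a e i k v m 1
  | leaf : 0 < k → 1 < k + v + m → S.opt a e i k v m = S.opt a e (i + 1) (k - 1) v m →
      IsChoice S a e i k v m 2

/-- A new level can be opened every time, at a cost of at most `e * 2 ^ b`. This raises `k`, except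
for at most one level that starts with `k + v = 0`, so at most `n + 1` levels are paid for. -/
theorem opt_le_mul (he : 0 ≤ e) :
    S.opt a e i k v m ≤ (n + 1) * (e * 2 ^ b) := by
  have key : S.opt a e i k v m ≤
      ((n - k : ℕ) + (if k + v = 0 then 1 else 0) : ℤ) * (e * 2 ^ b) := by
    have hz : 0 ≤ e * 2 ^ b := by positivity
    have hs : ∀ i, e * S.suffix i ≤ e * 2 ^ b := fun i =>
      mul_le_mul_of_nonneg_left (S.suffix_le i) he
    fun_induction S.opt a e i k v m with
    | case1 i k v m h ih1 ih2 ih3 =>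
      refine (min_le_left _ _).trans ((add_le_add (hs i) ih1).trans ?_)
      rw [← one_add_mul]
      refine mul_le_mul_of_nonneg_right ?_ hz
      split_ifs <;> omega
    | case2 => positivity
  refine key.trans (mul_le_mul_of_nonneg_right ?_ (by positivity))
  split_ifs <;> omega

/-- More free nodes cannot hurt. -/
theorem opt_antitone (ha : 0 ≤ a) (he : 0 ≤ e) {k' v' : ℕ} (hk : k ≤ k') (hv : v ≤ v')
    (h0 : i + k < n → 0 < k + v + m) : S.opt a e i k' v' m ≤ S.opt a e i k v m := by
  by_cases hik : n ≤ i + k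
  · rw [opt_of_le hik, opt_of_le (by omega)]
  have hpos := h0 (by omega)
  fun_induction S.opt a e i k v m generalizing k' v' with
  | case1 i k v m h ih1 ih2 ih3 =>
    by_cases hik' : n ≤ i + k'
    · rw [opt_of_le hik']
      have := mul_nonneg he (S.suffix_nonneg i)
      have := mul_nonneg ha (S.wt_nonneg i)
      have h1 : ∀ i k v m, 0 ≤ S.opt a e i k v m := fun _ _ _ _ => opt_nonneg ha he
      refine le_min (by linarith [h1 i (min (2 * k + v) n) m 0]) (le_min ?_ ?_) <;> split_ifs <;>
        linarith [h1 i (min (2 * k + v) n) m 0, h1 (i + 1) (k - 1) v (m + 1),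
          h1 (i + 1) (k - 1) v m]
    -- The larger state imitates the decision of the smaller one. This is the case of a new level,
    -- which also covers the forbidden choices.
    have hj : S.opt a e i k' v' m ≤ e * S.suffix i + S.opt a e i (min (2 * k + v) n) m 0 := by
      refine (opt_le_level he ha).trans (add_le_add le_rfl ?_)
      by_cases hc : n ≤ i + min (2 * k + v) n
      · rw [opt_of_le hc, opt_of_le (by omega)]
      · exact ih1 (by omega) le_rfl (by omega) (by omega) (by omega)
    refine le_min hj (le_min ?_ ?_)
    · split_ifs with hc
      · refine (opt_le_master he ha (by omega) hc.2).trans (add_le_add le_rfl ?_)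
        exact ih2 hc (by omega) hv (by omega) (by omega) (by omega)
      · exact hj
    · split_ifs with hc
      · exact (opt_le_leaf he ha (by omega) (by omega)).trans
          (ih3 hc (by omega) hv (by omega) (by omega) (by omega))
      · exact hj
  | case2 i k v m h => omega

/-- Leaves first, then masters, then the next level: one level of an arbitrary tree. -/
theorem opt_le_of_level (ha : 0 ≤ a) (he : 0 ≤ e) {l u : ℕ} (hk : l + u ≤ k) (hn : i + l + u ≤ n)
    (h0 : i + l + u < n → 0 < 2 * (k - l - u) + v + u) :
    S.opt a e i k v 0 ≤ a * (S.suffix (i + l) - S.suffix (i + l + u)) +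
      e * S.suffix (i + l + u) + S.opt a e (i + l + u) (2 * (k - l - u) + v) u 0 := by
  by_cases hlt : i + l + u < n
  swap
  · rw [opt_of_le (by omega)]
    have h1 := S.suffix_antitone (show i + l ≤ i + l + u by omega)
    have h2 : 0 ≤ S.opt a e (i + l + u) (2 * (k - l - u) + v) u 0 := opt_nonneg ha he
    have h3 := mul_nonneg he (S.suffix_nonneg (i + l + u))
    nlinarith
  have leaves : ∀ j ≤ l, S.opt a e i k v 0 ≤ S.opt a e (i + j) (k - j) v 0 := by
    intro j hj
    induction j with
    | zero => exact le_rfl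
    | succ j ih =>
      refine (ih (by omega)).trans ?_
      -- The leaf rule forbids taking the last node; as symbols remain afterwards, `h0` guarantees
      -- another one.
      by_cases hd : 1 < (k - j) + v + 0
      · exact opt_le_leaf he ha (by omega) hd
      · have := h0 hlt; omega
  have masters : ∀ j ≤ u, S.opt a e (i + l) (k - l) v 0 ≤
      a * (S.suffix (i + l) - S.suffix (i + l + j)) + S.opt a e (i + l + j) (k - l - j) v j := by
    intro j hj
    induction j with
    | zero => simp
    | succ j ih =>
      have h1 := ih (by omega)
      have h2 : S.opt a e (i + l + j) (k - l - j) v j ≤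
          a * S.wt (i + l + j) + S.opt a e (i + l + j + 1) (k - l - j - 1) v (j + 1) :=
        opt_le_master he ha (by omega) (by omega)
      have e1 : k - l - (j + 1) = k - l - j - 1 := by omega
      rw [e1, ← add_assoc (i + l) j 1]
      have : a * S.suffix (i + l + j) = a * S.wt (i + l + j) + a * S.suffix (i + l + j + 1) := by
        rw [S.suffix_succ (i + l + j)]; ring
      linarith
  have h1 := leaves l le_rfl
  have h2 := masters u le_rfl
  have h3 : S.opt a e (i + l + u) (k - l - u) v u ≤ _ := opt_le_level he ha
  linarith

end Source

end

section

/-! ## Lower bound for the cost of an arbitrary tree -/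

namespace CodeTree

variable {n b : ℕ}

/-- `2 ^ b * L(T)`. -/
def totalLen (S : Source n b) (T : CodeTree n) : ℤ :=
  ∑ j, ((T.code j).length : ℤ) * S.weight j

/-- `2 ^ b * q_1(T)`. -/
def masterWeight (S : Source n b) (T : CodeTree n) : ℤ :=
  ∑ j, if T.code j ∈ T.masters then (S.weight j : ℤ) else 0

variable {T : CodeTree n} {s : Fin 2}

theorem admissible_of_mem (h : T ∈ treeSet n s) : T.IsAdmissible := by
  unfold treeSet at h; split_ifs at h <;> exact h.1

theorem IsAdmissible.code_mem_nodes (h : T.IsAdmissible) (j : Fin n) : T.code j ∈ T.nodes :=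
  (h.code_mem j).elim (fun h' => h'.1) fun h' => (h.master_incomplete _ h').1.1

theorem IsAdmissible.not_master_of_leaf (h : T.IsAdmissible) {w : List Bool}
    (hw : T.IsLeaf w) : w ∉ T.masters := fun hm =>
  hw.2 false (h.master_incomplete _ hm).1.2.1

theorem IsAdmissible.leaf_iff (h : T.IsAdmissible) (j : Fin n) :
    T.IsLeaf (T.code j) ↔ T.code j ∉ T.masters :=
  ⟨h.not_master_of_leaf, fun h' => (h.code_mem j).resolve_right h'⟩

theorem IsAdmissible.take_mem (h : T.IsAdmissible) {w : List Bool} (hw : w ∈ T.nodes) (d : ℕ) :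
    w.take d ∈ T.nodes := by
  induction w using List.reverseRecOn with
  | nil => simpa using hw
  | append_singleton w x ih =>
    by_cases hd : d ≤ w.length
    · rw [List.take_append_of_le_length hd]; exact ih (h.parent_mem _ _ hw)
    · rw [List.take_of_length_le (by simp; omega)]; exact hw

/-- The nodes of depth `d`. -/
def level (T : CodeTree n) (d : ℕ) : Finset (List Bool) := T.nodes.filter (·.length = d)

/-- The nodes of depth `d` that have to be slaves because of a used master, or in `T_1` because of
the exceptional node. -/
def forced (T : CodeTree n) (s : Fin 2) (d : ℕ) : Finset (List Bool) :=
  (T.level d).filter fun w =>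
    (∃ j, T.code j ∈ T.masters ∧ w = T.code j ++ [false]) ∨ (s = 1 ∧ w = [false])

/-- The number of symbols of depth less than `d`. -/
def numAbove (T : CodeTree n) (d : ℕ) : ℕ := (univ.filter fun j => (T.code j).length < d).card

def leafSymbols (T : CodeTree n) (d : ℕ) : Finset (Fin n) :=
  univ.filter fun j => (T.code j).length = d ∧ T.code j ∉ T.masters

def masterSymbols (T : CodeTree n) (d : ℕ) : Finset (Fin n) :=
  univ.filter fun j => (T.code j).length = d ∧ T.code j ∈ T.masters

theorem numAbove_succ (T : CodeTree n) (d : ℕ) :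
    T.numAbove (d + 1) = T.numAbove d + (T.leafSymbols d).card + (T.masterSymbols d).card := by
  unfold numAbove leafSymbols masterSymbols
  rw [← card_union_of_disjoint, ← card_union_of_disjoint]
  · congr 1
    ext j
    simp only [mem_filter, mem_univ, true_and, mem_union]
    by_cases h : T.code j ∈ T.masters <;> simp [h] <;> omega
  · simp only [disjoint_left, mem_filter, mem_univ, true_and, mem_union]
    rintro j (h | h) ⟨h1, h2⟩
    · omega
    · exact h.2 h2
  · simp only [disjoint_left, mem_filter, mem_univ, true_and]
    intro j h h1; omega

/-- Distinct masters have distinct children. The hypothesis on `d` keeps the exceptional node of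
`T_1`, which has depth `1`, out of the count. -/
theorem card_forced_succ (h : T.IsAdmissible) {d : ℕ} (hd : (s : ℕ) ≤ d) :
    (T.forced s (d + 1)).card = (T.masterSymbols d).card := by
  have : T.forced s (d + 1) = (T.masterSymbols d).image fun j => T.code j ++ [false] := by
    ext w
    simp only [forced, level, masterSymbols, mem_filter, mem_image, mem_univ, true_and]
    constructor
    · rintro ⟨⟨h1, h2⟩, ⟨j, h3, rfl⟩ | ⟨h3, rfl⟩⟩
      · exact ⟨j, ⟨by simpa using h2, h3⟩, rfl⟩
      · subst h3; simp at h2 hd; omega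
    · rintro ⟨j, ⟨h1, h2⟩, rfl⟩
      exact ⟨⟨(h.master_incomplete _ h2).1.2.1, by simpa using h1⟩, Or.inl ⟨j, h2, rfl⟩⟩
  rw [this, card_image_of_injective]
  intro j j' hj
  exact h.code_injective (by simpa using hj)

/-- A Kraft-type count, node by node: the number of children, plus `2` for a used leaf, plus `1` for
a used master or a forced slave, is at most `2`; and a node has at most one of these three roles. -/
theorem card_level_succ_le (hT : T ∈ treeSet n s) (d : ℕ) :
    (T.level (d + 1)).card + 2 * (T.leafSymbols d).card + (T.masterSymbols d).card +
      (T.forced s d).card ≤ 2 * (T.level d).card ∧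
    (T.leafSymbols d).card + (T.masterSymbols d).card + (T.forced s d).card ≤
      (T.level d).card := by
  have h := admissible_of_mem hT
  set X0 := (T.level d).filter fun w => w ++ [false] ∈ T.nodes with hX0
  set X1 := (T.level d).filter fun w => w ++ [true] ∈ T.nodes with hX1
  set A := (T.level d).filter fun w => w ∈ (T.leafSymbols d).image T.code with hA
  set M := (T.level d).filter fun w => w ∈ (T.masterSymbols d).image T.code with hM
  have cA : A.card = (T.leafSymbols d).card := by
    rw [hA, filter_mem_eq_inter, inter_eq_right.2, card_image_of_injective _ h.code_injective]
    intro w hw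
    simp only [mem_image, leafSymbols, mem_filter, mem_univ, true_and] at hw
    obtain ⟨j, ⟨h1, h2⟩, rfl⟩ := hw
    exact mem_filter.2 ⟨h.code_mem_nodes j, h1⟩
  have cM : M.card = (T.masterSymbols d).card := by
    rw [hM, filter_mem_eq_inter, inter_eq_right.2, card_image_of_injective _ h.code_injective]
    intro w hw
    simp only [mem_image, masterSymbols, mem_filter, mem_univ, true_and] at hw
    obtain ⟨j, ⟨h1, h2⟩, rfl⟩ := hw
    exact mem_filter.2 ⟨h.code_mem_nodes j, h1⟩
  have cX : (T.level (d + 1)).card ≤ X0.card + X1.card := by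
    have hsub : T.level (d + 1) ⊆ X0.image (· ++ [false]) ∪ X1.image (· ++ [true]) := by
      intro w hw
      simp only [level, mem_filter] at hw
      obtain ⟨hw, hl⟩ := hw
      obtain ⟨u, x, rfl⟩ : ∃ u x, w = u ++ [x] :=
        (List.eq_nil_or_concat w).elim (fun h => by simp [h] at hl) (by simp)
      have hu : u ∈ T.level d := mem_filter.2 ⟨h.parent_mem _ _ hw, by simpa using hl⟩
      cases x
      · exact mem_union_left _ (mem_image.2 ⟨u, mem_filter.2 ⟨hu, hw⟩, rfl⟩)
      · exact mem_union_right _ (mem_image.2 ⟨u, mem_filter.2 ⟨hu, hw⟩, rfl⟩)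
    exact (card_le_card hsub).trans ((card_union_le _ _).trans
      (add_le_add card_image_le card_image_le))
  set V : List Bool → Prop := fun w =>
    (∃ j, T.code j ∈ T.masters ∧ w = T.code j ++ [false]) ∨ (s = 1 ∧ w = [false]) with hV
  have hslave : ∀ w, V w → w ∉ T.masters ∧ ((w ++ [false] ∈ T.nodes ∧ w ++ [true] ∉ T.nodes) ∨
      (w ++ [false] ∉ T.nodes ∧ w ++ [true] ∈ T.nodes)) := by
    rintro w (⟨j, hj, rfl⟩ | ⟨rfl, rfl⟩)
    · exact ⟨h.master_child _ hj, Or.inl (h.master_incomplete _ hj).2.2⟩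
    · simp only [treeSet, if_neg (show (1 : Fin 2) ≠ 0 by decide)] at hT
      obtain ⟨-, -, h1, h2, h3, h4⟩ := hT
      exact ⟨fun hm => h4 (h.master_incomplete _ hm).1.2.1, Or.inr ⟨h4, h3⟩⟩
  have hleaf : ∀ w ∈ (T.leafSymbols d).image T.code,
      w ∉ T.masters ∧ ∀ a, w ++ [a] ∉ T.nodes := by
    intro w hw
    simp only [mem_image, leafSymbols, mem_filter, mem_univ, true_and] at hw
    obtain ⟨j, ⟨h1, h2⟩, rfl⟩ := hw
    exact ⟨h2, ((h.leaf_iff j).2 h2).2⟩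
  have hmas : ∀ w ∈ (T.masterSymbols d).image T.code, w ∈ T.masters ∧ w ++ [true] ∉ T.nodes := by
    intro w hw
    simp only [mem_image, masterSymbols, mem_filter, mem_univ, true_and] at hw
    obtain ⟨j, ⟨h1, h2⟩, rfl⟩ := hw
    exact ⟨h2, (h.master_incomplete _ h2).1.2.2⟩
  have key : ∀ w, ((if w ++ [false] ∈ T.nodes then 1 else 0) +
      (if w ++ [true] ∈ T.nodes then 1 else 0) +
      2 * (if w ∈ (T.leafSymbols d).image T.code then 1 else 0) +
      (if w ∈ (T.masterSymbols d).image T.code then 1 else 0) + (if V w then 1 else 0)) ≤ 2 ∧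
      ((if w ∈ (T.leafSymbols d).image T.code then 1 else 0) +
      (if w ∈ (T.masterSymbols d).image T.code then 1 else 0) + (if V w then 1 else 0)) ≤ 1 := by
    intro w
    by_cases c1 : w ∈ (T.leafSymbols d).image T.code
    · have h1 := hleaf w c1
      have c2 : w ∉ (T.masterSymbols d).image T.code := fun c => h1.1 (hmas w c).1
      have c3 : ¬ V w := fun c => by
        have := hslave w c
        have h2 := h1.2 true
        have h3 := h1.2 false
        tauto
      simp [h1.2, c1, c2, c3]
    · by_cases c2 : w ∈ (T.masterSymbols d).image T.code
      · have h1 := hmas w c2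
        have c3 : ¬ V w := fun c => (hslave w c).1 h1.1
        simp only [c1, c2, c3, h1.2, if_true, if_false]
        split_ifs <;> simp
      · by_cases c3 : V w
        · rcases (hslave w c3).2 with h1 | h1 <;> simp [c1, c2, c3, h1.1, h1.2]
        · simp only [c1, c2, c3, if_false]
          split_ifs <;> simp
  have key1 := sum_le_sum fun w (_ : w ∈ T.level d) => (key w).1
  have key2 := sum_le_sum fun w (_ : w ∈ T.level d) => (key w).2
  simp only [sum_add_distrib, ← mul_sum, sum_boole, sum_const, smul_eq_mul, Nat.cast_id]
    at key1 key2
  rw [← cA, ← cM]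
  rw [← hX0, ← hX1, ← hA, ← hM] at key1
  rw [← hA, ← hM] at key2
  have : (T.forced s d).card = ((T.level d).filter fun w => V w).card := rfl
  constructor <;> omega

/-- The cost that is caused below depth `d`. -/
def costBelow (S : Source n b) (a e : ℤ) (T : CodeTree n) (d : ℕ) : ℤ :=
  ∑ j, if d ≤ (T.code j).length then e * ((T.code j).length - d) * S.weight j +
    (if T.code j ∈ T.masters then a * S.weight j else 0) else 0

/-- Level `d` contributes `e` times the weight of the deeper symbols and `a` times that of its
masters, that is, `e - a` times the weight of `P` plus `a` times that of `Q`. Both coefficients are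
nonnegative because `0 ≤ x ≤ 1`, and a set of symbols weighs at least as much as equally many of the
lightest ones. -/
theorem costBelow_ge (S : Source n b) {a e : ℤ} (ha : 0 ≤ a) (hae : a ≤ e) (T : CodeTree n)
    (d : ℕ) :
    a * (S.suffix (T.numAbove d + (T.leafSymbols d).card) - S.suffix (T.numAbove (d + 1))) +
      e * S.suffix (T.numAbove (d + 1)) + T.costBelow S a e (d + 1) ≤ T.costBelow S a e d := by
  set P : Finset (Fin n) := univ.filter fun j => d < (T.code j).length with hP
  set Q : Finset (Fin n) := univ.filter fun j =>
    d < (T.code j).length ∨ ((T.code j).length = d ∧ T.code j ∈ T.masters) with hQ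
  have hPn : P.card + T.numAbove (d + 1) = n := by
    have := card_filter_add_card_filter_not (s := (univ : Finset (Fin n)))
      (fun j => d < (T.code j).length)
    simp only [numAbove, Nat.lt_succ_iff]
    simpa using this
  have h1 : S.suffix (T.numAbove (d + 1)) ≤ ∑ j ∈ P, (S.weight j : ℤ) := by
    convert S.suffix_card_le P using 2
    omega
  have h2 : S.suffix (T.numAbove d + (T.leafSymbols d).card) ≤ ∑ j ∈ Q, (S.weight j : ℤ) := by
    convert S.suffix_card_le Q using 2
    have h4 : Q.card = P.card + (T.masterSymbols d).card := by
      rw [masterSymbols, ← card_union_of_disjoint, ← filter_or]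
      simp only [disjoint_left, mem_filter, mem_univ, true_and, hP]
      intro j h h1; omega
    have h5 := T.numAbove_succ d
    omega
  have h3 : T.costBelow S a e d = (e - a) * ∑ j ∈ P, (S.weight j : ℤ) +
      a * ∑ j ∈ Q, (S.weight j : ℤ) + T.costBelow S a e (d + 1) := by
    simp only [costBelow, hP, hQ, sum_filter, mul_sum, ← sum_add_distrib]
    refine sum_congr rfl fun j _ => ?_
    rcases lt_trichotomy (T.code j).length d with h | h | h
    · simp [h.not_ge, h.not_gt, h.ne, (show ¬ d + 1 ≤ (T.code j).length by omega)]
    · by_cases hm : T.code j ∈ T.masters <;> simp [h, hm]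
    · simp only [h.le, if_true, h, true_or, (show d + 1 ≤ (T.code j).length by omega)]
      push_cast; ring
  have := mul_le_mul_of_nonneg_left h1 (sub_nonneg.2 hae)
  have := mul_le_mul_of_nonneg_left h2 ha
  linarith

/-- Induction on a bound `c` for the number of levels left. A forced slave of depth `d` has exactly
one child, so it enters the state as a node already granted to level `d + 1`. By the count on each
level the tree has no more free nodes on the next level than the dynamic program allows, and
`opt_antitone` closes the gap. -/
theorem opt_le_costBelow (S : Source n b) {a e : ℤ} (ha : 0 ≤ a) (hae : a ≤ e)
    (hT : T ∈ treeSet n s) (c : ℕ) {d : ℕ} (hd : (s : ℕ) ≤ d)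
    (hc : ∀ j, (T.code j).length < d + c) :
    S.opt a e (T.numAbove d) ((T.level d).card - (T.forced s d).card) (T.forced s d).card 0 ≤
      T.costBelow S a e d := by
  have h := admissible_of_mem hT
  have he : 0 ≤ e := ha.trans hae
  induction c generalizing d with
  | zero =>
    have : T.numAbove d = n := by
      unfold numAbove
      rw [filter_true_of_mem fun j _ => by simpa using hc j]; simp
    rw [this, Source.opt_of_le (by omega)]
    refine sum_nonneg fun j _ => ?_
    rw [if_neg (by have := hc j; omega)]
  | succ c ih =>
    refine le_trans ?_ (costBelow_ge S ha hae T d)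
    have h1 := card_level_succ_le hT d
    have h2 := T.numAbove_succ d
    have h3 := card_forced_succ h hd
    have h4 : T.numAbove (d + 1) ≤ n := by
      unfold numAbove; exact (card_le_univ _).trans (by simp)
    have h5 : T.numAbove (d + 1) < n → 0 < (T.level (d + 1)).card := by
      intro hlt
      obtain ⟨j, hj⟩ : ∃ j, d + 1 ≤ (T.code j).length := by
        by_contra! hcon
        refine hlt.ne ?_
        unfold numAbove
        rw [filter_true_of_mem fun j _ => hcon j]; simp
      refine card_pos.2 ⟨(T.code j).take (d + 1), mem_filter.2 ⟨h.take_mem (h.code_mem_nodes j) _, ?_⟩⟩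
      simp [hj]
    have h6 : (T.forced s (d + 1)).card ≤ (T.level (d + 1)).card := card_filter_le _ _
    refine (Source.opt_le_of_level ha he (l := (T.leafSymbols d).card)
      (u := (T.masterSymbols d).card) ?_ ?_ ?_).trans ?_
    · omega
    · omega
    · omega
    · rw [← h2]
      refine add_le_add le_rfl (le_trans ?_ (ih (by omega) fun j => by have := hc j; omega))
      rw [h3]
      refine Source.opt_antitone ha he (by omega) le_rfl ?_
      omega

/-- The value of the dynamic program bounds the cost of every tree from below. -/
theorem opt_le_cost (S : Source n b) {a e : ℤ} (ha : 0 ≤ a) (hae : a ≤ e)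
    (hT : T ∈ treeSet n s) :
    e * (s : ℕ) * 2 ^ b + S.opt a e 0 1 s 0 ≤ e * T.totalLen S + a * T.masterWeight S := by
  have h := admissible_of_mem hT
  have hroot : T.level 0 = {[]} := by
    ext w
    simp only [level, mem_filter, List.length_eq_zero_iff, mem_singleton]
    exact ⟨fun h => h.2, fun h' => ⟨h' ▸ h.root_mem, h'⟩⟩
  obtain ⟨c, hc⟩ : ∃ c, ∀ j, (T.code j).length < c :=
    ⟨(univ.sup fun j => (T.code j).length) + 1, fun j =>
      Nat.lt_succ_of_le (le_sup (f := fun j => (T.code j).length) (mem_univ j))⟩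
  -- For `T_1` the recursion starts at depth `1`, where `[true]` is free and `[false]` is forced;
  -- the state is then `(0, 1, 1, 0)`, and the edges above cost `e * 2 ^ b`. This explains `v = s`
  -- and the summand `e * s * 2 ^ b`.
  have key := opt_le_costBelow S ha hae hT c (d := s) le_rfl fun j => by have := hc j; omega
  have hs : s = 0 ∨ s = 1 := by omega
  rcases hs with rfl | rfl
  · have h1 : T.numAbove 0 = 0 := by simp [numAbove]
    have h2 : T.forced 0 0 = ∅ := by
      simp [forced, hroot]
    have h3 : T.costBelow S a e 0 = e * T.totalLen S + a * T.masterWeight S := by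
      simp only [costBelow, totalLen, masterWeight, mul_sum, ← sum_add_distrib]
      refine sum_congr rfl fun j _ => ?_
      simp [mul_assoc]
    simp only [Fin.val_zero, h1, h2, h3, hroot] at key
    simpa using key
  · have hT' := hT
    simp only [treeSet, if_neg (show (1 : Fin 2) ≠ 0 by decide)] at hT'
    obtain ⟨-, -, t1, t2, t3, t4⟩ := hT'
    have hr : [] ∉ T.masters := fun hm => (h.master_incomplete _ hm).1.2.2 t2
    have hpos : ∀ j, 1 ≤ (T.code j).length := by
      intro j
      by_contra! hj
      have hj : T.code j = [] := List.length_eq_zero_iff.1 (by omega)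
      rcases h.code_mem j with h' | h'
      · rw [hj] at h'; exact h'.2 true t2
      · rw [hj] at h'; exact hr h'
    have h1 : T.numAbove 1 = 0 := by
      simp only [numAbove, card_eq_zero, filter_eq_empty_iff]
      intro j _ hj; have := hpos j; omega
    have h2 : T.level 1 = {[false], [true]} := by
      ext w
      simp only [level, mem_filter, mem_insert, mem_singleton]
      constructor
      · rintro ⟨-, h2⟩
        obtain ⟨x, rfl⟩ := List.length_eq_one_iff.1 h2
        cases x <;> simp
      · rintro (rfl | rfl) <;> simp [t1, t2]
    have h3 : T.forced 1 1 = {[false]} := by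
      ext w
      simp only [forced, h2, mem_filter, mem_insert, mem_singleton, true_and]
      constructor
      · rintro ⟨h4, ⟨j, h5, rfl⟩ | h5⟩
        · have : T.code j = [] := by
            rcases h4 with h4 | h4
            · simpa using h4
            · simpa using congrArg List.getLast? h4
          exact absurd (this ▸ h5) hr
        · exact h5
      · rintro rfl; simp
    have h4 : T.costBelow S a e 1 = e * T.totalLen S + a * T.masterWeight S - e * 2 ^ b := by
      have : (2 : ℤ) ^ b = ∑ j, (S.weight j : ℤ) := by exact_mod_cast S.weight_sum.symm
      simp only [costBelow, totalLen, masterWeight, this, mul_sum, ← sum_add_distrib,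
        ← sum_sub_distrib]
      refine sum_congr rfl fun j _ => ?_
      rw [if_pos (hpos j)]
      split_ifs <;> (push_cast; ring)
    have h5 : ((1 : Fin 2) : ℕ) = 1 := rfl
    simp only [h5, h1, h2, h3, h4] at key
    have c2 : ({[false], [true]} : Finset (List Bool)).card - ({[false]} : Finset (List Bool)).card
        = 1 := by decide
    rw [c2] at key
    simp only [card_singleton] at key
    rw [h5]; push_cast; linarith

end CodeTree

end

section

/-! ## Growing a tree from the root -/

namespace CodeTree

variable {n : ℕ}

/-- A tree under construction: the first `i` symbols are assigned, and the leaves in `pend` may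
still be changed. -/
structure IsPartial (s : Fin 2) (T : CodeTree n) (pend : Finset (List Bool)) (i : ℕ) : Prop where
  root_mem : [] ∈ T.nodes
  parent_mem : ∀ w a, w ++ [a] ∈ T.nodes → w ∈ T.nodes
  master_incomplete : ∀ w ∈ T.masters, T.IsIncomplete w ∧ T.IsIncomplete (w ++ [false])
  master_child : ∀ w ∈ T.masters, w ++ [false] ∉ T.masters
  code_inj : ∀ j j' : Fin n, (j : ℕ) < i → (j' : ℕ) < i → T.code j = T.code j' → j = j'
  code_mem : ∀ j : Fin n, (j : ℕ) < i → T.IsLeaf (T.code j) ∨ T.code j ∈ T.masters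
  code_pend : ∀ j : Fin n, (j : ℕ) < i → T.code j ∉ pend
  pend_leaf : ∀ w ∈ pend, T.IsLeaf w
  left_mem : ∀ w, (s = 1 → w ≠ [false]) → w ++ [true] ∈ T.nodes → w ++ [false] ∈ T.nodes
  exceptional : s = 1 → [false] ∈ T.nodes ∧ [true] ∈ T.nodes ∧
      [false, true] ∈ T.nodes ∧ [false, false] ∉ T.nodes

/-- Assign symbol `i` to `w`. -/
def setCode (T : CodeTree n) (i : Fin n) (w : List Bool) : CodeTree n :=
  { T with code := Function.update T.code i w }

/-- Give `w` both children. -/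
def expand (T : CodeTree n) (w : List Bool) : CodeTree n :=
  { T with nodes := insert (w ++ [true]) (insert (w ++ [false]) T.nodes) }

/-- Make `w` a master. -/
def addMaster (T : CodeTree n) (w : List Bool) : CodeTree n :=
  { T with
    nodes := insert (w ++ [false] ++ [false]) (insert (w ++ [false]) T.nodes)
    masters := insert w T.masters }

variable {s : Fin 2} {T : CodeTree n} {pend : Finset (List Bool)} {i : ℕ} {w : List Bool}

theorem append_singleton_inj {u w : List Bool} {x y : Bool} :
    u ++ [x] = w ++ [y] ↔ u = w ∧ x = y := by
  constructor
  · intro h; simpa using List.append_inj' h rfl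
  · rintro ⟨rfl, rfl⟩; rfl

theorem append_singleton_ne_self {u : List Bool} {x : Bool} : u ++ [x] ≠ u := by simp

theorem IsPartial.admissible (h : IsPartial s T pend i) (hi : n ≤ i) : T ∈ treeSet n s := by
  have hT : T.IsAdmissible := ⟨h.root_mem, h.parent_mem, h.master_incomplete, h.master_child,
    fun j j' hj => h.code_inj j j' (by omega) (by omega) hj, fun j => h.code_mem j (by omega)⟩
  unfold treeSet
  split_ifs with hs
  · exact ⟨hT, fun w => h.left_mem w (by simp [hs])⟩
  · have hs1 : s = 1 := by omega
    exact ⟨hT, fun w hw => h.left_mem w fun _ => hw, h.exceptional hs1⟩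

theorem IsPartial.not_master (h : IsPartial s T pend i) (hw : w ∈ pend) : w ∉ T.masters :=
  fun hm => (h.pend_leaf w hw).2 false (h.master_incomplete w hm).1.2.1

theorem IsPartial.setCode (h : IsPartial s T pend i) (hi : i < n) (hw : w ∈ pend) :
    IsPartial s (T.setCode ⟨i, hi⟩ w) (pend.erase w) (i + 1) := by
  have key : ∀ j : Fin n, (j : ℕ) < i + 1 →
      (j = ⟨i, hi⟩ ∧ (T.setCode ⟨i, hi⟩ w).code j = w) ∨
      ((j : ℕ) < i ∧ (T.setCode ⟨i, hi⟩ w).code j = T.code j) := by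
    intro j hj
    by_cases hji : j = ⟨i, hi⟩
    · left; subst hji; simp [CodeTree.setCode]
    · right
      refine ⟨?_, by simp [CodeTree.setCode, hji]⟩
      have : (j : ℕ) ≠ i := fun h => hji (Fin.ext h)
      omega
  refine ⟨h.root_mem, h.parent_mem, h.master_incomplete, h.master_child, ?_, ?_, ?_, ?_,
    h.left_mem, h.exceptional⟩
  · intro j j' hj hj' hjj
    rcases key j hj with ⟨a1, a2⟩ | ⟨a1, a2⟩ <;> rcases key j' hj' with ⟨b1, b2⟩ | ⟨b1, b2⟩ <;>
      rw [a2, b2] at hjj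
    · rw [a1, b1]
    · exact absurd (hjj ▸ hw) (h.code_pend j' b1)
    · exact absurd (hjj ▸ hw) (h.code_pend j a1)
    · exact h.code_inj j j' a1 b1 hjj
  · intro j hj
    rcases key j hj with ⟨a1, a2⟩ | ⟨a1, a2⟩ <;> rw [a2]
    · exact Or.inl (h.pend_leaf w hw)
    · exact h.code_mem j a1
  · intro j hj
    rcases key j hj with ⟨a1, a2⟩ | ⟨a1, a2⟩ <;> rw [a2]
    · simp
    · exact fun hm => h.code_pend j a1 (mem_of_mem_erase hm)
  · exact fun u hu => h.pend_leaf u (mem_of_mem_erase hu)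

/-- As `w` was a leaf, every old node other than `w` keeps its children, and with them its status as
a leaf or as an incomplete node. -/
theorem IsPartial.expand (h : IsPartial s T pend i) (hw : w ∈ pend) :
    IsPartial s (T.expand w)
      (insert (w ++ [true]) (insert (w ++ [false]) (pend.erase w))) i := by
  have hl := h.pend_leaf w hw
  have hm := h.not_master hw
  have mem : ∀ {u}, u ∈ (T.expand w).nodes ↔
      u = w ++ [true] ∨ u = w ++ [false] ∨ u ∈ T.nodes := by
    intro u; simp [CodeTree.expand]
  have hinc : ∀ {u}, u ≠ w → T.IsIncomplete u → (T.expand w).IsIncomplete u := by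
    rintro u hu ⟨h1, h2, h3⟩
    refine ⟨mem.2 (.inr (.inr h1)), mem.2 (.inr (.inr h2)), ?_⟩
    rw [mem, append_singleton_inj, append_singleton_inj]; tauto
  have hleaf : ∀ {u}, u ≠ w → T.IsLeaf u → (T.expand w).IsLeaf u := by
    rintro u hu ⟨h1, h2⟩
    refine ⟨mem.2 (.inr (.inr h1)), fun x => ?_⟩
    rw [mem, append_singleton_inj, append_singleton_inj]
    have := h2 x; tauto
  have hnew : ∀ x, (T.expand w).IsLeaf (w ++ [x]) := by
    intro x
    refine ⟨mem.2 (by cases x <;> simp), fun y => ?_⟩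
    rw [mem, append_singleton_inj, append_singleton_inj]
    rintro (⟨h1, -⟩ | ⟨h1, -⟩ | h1)
    · exact append_singleton_ne_self h1
    · exact append_singleton_ne_self h1
    · exact hl.2 x (h.parent_mem _ _ h1)
  refine ⟨mem.2 (.inr (.inr h.root_mem)), ?_, ?_, h.master_child, h.code_inj, ?_, ?_, ?_, ?_, ?_⟩
  · intro u x hu
    rw [mem, append_singleton_inj, append_singleton_inj] at hu
    rcases hu with ⟨rfl, -⟩ | ⟨rfl, -⟩ | hu
    · exact mem.2 (.inr (.inr hl.1))
    · exact mem.2 (.inr (.inr hl.1))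
    · exact mem.2 (.inr (.inr (h.parent_mem _ _ hu)))
  · intro u hu
    obtain ⟨h1, h2⟩ := h.master_incomplete u hu
    have hu' : u ++ [false] ≠ w := by
      rintro rfl; exact hl.2 _ h2.2.1
    exact ⟨hinc (by rintro rfl; exact hm hu) h1, hinc hu' h2⟩
  · intro j hj
    have hne : T.code j ≠ w := fun h' => h.code_pend j hj (h' ▸ hw)
    exact (h.code_mem j hj).imp (hleaf hne) id
  · intro j hj
    simp only [mem_insert, mem_erase, not_or, not_and]
    refine ⟨fun hc => ?_, fun hc => ?_, fun _ => h.code_pend j hj⟩ <;>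
      change T.code j = _ at hc <;>
      · rcases h.code_mem j hj with h' | h'
        · rw [hc] at h'; exact hl.2 _ h'.1
        · have := (h.master_incomplete _ h').1.1
          rw [hc] at this; exact hl.2 _ this
  · intro u hu
    simp only [mem_insert, mem_erase] at hu
    rcases hu with rfl | rfl | ⟨h1, h2⟩
    · exact hnew _
    · exact hnew _
    · exact hleaf h1 (h.pend_leaf u h2)
  · intro u hu
    rw [mem, mem, append_singleton_inj, append_singleton_inj, append_singleton_inj,
      append_singleton_inj]
    have := h.left_mem u hu
    tauto
  · intro hs
    obtain ⟨h1, h2, h3, h4⟩ := h.exceptional hs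
    refine ⟨mem.2 (.inr (.inr h1)), mem.2 (.inr (.inr h2)), mem.2 (.inr (.inr h3)), ?_⟩
    rw [mem]
    rintro (hc | hc | hc)
    · rw [show [false, false] = [false] ++ [false] from rfl, append_singleton_inj] at hc
      simp at hc
    · rw [show [false, false] = [false] ++ [false] from rfl, append_singleton_inj] at hc
      exact hl.2 true (hc.1 ▸ h3)
    · exact h4 hc

/-- A pending leaf is traded for one two levels below: between them lies the slave, which needs a
`0`-child of its own. -/
theorem IsPartial.addMaster (h : IsPartial s T pend i) (hi : i < n) (hw : w ∈ pend) :
    IsPartial s ((T.addMaster w).setCode ⟨i, hi⟩ w)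
      (insert (w ++ [false] ++ [false]) (pend.erase w)) (i + 1) := by
  have hl := h.pend_leaf w hw
  have hm := h.not_master hw
  set T' := (T.addMaster w).setCode ⟨i, hi⟩ w with hT'
  have mem : ∀ {u}, u ∈ T'.nodes ↔
      u = w ++ [false] ++ [false] ∨ u = w ++ [false] ∨ u ∈ T.nodes := by
    intro u; simp [hT', CodeTree.addMaster, CodeTree.setCode]
  have memm : ∀ {u}, u ∈ T'.masters ↔ u = w ∨ u ∈ T.masters := by
    intro u; simp [hT', CodeTree.addMaster, CodeTree.setCode]
  have key : ∀ j : Fin n, (j : ℕ) < i + 1 →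
      (j = ⟨i, hi⟩ ∧ T'.code j = w) ∨ ((j : ℕ) < i ∧ T'.code j = T.code j) := by
    intro j hj
    by_cases hji : j = ⟨i, hi⟩
    · left; subst hji; simp [hT', CodeTree.setCode]
    · right
      refine ⟨?_, by simp [hT', CodeTree.setCode, CodeTree.addMaster, hji]⟩
      have : (j : ℕ) ≠ i := fun h => hji (Fin.ext h)
      omega
  have hmn : ∀ {u}, u ∈ T.masters → u ∈ T.nodes := fun hu => (h.master_incomplete _ hu).1.1
  have hinc : ∀ {u}, u ∈ T.nodes → u ≠ w → T.IsIncomplete u → T'.IsIncomplete u := by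
    rintro u hu hne ⟨h1, h2, h3⟩
    refine ⟨mem.2 (.inr (.inr h1)), mem.2 (.inr (.inr h2)), ?_⟩
    rw [mem, append_singleton_inj, append_singleton_inj]
    rintro (⟨rfl, -⟩ | ⟨h4, -⟩ | h4)
    · exact hl.2 _ hu
    · exact hne h4
    · exact h3 h4
  have hleaf : ∀ {u}, u ≠ w → T.IsLeaf u → T'.IsLeaf u := by
    rintro u hne ⟨h1, h2⟩
    refine ⟨mem.2 (.inr (.inr h1)), fun x => ?_⟩
    rw [mem, append_singleton_inj, append_singleton_inj]
    rintro (⟨rfl, -⟩ | ⟨h4, -⟩ | h4)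
    · exact hl.2 _ h1
    · exact hne h4
    · exact h2 x h4
  have w0 : ∀ x, w ++ [false] ++ [x] ∉ T.nodes := fun x hx => hl.2 _ (h.parent_mem _ _ hx)
  have w00 : ∀ x, w ++ [false] ++ [false] ++ [x] ∉ T.nodes :=
    fun x hx => w0 _ (h.parent_mem _ _ hx)
  refine ⟨mem.2 (.inr (.inr h.root_mem)), ?_, ?_, ?_, ?_, ?_, ?_, ?_, ?_, ?_⟩
  · intro u x hu
    rw [mem, append_singleton_inj, append_singleton_inj] at hu
    rcases hu with ⟨rfl, -⟩ | ⟨rfl, -⟩ | hu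
    · exact mem.2 (.inr (.inl rfl))
    · exact mem.2 (.inr (.inr hl.1))
    · exact mem.2 (.inr (.inr (h.parent_mem _ _ hu)))
  · intro u hu
    rcases memm.1 hu with rfl | hu'
    · refine ⟨⟨mem.2 (.inr (.inr hl.1)), mem.2 (.inr (.inl rfl)), ?_⟩,
        ⟨mem.2 (.inr (.inl rfl)), mem.2 (.inl rfl), ?_⟩⟩
      · rw [mem, append_singleton_inj, append_singleton_inj]
        rintro (⟨-, h1⟩ | ⟨-, h1⟩ | h1)
        · simp at h1
        · simp at h1
        · exact hl.2 _ h1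
      · rw [mem]
        rintro (h1 | h1 | h1)
        · exact absurd (append_singleton_inj.1 h1).2 (by simp)
        · exact absurd (append_singleton_inj.1 h1).2 (by simp)
        · exact w0 _ h1
    · obtain ⟨h1, h2⟩ := h.master_incomplete u hu'
      exact ⟨hinc h1.1 (by rintro rfl; exact hm hu') h1,
        hinc h2.1 (by rintro rfl; exact hl.2 _ h2.2.1) h2⟩
  · intro u hu
    rw [memm, not_or]
    rcases memm.1 hu with rfl | hu
    · exact ⟨append_singleton_ne_self, fun h1 => hl.2 _ (hmn h1)⟩
    · exact ⟨fun h1 => hl.2 _ (h1 ▸ (h.master_incomplete u hu).2.2.1), h.master_child u hu⟩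
  · intro j j' hj hj' hjj
    rcases key j hj with ⟨a1, a2⟩ | ⟨a1, a2⟩ <;> rcases key j' hj' with ⟨b1, b2⟩ | ⟨b1, b2⟩ <;>
      rw [a2, b2] at hjj
    · rw [a1, b1]
    · exact absurd (hjj ▸ hw) (h.code_pend j' b1)
    · exact absurd (hjj ▸ hw) (h.code_pend j a1)
    · exact h.code_inj j j' a1 b1 hjj
  · intro j hj
    rcases key j hj with ⟨a1, a2⟩ | ⟨a1, a2⟩ <;> rw [a2]
    · exact Or.inr (memm.2 (.inl rfl))
    · have hne : T.code j ≠ w := fun h' => h.code_pend j a1 (h' ▸ hw)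
      exact (h.code_mem j a1).imp (hleaf hne) fun h' => memm.2 (.inr h')
  · intro j hj
    simp only [mem_insert, mem_erase, not_or, not_and]
    rcases key j hj with ⟨a1, a2⟩ | ⟨a1, a2⟩ <;> rw [a2]
    · exact ⟨by simp, fun h => absurd rfl h⟩
    · refine ⟨fun hc => ?_, fun _ => h.code_pend j a1⟩
      rcases h.code_mem j a1 with h' | h'
      · rw [hc] at h'; exact w0 _ h'.1
      · rw [hc] at h'; exact w0 _ (hmn h')
  · intro u hu
    simp only [mem_insert, mem_erase] at hu
    rcases hu with rfl | ⟨h1, h2⟩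
    · refine ⟨mem.2 (.inl rfl), fun x => ?_⟩
      rw [mem]
      rintro (h1 | h1 | h1)
      · exact append_singleton_ne_self h1
      · exact absurd (congrArg List.length h1) (by simp)
      · exact w00 _ h1
    · exact hleaf h1 (h.pend_leaf u h2)
  · intro u hu h1
    rw [mem, append_singleton_inj, append_singleton_inj] at h1
    rcases h1 with ⟨-, h1⟩ | ⟨-, h1⟩ | h1
    · simp at h1
    · simp at h1
    · exact mem.2 (.inr (.inr (h.left_mem u hu h1)))
  · intro hs
    obtain ⟨h1, h2, h3, h4⟩ := h.exceptional hs
    refine ⟨mem.2 (.inr (.inr h1)), mem.2 (.inr (.inr h2)), mem.2 (.inr (.inr h3)), ?_⟩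
    rw [mem]
    rw [show [false, false] = [false] ++ [false] from rfl, append_singleton_inj,
      append_singleton_inj]
    rintro (⟨hc, -⟩ | ⟨hc, -⟩ | hc)
    · exact hl.2 false (by rw [← hc]; exact h1)
    · exact hl.2 true (hc ▸ h3)
    · exact h4 hc

/-! ### Pointer form -/

/-- The functions `L`, `R`, `Ma` hold the tree in pointer form, its nodes being numbered by `φ` with
numbers below `cnt`. -/
structure Pointers (T : CodeTree n) (φ : List Bool → ℤ) (cnt : ℤ) (L R Ma : ℤ → ℤ) : Prop where
  root : φ [] = 0
  inj : Set.InjOn φ (T.nodes : Set (List Bool))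
  nonneg : ∀ w ∈ T.nodes, 0 ≤ φ w
  lt : ∀ w ∈ T.nodes, φ w < cnt
  left : ∀ w ∈ T.nodes, L (φ w) = if w ++ [false] ∈ T.nodes then φ (w ++ [false]) else -1
  right : ∀ w ∈ T.nodes, R (φ w) = if w ++ [true] ∈ T.nodes then φ (w ++ [true]) else -1
  master : ∀ w ∈ T.nodes, Ma (φ w) = if w ∈ T.masters then 1 else 0

/-- Add a child `x` to `w`. -/
def addChild (T : CodeTree n) (w : List Bool) (x : Bool) : CodeTree n :=
  { T with nodes := insert (w ++ [x]) T.nodes }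

variable {φ : List Bool → ℤ} {cnt : ℤ} {L R Ma : ℤ → ℤ}

/-- The new node gets the number `cnt`, which no old node has, so only one cell of the parent and
the cells at `cnt` change. The pointwise hypotheses on the new arrays make the order of the writes
irrelevant. -/
theorem Pointers.addChild (h : Pointers T φ cnt L R Ma)
    (hpar : ∀ w a, w ++ [a] ∈ T.nodes → w ∈ T.nodes) (hmas : T.masters ⊆ T.nodes)
    (hw : w ∈ T.nodes) {x : Bool} (hx : w ++ [x] ∉ T.nodes) {L' R' Ma' : ℤ → ℤ}
    (hL : ∀ z, L' z = if x = false ∧ z = φ w then cnt else if z = cnt then -1 else L z)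
    (hR : ∀ z, R' z = if x = true ∧ z = φ w then cnt else if z = cnt then -1 else R z)
    (hMa : ∀ z, Ma' z = if z = cnt then 0 else Ma z) :
    Pointers (T.addChild w x) (Function.update φ (w ++ [x]) cnt) (cnt + 1) L' R' Ma' := by
  have hne : ∀ {u}, u ∈ T.nodes → u ≠ w ++ [x] := fun hu h => hx (h ▸ hu)
  have mem : ∀ {u}, u ∈ (T.addChild w x).nodes ↔ u = w ++ [x] ∨ u ∈ T.nodes := by
    intro u; simp [CodeTree.addChild]
  have hφ : ∀ {u}, u ∈ T.nodes → Function.update φ (w ++ [x]) cnt u = φ u := fun hu =>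
    Function.update_of_ne (hne hu) _ _
  have hlt : ∀ {u}, u ∈ T.nodes → φ u ≠ cnt := fun hu => (h.lt _ hu).ne
  have hchild : ∀ y, w ++ [x] ++ [y] ∉ (T.addChild w x).nodes := by
    intro y hy
    rcases mem.1 hy with h1 | h1
    · exact append_singleton_ne_self h1
    · exact hx (hpar _ _ h1)
  have hw0 := h.nonneg w hw
  have hwlt := h.lt w hw
  refine ⟨?_, ?_, ?_, ?_, ?_, ?_, ?_⟩
  · rw [Function.update_of_ne (by simp)]; exact h.root
  · intro u hu u' hu' heq
    rcases mem.1 hu with rfl | hu <;> rcases mem.1 hu' with rfl | hu'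
    · rfl
    · rw [hφ hu', Function.update_self] at heq; exact absurd heq.symm (hlt hu')
    · rw [hφ hu, Function.update_self] at heq; exact absurd heq (hlt hu)
    · rw [hφ hu, hφ hu'] at heq; exact h.inj hu hu' heq
  · intro u hu
    rcases mem.1 hu with rfl | hu
    · rw [Function.update_self]; linarith
    · rw [hφ hu]; exact h.nonneg u hu
  · intro u hu
    rcases mem.1 hu with rfl | hu
    · rw [Function.update_self]; linarith
    · rw [hφ hu]; linarith [h.lt u hu]
  · intro u hu
    rcases mem.1 hu with rfl | hv
    · rw [if_neg (hchild _), Function.update_self, hL, if_neg (by omega), if_pos rfl]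
    · rw [hφ hv, hL, if_neg (hlt hv) (c := φ u = cnt), h.left u hv]
      by_cases hc : x = false ∧ φ u = φ w
      · obtain ⟨rfl, hc⟩ := hc
        obtain rfl := h.inj hv hw hc
        rw [if_pos ⟨rfl, rfl⟩, if_pos (mem.2 (.inl rfl)), Function.update_self]
      · rw [if_neg hc]
        have hne' : u ++ [false] ≠ w ++ [x] := fun h' => by
          rw [append_singleton_inj] at h'; exact hc ⟨h'.2.symm, by rw [h'.1]⟩
        rw [Function.update_of_ne hne']
        simp only [mem, hne', false_or]
  · intro u hu
    rcases mem.1 hu with rfl | hv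
    · rw [if_neg (hchild _), Function.update_self, hR, if_neg (by omega), if_pos rfl]
    · rw [hφ hv, hR, if_neg (hlt hv) (c := φ u = cnt), h.right u hv]
      by_cases hc : x = true ∧ φ u = φ w
      · obtain ⟨rfl, hc⟩ := hc
        obtain rfl := h.inj hv hw hc
        rw [if_pos ⟨rfl, rfl⟩, if_pos (mem.2 (.inl rfl)), Function.update_self]
      · rw [if_neg hc]
        have hne' : u ++ [true] ≠ w ++ [x] := fun h' => by
          rw [append_singleton_inj] at h'; exact hc ⟨h'.2.symm, by rw [h'.1]⟩
        rw [Function.update_of_ne hne']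
        simp only [mem, hne', false_or]
  · intro u hu
    rcases mem.1 hu with rfl | hu
    · rw [Function.update_self, hMa, if_pos rfl, if_neg]
      exact fun hm => hx (hmas hm)
    · rw [hφ hu, hMa, if_neg (hlt hu)]; exact h.master u hu

theorem Pointers.addMark (h : Pointers T φ cnt L R Ma) (hw : w ∈ T.nodes) {Ma' : ℤ → ℤ}
    (hMa : ∀ z, Ma' z = if z = φ w then 1 else Ma z) :
    Pointers { T with masters := insert w T.masters } φ cnt L R Ma' := by
  refine ⟨h.root, h.inj, h.nonneg, h.lt, h.left, h.right, fun u hu => ?_⟩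
  rw [hMa]
  by_cases hc : φ u = φ w
  · obtain rfl := h.inj hu hw hc
    simp
  · have : u ≠ w := fun h' => hc (by rw [h'])
    rw [if_neg hc, h.master u hu]
    simp [this]

/-- `Key` holds the depths of the pending nodes, and `-1` for all others. -/
structure Keys (T : CodeTree n) (pend : Finset (List Bool)) (φ : List Bool → ℤ) (cnt : ℤ)
    (Key : ℤ → ℤ) : Prop where
  pend_key : ∀ w ∈ pend, Key (φ w) = w.length
  of_key : ∀ h, 0 ≤ h → h < cnt → Key h = -1 ∨ ∃ w ∈ pend, φ w = h

theorem Keys.erase {Key : ℤ → ℤ} (h : Keys T pend φ cnt Key) (hP : Pointers T φ cnt L R Ma)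
    (hsub : pend ⊆ T.nodes) (hw : w ∈ pend) {Key' : ℤ → ℤ}
    (hK : ∀ z, Key' z = if z = φ w then -1 else Key z) :
    Keys T (pend.erase w) φ cnt Key' := by
  refine ⟨fun u hu => ?_, fun z h0 h1 => ?_⟩
  · rw [mem_erase] at hu
    rw [hK, if_neg fun hc => hu.1 (hP.inj (hsub hu.2) (hsub hw) hc), h.pend_key u hu.2]
  · rw [hK]
    by_cases hz : z = φ w
    · simp [hz]
    · rw [if_neg hz]
      refine (h.of_key z h0 h1).imp id ?_
      rintro ⟨u, hu, rfl⟩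
      exact ⟨u, mem_erase.2 ⟨fun hc => hz (by rw [hc]), hu⟩, rfl⟩

/-- A new node that is not pending. -/
theorem Keys.addDone {Key : ℤ → ℤ} (h : Keys T pend φ cnt Key) (hP : Pointers T φ cnt L R Ma)
    (hsub : pend ⊆ T.nodes) {x : Bool} (hx : w ++ [x] ∉ T.nodes) {Key' : ℤ → ℤ}
    (hK : ∀ z, Key' z = if z = cnt then -1 else Key z) :
    Keys (T.addChild w x) pend (Function.update φ (w ++ [x]) cnt) (cnt + 1) Key' := by
  have hφ : ∀ {u}, u ∈ pend → Function.update φ (w ++ [x]) cnt u = φ u := fun hu =>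
    Function.update_of_ne (ne_of_mem_of_not_mem (hsub hu) hx) _ _
  refine ⟨fun u hu => ?_, fun z h0 h1 => ?_⟩
  · rw [hφ hu, hK, if_neg (hP.lt u (hsub hu)).ne, h.pend_key u hu]
  · rw [hK]
    by_cases hz : z = cnt
    · simp [hz]
    · rw [if_neg hz]
      refine (h.of_key z h0 (by omega)).imp id ?_
      rintro ⟨u, hu, rfl⟩
      exact ⟨u, hu, hφ hu⟩

/-- A new pending node. -/
theorem Keys.addPend {Key : ℤ → ℤ} (h : Keys T pend φ cnt Key) (hP : Pointers T φ cnt L R Ma)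
    (hsub : pend ⊆ T.nodes) {x : Bool} (hx : w ++ [x] ∉ T.nodes) {Key' : ℤ → ℤ}
    (hK : ∀ z, Key' z = if z = cnt then (w.length : ℤ) + 1 else Key z) :
    Keys (T.addChild w x) (insert (w ++ [x]) pend) (Function.update φ (w ++ [x]) cnt) (cnt + 1)
      Key' := by
  have hφ : ∀ {u}, u ∈ pend → Function.update φ (w ++ [x]) cnt u = φ u := fun hu =>
    Function.update_of_ne (ne_of_mem_of_not_mem (hsub hu) hx) _ _
  refine ⟨fun u hu => ?_, fun z h0 h1 => ?_⟩
  · rcases mem_insert.1 hu with rfl | hu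
    · rw [Function.update_self, hK, if_pos rfl]; simp
    · rw [hφ hu, hK, if_neg (hP.lt u (hsub hu)).ne, h.pend_key u hu]
  · rw [hK]
    by_cases hz : z = cnt
    · exact .inr ⟨w ++ [x], mem_insert_self _ _, by rw [Function.update_self, hz]⟩
    · rw [if_neg hz]
      refine (h.of_key z h0 (by omega)).imp id ?_
      rintro ⟨u, hu, rfl⟩
      exact ⟨u, mem_insert_of_mem hu, hφ hu⟩

theorem IsPartial.pend_subset (h : IsPartial s T pend i) : pend ⊆ T.nodes :=
  fun w hw => (h.pend_leaf w hw).1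

theorem IsPartial.masters_subset (h : IsPartial s T pend i) : T.masters ⊆ T.nodes :=
  fun w hw => (h.master_incomplete w hw).1.1

section Moves

variable {Key L' R' Ma' Key' : ℤ → ℤ}

theorem IsPartial.fresh (h : IsPartial s T pend i) (hw : w ∈ pend) (x : Bool) :
    w ++ [x] ∉ T.nodes := (h.pend_leaf w hw).2 x

theorem addChild_parent_mem (hpar : ∀ w a, w ++ [a] ∈ T.nodes → w ∈ T.nodes) (hw : w ∈ T.nodes)
    {x : Bool} : ∀ u a, u ++ [a] ∈ (T.addChild w x).nodes → u ∈ (T.addChild w x).nodes := by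
  intro u y hu
  simp only [addChild, mem_insert, append_singleton_inj] at hu ⊢
  rcases hu with ⟨rfl, -⟩ | hu
  · exact .inr hw
  · exact .inr (hpar _ _ hu)

/-- Two additions of a child, joined by intermediate arrays that need not occur in any state of the
program. -/
theorem Pointers.expand (h : IsPartial s T pend i) (hP : Pointers T φ cnt L R Ma) (hw : w ∈ pend)
    (hL : ∀ z, L' z = if z = φ w then cnt else if z = cnt ∨ z = cnt + 1 then -1 else L z)
    (hR : ∀ z, R' z = if z = φ w then cnt + 1 else if z = cnt ∨ z = cnt + 1 then -1 else R z)
    (hMa : ∀ z, Ma' z = if z = cnt ∨ z = cnt + 1 then 0 else Ma z) :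
    Pointers (T.expand w)
      (Function.update (Function.update φ (w ++ [false]) cnt) (w ++ [true]) (cnt + 1)) (cnt + 1 + 1)
      L' R' Ma' := by
  have hwn := h.pend_subset hw
  have hlt := hP.lt w hwn
  have h1 := hP.addChild h.parent_mem h.masters_subset hwn (h.fresh hw false)
    (L' := fun z => if z = φ w then cnt else if z = cnt then -1 else L z)
    (R' := fun z => if z = cnt then -1 else R z) (Ma' := fun z => if z = cnt then 0 else Ma z)
    (by simp) (by simp) (by simp)
  have hφ : Function.update φ (w ++ [false]) cnt w = φ w := Function.update_of_ne (by simp) _ _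
  refine h1.addChild (w := w) (x := true) (addChild_parent_mem h.parent_mem hwn)
    (h.masters_subset.trans (subset_insert _ _)) (mem_insert_of_mem hwn) ?_ ?_ ?_ ?_
  · simp only [CodeTree.addChild, mem_insert, append_singleton_inj, not_or]
    exact ⟨by simp, h.fresh hw true⟩
  · intro z; rw [hL]; simp only [true_and, false_and, reduceCtorEq, if_false]; split_ifs <;> first | rfl | omega
  · intro z; rw [hR, hφ]; simp only [true_and, false_and, reduceCtorEq, if_false]; split_ifs <;> first | rfl | omega
  · intro z; rw [hMa]; split_ifs <;> first | rfl | omega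

theorem Keys.expand (h : IsPartial s T pend i) (hP : Pointers T φ cnt L R Ma)
    (hK : Keys T pend φ cnt Key) (hw : w ∈ pend)
    (hKey : ∀ z, Key' z = if z = φ w then -1 else
      if z = cnt ∨ z = cnt + 1 then (w.length : ℤ) + 1 else Key z) :
    Keys (T.expand w) (insert (w ++ [true]) (insert (w ++ [false]) (pend.erase w)))
      (Function.update (Function.update φ (w ++ [false]) cnt) (w ++ [true]) (cnt + 1)) (cnt + 1 + 1)
      Key' := by
  have hwn := h.pend_subset hw
  have hlt := hP.lt w hwn
  have hsub : pend.erase w ⊆ T.nodes := (erase_subset _ _).trans h.pend_subset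
  have h1 := hP.addChild h.parent_mem h.masters_subset hwn (h.fresh hw false)
    (L' := fun z => if z = φ w then cnt else if z = cnt then -1 else L z)
    (R' := fun z => if z = cnt then -1 else R z) (Ma' := fun z => if z = cnt then 0 else Ma z)
    (by simp) (by simp) (by simp)
  have k1 := hK.erase hP h.pend_subset hw (Key' := fun z => if z = φ w then -1 else Key z)
    (fun _ => rfl)
  have k2 := k1.addPend hP hsub (h.fresh hw false) (Key' := fun z => if z = cnt then
    (w.length : ℤ) + 1 else if z = φ w then -1 else Key z) (fun _ => rfl)
  refine k2.addPend h1 (w := w) (x := true) (insert_subset_insert _ hsub) ?_ ?_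
  · simp only [CodeTree.addChild, mem_insert, append_singleton_inj, not_or]
    exact ⟨by simp, h.fresh hw true⟩
  · intro z; rw [hKey]; split_ifs <;> first | rfl | omega

theorem Pointers.addMaster (h : IsPartial s T pend i) (hP : Pointers T φ cnt L R Ma)
    (hw : w ∈ pend)
    (hL : ∀ z, L' z = if z = φ w then cnt else if z = cnt then cnt + 1 else
      if z = cnt + 1 then -1 else L z)
    (hR : ∀ z, R' z = if z = cnt ∨ z = cnt + 1 then -1 else R z)
    (hMa : ∀ z, Ma' z = if z = φ w then 1 else if z = cnt ∨ z = cnt + 1 then 0 else Ma z) :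
    Pointers (T.addMaster w)
      (Function.update (Function.update φ (w ++ [false]) cnt) (w ++ [false] ++ [false]) (cnt + 1))
      (cnt + 1 + 1) L' R' Ma' := by
  have hwn := h.pend_subset hw
  have hlt := hP.lt w hwn
  have h1 := hP.addChild h.parent_mem h.masters_subset hwn (h.fresh hw false)
    (L' := fun z => if z = φ w then cnt else if z = cnt then -1 else L z)
    (R' := fun z => if z = cnt then -1 else R z) (Ma' := fun z => if z = cnt then 0 else Ma z)
    (by simp) (by simp) (by simp)
  have hφ : Function.update φ (w ++ [false]) cnt (w ++ [false]) = cnt := Function.update_self _ _ _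
  have h2 := h1.addChild (w := w ++ [false]) (x := false) (addChild_parent_mem h.parent_mem hwn)
    (h.masters_subset.trans (subset_insert _ _)) (mem_insert_self _ _)
    (by
      simp only [CodeTree.addChild, mem_insert, append_singleton_inj, not_or]
      exact ⟨by simp, fun h' => h.fresh hw false (h.parent_mem _ _ h')⟩)
    (L' := L') (R' := R') (Ma' := fun z => if z = cnt ∨ z = cnt + 1 then 0 else Ma z)
    (by intro z; rw [hL, hφ]; simp only [true_and]; split_ifs <;> first | rfl | omega)
    (by intro z; rw [hR]; simp only [false_and, reduceCtorEq, if_false]; split_ifs <;> first | rfl | omega)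
    (by intro z; split_ifs <;> first | rfl | omega)
  have hφ' : Function.update (Function.update φ (w ++ [false]) cnt) (w ++ [false] ++ [false])
      (cnt + 1) w = φ w := by
    rw [Function.update_of_ne (fun h => absurd (congrArg List.length h) (by simp)),
      Function.update_of_ne (by simp)]
  refine h2.addMark (w := w) ?_ (by intro z; rw [hMa, hφ'])
  simp only [CodeTree.addChild, mem_insert]
  exact .inr (.inr hwn)

theorem Keys.addMaster (h : IsPartial s T pend i) (hP : Pointers T φ cnt L R Ma)
    (hK : Keys T pend φ cnt Key) (hw : w ∈ pend)
    (hKey : ∀ z, Key' z = if z = φ w then -1 else if z = cnt then -1 else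
      if z = cnt + 1 then (w.length : ℤ) + 2 else Key z) :
    Keys (T.addMaster w) (insert (w ++ [false] ++ [false]) (pend.erase w))
      (Function.update (Function.update φ (w ++ [false]) cnt) (w ++ [false] ++ [false]) (cnt + 1))
      (cnt + 1 + 1) Key' := by
  have hwn := h.pend_subset hw
  have hlt := hP.lt w hwn
  have hsub : pend.erase w ⊆ T.nodes := (erase_subset _ _).trans h.pend_subset
  have h1 := hP.addChild h.parent_mem h.masters_subset hwn (h.fresh hw false)
    (L' := fun z => if z = φ w then cnt else if z = cnt then -1 else L z)
    (R' := fun z => if z = cnt then -1 else R z) (Ma' := fun z => if z = cnt then 0 else Ma z)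
    (by simp) (by simp) (by simp)
  have k1 := hK.erase hP h.pend_subset hw (Key' := fun z => if z = φ w then -1 else Key z)
    (fun _ => rfl)
  have k2 := k1.addDone hP hsub (h.fresh hw false) (Key' := fun z => if z = cnt then
    -1 else if z = φ w then -1 else Key z) (fun _ => rfl)
  have k3 := k2.addPend h1 (w := w ++ [false]) (x := false) (Key' := Key')
    (hsub.trans (subset_insert _ _))
    (by
      simp only [CodeTree.addChild, mem_insert, append_singleton_inj, not_or]
      exact ⟨by simp, fun h' => h.fresh hw false (h.parent_mem _ _ h')⟩)
    (by
      intro z; rw [hKey]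
      simp only [List.length_append, List.length_singleton]
      split_ifs <;> first | rfl | omega)
  exact ⟨k3.pend_key, k3.of_key⟩

end Moves

end CodeTree

end

section

/-! ## The program that builds a tree -/

/-- number of assigned symbols -/
notation "rI" => Reg.scratch 0
/-- free nodes of the current, the next and the second next level -/
notation "rK" => Reg.scratch 1
notation "rV" => Reg.scratch 2
notation "rM" => Reg.scratch 3
/-- position in the table -/
notation "rPos" => Reg.scratch 4
/-- base of the positions -/
notation "rBase" => Reg.scratch 5
notation "rQ" => Reg.scratch 6
notation "rQ'" => Reg.scratch 7
notation "rBest" => Reg.scratch 8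
notation "rChoice" => Reg.scratch 9
notation "rCand" => Reg.scratch 10
notation "rNext" => Reg.scratch 11
/-- current depth -/
notation "rD" => Reg.scratch 12
/-- number of nodes -/
notation "rCnt" => Reg.scratch 13
notation "rH" => Reg.scratch 14
/-- number of nodes of the level still to be expanded -/
notation "rE" => Reg.scratch 15
notation "aSuffix" => Arr.scratch 0
notation "aTable" => Arr.scratch 1
notation "aChoice" => Arr.scratch 2
/-- depths of the pending nodes -/
notation "aKey" => Arr.scratch 3

namespace Expr

abbrev add {R A : Type} (x y : Expr R A) : Expr R A := op .add x y
abbrev sub {R A : Type} (x y : Expr R A) : Expr R A := op .sub x y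
abbrev mul {R A : Type} (x y : Expr R A) : Expr R A := op .mul x y
abbrev div {R A : Type} (x y : Expr R A) : Expr R A := op .div x y
abbrev lt {R A : Type} (x y : Expr R A) : Expr R A := op .lt x y
abbrev eq {R A : Type} (x y : Expr R A) : Expr R A := op .eq x y

end Expr

namespace CodeTree

variable {n b : ℕ}

/-- Contribution of the first `i` symbols to `2 ^ b * L(T)`. -/
def partLen (S : Source n b) (T : CodeTree n) (i : ℕ) : ℤ :=
  ∑ j : Fin n, if (j : ℕ) < i then ((T.code j).length : ℤ) * S.weight j else 0

/-- Contribution of the first `i` symbols to `2 ^ b * q_1(T)`. -/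
def partMas (S : Source n b) (T : CodeTree n) (i : ℕ) : ℤ :=
  ∑ j : Fin n, if (j : ℕ) < i ∧ T.code j ∈ T.masters then (S.weight j : ℤ) else 0

theorem sum_lt_succ {f g : Fin n → ℤ} {i : ℕ} (hi : i < n)
    (h : ∀ j : Fin n, (j : ℕ) < i → g j = f j) :
    (∑ j : Fin n, if (j : ℕ) < i + 1 then g j else 0) =
      (∑ j : Fin n, if (j : ℕ) < i then f j else 0) + g ⟨i, hi⟩ := by
  have : ∀ j : Fin n, (if (j : ℕ) < i + 1 then g j else 0) =
      (if (j : ℕ) < i then f j else 0) + if j = ⟨i, hi⟩ then g j else 0 := by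
    intro j
    by_cases h1 : j = ⟨i, hi⟩
    · subst h1; simp
    · have h2 : (j : ℕ) ≠ i := fun h' => h1 (Fin.ext h')
      by_cases h3 : (j : ℕ) < i
      · rw [if_pos (by omega), if_pos h3, if_neg h1, h j h3, add_zero]
      · rw [if_neg (by omega), if_neg h3, if_neg h1, add_zero]
  rw [sum_congr rfl fun j _ => this j, sum_add_distrib]
  simp

variable {S : Source n b} {T T' : CodeTree n} {i : ℕ}

theorem partLen_succ (hi : i < n) (h : ∀ j : Fin n, (j : ℕ) < i → T'.code j = T.code j) :
    T'.partLen S (i + 1) = T.partLen S i + (T'.code ⟨i, hi⟩).length * S.wt i := by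
  unfold partLen
  rw [sum_lt_succ hi (f := fun j => ((T.code j).length : ℤ) * S.weight j)
    fun j hj => by rw [h j hj]]
  simp [Source.wt, hi]

theorem partMas_succ (hi : i < n)
    (h : ∀ j : Fin n, (j : ℕ) < i → (T'.code j ∈ T'.masters ↔ T.code j ∈ T.masters)) :
    T'.partMas S (i + 1) =
      T.partMas S i + if T'.code ⟨i, hi⟩ ∈ T'.masters then S.wt i else 0 := by
  unfold partMas
  simp only [ite_and]
  rw [sum_lt_succ hi (f := fun j => if T.code j ∈ T.masters then (S.weight j : ℤ) else 0)
    fun j hj => by simp only [h j hj]]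
  simp [Source.wt, hi]

theorem partLen_of_le (hi : n ≤ i) : T.partLen S i = T.totalLen S :=
  sum_congr rfl fun j _ => if_pos (by omega)

theorem partMas_of_le (hi : n ≤ i) : T.partMas S i = T.masterWeight S :=
  sum_congr rfl fun j _ => by simp only [show (j : ℕ) < i by omega, true_and]

end CodeTree

open CodeTree

variable {n b : ℕ} {S : Source n b} {s : Fin 2}

/-- The arrays and registers of `σ` hold the tree `T` under construction: the first `i` symbols
are assigned, and `k`, `v`, `m` nodes of depth `d`, `d + 1`, `d + 2` are pending. -/
structure Holds (s : Fin 2) (S : Source n b) (σ : St) (T : CodeTree n) (φ : List Bool → ℤ)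
    (pend : Finset (List Bool)) (i d k v m : ℕ) : Prop where
  isPartial : IsPartial s T pend i
  pointers : T.Pointers φ (σ.reg rCnt) (σ.arr (.tree s .left)) (σ.arr (.tree s .right))
    (σ.arr (.tree s .master))
  keys : T.Keys pend φ (σ.reg rCnt) (σ.arr aKey)
  symbol : ∀ j : Fin n, (j : ℕ) < i → σ.arr (.tree s .symbol) (j : ℕ) = φ (T.code j)
  len_eq : σ.reg (.len s) = T.partLen S i
  -- For `s = 1` the symbols at leaves are counted: the weight assigned so far, less that of the
  -- masters.
  swt_eq : σ.reg (.swt s) =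
    if s = 0 then T.partMas S i else 2 ^ b - S.suffix i - T.partMas S i
  card_zero : (pend.filter (·.length = d)).card = k
  card_one : (pend.filter (·.length = d + 1)).card = v
  card_two : (pend.filter (·.length = d + 2)).card = m
  length_le : ∀ w ∈ pend, w.length ≤ d + 2
  -- Invariant under all three moves: an expansion adds two nodes and one pending node, a master
  -- adds two nodes and one symbol, a leaf turns a pending node into a symbol. The initial trees
  -- have one node, one of them pending, and four nodes, two of them pending. It keeps the number of
  -- nodes linear in `n`.
  cnt_eq : σ.reg rCnt + 1 = 2 * (k + v + m + i : ℕ) + (s : ℕ)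

/-- Some tree is held, in which masters of total weight `p` are used. -/
def HoldsTree (s : Fin 2) (S : Source n b) (σ : St) (i d k v m : ℕ) (p : ℤ) : Prop :=
  ∃ T φ pend, Holds s S σ T φ pend i d k v m ∧ T.partMas S i = p

/-- Registers used by the building steps. -/
def buildRegs (s : Fin 2) : List Reg := [rI, rK, rV, rM, rD, rCnt, rE, .len s, .swt s]

/-- Find a pending node of depth `rD`. -/
def findPending : Prg :=
  .seq (.assign rH (.const 0))
    (.loop (.sub (.const 1) (.eq (.get aKey (.reg rH)) (.reg rD)))
      (.assign rH (.add (.reg rH) (.const 1))))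

theorem RamState.setReg_setReg {R A : Type} (σ : RamState R A) (r : R) (x y : ℤ) :
    (σ.setReg r x).setReg r y = σ.setReg r y := by
  simp [setReg]

theorem findPending_halts {w : ℕ} {M : ℤ} (hM : 2 ≤ M) (hw : M ^ 10 < 2 ^ w) {σ : St}
    {T : CodeTree n} {φ : List Bool → ℤ} {pend : Finset (List Bool)} {i d k v m : ℕ}
    (h : Holds s S σ T φ pend i d (k + 1) v m) (hd : σ.reg rD = d) (hdM : (d : ℤ) + 2 ≤ M)
    (hcM : σ.reg rCnt ≤ M) :
    Halts w findPending σ ((σ.reg rCnt).toNat * 20 + 20)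
      (fun τ => ∃ u ∈ pend, u.length = d ∧ τ = σ.setReg rH (φ u)) := by
  have hP := h.pointers
  have hsub := h.isPartial.pend_subset
  obtain ⟨u, hu⟩ : (pend.filter (·.length = d)).Nonempty := by
    rw [← card_pos, h.card_zero]; omega
  obtain ⟨hup, hud⟩ := mem_filter.1 hu
  have hu0 := hP.nonneg u (hsub hup)
  have hul := hP.lt u (hsub hup)
  have hpow : ∀ {a : ℕ}, a ≤ 10 → M ^ a < 2 ^ w := fun ha =>
    (pow_le_pow_right₀ (by linarith) ha).trans_lt hw
  have hkey : ∀ z, 0 ≤ z → z < σ.reg rCnt → |σ.arr aKey z| ≤ M := by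
    intro z h0 h1
    rcases h.keys.of_key z h0 h1 with h2 | ⟨x, hx, rfl⟩
    · rw [h2]; simp; linarith
    · rw [h.keys.pend_key x hx]
      have := h.length_le x hx
      rw [abs_of_nonneg (by positivity)]; omega
  -- The variant is the distance to the number of one fixed pending node `u` of depth `d`. The scan
  -- may stop earlier, at another pending node of that depth.
  set I : ℕ → St → Prop := fun j τ => ∃ z : ℤ, 0 ≤ z ∧ z + j = φ u ∧ τ = σ.setReg rH z ∧
    ∀ y, 0 ≤ y → y < z → σ.arr aKey y ≠ d with hI
  have hread : ∀ z, 0 ≤ z → z < σ.reg rCnt → ∀ r ∈ [rH, rD], |(σ.setReg rH z).reg r| ≤ M := by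
    intro z h0 h1
    simp [hd, abs_of_nonneg h0, abs_of_nonneg (show (0 : ℤ) ≤ d by positivity)]
    constructor <;> linarith
  have hloop := fun j (τ : St) (hτ : I j τ) => Halts.loop (w := w) (I := I)
    (e := .sub (.const 1) (.eq (.get aKey (.reg rH)) (.reg rD)))
    (c := .assign rH (.add (.reg rH) (.const 1))) (T := 4)
    (by
      rintro j τ ⟨z, h0, h1, rfl, -⟩
      refine Expr.fits_of_pow_cost_lt hM (hread z h0 (by omega)) ?_ ?_ (hpow (by decide))
      · simp [Expr.RegsIn]
      · simp only [Expr.ReadsLe, Expr.eval, RamState.setReg_arr, RamState.setReg_reg_same]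
        exact ⟨trivial, ⟨trivial, hkey z h0 (by omega)⟩, trivial⟩)
    (by
      rintro j τ ⟨z, h0, h1, rfl, h2⟩ hne
      refine (Cmd.wp.halts hM [rH, rD] (hread z h0 (by omega)) (hpow (by decide)) ?_).mono
        (by decide) (fun _ => id)
      have hz : σ.arr aKey z ≠ d := by
        intro hz
        apply hne
        simp [Expr.eval, WordOp.eval, hd, hz]
      have hj : j ≠ 0 := by
        rintro rfl
        have : z = φ u := by simpa using h1
        rw [this, h.keys.pend_key u hup, hud] at hz
        exact hz rfl
      refine ⟨by simp [Expr.RegsIn], by simp [Expr.ReadsLe], j - 1, by omega, z + 1, by omega,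
        by omega, ?_, ?_⟩
      · simp [RamState.setReg_setReg, Expr.eval, WordOp.eval]
      · intro y hy hy'
        rcases (show y < z ∨ y = z by omega) with hlt | rfl
        · exact h2 y hy hlt
        · exact hz) j hτ
  have hfirst : Halts w (.assign rH (.const 0)) σ 2 (I (φ u).toNat) := by
    refine (Cmd.wp.halts hM [rD] ?_ (hpow (by decide)) ?_)
    · intro r hr; simp at hr; subst hr
      rw [hd, abs_of_nonneg (by positivity)]; linarith
    · exact ⟨by simp [Expr.RegsIn], by simp [Expr.ReadsLe], 0, le_rfl, by omega, rfl,
        fun y h1 h2 => by omega⟩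
  refine (hfirst.seq fun τ hτ => hloop _ τ hτ).mono ?_ ?_
  · simp only [Expr.cost]; omega
  · rintro τ ⟨⟨j, z, h0, h1, rfl, -⟩, h2⟩
    simp only [Expr.eval, WordOp.eval, RamState.setReg_arr, RamState.setReg_reg_same,
      RamState.setReg_reg_ne _ _ (show (rD : Reg) ≠ rH by simp), hd] at h2
    have hz : σ.arr aKey z = d := by
      by_contra hne
      rw [if_neg hne] at h2; simp at h2
    rcases h.keys.of_key z h0 (by omega) with h3 | ⟨x, hx, rfl⟩
    · omega
    · have := h.keys.pend_key x hx
      exact ⟨x, hx, by omega, rfl⟩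

end

/-! ### Elementary moves of the construction: leaf, master, expansion. -/

section

open CodeTree
variable {n b : ℕ} {S : Source n b} {s : Fin 2}

namespace Cmd

/-- Add a node without children; `key` is its entry in `aKey`. -/
def newNode (s : Fin 2) (key : Expr Reg Arr) : Prg :=
  .block [
    .store (.tree s .left) (.reg rCnt) (.const (-1)),
    .store (.tree s .right) (.reg rCnt) (.const (-1)),
    .store (.tree s .master) (.reg rCnt) (.const 0),
    .store aKey (.reg rCnt) key,
    .assign rCnt (.add (.reg rCnt) (.const 1))]

/-- Assign the next symbol to the node `rH`. -/
def assignSymbol (s : Fin 2) (switch : Prop) [Decidable switch] : Prg :=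
  .block [
    .store (.tree s .symbol) (.reg rI) (.reg rH),
    .assign (.len s) (.add (.reg (.len s)) (.mul (.reg rD) (.get .weight (.reg rI)))),
    if switch then .assign (.swt s) (.add (.reg (.swt s)) (.get .weight (.reg rI))) else .skip,
    .assign rI (.add (.reg rI) (.const 1)),
    .assign rK (.sub (.reg rK) (.const 1))]

/-- A switch to the other tree is caused by leaves in `T_1` and by masters in `T_0`; hence `s = 1`
here and `s = 0` in `masterTail`. -/
def leafTail (s : Fin 2) : Prg :=
  .block [.store aKey (.reg rH) (.const (-1)), assignSymbol s (s = 1)]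

/-- Of the two new nodes, the slave is never pending and gets the key `-1`; its child is pending,
two levels below the master. -/
def masterTail (s : Fin 2) : Prg :=
  .block [
    .store aKey (.reg rH) (.const (-1)),
    newNode s (.const (-1)),
    newNode s (.add (.reg rD) (.const 2)),
    .store (.tree s .left) (.sub (.reg rCnt) (.const 2)) (.sub (.reg rCnt) (.const 1)),
    .store (.tree s .left) (.reg rH) (.sub (.reg rCnt) (.const 2)),
    .store (.tree s .master) (.reg rH) (.const 1),
    assignSymbol s (s = 0),
    .assign rM (.add (.reg rM) (.const 1))]

def expandTail (s : Fin 2) : Prg :=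
  .block [
    .store aKey (.reg rH) (.const (-1)),
    newNode s (.add (.reg rD) (.const 1)),
    newNode s (.add (.reg rD) (.const 1)),
    .store (.tree s .left) (.reg rH) (.sub (.reg rCnt) (.const 2)),
    .store (.tree s .right) (.reg rH) (.sub (.reg rCnt) (.const 1)),
    .assign rE (.sub (.reg rE) (.const 1))]

end Cmd

open Cmd

section
variable {w : ℕ} {M : ℤ} {σ : St} {T : CodeTree n} {φ : List Bool → ℤ}
  {pend : Finset (List Bool)} {i d k v m : ℕ}

theorem Finset.card_filter_erase_of_pos {α : Type*} [DecidableEq α] {t : Finset α} {p : α → Prop}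
    [DecidablePred p] {x : α} (hx : x ∈ t) (hp : p x) {k : ℕ} (h : (t.filter p).card = k + 1) :
    ((t.erase x).filter p).card = k := by
  rw [filter_erase, card_erase_of_mem (mem_filter.2 ⟨hx, hp⟩), h]; rfl

theorem Finset.card_filter_erase_of_neg {α : Type*} [DecidableEq α] {t : Finset α} {p : α → Prop}
    [DecidablePred p] {x : α} (hp : ¬ p x) : ((t.erase x).filter p).card = (t.filter p).card := by
  rw [filter_erase, erase_eq_of_notMem (by simp [hp])]

theorem Holds.abs_node_le (h : Holds s S σ T φ pend i d k v m)
    (hb : ∀ r ∈ buildRegs s, |σ.reg r| ≤ M) {u : List Bool} (hu : u ∈ pend) : |φ u| ≤ M := by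
  have h1 := h.pointers.lt u (h.isPartial.pend_subset hu)
  have h2 := h.pointers.nonneg u (h.isPartial.pend_subset hu)
  have h3 := hb rCnt (by simp [buildRegs])
  rw [abs_le] at *; omega

/-- The program enters only through its net effect on arrays and registers, which symbolic execution
supplies. The same holds for `Holds.expand` and `Holds.addMaster`. -/
theorem Holds.leaf (h : Holds s S σ T φ pend i d (k + 1) v m) (hi : i < n) {u : List Bool}
    (hu : u ∈ pend) (hud : u.length = d) {τ : St} (hcnt : τ.reg rCnt = σ.reg rCnt)
    (hL : τ.arr (.tree s .left) = σ.arr (.tree s .left))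
    (hR : τ.arr (.tree s .right) = σ.arr (.tree s .right))
    (hMa : τ.arr (.tree s .master) = σ.arr (.tree s .master))
    (hSy : τ.arr (.tree s .symbol) = Function.update (σ.arr (.tree s .symbol)) i (φ u))
    (hKey : τ.arr aKey = Function.update (σ.arr aKey) (φ u) (-1))
    (hlen : τ.reg (.len s) = σ.reg (.len s) + d * S.wt i)
    (hswt : τ.reg (.swt s) = σ.reg (.swt s) + if s = 1 then S.wt i else 0) :
    HoldsTree s S τ (i + 1) d k v m (T.partMas S i) := by
  have hcode : ∀ j : Fin n, (j : ℕ) < i → (T.setCode ⟨i, hi⟩ u).code j = T.code j := by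
    intro j hj
    exact Function.update_of_ne (fun h => by simp [h] at hj) _ _
  have hself : (T.setCode ⟨i, hi⟩ u).code ⟨i, hi⟩ = u := Function.update_self _ _ _
  have hlen' := partLen_succ (S := S) hi hcode
  have hmas := partMas_succ (S := S) (T' := T.setCode ⟨i, hi⟩ u) (T := T) hi
    (fun j hj => by rw [hcode j hj]; rfl)
  rw [hself, if_neg (show u ∉ (T.setCode ⟨i, hi⟩ u).masters from h.isPartial.not_master hu),
    add_zero] at hmas
  rw [hself, hud] at hlen'
  have hsuf := S.suffix_succ i
  refine ⟨T.setCode ⟨i, hi⟩ u, φ, pend.erase u, ⟨h.isPartial.setCode hi hu, ?_, ?_, ?_, ?_, ?_, ?_,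
    ?_, ?_, ?_, ?_⟩, hmas⟩
  · rw [hcnt, hL, hR, hMa]
    obtain ⟨h1, h2, h3, h4, h5, h6, h7⟩ := h.pointers
    exact ⟨h1, h2, h3, h4, h5, h6, h7⟩
  · obtain ⟨h1, h2⟩ := h.keys.erase h.pointers h.isPartial.pend_subset hu
      (Key' := τ.arr aKey) (fun z => by rw [hKey, Function.update_apply])
    exact ⟨h1, by rwa [hcnt]⟩
  · intro j hj
    rw [hSy]
    by_cases hji : j = ⟨i, hi⟩
    · subst hji; rw [hself]; simp
    · have : (j : ℕ) < i := by
        have : (j : ℕ) ≠ i := fun h' => hji (Fin.ext h')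
        omega
      rw [Function.update_of_ne (by omega), hcode j this, h.symbol j this]
  · rw [hlen, hlen', h.len_eq]
  · rw [hswt, h.swt_eq, hmas]
    have hs : s = 0 ∨ s = 1 := by omega
    rcases hs with rfl | rfl
    · simp
    · simp only [one_ne_zero, if_false, if_true]; linarith
  · exact Finset.card_filter_erase_of_pos hu hud h.card_zero
  · rw [Finset.card_filter_erase_of_neg (by omega)]; exact h.card_one
  · rw [Finset.card_filter_erase_of_neg (by omega)]; exact h.card_two
  · exact fun w hw => h.length_le w (mem_of_mem_erase hw)
  · have := h.cnt_eq
    rw [hcnt]; push_cast at *; linarith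

theorem Holds.expand (h : Holds s S σ T φ pend i d (k + 1) v m) {u : List Bool}
    (hu : u ∈ pend) (hud : u.length = d) {τ : St} (hcnt : τ.reg rCnt = σ.reg rCnt + 1 + 1)
    (hL : ∀ z, τ.arr (.tree s .left) z = if z = φ u then σ.reg rCnt else
      if z = σ.reg rCnt ∨ z = σ.reg rCnt + 1 then -1 else σ.arr (.tree s .left) z)
    (hR : ∀ z, τ.arr (.tree s .right) z = if z = φ u then σ.reg rCnt + 1 else
      if z = σ.reg rCnt ∨ z = σ.reg rCnt + 1 then -1 else σ.arr (.tree s .right) z)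
    (hMa : ∀ z, τ.arr (.tree s .master) z =
      if z = σ.reg rCnt ∨ z = σ.reg rCnt + 1 then 0 else σ.arr (.tree s .master) z)
    (hSy : τ.arr (.tree s .symbol) = σ.arr (.tree s .symbol))
    (hKey : ∀ z, τ.arr aKey z = if z = φ u then -1 else
      if z = σ.reg rCnt ∨ z = σ.reg rCnt + 1 then (d : ℤ) + 1 else σ.arr aKey z)
    (hlen : τ.reg (.len s) = σ.reg (.len s)) (hswt : τ.reg (.swt s) = σ.reg (.swt s)) :
    HoldsTree s S τ i d k (v + 2) m (T.partMas S i) := by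
  have hne0 : ∀ {x} (y : Bool), x ∈ T.nodes → x ≠ u ++ [y] := fun y hx h' =>
    h.isPartial.fresh hu y (h' ▸ hx)
  have hsub := h.isPartial.pend_subset
  have hmem : ∀ y, u ++ [y] ∉ pend.erase u := fun y hy => hne0 y (hsub (mem_of_mem_erase hy)) rfl
  refine ⟨T.expand u, Function.update (Function.update φ (u ++ [false]) (σ.reg rCnt)) (u ++ [true])
    (σ.reg rCnt + 1), insert (u ++ [true]) (insert (u ++ [false]) (pend.erase u)),
    ⟨h.isPartial.expand hu, ?_, ?_, ?_, ?_, ?_, ?_, ?_, ?_, ?_, ?_⟩, rfl⟩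
  · rw [hcnt]
    exact Pointers.expand h.isPartial h.pointers hu hL hR hMa
  · rw [hcnt]
    exact Keys.expand h.isPartial h.pointers h.keys hu (by rw [hud]; exact hKey)
  · intro j hj
    rw [hSy, h.symbol j hj]
    have : T.code j ∈ T.nodes := (h.isPartial.code_mem j hj).elim (fun h' => h'.1)
      fun h' => h.isPartial.masters_subset h'
    exact ((Function.update_of_ne (hne0 _ this) _ _).trans
      (Function.update_of_ne (hne0 _ this) _ _)).symm
  · rw [hlen, h.len_eq]; rfl
  · rw [hswt, h.swt_eq]; rfl
  · rw [filter_insert, if_neg (by simp; omega), filter_insert, if_neg (by simp; omega)]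
    exact Finset.card_filter_erase_of_pos hu hud h.card_zero
  · rw [filter_insert, if_pos (by simp; omega), filter_insert, if_pos (by simp; omega),
      card_insert_of_notMem, card_insert_of_notMem,
      Finset.card_filter_erase_of_neg (by omega), h.card_one]
    · exact fun h' => hmem _ (mem_filter.1 h').1
    · simp only [mem_insert, append_singleton_inj, not_or]
      exact ⟨by simp, fun h' => hmem _ (mem_filter.1 h').1⟩
  · rw [filter_insert, if_neg (by simp; omega), filter_insert, if_neg (by simp; omega),
      Finset.card_filter_erase_of_neg (by omega), h.card_two]
  · intro w hw
    simp only [mem_insert] at hw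
    rcases hw with rfl | rfl | hw
    · simp; omega
    · simp; omega
    · exact h.length_le w (mem_of_mem_erase hw)
  · have := h.cnt_eq
    rw [hcnt]; push_cast at *; linarith

theorem Holds.addMaster (h : Holds s S σ T φ pend i d (k + 1) v m) (hi : i < n) {u : List Bool}
    (hu : u ∈ pend) (hud : u.length = d) {τ : St} (hcnt : τ.reg rCnt = σ.reg rCnt + 1 + 1)
    (hL : ∀ z, τ.arr (.tree s .left) z = if z = φ u then σ.reg rCnt else
      if z = σ.reg rCnt then σ.reg rCnt + 1 else
      if z = σ.reg rCnt + 1 then -1 else σ.arr (.tree s .left) z)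
    (hR : ∀ z, τ.arr (.tree s .right) z =
      if z = σ.reg rCnt ∨ z = σ.reg rCnt + 1 then -1 else σ.arr (.tree s .right) z)
    (hMa : ∀ z, τ.arr (.tree s .master) z = if z = φ u then 1 else
      if z = σ.reg rCnt ∨ z = σ.reg rCnt + 1 then 0 else σ.arr (.tree s .master) z)
    (hSy : τ.arr (.tree s .symbol) = Function.update (σ.arr (.tree s .symbol)) i (φ u))
    (hKey : ∀ z, τ.arr aKey z = if z = φ u then -1 else if z = σ.reg rCnt then -1 else
      if z = σ.reg rCnt + 1 then (d : ℤ) + 2 else σ.arr aKey z)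
    (hlen : τ.reg (.len s) = σ.reg (.len s) + d * S.wt i)
    (hswt : τ.reg (.swt s) = σ.reg (.swt s) + if s = 0 then S.wt i else 0) :
    HoldsTree s S τ (i + 1) d k v (m + 1) (T.partMas S i + S.wt i) := by
  have hne0 : ∀ {x} (y : Bool), x ∈ T.nodes → x ≠ u ++ [y] := fun y hx h' =>
    h.isPartial.fresh hu y (h' ▸ hx)
  have hne1 : ∀ {x}, x ∈ T.nodes → x ≠ u ++ [false] ++ [false] := fun hx h' =>
    h.isPartial.fresh hu false (h.isPartial.parent_mem _ _ (h' ▸ hx))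
  have hsub := h.isPartial.pend_subset
  have hmem : u ++ [false] ++ [false] ∉ pend.erase u :=
    fun hy => hne1 (hsub (mem_of_mem_erase hy)) rfl
  set T' := (T.addMaster u).setCode ⟨i, hi⟩ u with hT'
  have hcode : ∀ j : Fin n, (j : ℕ) < i → T'.code j = T.code j := by
    intro j hj
    exact Function.update_of_ne (fun h => by simp [h] at hj) _ _
  have hself : T'.code ⟨i, hi⟩ = u := Function.update_self _ _ _
  have hum : u ∈ T'.masters := mem_insert_self _ _
  have hlen' := partLen_succ (S := S) hi hcode
  have hmas := partMas_succ (S := S) (T' := T') (T := T) hi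
    (fun j hj => by
      rw [hcode j hj]
      change T.code j ∈ insert u T.masters ↔ _
      rw [mem_insert, or_iff_right]
      exact fun h' => h.isPartial.code_pend j hj (h' ▸ hu))
  rw [hself, if_pos hum] at hmas
  rw [hself, hud] at hlen'
  have hsuf := S.suffix_succ i
  have hφ : ∀ {x}, x ∈ T.nodes → Function.update (Function.update φ (u ++ [false]) (σ.reg rCnt))
      (u ++ [false] ++ [false]) (σ.reg rCnt + 1) x = φ x := fun hx =>
    (Function.update_of_ne (hne1 hx) _ _).trans (Function.update_of_ne (hne0 _ hx) _ _)
  refine ⟨T', Function.update (Function.update φ (u ++ [false]) (σ.reg rCnt))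
    (u ++ [false] ++ [false]) (σ.reg rCnt + 1), insert (u ++ [false] ++ [false]) (pend.erase u),
    ⟨h.isPartial.addMaster hi hu, ?_, ?_, ?_, ?_, ?_, ?_, ?_, ?_, ?_, ?_⟩, hmas⟩
  · rw [hcnt]
    obtain ⟨h1, h2, h3, h4, h5, h6, h7⟩ :=
      Pointers.addMaster h.isPartial h.pointers hu hL hR hMa
    exact ⟨h1, h2, h3, h4, h5, h6, h7⟩
  · rw [hcnt]
    obtain ⟨h1, h2⟩ :=
      Keys.addMaster h.isPartial h.pointers h.keys hu (by rw [hud]; exact hKey)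
    exact ⟨h1, h2⟩
  · intro j hj
    rw [hSy]
    by_cases hji : j = ⟨i, hi⟩
    · subst hji; rw [hself, hφ (hsub hu)]; simp
    · have hlt : (j : ℕ) < i := by
        have : (j : ℕ) ≠ i := fun h' => hji (Fin.ext h')
        omega
      have : T.code j ∈ T.nodes := (h.isPartial.code_mem j hlt).elim (fun h' => h'.1)
        fun h' => h.isPartial.masters_subset h'
      rw [Function.update_of_ne (by omega), hcode j hlt, h.symbol j hlt, hφ this]
  · rw [hlen, hlen', h.len_eq]
  · rw [hswt, h.swt_eq, hmas]
    have hs : s = 0 ∨ s = 1 := by omega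
    rcases hs with rfl | rfl
    · simp
    · simp only [one_ne_zero, if_false]; linarith
  · rw [filter_insert, if_neg (by simp; omega)]
    exact Finset.card_filter_erase_of_pos hu hud h.card_zero
  · rw [filter_insert, if_neg (by simp; omega), Finset.card_filter_erase_of_neg (by omega),
      h.card_one]
  · rw [filter_insert, if_pos (by simp; omega), card_insert_of_notMem,
      Finset.card_filter_erase_of_neg (by omega), h.card_two]
    exact fun h' => hmem (mem_filter.1 h').1
  · intro w hw
    simp only [mem_insert] at hw
    rcases hw with rfl | hw
    · simp; omega
    · exact h.length_le w (mem_of_mem_erase hw)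
  · have := h.cnt_eq
    rw [hcnt]; push_cast at *; linarith

theorem leafTail_halts (hM : 2 ≤ M) (hw : M ^ (leafTail s).growth < 2 ^ w)
    (h : Holds s S σ T φ pend i d (k + 1) v m) (hi : i < n)
    (hb : ∀ r ∈ buildRegs s, |σ.reg r| ≤ M) (hwt : σ.arr .weight i = S.wt i) (hwM : |S.wt i| ≤ M)
    (hI : σ.reg rI = i) (hK : σ.reg rK = (k + 1 : ℕ)) (hD : σ.reg rD = d) {u : List Bool}
    (hu : u ∈ pend) (hud : u.length = d) (hH : σ.reg rH = φ u) :
    Halts w (leafTail s) σ (leafTail s).maxCost (fun τ =>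
      HoldsTree s S τ (i + 1) d k v m (T.partMas S i) ∧ τ.reg rI = (i + 1 : ℕ) ∧
      τ.reg rK = k ∧ τ.reg (.len s) = σ.reg (.len s) + d * S.wt i) := by
  refine Cmd.wp.halts hM (rH :: buildRegs s) ?_ hw ?_
  · simp only [List.mem_cons, forall_eq_or_imp]
    exact ⟨hH ▸ h.abs_node_le hb hu, hb⟩
  have hs : s = 0 ∨ s = 1 := by omega
  rcases hs with rfl | rfl <;>
  · simp [leafTail, assignSymbol, Cmd.block, Cmd.wp, Expr.RegsIn, Expr.ReadsLe, Expr.eval,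
      WordOp.eval, buildRegs, hI, hK, hD, hH, hwt, hwM]
    exact h.leaf hi hu hud (by simp) (by simp) (by simp) (by simp) (by simp) (by simp) (by simp)
      (by simp)

theorem masterTail_halts (hM : 2 ≤ M) (hw : M ^ (masterTail s).growth < 2 ^ w)
    (h : Holds s S σ T φ pend i d (k + 1) v m) (hi : i < n)
    (hb : ∀ r ∈ buildRegs s, |σ.reg r| ≤ M) (hwt : σ.arr .weight i = S.wt i) (hwM : |S.wt i| ≤ M)
    (hI : σ.reg rI = i) (hK : σ.reg rK = (k + 1 : ℕ)) (hD : σ.reg rD = d) (hm : σ.reg rM = m)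
    {u : List Bool} (hu : u ∈ pend) (hud : u.length = d) (hH : σ.reg rH = φ u) :
    Halts w (masterTail s) σ (masterTail s).maxCost (fun τ =>
      HoldsTree s S τ (i + 1) d k v (m + 1) (T.partMas S i + S.wt i) ∧ τ.reg rI = (i + 1 : ℕ) ∧
      τ.reg rK = k ∧ τ.reg rM = (m + 1 : ℕ) ∧
      τ.reg (.len s) = σ.reg (.len s) + d * S.wt i) := by
  refine Cmd.wp.halts hM (rH :: buildRegs s) ?_ hw ?_
  · simp only [List.mem_cons, forall_eq_or_imp]
    exact ⟨hH ▸ h.abs_node_le hb hu, hb⟩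
  have hlt := h.pointers.lt u (h.isPartial.pend_subset hu)
  have hs : s = 0 ∨ s = 1 := by omega
  rcases hs with rfl | rfl <;>
  · simp [masterTail, newNode, assignSymbol, Cmd.block, Cmd.wp, Expr.RegsIn, Expr.ReadsLe,
      Expr.eval, WordOp.eval, buildRegs, hI, hK, hD, hH, hm, hwt, hwM]
    apply h.addMaster hi hu hud
    case hSy | hlen | hswt | hcnt => simp
    all_goals
      intro z
      simp [Function.update_apply]
      split_ifs <;> first | rfl | omega

theorem expandTail_halts (hM : 2 ≤ M) (hw : M ^ (expandTail s).growth < 2 ^ w)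
    (h : Holds s S σ T φ pend i d (k + 1) v m) (hb : ∀ r ∈ buildRegs s, |σ.reg r| ≤ M)
    (hD : σ.reg rD = d) {u : List Bool} (hu : u ∈ pend) (hud : u.length = d)
    (hH : σ.reg rH = φ u) :
    Halts w (expandTail s) σ (expandTail s).maxCost (fun τ =>
      HoldsTree s S τ i d k (v + 2) m (T.partMas S i) ∧ τ.reg rE = σ.reg rE - 1) := by
  refine Cmd.wp.halts hM (rH :: buildRegs s) ?_ hw ?_
  · simp only [List.mem_cons, forall_eq_or_imp]
    exact ⟨hH ▸ h.abs_node_le hb hu, hb⟩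
  have hlt := h.pointers.lt u (h.isPartial.pend_subset hu)
  have hs : s = 0 ∨ s = 1 := by omega
  rcases hs with rfl | rfl <;>
  · simp [expandTail, newNode, Cmd.block, Cmd.wp, Expr.RegsIn, Expr.ReadsLe,
      Expr.eval, WordOp.eval, buildRegs, hD, hH]
    apply h.expand hu hud
    case hSy | hlen | hswt | hcnt => simp
    all_goals
      intro z
      simp [Function.update_apply]
      split_ifs <;> first | rfl | omega

end

end

/-! ### Computing one entry of the table of the dynamic program. -/

section

open CodeTree Cmd
variable {n b : ℕ} {S : Source n b} {s : Fin 2}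

/-- Position of an entry in the table. -/
def tablePos (n i k v m : ℕ) : ℕ := ((i * (n + 1) + k) * (n + 1) + v) * (n + 1) + m

theorem tablePos_lt {n i k v m : ℕ} (hi : i ≤ n) (hk : k ≤ n) (hv : v ≤ n) (hm : m ≤ n) :
    tablePos n i k v m < (n + 1) ^ 4 := by
  have h1 : i * (n + 1) + k + 1 ≤ (n + 1) * (n + 1) := by nlinarith
  have h2 : (i * (n + 1) + k) * (n + 1) + v + 1 ≤ (n + 1) * (n + 1) * (n + 1) := by nlinarith
  unfold tablePos
  nlinarith

theorem exists_tablePos {n t : ℕ} (ht : t < (n + 1) ^ 4) :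
    ∃ i k v m, i ≤ n ∧ k ≤ n ∧ v ≤ n ∧ m ≤ n ∧ t = tablePos n i k v m := by
  have hB : 0 < n + 1 := Nat.succ_pos n
  refine ⟨t / (n + 1) / (n + 1) / (n + 1), t / (n + 1) / (n + 1) % (n + 1),
    t / (n + 1) % (n + 1), t % (n + 1), ?_, ?_, ?_, ?_, ?_⟩
  · rw [Nat.div_div_eq_div_mul, Nat.div_div_eq_div_mul, ← Nat.lt_succ_iff,
      Nat.div_lt_iff_lt_mul (by positivity)]
    calc t < (n + 1) ^ 4 := ht
      _ = _ := by rw [Nat.succ_eq_add_one]; ring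
  · exact Nat.lt_succ_iff.1 (Nat.mod_lt _ hB)
  · exact Nat.lt_succ_iff.1 (Nat.mod_lt _ hB)
  · exact Nat.lt_succ_iff.1 (Nat.mod_lt _ hB)
  · unfold tablePos
    rw [Nat.div_add_mod', Nat.div_add_mod', Nat.div_add_mod']

theorem digits_inj {x y c d B : ℕ} (hc : c < B) (hd : d < B) (h : x * B + c = y * B + d) :
    x = y ∧ c = d := by
  have h1 : x = y := by
    have := congrArg (· / B) h
    simpa [add_comm, Nat.add_mul_div_right _ _ (by omega : 0 < B), Nat.div_eq_of_lt hc,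
      Nat.div_eq_of_lt hd] using this
  subst h1
  exact ⟨rfl, by omega⟩

theorem tablePos_inj {n i k v m i' k' v' m' : ℕ} (hk : k ≤ n) (hv : v ≤ n) (hm : m ≤ n)
    (hk' : k' ≤ n) (hv' : v' ≤ n) (hm' : m' ≤ n)
    (h : tablePos n i k v m = tablePos n i' k' v' m') : i = i' ∧ k = k' ∧ v = v' ∧ m = m' := by
  unfold tablePos at h
  obtain ⟨h, h1⟩ := digits_inj (by omega) (by omega) h
  obtain ⟨h, h2⟩ := digits_inj (by omega) (by omega) h
  obtain ⟨h, h3⟩ := digits_inj (by omega) (by omega) h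
  exact ⟨h, h3, h2, h1⟩

namespace Cmd

open Expr

abbrev posExpr (i k v m : Expr Reg Arr) : Expr Reg Arr :=
  add (mul (add (mul (add (mul i (.reg rBase)) k) (.reg rBase)) v) (.reg rBase)) m

def decodePos : Prg :=
  .block [
    .assign rPos (sub (.reg rPos) (.const 1)),
    .assign rQ (div (.reg rPos) (.reg rBase)),
    .assign rM (sub (.reg rPos) (mul (.reg rQ) (.reg rBase))),
    .assign rQ' (div (.reg rQ) (.reg rBase)),
    .assign rV (sub (.reg rQ) (mul (.reg rQ') (.reg rBase))),
    .assign rI (div (.reg rQ') (.reg rBase)),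
    .assign rK (sub (.reg rQ') (mul (.reg rI) (.reg rBase)))]

/-- Replace the best value by that of another choice if this is better. -/
def tryChoice (c : ℤ) (e : Expr Reg Arr) : Prg :=
  .block [
    .assign rCand e,
    .ite (lt (.reg rCand) (.reg rBest))
      (.block [.assign rBest (.reg rCand), .assign rChoice (.const c)]) .skip]

def pendingExpr : Expr Reg Arr := add (add (.reg rK) (.reg rV)) (.reg rM)

def tryLevel : Prg :=
  .block [
    .assign rNext (add (mul (.const 2) (.reg rK)) (.reg rV)),
    .ite (lt (.reg rNext) (.reg .size)) .skip (.assign rNext (.reg .size)),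
    .assign rBest (add (mul (.reg .den) (.get aSuffix (.reg rI)))
      (.get aTable (posExpr (.reg rI) (.reg rNext) (.reg rM) (.const 0))))]

/-- Products of comparisons stand for conjunctions, here and in the two guards below. -/
def masterAllowed : Expr Reg Arr := mul (lt (.const 0) (.reg rK)) (lt (.reg rM) (.reg .size))

def masterValue : Expr Reg Arr :=
  add (mul (.reg .num) (.get .weight (.reg rI)))
    (.get aTable (posExpr (add (.reg rI) (.const 1)) (sub (.reg rK) (.const 1)) (.reg rV)
      (add (.reg rM) (.const 1))))

def leafAllowed : Expr Reg Arr := mul (lt (.const 0) (.reg rK)) (lt (.const 1) pendingExpr)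

def leafValue : Expr Reg Arr :=
  .get aTable (posExpr (add (.reg rI) (.const 1)) (sub (.reg rK) (.const 1)) (.reg rV) (.reg rM))

def entryNeeded : Expr Reg Arr :=
  mul (lt (add (.reg rI) (.reg rK)) (.reg .size)) (lt (.const 0) pendingExpr)

def initEntry : Prg := .block [.assign rBest (.const 0), .assign rChoice (.const 0)]

def bestEntry : Prg :=
  .block [tryLevel, .ite masterAllowed (tryChoice 1 masterValue) .skip,
    .ite leafAllowed (tryChoice 2 leafValue) .skip]

def storeEntry : Prg :=
  .block [.store aTable (.reg rPos) (.reg rBest), .store aChoice (.reg rPos) (.reg rChoice)]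

def computeEntry : Prg := .block [initEntry, .ite entryNeeded bestEntry .skip, storeEntry]

end Cmd

/-- The input and the auxiliary data on which the construction of the table relies. -/
structure Env (S : Source n b) (a e : ℤ) (σ : St) : Prop where
  size : σ.reg .size = n
  num : σ.reg .num = a
  den : σ.reg .den = e
  base : σ.reg rBase = (n + 1 : ℕ)
  weight : ∀ i < n, σ.arr .weight i = S.wt i
  suffix : ∀ i ≤ n, σ.arr aSuffix i = S.suffix i

theorem Env.congr {a e : ℤ} {σ τ : St} (h : Env S a e σ)
    (hr : ∀ r ∈ [Reg.size, .num, .den, rBase], τ.reg r = σ.reg r)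
    (ha : ∀ r ∈ [Arr.weight, aSuffix], τ.arr r = σ.arr r) : Env S a e τ := by
  simp only [List.mem_cons, List.not_mem_nil, or_false, forall_eq_or_imp, forall_eq] at hr ha
  obtain ⟨h1, h2, h3, h4⟩ := hr
  obtain ⟨h5, h6⟩ := ha
  exact ⟨h1 ▸ h.size, h2 ▸ h.num, h3 ▸ h.den, h4 ▸ h.base, h5 ▸ h.weight, h6 ▸ h.suffix⟩

/-- The entry of the table is correct. -/
def EntryOk (S : Source n b) (a e : ℤ) (σ : St) (i k v m : ℕ) : Prop :=
  σ.arr aTable (tablePos n i k v m) = S.opt a e i k v m ∧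
  |σ.arr aChoice (tablePos n i k v m)| ≤ 2 ∧
  (i + k < n → 0 < k + v + m →
    Source.IsChoice S a e i k v m (σ.arr aChoice (tablePos n i k v m)))

/-- The table is filled from the last position downwards, since every decision leads to a state of
larger position. -/
def TableFrom (S : Source n b) (a e : ℤ) (σ : St) (t : ℕ) : Prop :=
  ∀ i k v m, i ≤ n → k ≤ n → v ≤ n → m ≤ n → t ≤ tablePos n i k v m → EntryOk S a e σ i k v m

theorem decodePos_halts {w : ℕ} {M : ℤ} (hM : 2 ≤ M) (hw : M ^ decodePos.growth < 2 ^ w) {σ : St}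
    {i k v m : ℕ} (hk : k ≤ n) (hv : v ≤ n) (hm : m ≤ n) (hB : σ.reg rBase = (n + 1 : ℕ))
    (hpos : σ.reg rPos = (tablePos n i k v m + 1 : ℕ)) (hBM : |σ.reg rBase| ≤ M)
    (hpM : |σ.reg rPos| ≤ M) :
    Halts w decodePos σ decodePos.maxCost (fun τ => τ.reg rPos = tablePos n i k v m ∧
      τ.reg rI = i ∧ τ.reg rK = k ∧ τ.reg rV = v ∧ τ.reg rM = m) := by
  refine Cmd.wp.halts hM [rPos, rBase] (by simp [hBM, hpM]) hw ?_
  have hdiv : ∀ (x : ℤ) (y : ℕ), y ≤ n → (x * (n + 1 : ℕ) + y) / (n + 1 : ℕ) = x := by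
    intro x y hy
    rw [add_comm, Int.add_mul_ediv_right _ _ (by positivity),
      Int.ediv_eq_zero_of_lt (by positivity) (by omega), zero_add]
  have h1 : (tablePos n i k v m : ℤ) =
      ((i * (n + 1 : ℕ) + k) * (n + 1 : ℕ) + v) * (n + 1 : ℕ) + m := by
    simp [tablePos]
  have hpos' : σ.reg rPos - 1 = tablePos n i k v m := by rw [hpos]; push_cast; ring
  have d1 := hdiv (((i * (n + 1 : ℕ) + k) * (n + 1 : ℕ) + v)) m hm
  have d2 := hdiv ((i * (n + 1 : ℕ) + k)) v hv
  have d3 := hdiv i k hk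
  rw [← h1] at d1
  push_cast at d1 d2 d3 h1
  simp [decodePos, Cmd.block, Cmd.wp, Expr.RegsIn, Expr.ReadsLe, Expr.eval, WordOp.eval, hpos', hB]
  rw [d1, d2, d3]
  refine ⟨rfl, by ring, by ring, by rw [h1]; ring⟩

/-- `τ` differs from `σ` only in the registers used to compare the choices. -/
def Comparing (σ τ : St) (best choice : ℤ) : Prop :=
  τ.arr = σ.arr ∧ (∀ r, r ≠ rBest → r ≠ rChoice → r ≠ rCand → r ≠ rNext → τ.reg r = σ.reg r) ∧
    τ.reg rBest = best ∧ τ.reg rChoice = choice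

/-- The cells read by `x` are required to be bounded only if the condition holds. On ties the
earlier choice stays. -/
theorem tryChoice_halts {w : ℕ} {M : ℤ} (hM : 2 ≤ M) {σ : St} {P : List Reg} {c : ℤ}
    {cond x : Expr Reg Arr} (hw : M ^ (Cmd.ite cond (tryChoice c x) .skip).growth < 2 ^ w)
    (hc : |c| ≤ 2) (hb : ∀ r ∈ P, |σ.reg r| ≤ M) (h1 : cond.RegsIn P) (h2 : cond.ReadsLe M σ)
    (h3 : cond.eval σ ≠ 0 → x.RegsIn P ∧ x.ReadsLe M σ) (hbest : |σ.reg rBest| ≤ M) :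
    Halts w (.ite cond (tryChoice c x) .skip) σ (Cmd.ite cond (tryChoice c x) .skip).maxCost
      (fun τ => (cond.eval σ ≠ 0 ∧ x.eval σ < σ.reg rBest ∧ Comparing σ τ (x.eval σ) c) ∨
        ((cond.eval σ ≠ 0 → σ.reg rBest ≤ x.eval σ) ∧
          Comparing σ τ (σ.reg rBest) (σ.reg rChoice))) := by
  have mono : ∀ {e : Expr Reg Arr}, e.RegsIn P → e.RegsIn (rBest :: P) := by
    intro e
    induction e with
    | const z => exact id
    | reg r => exact List.mem_cons_of_mem _
    | get a i ih => exact ih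
    | op o e₁ e₂ ih₁ ih₂ => exact fun h => ⟨ih₁ h.1, ih₂ h.2⟩
  refine Cmd.wp.halts hM (rBest :: P) ?_ hw ⟨⟨mono h1, h2⟩, fun h0 => ?_, fun h0 => ?_⟩
  · simp only [List.mem_cons, forall_eq_or_imp]; exact ⟨hbest, hb⟩
  · refine ⟨mono (h3 h0).1, (h3 h0).2, ?_⟩
    simp [tryChoice, Cmd.block, Cmd.wp, Expr.RegsIn, Expr.ReadsLe, Expr.eval, WordOp.eval, h0, hc]
    constructor
    · intro hlt
      refine .inl ⟨hlt, ?_, ?_, ?_, ?_⟩ <;> simp +contextual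
    · intro hle
      refine .inr ⟨hle, ?_, ?_, ?_, ?_⟩ <;> simp +contextual
  · exact .inr ⟨fun h => absurd h0 h, rfl, fun _ _ _ _ _ => rfl, rfl, rfl⟩

theorem tryLevel_halts {w : ℕ} {M : ℤ} (hM : 2 ≤ M) (hw : M ^ tryLevel.growth < 2 ^ w)
    {σ : St} {a e : ℤ} (hE : Env S a e σ) {i k v m : ℕ} (hi : i ≤ n) (hk : k < n)
    (hm : m ≤ n) (hd : 0 < k + v + m) (hv : v ≤ n)
    (ht : TableFrom S a e σ (tablePos n i k v m + 1)) (hI : σ.reg rI = i) (hK : σ.reg rK = k)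
    (hV : σ.reg rV = v) (hm' : σ.reg rM = m)
    (hb : ∀ r ∈ [Reg.size, .num, .den, rBase, rPos, rI, rK, rV, rM], |σ.reg r| ≤ M)
    (hoM : ∀ i k v m, |S.opt a e i k v m| ≤ M) (hsM : ∀ i, |S.suffix i| ≤ M) :
    Halts w tryLevel σ tryLevel.maxCost (fun τ =>
      Comparing σ τ (e * S.suffix i + S.opt a e i (2 * k + v) m 0) (σ.reg rChoice)) := by
  -- Either the digit `k` rises, or `k = v = 0` and the digit `v` rises to `m > 0`.
  have hlt : tablePos n i k v m + 1 ≤ tablePos n i (min (2 * k + v) n) m 0 := by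
    unfold tablePos
    rcases (show k + 1 ≤ min (2 * k + v) n ∨ (k = 0 ∧ v = 0 ∧ 0 < m) by omega) with h | ⟨rfl, rfl, h⟩
    · nlinarith [Nat.mul_le_mul_right ((n + 1) * (n + 1)) h]
    · simp; nlinarith
  have hT := (ht i (min (2 * k + v) n) m 0 hi (by omega) hm (by omega) hlt).1
  rw [Source.opt_min] at hT
  refine Cmd.wp.halts hM _ hb hw ?_
  have hS := hE.suffix i hi
  have hoM' := hoM i (2 * k + v) m 0
  have hsM' := hsM i
  rcases lt_or_ge (2 * k + v) n with hc | hc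
  · rw [min_eq_left hc.le] at hT
    unfold tablePos at hT; push_cast at hT
    rw [add_zero] at hT
    have hc1 : (2 * k + v : ℤ) < n := by exact_mod_cast hc
    simp [tryLevel, Cmd.block, Cmd.wp, Expr.RegsIn, Expr.ReadsLe, Expr.eval, WordOp.eval, hI, hK,
      hV, hm', hE.size, hE.den, hE.base, hc1, hT, hS, hoM', hsM', hc1.not_ge]
    refine ⟨?_, ?_, ?_, ?_⟩ <;> simp +contextual
  · rw [min_eq_right hc] at hT
    unfold tablePos at hT; push_cast at hT
    rw [add_zero] at hT
    have hc1 : (n : ℤ) ≤ 2 * k + v := by exact_mod_cast hc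
    simp [tryLevel, Cmd.block, Cmd.wp, Expr.RegsIn, Expr.ReadsLe, Expr.eval, WordOp.eval, hI, hK,
      hV, hm', hE.size, hE.den, hE.base, hc1, hT, hS, hoM', hsM', hc1.not_gt]
    refine ⟨?_, ?_, ?_, ?_⟩ <;> simp +contextual

/-- The fragments whose growth the word length has to absorb. The assignment of `entryNeeded` is
never executed; its growth is the cost of evaluating that guard. -/
def tablePieces : List Prg :=
  [decodePos, initEntry, tryLevel, .ite masterAllowed (tryChoice 1 masterValue) .skip,
    .ite leafAllowed (tryChoice 2 leafValue) .skip, .assign rBest entryNeeded, storeEntry]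

/-- Bounds on all numbers that occur in the construction of the table. -/
structure Bounds (S : Source n b) (a e : ℤ) (M : ℤ) : Prop where
  two_le : 2 ≤ M
  level : ∀ i j k v m, |e * S.suffix j + S.opt a e i k v m| ≤ M
  opt : ∀ i k v m, |S.opt a e i k v m| ≤ M
  suffix : ∀ i, |S.suffix i| ≤ M
  wt : ∀ i, |S.wt i| ≤ M
  num : |a| ≤ M
  den : |e| ≤ M
  pos : ((n + 1) ^ 4 : ℤ) ≤ M

theorem Comparing.trans {σ τ υ : St} {x y c d : ℤ} (h : Comparing σ τ x c)
    (h' : Comparing τ υ y d) : Comparing σ υ y d :=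
  ⟨h'.1.trans h.1, fun r h1 h2 h3 h4 => (h'.2.1 r h1 h2 h3 h4).trans (h.2.1 r h1 h2 h3 h4), h'.2.2⟩

theorem TableFrom.congr {a e : ℤ} {σ τ : St} {t : ℕ} (h : TableFrom S a e σ t)
    (h1 : τ.arr aTable = σ.arr aTable) (h2 : τ.arr aChoice = σ.arr aChoice) :
    TableFrom S a e τ t := by
  intro i k v m hi hk hv hm ht
  have := h i k v m hi hk hv hm ht
  unfold EntryOk at *
  rwa [h1, h2]

section
variable {w : ℕ} {M : ℤ} {σ : St} {a e : ℤ} {i k v m : ℕ}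

theorem bestEntry_halts (hB : Bounds S a e M) (hw : ∀ c ∈ tablePieces, M ^ c.growth < 2 ^ w)
    (ha : 0 ≤ a) (he : 0 ≤ e) (hE : Env S a e σ) (hik : i + k < n) (hd : 0 < k + v + m)
    (hv : v ≤ n) (hm : m ≤ n) (ht : TableFrom S a e σ (tablePos n i k v m + 1))
    (hI : σ.reg rI = i) (hK : σ.reg rK = k) (hV : σ.reg rV = v) (hm' : σ.reg rM = m)
    (hch : σ.reg rChoice = 0)
    (hb : ∀ r ∈ [Reg.size, .num, .den, rBase, rPos, rI, rK, rV, rM], |σ.reg r| ≤ M) :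
    Halts w bestEntry σ bestEntry.maxCost (fun τ => ∃ c, Comparing σ τ (S.opt a e i k v m) c ∧
      Source.IsChoice S a e i k v m c) := by
  set J := e * S.suffix i + S.opt a e i (2 * k + v) m 0 with hJ
  set A := a * S.wt i + S.opt a e (i + 1) (k - 1) v (m + 1) with hA
  set Le := S.opt a e (i + 1) (k - 1) v m with hLe
  have hopt : S.opt a e i k v m = min J (min (if 0 < k ∧ m < n then A else J)
      (if 0 < k ∧ 1 < k + v + m then Le else J)) := by
    rw [Source.opt, dif_pos ⟨hik, hd⟩, Source.opt_min]
  have stay : ∀ {τ : St} {x c : ℤ}, Comparing σ τ x c →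
      Env S a e τ ∧ TableFrom S a e τ (tablePos n i k v m + 1) ∧ τ.reg rI = i ∧ τ.reg rK = k ∧
      τ.reg rV = v ∧ τ.reg rM = m ∧
      ∀ r ∈ [Reg.size, .num, .den, rBase, rPos, rI, rK, rV, rM], |τ.reg r| ≤ M := by
    intro τ x c hc
    have hr : ∀ r ∈ [Reg.size, .num, .den, rBase, rPos, rI, rK, rV, rM],
        τ.reg r = σ.reg r := by
      intro r hr
      simp only [List.mem_cons, List.not_mem_nil, or_false] at hr
      apply hc.2.1 <;> rcases hr with rfl | rfl | rfl | rfl | rfl | rfl | rfl | rfl | rfl <;> simp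
    refine ⟨hE.congr (fun r h => hr r ?_) fun r _ => by rw [hc.1],
      ht.congr (by rw [hc.1]) (by rw [hc.1]), ?_, ?_, ?_, ?_, fun r h => ?_⟩
    · simp only [List.mem_cons, List.not_mem_nil, or_false] at h ⊢; tauto
    · rw [hr _ (by simp), hI]
    · rw [hr _ (by simp), hK]
    · rw [hr _ (by simp), hV]
    · rw [hr _ (by simp), hm']
    · rw [hr r h]; exact hb r h
  have hJM : |J| ≤ M := hB.level _ _ _ _ _
  have sumlt : (0 : ℤ) < k + v + m := by exact_mod_cast hd
  -- Raising `i` adds `n + 1` to the part of the position formed by `i` and `k`, while `k` loses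
  -- only `1`.
  have hpos : ∀ v' m' : ℕ, v' ≤ n → m' ≤ n →
      tablePos n i k v m + 1 ≤ tablePos n (i + 1) (k - 1) v' m' := by
    intro v' m' hv' hm'
    have h1 : i * (n + 1) + k + 1 ≤ (i + 1) * (n + 1) + (k - 1) := by
      have : (i + 1) * (n + 1) = i * (n + 1) + (n + 1) := by ring
      omega
    unfold tablePos
    nlinarith [Nat.mul_le_mul_right ((n + 1) * (n + 1)) h1]
  have q1 : ∀ {τ : St} {x c : ℤ}, Comparing σ τ x c →
      (masterAllowed.eval τ ≠ 0 ↔ 0 < k ∧ m < n) ∧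
      (leafAllowed.eval τ ≠ 0 ↔ 0 < k ∧ 1 < k + v + m) := by
    intro τ x c hc
    obtain ⟨h1, h2, h3, h4, h5, h6, h7⟩ := stay hc
    have e1 : ((1 : ℤ) < k + v + m) ↔ 1 < k + v + m := by norm_cast
    constructor
    · simp [masterAllowed, Expr.eval, WordOp.eval, h4, h6, h1.size, Nat.pos_iff_ne_zero, and_comm]
    · simp [leafAllowed, pendingExpr, Expr.eval, WordOp.eval, h4, h5, h6, e1,
        Nat.pos_iff_ne_zero, and_comm]
  have q2 : ∀ {τ : St} {x c : ℤ}, Comparing σ τ x c → 0 < k → m < n →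
      masterValue.ReadsLe M τ ∧ masterValue.eval τ = A := by
    intro τ x c hc hk0 hmn
    obtain ⟨h1, h2, h3, h4, h5, h6, h7⟩ := stay hc
    have hT := (h2 (i + 1) (k - 1) v (m + 1) (by omega) (by omega) hv (by omega)
      (hpos _ _ hv (by omega))).1
    have hT' := hB.opt (i + 1) (k - 1) v (m + 1)
    have hW := h1.weight i (by omega)
    unfold tablePos at hT; push_cast [Nat.cast_sub (show 1 ≤ k by omega)] at hT
    constructor
    · simp [masterValue, Expr.ReadsLe, Expr.eval, WordOp.eval, h3, h4, h5, h6, h1.base, hT, hW,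
        hT', hB.wt]
    · simp [masterValue, Expr.ReadsLe, Expr.eval, WordOp.eval, h3, h4, h5, h6, h1.base, hT, hW,
        h1.num, hA]
  have q3 : ∀ {τ : St} {x c : ℤ}, Comparing σ τ x c → 0 < k →
      leafValue.ReadsLe M τ ∧ leafValue.eval τ = Le := by
    intro τ x c hc hk0
    obtain ⟨h1, h2, h3, h4, h5, h6, h7⟩ := stay hc
    have hT := (h2 (i + 1) (k - 1) v m (by omega) (by omega) hv (by omega)
      (hpos _ _ hv (by omega))).1
    have hT' := hB.opt (i + 1) (k - 1) v m
    unfold tablePos at hT; push_cast [Nat.cast_sub (show 1 ≤ k by omega)] at hT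
    constructor
    · simp [leafValue, Expr.ReadsLe, Expr.eval, WordOp.eval, h3, h4, h5, h6, h1.base, hT, hT']
    · simp [leafValue, Expr.ReadsLe, Expr.eval, WordOp.eval, h3, h4, h5, h6, h1.base, hT, hLe]
  refine ((tryLevel_halts hB.two_le (hw _ (by simp [tablePieces])) hE (by omega) (by omega) hm hd hv ht hI hK
    hV hm' hb hB.opt hB.suffix).block_cons (T₂ := _) fun τ hc => ?_).mono le_rfl fun _ => id
  obtain ⟨h1, h2, h3, h4, h5, h6, h7⟩ := stay hc
  have hbest : |τ.reg rBest| ≤ M := by rw [hc.2.2.1]; exact hJM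
  refine (tryChoice_halts hB.two_le (hw _ (by simp [tablePieces])) (by norm_num) h7
    (by simp [masterAllowed, Expr.RegsIn]) (by simp [masterAllowed, Expr.ReadsLe])
    (fun h0 => ⟨by simp [masterValue, Expr.RegsIn], ?_⟩) hbest).block_cons (T₂ := _) ?_
  · have := (q1 hc).1.1 h0
    exact (q2 hc this.1 this.2).1
  intro τ' hc'
  -- After two candidates the register holds their minimum `x`, and `c` tells which of them attains
  -- it.
  have hc1 : ∃ x c, Comparing σ τ' x c ∧ |x| ≤ M ∧
      x = min J (if 0 < k ∧ m < n then A else J) ∧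
      ((c = 0 ∧ x = J) ∨ (c = 1 ∧ 0 < k ∧ m < n ∧ x = A)) := by
    rcases hc' with ⟨g1, g2, g3⟩ | ⟨g1, g3⟩
    · have hcond := (q1 hc).1.1 g1
      have hval := (q2 hc hcond.1 hcond.2).2
      rw [hc.2.2.1, hval] at g2
      rw [hval] at g3
      refine ⟨_, _, hc.trans g3, ?_, ?_, .inr ⟨rfl, hcond.1, hcond.2, rfl⟩⟩
      · have h0 : 0 ≤ A := add_nonneg (mul_nonneg ha (S.wt_nonneg i)) (Source.opt_nonneg ha he)
        rw [abs_of_nonneg h0]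
        exact g2.le.trans (le_of_abs_le hJM)
      · rw [if_pos hcond, min_eq_right g2.le]
    · rw [hc.2.2.1] at g1 g3
      rw [hc.2.2.2, hch] at g3
      refine ⟨_, _, hc.trans g3, hJM, ?_, .inl ⟨rfl, rfl⟩⟩
      split_ifs with hcond
      · have := g1 ((q1 hc).1.2 hcond)
        rw [(q2 hc hcond.1 hcond.2).2] at this
        rw [min_eq_left this]
      · rw [min_self]
  obtain ⟨x, c, hcx, hxM, hx, hxc⟩ := hc1
  obtain ⟨h1, h2, h3, h4, h5, h6, h7⟩ := stay hcx
  have hbest : |τ'.reg rBest| ≤ M := by rw [hcx.2.2.1]; exact hxM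
  refine (tryChoice_halts hB.two_le (hw _ (by simp [tablePieces])) (by norm_num) h7
    (by simp [leafAllowed, pendingExpr, Expr.RegsIn])
    (by simp [leafAllowed, pendingExpr, Expr.ReadsLe])
    (fun h0 => ⟨by simp [leafValue, Expr.RegsIn], ?_⟩) hbest).block_cons (T₂ := 1) ?_
  · exact (q3 hcx ((q1 hcx).2.1 h0).1).1
  intro τ'' hc''
  refine Halts.block_nil ?_
  rw [hopt, min_left_comm, ← min_assoc, min_comm _ J, ← hx]
  rcases hc'' with ⟨g1, g2, g3⟩ | ⟨g1, g3⟩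
  · have hcond := (q1 hcx).2.1 g1
    have hval := (q3 hcx hcond.1).2
    rw [hcx.2.2.1, hval] at g2
    rw [hval] at g3
    rw [if_pos hcond, min_eq_right g2.le]
    refine ⟨_, hcx.trans g3, .leaf hcond.1 hcond.2 ?_⟩
    rw [hopt, min_left_comm, ← min_assoc, min_comm _ J, ← hx, if_pos hcond, min_eq_right g2.le]
  · rw [hcx.2.2.1] at g1 g3
    rw [hcx.2.2.2] at g3
    have hmin : min x (if 0 < k ∧ 1 < k + v + m then Le else J) = x := by
      split_ifs with hcond
      · have := g1 ((q1 hcx).2.2 hcond)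
        rw [(q3 hcx hcond.1).2] at this
        exact min_eq_left this
      · rw [hx]; exact min_eq_left (min_le_left _ _)
    rw [hmin]
    refine ⟨_, hcx.trans g3, ?_⟩
    have hopt' : S.opt a e i k v m = x := by
      rw [hopt, min_left_comm, ← min_assoc, min_comm _ J, ← hx, hmin]
    rcases hxc with ⟨rfl, h⟩ | ⟨rfl, k1, k2, h⟩
    · exact .level (hopt'.trans h)
    · exact .master k1 k2 (hopt'.trans h)

theorem computeEntry_halts (hB : Bounds S a e M) (hw : ∀ c ∈ tablePieces, M ^ c.growth < 2 ^ w)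
    (ha : 0 ≤ a) (he : 0 ≤ e) (hE : Env S a e σ) (hk : k ≤ n) (hv : v ≤ n)
    (hm : m ≤ n) (ht : TableFrom S a e σ (tablePos n i k v m + 1))
    (hpos : σ.reg rPos = tablePos n i k v m) (hI : σ.reg rI = i) (hK : σ.reg rK = k)
    (hV : σ.reg rV = v) (hm' : σ.reg rM = m)
    (hb : ∀ r ∈ [Reg.size, .num, .den, rBase, rPos, rI, rK, rV, rM], |σ.reg r| ≤ M) :
    Halts w computeEntry σ (computeEntry.maxCost)
      (fun τ => TableFrom S a e τ (tablePos n i k v m)) := by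
  have hentry : entryNeeded.eval σ ≠ 0 ↔ i + k < n ∧ 0 < k + v + m := by
    have e1 : ((0 : ℤ) < k + v + m) ↔ 0 < k + v + m := by norm_cast
    have e2 : ((i : ℤ) + k < n) ↔ i + k < n := by norm_cast
    simp [entryNeeded, pendingExpr, Expr.eval, WordOp.eval, hI, hK, hV, hm', hE.size, e2]
    rw [e1]; omega
  have init : Halts w initEntry σ initEntry.maxCost (fun τ => Comparing σ τ 0 0) := by
    refine Cmd.wp.halts hB.two_le [] (by simp) (hw _ (by simp [tablePieces])) ?_
    simp [initEntry, Cmd.block, Cmd.wp, Expr.RegsIn, Expr.ReadsLe, Expr.eval]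
    refine ⟨?_, ?_, ?_, ?_⟩ <;> simp +contextual
  have store : ∀ {τ : St} {c : ℤ}, Comparing σ τ (S.opt a e i k v m) c → |c| ≤ 2 →
      (i + k < n → 0 < k + v + m → Source.IsChoice S a e i k v m c) →
      Halts w storeEntry τ storeEntry.maxCost
        (fun τ => TableFrom S a e τ (tablePos n i k v m)) := by
    intro τ c hc hc2 hch
    have hp : τ.reg rPos = tablePos n i k v m := by
      rw [hc.2.1 _ (by simp) (by simp) (by simp) (by simp), hpos]
    refine Cmd.wp.halts hB.two_le [rPos, rBest, rChoice] ?_ (hw _ (by simp [tablePieces])) ?_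
    · have := hb rPos (by simp)
      rw [hpos] at this
      simp [hp, hc.2.2.1, hc.2.2.2, hB.opt, this]
      constructor
      · simpa using this
      · exact hc2.trans hB.two_le
    · simp [storeEntry, Cmd.block, Cmd.wp, Expr.RegsIn, Expr.ReadsLe, Expr.eval, hp, hc.2.2.1,
        hc.2.2.2]
      intro i' k' v' m' hi' hk' hv' hm'' hle
      by_cases heq : tablePos n i k v m = tablePos n i' k' v' m'
      · obtain ⟨rfl, rfl, rfl, rfl⟩ := tablePos_inj hk hv hm hk' hv' hm'' heq
        refine ⟨by simp, by simpa using hc2, fun h1 h2 => by simpa using hch h1 h2⟩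
      · have hne : (tablePos n i' k' v' m' : ℤ) ≠ tablePos n i k v m := by
          exact fun h => heq (by exact_mod_cast h.symm)
        have := ht i' k' v' m' hi' hk' hv' hm'' (by omega)
        unfold EntryOk at *
        simpa [hne, hc.1] using this
  have hbd : ∀ {τ : St}, Comparing σ τ 0 0 →
      ∀ r ∈ [Reg.size, .num, .den, rBase, rPos, rI, rK, rV, rM], τ.reg r = σ.reg r := by
    intro τ hc r hr
    simp only [List.mem_cons, List.not_mem_nil, or_false] at hr
    apply hc.2.1 <;> rcases hr with rfl | rfl | rfl | rfl | rfl | rfl | rfl | rfl | rfl <;> simp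
  refine (init.block_cons (T₂ := (Cmd.ite entryNeeded bestEntry .skip).maxCost +
    (storeEntry.maxCost + 1)) fun τ hc => ?_).mono le_rfl fun _ => id
  have hr := hbd hc
  have hev : entryNeeded.eval τ = entryNeeded.eval σ := by
    simp [entryNeeded, pendingExpr, Expr.eval, hr]
  refine Halts.block_cons (Q := fun τ => ∃ c, Comparing σ τ (S.opt a e i k v m) c ∧ |c| ≤ 2 ∧
    (i + k < n → 0 < k + v + m → Source.IsChoice S a e i k v m c)) ?_ ?_
  · have hfit : entryNeeded.Fits w τ := by
      refine Expr.fits_of_pow_cost_lt hB.two_le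
        (P := [Reg.size, .num, .den, rBase, rPos, rI, rK, rV, rM])
        (fun r h => by rw [hr r h]; exact hb r h) (by simp [entryNeeded, pendingExpr, Expr.RegsIn])
        (by simp [entryNeeded, pendingExpr, Expr.ReadsLe]) ?_
      exact hw (.assign rBest entryNeeded) (by simp [tablePieces])
    refine (Halts.ite hfit (T := bestEntry.maxCost + 1) (fun h0 => ?_) (fun h0 => ?_)).mono
      (by simp [Cmd.maxCost]) fun _ => id
    · rw [hev] at h0
      obtain ⟨g1, g2⟩ := hentry.1 h0
      refine (bestEntry_halts hB hw ha he (hE.congr (fun r h => hr r ?_) fun r _ => by rw [hc.1])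
        g1 g2 hv hm (ht.congr (by rw [hc.1]) (by rw [hc.1])) ?_ ?_ ?_ ?_ hc.2.2.2
        (fun r h => by rw [hr r h]; exact hb r h)).mono (by omega) ?_
      · simp only [List.mem_cons, List.not_mem_nil, or_false] at h ⊢; tauto
      · rw [hr _ (by simp), hI]
      · rw [hr _ (by simp), hK]
      · rw [hr _ (by simp), hV]
      · rw [hr _ (by simp), hm']
      · rintro υ ⟨c, h1, h2⟩
        refine ⟨c, hc.trans h1, ?_, fun _ _ => h2⟩
        cases h2 <;> norm_num
    · rw [hev] at h0
      have hno : ¬ (i + k < n ∧ 0 < k + v + m) := fun h => hentry.2 h h0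
      refine (Halts.skip ?_).mono (by omega) fun _ => id
      -- For entries that are not needed the initial value `0` is already correct, and no choice has
      -- to be recorded.
      have h0' : S.opt a e i k v m = 0 := by rw [Source.opt, dif_neg hno]
      exact ⟨0, by rw [h0']; exact hc, by norm_num, fun h1 h2 => absurd ⟨h1, h2⟩ hno⟩
  · rintro υ ⟨c, h1, h2, h3⟩
    exact (store h1 h2 h3).block_cons fun _ h => Halts.block_nil h

end

end

/-! ### Filling the arrays of suffix weights and of table entries. -/

section

open CodeTree Cmd
variable {n b : ℕ} {S : Source n b} {s : Fin 2}

namespace Cmd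

open Expr

def suffixInit : Prg :=
  .block [.assign rBase (add (.reg .size) (.const 1)), .assign rI (.reg .size),
    .store aSuffix (.reg rI) (.const 0)]

def suffixStep : Prg :=
  .block [
    .assign rI (sub (.reg rI) (.const 1)),
    .store aSuffix (.reg rI)
      (add (.get .weight (.reg rI)) (.get aSuffix (add (.reg rI) (.const 1))))]

def fillSuffix : Prg := .seq suffixInit (.loop (.reg rI) suffixStep)

def tableInit : Prg :=
  .assign rPos (mul (mul (.reg rBase) (.reg rBase)) (mul (.reg rBase) (.reg rBase)))

def tableStep : Prg := .seq decodePos computeEntry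

def fillTable : Prg := .seq tableInit (.loop (.reg rPos) tableStep)

def prepare : Prg := .seq fillSuffix fillTable

def preparePieces : List Prg := [suffixInit, suffixStep, tableInit] ++ tablePieces

end Cmd

section
variable {w : ℕ} {M : ℤ} {σ : St} {a e : ℤ}

theorem Expr.reg_fits (hw : M < 2 ^ w) {r : Reg} (h : |σ.reg r| ≤ M) :
    (Expr.reg r : Expr Reg Arr).Fits w σ := h.trans_lt hw

theorem Bounds.lt_of_growth (hB : Bounds S a e M) {c : Prg} (hw : M ^ c.growth < 2 ^ w) :
    M < 2 ^ w :=
  lt_of_le_of_lt (by simpa using pow_le_pow_right₀ (by linarith [hB.two_le]) c.one_le_growth) hw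

theorem Bounds.size_le (hB : Bounds S a e M) : (n : ℤ) + 1 ≤ M := by
  refine le_trans ?_ hB.pos
  exact_mod_cast Nat.le_self_pow (by norm_num) (n + 1)

theorem fillSuffix_halts (hB : Bounds S a e M) (hw : ∀ c ∈ preparePieces, M ^ c.growth < 2 ^ w)
    (hn : σ.reg .size = n) (hnum : σ.reg .num = a) (hden : σ.reg .den = e)
    (hwt : ∀ i < n, σ.arr .weight i = S.wt i) :
    Halts w fillSuffix σ (suffixInit.maxCost + (n + 1) * (suffixStep.maxCost + 2))
      (Env S a e) := by
  have hnM := hB.size_le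
  have h1 : Halts w suffixInit σ suffixInit.maxCost (fun τ => τ.reg .size = n ∧ τ.reg .num = a ∧
      τ.reg .den = e ∧ τ.reg rBase = (n + 1 : ℕ) ∧ (∀ i < n, τ.arr .weight i = S.wt i) ∧
      τ.reg rI = n ∧ τ.arr aSuffix n = 0) := by
    refine Cmd.wp.halts hB.two_le [Reg.size] ?_ (hw _ (by simp [preparePieces])) ?_
    · simp [hn, abs_of_nonneg (show (0 : ℤ) ≤ n by positivity)]; linarith
    · simp [suffixInit, Cmd.block, Cmd.wp, Expr.RegsIn, Expr.ReadsLe, Expr.eval, WordOp.eval, hn,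
        hnum, hden]
      exact hwt
  refine (h1.seq fun τ hτ => (Halts.loop (T := suffixStep.maxCost)
    (I := fun k υ => k ≤ n ∧ υ.reg .size = n ∧ υ.reg .num = a ∧
      υ.reg .den = e ∧ υ.reg rBase = (n + 1 : ℕ) ∧ (∀ i < n, υ.arr .weight i = S.wt i) ∧
      υ.reg rI = k ∧ ∀ i, k ≤ i → i ≤ n → υ.arr aSuffix i = S.suffix i) ?_ ?_ n
      ⟨le_rfl, hτ.1, hτ.2.1, hτ.2.2.1, hτ.2.2.2.1, hτ.2.2.2.2.1, hτ.2.2.2.2.2.1, ?_⟩)).mono ?_ ?_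
  · rintro k υ ⟨hk, -, -, -, -, -, hI, -⟩
    refine Expr.reg_fits (hB.lt_of_growth (hw suffixInit (by simp [preparePieces]))) ?_
    rw [hI, abs_of_nonneg (by positivity)]; omega
  · rintro k υ ⟨hk, g1, g2, g3, g4, g5, g6, g7⟩ hne
    obtain ⟨j, rfl⟩ : ∃ j, k = j + 1 := by
      refine Nat.exists_eq_succ_of_ne_zero ?_
      rintro rfl; exact hne g6
    refine Cmd.wp.halts hB.two_le [rI] ?_ (hw _ (by simp [preparePieces])) ?_
    · simp [g6]; rw [abs_of_nonneg (by positivity)]; omega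
    · have e1 := g5 j (by omega)
      -- The cell filled in the preceding round; at the start this is the cell `n`, which was set to
      -- `0`.
      have e2 := g7 (j + 1) le_rfl hk
      have e3 := hB.wt j
      have e4 := hB.suffix (j + 1)
      push_cast at e2
      simp [suffixStep, Cmd.block, Cmd.wp, Expr.RegsIn, Expr.ReadsLe, Expr.eval, WordOp.eval, g6,
        e1, e2, e3, e4]
      refine ⟨by omega, g1, g2, g3, by simpa using g4, g5, fun i h1 h2 => ?_⟩
      rcases eq_or_lt_of_le h1 with rfl | h1
      · rw [Function.update_self, ← S.suffix_succ]
      · rw [Function.update_of_ne (by omega)]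
        exact g7 i h1 h2
  · intro i h1 h2
    obtain rfl : i = n := by omega
    rw [hτ.2.2.2.2.2.2, S.suffix_of_le le_rfl]
  · exact le_of_eq (by simp only [Expr.cost])
  · rintro υ ⟨⟨k, hk, g1, g2, g3, g4, g5, g6, g7⟩, h0⟩
    have : k = 0 := by
      have : υ.reg rI = 0 := h0
      omega
    subst this
    exact ⟨g1, g2, g3, g4, g5, fun i hi => g7 i (Nat.zero_le _) hi⟩

theorem fillTable_halts (hB : Bounds S a e M) (hw : ∀ c ∈ preparePieces, M ^ c.growth < 2 ^ w)
    (ha : 0 ≤ a) (he : 0 ≤ e) (hE : Env S a e σ) :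
    Halts w fillTable σ (4 + tableInit.maxCost + ((n + 1) ^ 4 + 1) * (tableStep.maxCost + 2))
      (fun τ => Env S a e τ ∧ TableFrom S a e τ 0) := by
  have hnM := hB.size_le
  have hwt : ∀ c ∈ tablePieces, M ^ c.growth < 2 ^ w := fun c hc =>
    hw c (List.mem_append_right _ hc)
  have h1 : Halts w tableInit σ tableInit.maxCost (fun τ => Env S a e τ ∧
      τ.reg rPos = ((n + 1) ^ 4 : ℕ)) := by
    refine Cmd.wp.halts hB.two_le [rBase] ?_ (hw _ (by simp [preparePieces])) ?_
    · simp [hE.base, abs_of_nonneg (show (0 : ℤ) ≤ (n : ℤ) + 1 by positivity)]; linarith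
    · simp [tableInit, Cmd.block, Cmd.wp, Expr.RegsIn, Expr.ReadsLe, Expr.eval, WordOp.eval,
        hE.base]
      exact ⟨hE.congr (by simp) (by simp), by ring⟩
  refine (h1.seq fun τ hτ => (Halts.loop (T := tableStep.maxCost)
    (I := fun k υ => k ≤ (n + 1) ^ 4 ∧ Env S a e υ ∧ υ.reg rPos = k ∧ TableFrom S a e υ k) ?_ ?_
      ((n + 1) ^ 4) ⟨le_rfl, hτ.1, hτ.2, ?_⟩)).mono ?_ ?_
  · rintro k υ ⟨hk, -, hI, -⟩
    refine Expr.reg_fits (hB.lt_of_growth (hw suffixInit (by simp [preparePieces]))) ?_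
    rw [hI, abs_of_nonneg (by positivity)]
    exact le_trans (by exact_mod_cast hk) hB.pos
  · rintro k υ ⟨hk, g1, g2, g3⟩ hne
    obtain ⟨t, rfl⟩ : ∃ j, k = j + 1 := by
      refine Nat.exists_eq_succ_of_ne_zero ?_
      rintro rfl; exact hne (by simpa [Expr.eval] using g2)
    obtain ⟨i, k, v, m, hi, hk', hv, hm, rfl⟩ := exists_tablePos (show t < (n + 1) ^ 4 by omega)
    have hcast : ((tablePos n i k v m + 1 : ℕ) : ℤ) ≤ M :=
      le_trans (by exact_mod_cast hk) hB.pos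
    have hbase : |υ.reg rBase| ≤ M := by
      rw [g1.base, abs_of_nonneg (by positivity)]; push_cast; linarith
    have hD := decodePos_halts hB.two_le (hwt _ (by simp [tablePieces])) hk' hv hm g1.base g2 hbase
      (by rw [g2, abs_of_nonneg (by positivity)]; exact hcast)
    refine (hD.keeping.seq (Q' := fun τ => ∃ j < tablePos n i k v m + 1, j ≤ (n + 1) ^ 4 ∧
      Env S a e τ ∧ τ.reg rPos = j ∧ TableFrom S a e τ j) (T₂ := computeEntry.maxCost) ?_).mono
      (by simp [tableStep, Cmd.maxCost]) fun _ => id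
    rintro τ ⟨⟨q1, q2, q3, q4, q5⟩, hR, hA⟩
    have hE' : Env S a e τ := by
      refine g1.congr (fun r hr => hR r ?_) fun r hr => hA r ?_ <;>
      · simp only [List.mem_cons, List.not_mem_nil, or_false] at hr
        rcases hr with rfl | rfl | rfl | rfl <;> simp [decodePos, Cmd.block, Cmd.KeepsReg, Cmd.KeepsArr]
    have hnat : ∀ {y : ℕ}, y ≤ n → |(y : ℤ)| ≤ M := fun hy => by
      rw [abs_of_nonneg (by positivity)]; omega
    have hC := computeEntry_halts hB hwt ha he hE' hk' hv hm
      (g3.congr (hA _ (by simp [decodePos, Cmd.block, Cmd.KeepsArr]))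
        (hA _ (by simp [decodePos, Cmd.block, Cmd.KeepsArr]))) q1 q2 q3 q4 q5 (by
        simp only [List.mem_cons, List.not_mem_nil, or_false, forall_eq_or_imp, forall_eq]
        refine ⟨?_, ?_, ?_, ?_, ?_, ?_, ?_, ?_, ?_⟩
        · rw [hE'.size]; exact hnat le_rfl
        · rw [hE'.num]; exact hB.num
        · rw [hE'.den]; exact hB.den
        · rw [hE'.base, abs_of_nonneg (by positivity)]; push_cast; linarith
        · rw [q1, abs_of_nonneg (by positivity)]; push_cast at hcast; linarith
        · rw [q2]; exact hnat hi
        · rw [q3]; exact hnat hk'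
        · rw [q4]; exact hnat hv
        · rw [q5]; exact hnat hm)
    refine hC.keeping.mono le_rfl ?_
    rintro υ ⟨q6, hR', hA'⟩
    refine ⟨_, Nat.lt_succ_self _, by omega, hE'.congr (fun r hr => hR' r ?_) fun r hr => hA' r ?_,
      ?_, q6⟩
    · simp only [List.mem_cons, List.not_mem_nil, or_false] at hr
      rcases hr with rfl | rfl | rfl | rfl <;> simp [computeEntry, initEntry, bestEntry, storeEntry,
        tryLevel, tryChoice, Cmd.block, Cmd.KeepsReg, Cmd.KeepsArr]
    · simp only [List.mem_cons, List.not_mem_nil, or_false] at hr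
      rcases hr with rfl | rfl <;> simp [computeEntry, initEntry, bestEntry, storeEntry,
        tryLevel, tryChoice, Cmd.block, Cmd.KeepsReg, Cmd.KeepsArr]
    · rw [hR' rPos (by simp [computeEntry, initEntry, bestEntry, storeEntry,
        tryLevel, tryChoice, Cmd.block, Cmd.KeepsReg, Cmd.KeepsArr]), q1]
  · intro i k v m hi hk hv hm ht
    exact absurd (tablePos_lt hi hk hv hm) (by omega)
  · simp only [Expr.cost, add_assoc, Nat.reduceAdd]; omega
  · rintro υ ⟨⟨k, hk, g1, g2, g3⟩, h0⟩
    have : k = 0 := by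
      have : υ.reg rPos = 0 := h0
      omega
    subst this
    exact ⟨g1, g3⟩

/-- The table dominates: `(n + 1) ^ 4` entries, each at constant cost. -/
theorem prepare_halts (hB : Bounds S a e M) (hw : ∀ c ∈ preparePieces, M ^ c.growth < 2 ^ w)
    (ha : 0 ≤ a) (he : 0 ≤ e) (hn : σ.reg .size = n) (hnum : σ.reg .num = a)
    (hden : σ.reg .den = e) (hwt : ∀ i < n, σ.arr .weight i = S.wt i) :
    Halts w prepare σ ((n + 1) ^ 4 *
      (suffixInit.maxCost + suffixStep.maxCost + tableInit.maxCost + 2 * tableStep.maxCost + 20))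
      (fun τ => Env S a e τ ∧ TableFrom S a e τ 0) := by
  refine ((fillSuffix_halts hB hw hn hnum hden hwt).seq fun τ hτ =>
    fillTable_halts hB hw ha he hτ).mono ?_ fun _ => id
  have h1 : n + 1 ≤ (n + 1) ^ 4 := Nat.le_self_pow (by norm_num) _
  generalize suffixInit.maxCost = x₁
  generalize suffixStep.maxCost = x₂
  generalize tableInit.maxCost = x₃
  generalize tableStep.maxCost = x₄
  have h2 : 1 ≤ (n + 1) ^ 4 := Nat.one_le_pow _ _ (by omega)
  generalize (n + 1) ^ 4 = N at *
  nlinarith [Nat.mul_le_mul_right (x₂ + 2) h1, Nat.mul_le_mul_right (x₁ + x₃ + x₄) h2]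

end

end

/-! ### Building the tree level by level from the recorded decisions. -/

section

open CodeTree Cmd
variable {n b : ℕ} {S : Source n b} {s : Fin 2}

namespace Cmd

open Expr

def expandStep (s : Fin 2) : Prg := .seq findPending (expandTail s)

def levelStart : Prg := .assign rE (.reg rK)

def levelEnd : Prg :=
  .block [
    .assign rK (add (mul (.const 2) (.reg rK)) (.reg rV)),
    .assign rV (.reg rM),
    .assign rM (.const 0),
    .assign rD (add (.reg rD) (.const 1))]

def expandLevel (s : Fin 2) : Prg :=
  .block [levelStart, .loop (.reg rE) (expandStep s), levelEnd]

/-- Look up the optimal choice in the table. -/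
def lookup : Prg :=
  -- A leaf is the default: once `n ≤ i + k`, all remaining symbols become leaves of the current
  -- level. The table is then not consulted, so `k` may lie outside its range.
  .seq (.assign rChoice (.const 2))
    (.ite (lt (add (.reg rI) (.reg rK)) (.reg .size))
      (.assign rChoice (.get aChoice (posExpr (.reg rI) (.reg rK) (.reg rV) (.reg rM)))) .skip)

def placeSymbol (s : Fin 2) : Prg :=
  .seq findPending (.ite (eq (.reg rChoice) (.const 1)) (masterTail s) (leafTail s))

def buildStep (s : Fin 2) : Prg :=
  .seq lookup (.ite (.reg rChoice) (placeSymbol s) (expandLevel s))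

def buildLoop (s : Fin 2) : Prg := .loop (lt (.reg rI) (.reg .size)) (buildStep s)

def buildPieces (s : Fin 2) : List Prg :=
  [levelStart, levelEnd, lookup, expandTail s, leafTail s, masterTail s,
    .ite (lt (add (.reg rI) (.reg rK)) (.reg .size)) (.block []) (.block [])]

end Cmd

theorem Holds.congr {σ τ : St} {T : CodeTree n} {φ : List Bool → ℤ} {pend : Finset (List Bool)}
    {i d k v m : ℕ} (h : Holds s S σ T φ pend i d k v m)
    (hr : ∀ r ∈ [rCnt, .len s, .swt s], τ.reg r = σ.reg r) (ha : τ.arr = σ.arr) :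
    Holds s S τ T φ pend i d k v m := by
  simp only [List.mem_cons, List.not_mem_nil, or_false, forall_eq_or_imp, forall_eq] at hr
  obtain ⟨h1, h2, h3⟩ := hr
  obtain ⟨a1, a2, a3, a4, a5, a6, a7, a8, a9, a10, a11⟩ := h
  exact ⟨a1, by rwa [h1, ha], by rwa [h1, ha], by rwa [ha], by rwa [h2], by rwa [h3], a7, a8, a9,
    a10, by rwa [h1]⟩

theorem HoldsTree.congr {σ τ : St} {i d k v m : ℕ} {p : ℤ} (h : HoldsTree s S σ i d k v m p)
    (hr : ∀ r ∈ [rCnt, .len s, .swt s], τ.reg r = σ.reg r) (ha : τ.arr = σ.arr) :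
    HoldsTree s S τ i d k v m p := by
  obtain ⟨T, φ, pend, h1, h2⟩ := h
  exact ⟨T, φ, pend, h1.congr hr ha, h2⟩

theorem HoldsTree.nextLevel {σ : St} {i d v m : ℕ} {p : ℤ} (h : HoldsTree s S σ i d 0 v m p) :
    HoldsTree s S σ i (d + 1) v m 0 p := by
  obtain ⟨T, φ, pend, ⟨a1, a2, a3, a4, a5, a6, a7, a8, a9, a10, a11⟩, h2⟩ := h
  refine ⟨T, φ, pend, ⟨a1, a2, a3, a4, a5, a6, a8, a9, ?_, fun w hw => (a10 w hw).trans (by omega),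
    ?_⟩, h2⟩
  · rw [card_eq_zero, filter_eq_empty_iff]
    intro w hw
    have := a10 w hw
    omega
  · rw [a11]; push_cast; ring

theorem CodeTree.partLen_nonneg (T : CodeTree n) (i : ℕ) : 0 ≤ T.partLen S i :=
  sum_nonneg fun j _ => by split_ifs <;> positivity

theorem CodeTree.partMas_nonneg (T : CodeTree n) (i : ℕ) : 0 ≤ T.partMas S i :=
  sum_nonneg fun j _ => by split_ifs <;> positivity

theorem CodeTree.partMas_le (T : CodeTree n) (i : ℕ) : T.partMas S i ≤ 2 ^ b - S.suffix i := by
  rw [le_sub_iff_add_le, ← S.suffix_zero]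
  unfold partMas Source.suffix
  rw [sum_filter, sum_filter, ← sum_add_distrib]
  refine sum_le_sum fun j _ => ?_
  have : (0 : ℤ) ≤ S.weight j := by positivity
  split_ifs <;> omega

section
variable {w : ℕ} {M V : ℤ} {σ : St} {a e : ℤ} {i d k v m : ℕ} {p : ℤ}

/-- The state between two steps of the construction of an optimal tree of cost `V`. -/
structure Building (s : Fin 2) (S : Source n b) (a e V : ℤ) (σ : St) (i d k v m : ℕ) (p : ℤ) :
    Prop where
  env : Env S a e σ
  table : TableFrom S a e σ 0
  tree : HoldsTree s S σ i d k v m p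
  reg_i : σ.reg rI = i
  reg_k : σ.reg rK = k
  reg_v : σ.reg rV = v
  reg_m : σ.reg rM = m
  reg_d : σ.reg rD = d
  reg_e : σ.reg rE = 0
  le_i : i ≤ n
  -- The table caps `k` at `n`, the tree does not. A level is expanded only if `k < n`, so the next
  -- one starts with `2 * k + v ≤ 3 * n` free nodes.
  le_k : k ≤ 3 * n
  le_v : v ≤ n
  le_m : m ≤ i
  alive : i < n → 0 < k + v + m
  -- The cost of the placed symbols, the depth `d` already due for all remaining ones, and the
  -- optimal cost of completing the tree.
  cost : e * σ.reg (.len s) + a * p + e * d * S.suffix i + S.opt a e i k v m = V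

structure BuildBounds (S : Source n b) (a e M V : ℤ) : Prop extends Bounds S a e M where
  value : V + 2 ≤ M
  total : 2 ^ b ≤ M
  two_le_n : 2 ≤ n
  num_nonneg : 0 ≤ a
  den_pos : 1 ≤ e

/-- For `n ≥ 2` the bound `(n + 1) ^ 4` dominates every linear quantity met during the construction.
-/
theorem BuildBounds.mul_le (hB : BuildBounds S a e M V) : 20 * (n : ℤ) + 20 ≤ M := by
  refine le_trans ?_ hB.pos
  have h1 : (3 : ℤ) ≤ n + 1 := by have := hB.two_le_n; omega
  have h2 : (3 : ℤ) ^ 3 ≤ ((n : ℤ) + 1) ^ 3 := pow_le_pow_left₀ (by norm_num) h1 3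
  have h3 : ((n : ℤ) + 1) ^ 4 = (n + 1) ^ 3 * (n + 1) := by ring
  rw [h3]; nlinarith

theorem HoldsTree.abs_swt_le (h : HoldsTree s S σ i d k v m p) : |σ.reg (.swt s)| ≤ 2 ^ b := by
  obtain ⟨T, φ, pend, h, rfl⟩ := h
  have h1 := T.partMas_nonneg (S := S) i
  have h2 := T.partMas_le (S := S) i
  have h3 := S.suffix_nonneg i
  rw [h.swt_eq, abs_le]
  split_ifs <;> constructor <;> linarith

theorem HoldsTree.nonneg (h : HoldsTree s S σ i d k v m p) :
    0 ≤ p ∧ 0 ≤ σ.reg (.len s) := by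
  obtain ⟨T, φ, pend, h, rfl⟩ := h
  exact ⟨T.partMas_nonneg i, h.len_eq ▸ T.partLen_nonneg i⟩

theorem HoldsTree.cnt (h : HoldsTree s S σ i d k v m p) :
    σ.reg rCnt + 1 = 2 * (k + v + m + i : ℕ) + (s : ℕ) := by
  obtain ⟨T, φ, pend, h, rfl⟩ := h
  exact h.cnt_eq

/-- Depth and length are bounded by the cost as long as symbols are left. -/
theorem Building.depth_le (h : Building s S a e V σ i d k v m p) (hB : BuildBounds S a e M V)
    (hi : i < n) : (d : ℤ) ≤ V ∧ σ.reg (.len s) ≤ V := by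
  obtain ⟨h1, h2⟩ := h.tree.nonneg
  have h3 := S.suffix_pos hi
  have he := hB.den_pos
  have h4 := mul_nonneg hB.num_nonneg h1
  have h5 : 0 ≤ S.opt a e i k v m := Source.opt_nonneg hB.num_nonneg (by linarith)
  -- The remaining symbols weigh at least `1` in total, so their share of the cost invariant already
  -- bounds the depth.
  have h6 : (d : ℤ) ≤ e * d * S.suffix i := by
    have : (1 : ℤ) ≤ e * S.suffix i := by nlinarith
    have hd : (0 : ℤ) ≤ d := by positivity
    nlinarith
  have h7 : σ.reg (.len s) ≤ e * σ.reg (.len s) := by nlinarith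
  have h8 := h.cost
  have hd : (0 : ℤ) ≤ d := by positivity
  constructor <;> nlinarith

theorem abs_natCast_le {x : ℕ} (h : (x : ℤ) ≤ M) : |(x : ℤ)| ≤ M := by
  rwa [abs_of_nonneg (by positivity)]

/-- `expandTail` has growth at least `10`, so words that suffice for it suffice for the short guards
and for `findPending`. -/
theorem pow_lt_of_growth (hB : BuildBounds S a e M V)
    (hw : ∀ c ∈ buildPieces s, M ^ c.growth < 2 ^ w) {x : ℕ} (hx : x ≤ 10) : M ^ x < 2 ^ w := by
  refine lt_of_le_of_lt (pow_le_pow_right₀ (by linarith [hB.two_le]) ?_)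
    (hw (expandTail s) (by simp [buildPieces]))
  refine hx.trans ?_
  simp [expandTail, newNode, Cmd.block, Cmd.growth, Expr.cost]

/-- The registers during the expansion of a level. -/
theorem buildRegs_le (hB : BuildBounds S a e M V) (h : HoldsTree s S σ i d k v m p)
    {k' v' m' : ℕ} (hi : σ.reg rI = i) (hk : σ.reg rK = k') (hv : σ.reg rV = v')
    (hm : σ.reg rM = m') (hd : σ.reg rD = d) (hE : |σ.reg rE| ≤ M) (hin : i ≤ n)
    (hkn : k' ≤ 3 * n) (hvn : v' ≤ n) (hmn : m' ≤ n) (hcn : k + v + m ≤ 5 * n)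
    (hdM : (d : ℤ) ≤ M) (hlen : σ.reg (.len s) ≤ M) : ∀ r ∈ buildRegs s, |σ.reg r| ≤ M := by
  have hM := hB.mul_le
  simp only [buildRegs, List.mem_cons, List.not_mem_nil, or_false, forall_eq_or_imp, forall_eq]
  have hs : (s : ℕ) ≤ 1 := by omega
  have hc := h.cnt
  refine ⟨?_, ?_, ?_, ?_, ?_, ?_, ?_, ?_, h.abs_swt_le.trans hB.total⟩
  · rw [hi]; exact abs_natCast_le (by omega)
  · rw [hk]; exact abs_natCast_le (by omega)
  · rw [hv]; exact abs_natCast_le (by omega)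
  · rw [hm]; exact abs_natCast_le (by omega)
  · rw [hd]; exact abs_natCast_le hdM
  · rw [abs_le]; push_cast at hc; omega
  · exact hE
  · rw [abs_of_nonneg h.nonneg.2]; exact hlen

/-- With at most `5 * n` pending nodes and `n` symbols, the count of nodes is at most `12 * n`,
which keeps the scan within the stated bound. -/
theorem findPending_keeping (hB : BuildBounds S a e M V)
    (hw : ∀ c ∈ buildPieces s, M ^ c.growth < 2 ^ w)
    (h : HoldsTree s S σ i d (k + 1) v m p) (hd : σ.reg rD = d) (hdV : (d : ℤ) ≤ V)
    (hin : i ≤ n) (hcn : k + 1 + v + m ≤ 5 * n) :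
    Halts w findPending σ (20 * (13 * n) + 20) (fun τ =>
      (∃ T φ pend, Holds s S τ T φ pend i d (k + 1) v m ∧ T.partMas S i = p ∧
        ∃ u ∈ pend, u.length = d ∧ τ.reg rH = φ u) ∧
      τ.arr = σ.arr ∧ ∀ r, r ≠ rH → τ.reg r = σ.reg r) := by
  obtain ⟨T, φ, pend, hT, rfl⟩ := h
  have hc := hT.cnt_eq
  have hs : (s : ℕ) ≤ 1 := by omega
  have hM := hB.mul_le
  have hn := hB.two_le_n
  have hV := hB.value
  push_cast at hc
  refine (findPending_halts hB.two_le (pow_lt_of_growth hB hw le_rfl) hT hd (by linarith)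
    (by omega)).mono (by omega) ?_
  rintro τ ⟨u, hu, hud, rfl⟩
  refine ⟨⟨T, φ, pend, hT.congr (by simp) rfl, rfl, u, hu, hud, by simp⟩, rfl, ?_⟩
  intro r hr
  simp [hr]

theorem expandTail_keeps (r : Reg) (h : r ∉ [rCnt, rE]) : (expandTail s).KeepsReg r := by
  simp at h
  simp [expandTail, newNode, Cmd.block, Cmd.KeepsReg, h]

theorem expandLevel_halts (hB : BuildBounds S a e M V)
    (hw : ∀ c ∈ buildPieces s, M ^ c.growth < 2 ^ w) (h : Building s S a e V σ i d k v m p)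
    (hi : i < n) (hk : k < n)
    (hopt : S.opt a e i k v m = e * S.suffix i + S.opt a e i (2 * k + v) m 0) :
    Halts w (expandLevel s) σ (levelStart.maxCost + (n * (20 * (13 * n) + 20 +
      (expandTail s).maxCost + 2) + (levelEnd.maxCost + 1)))
      (fun τ => Building s S a e V τ i (d + 1) (2 * k + v) m 0 p) := by
  obtain ⟨hdV, hlV⟩ := h.depth_le hB hi
  have hV := hB.value
  have hM := hB.mul_le
  have hmi := h.le_m
  have hvn := h.le_v
  have h1 : Halts w levelStart σ levelStart.maxCost (fun τ => τ = σ.setReg rE k) := by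
    refine Cmd.wp.halts hB.two_le [rK] ?_ (hw _ (by simp [buildPieces])) ?_
    · simp [h.reg_k]; omega
    · simp [levelStart, Cmd.wp, Expr.RegsIn, Expr.ReadsLe, Expr.eval, h.reg_k]
  refine h1.block_cons fun τ₀ hτ₀ => ?_
  subst hτ₀
  -- While `j` nodes of the level are left, the other `k - j` have each produced two nodes of the
  -- next level. The registers `rK` and `rV` are adjusted only in `levelEnd`.
  set I : ℕ → St → Prop := fun j τ => j ≤ k ∧ HoldsTree s S τ i d j (v + 2 * (k - j)) m p ∧
    τ.reg rE = j ∧ (∀ r, r ∉ [rH, rCnt, rE] → τ.reg r = σ.reg r) ∧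
    ∀ x ∈ [Arr.weight, aSuffix, aTable, aChoice], τ.arr x = σ.arr x with hI
  have h2 : Halts w (.loop (.reg rE) (expandStep s)) (σ.setReg rE k)
      ((k + 1) * (20 * (13 * n) + 20 + (expandTail s).maxCost + 1 + 1)) (I 0) := by
    refine (Halts.loop (I := I) ?_ ?_ k ?_).mono le_rfl ?_
    · rintro j τ ⟨g1, g2, g3, g4⟩
      refine Expr.reg_fits (by simpa using pow_lt_of_growth hB hw (show 1 ≤ 10 by norm_num)) ?_
      rw [g3]; exact abs_natCast_le (by omega)
    · rintro j τ ⟨g1, g2, g3, g4, g5⟩ hne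
      obtain ⟨j, rfl⟩ : ∃ j', j = j' + 1 := by
        refine Nat.exists_eq_succ_of_ne_zero ?_
        rintro rfl; exact hne (by simpa [Expr.eval] using g3)
      have hD : τ.reg rD = d := by rw [g4 _ (by simp), h.reg_d]
      refine (findPending_keeping hB hw g2 hD hdV hi.le (by omega)).seq
        (T₂ := (expandTail s).maxCost) ?_
      rintro υ ⟨⟨T, φ, pend, q1, rfl, u, hu, hud, hH⟩, q2, q3⟩
      have hb : ∀ r ∈ buildRegs s, |υ.reg r| ≤ M := by
        have hr : ∀ r, r ∉ [rH, rCnt, rE] → υ.reg r = σ.reg r := by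
          intro r hr
          rw [q3 r (by simp at hr; tauto), g4 r hr]
        refine buildRegs_le (k' := k) (v' := v) (m' := m) hB ⟨T, φ, pend, q1, rfl⟩ ?_ ?_ ?_ ?_ ?_ ?_ hi.le
          (by omega) hvn (by omega) (by omega) (by linarith) ?_
        · rw [hr _ (by simp), h.reg_i]
        · rw [hr _ (by simp), h.reg_k]
        · rw [hr _ (by simp), h.reg_v]
        · rw [hr _ (by simp), h.reg_m]
        · rw [hr _ (by simp), h.reg_d]
        · rw [q3 _ (by simp), g3]; exact abs_natCast_le (by omega)
        · rw [hr _ (by simp)]; linarith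
      refine (expandTail_halts hB.two_le (hw _ (by simp [buildPieces])) q1 hb
        (by rw [q3 _ (by simp), hD]) hu hud hH).keeping.mono le_rfl ?_
      rintro ρ ⟨⟨p1, p2⟩, p3, p4⟩
      refine ⟨j, Nat.lt_succ_self _, by omega, ?_, ?_, ?_, ?_⟩
      · rwa [show v + 2 * (k - j) = v + 2 * (k - (j + 1)) + 2 by omega]
      · rw [p2, q3 _ (by simp), g3]; push_cast; ring
      · intro r hr
        rw [p3 r (expandTail_keeps r (by simp at hr ⊢; tauto)), q3 r (by simp at hr; tauto), g4 r hr]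
      · intro x hx
        rw [p4 x ?_, q2, g5 x hx]
        simp only [List.mem_cons, List.not_mem_nil, or_false] at hx
        rcases hx with rfl | rfl | rfl | rfl <;>
          simp [expandTail, newNode, Cmd.block, Cmd.KeepsArr]
    · refine ⟨le_rfl, ?_, by simp, ?_, fun _ _ => rfl⟩
      · rw [Nat.sub_self]
        exact h.tree.congr (by simp) rfl
      · intro r hr
        simp at hr
        simp [hr]
    · rintro τ ⟨⟨j, hj⟩, h0⟩
      have : (j : ℤ) = 0 := hj.2.2.1.symm.trans h0
      obtain rfl : j = 0 := by omega
      exact hj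
  have hkn : (k + 1) * (20 * (13 * n) + 20 + (expandTail s).maxCost + 1 + 1) ≤
      n * (20 * (13 * n) + 20 + (expandTail s).maxCost + 2) := Nat.mul_le_mul_right _ hk
  refine (h2.mono hkn fun _ => id).block_cons fun τ hτ => ?_
  obtain ⟨-, g2, g3, g4, g5⟩ := hτ
  rw [Nat.sub_zero] at g2
  have hr : ∀ r ∈ [rI, rK, rV, rM, rD, Reg.size, .num, .den, rBase, .len s],
      τ.reg r = σ.reg r := by
    intro r hr
    refine g4 r ?_
    simp only [List.mem_cons, List.not_mem_nil, or_false] at hr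
    rcases hr with rfl | rfl | rfl | rfl | rfl | rfl | rfl | rfl | rfl | rfl <;> simp
  simp only [List.mem_cons, List.not_mem_nil, or_false, forall_eq_or_imp, forall_eq] at hr g5
  obtain ⟨r1, r2, r3, r4, r5, r6, r7, r8, r9, r10⟩ := hr
  obtain ⟨x1, x2, x3, x4⟩ := g5
  refine Halts.block_cons (Q := fun τ => Building s S a e V τ i (d + 1) (2 * k + v) m 0 p) ?_
    fun _ h => Halts.block_nil h
  refine Cmd.wp.halts hB.two_le [rI, rK, rV, rM, rD] ?_ (hw _ (by simp [buildPieces])) ?_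
  · simp only [List.mem_cons, List.not_mem_nil, or_false, forall_eq_or_imp, forall_eq]
    rw [r1, r2, r3, r4, r5, h.reg_i, h.reg_k, h.reg_v, h.reg_m, h.reg_d]
    refine ⟨?_, ?_, ?_, ?_, ?_⟩ <;> exact abs_natCast_le (by omega)
  · simp [levelEnd, Cmd.block, Cmd.wp, Expr.RegsIn, Expr.ReadsLe, Expr.eval, WordOp.eval]
    rw [r2, r3, r4, r5, h.reg_k, h.reg_v, h.reg_m, h.reg_d]
    refine ⟨?_, ?_, ?_, ?_, ?_, ?_, ?_, ?_, by simpa using g3, hi.le, by omega, by omega, by omega,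
      ?_, ?_⟩
    · refine h.env.congr ?_ ?_
      · simp [r6, r7, r8, r9]
      · simp [x1, x2]
    · exact h.table.congr (by simp [x3]) (by simp [x4])
    -- No node of depth `d` is pending any more, so the three counts shift by one level.
    · have := g2.nextLevel
      rw [add_comm v] at this
      exact this.congr (by simp) rfl
    · simp [r1, h.reg_i]
    · simp
    · simp
    · simp
    · simp
    · intro _
      have := h.alive hi
      omega
    · have := h.cost
      simp [r10]
      linarith

end

end

/-! ### One step of the construction, and the number of steps. -/

section

open CodeTree Cmd
variable {n b : ℕ} {S : Source n b} {s : Fin 2}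
section
variable {w : ℕ} {M V : ℤ} {σ : St} {a e : ℤ} {i d k v m : ℕ} {p : ℤ}

theorem lookup_halts (hB : BuildBounds S a e M V) (hw : ∀ c ∈ buildPieces s, M ^ c.growth < 2 ^ w)
    (h : Building s S a e V σ i d k v m p) (hi : i < n) :
    Halts w lookup σ lookup.maxCost (fun τ => (∃ c, τ = σ.setReg rChoice c) ∧
      (if i + k < n then Source.IsChoice S a e i k v m (τ.reg rChoice)
        else τ.reg rChoice = 2)) := by
  have hM := hB.mul_le
  have hmi := h.le_m
  have hvn := h.le_v
  have hk3 := h.le_k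
  have hbase := hB.size_le
  refine Cmd.wp.halts hB.two_le [rI, rK, rV, rM, rBase, .size] ?_ (hw _ (by simp [buildPieces])) ?_
  · simp only [List.mem_cons, List.not_mem_nil, or_false, forall_eq_or_imp, forall_eq]
    rw [h.reg_i, h.reg_k, h.reg_v, h.reg_m, h.env.base, h.env.size]
    refine ⟨?_, ?_, ?_, ?_, ?_, ?_⟩ <;> exact abs_natCast_le (by omega)
  by_cases hik : i + k < n
  · obtain ⟨-, h1, h2⟩ := h.table i k v m hi.le (by omega) hvn (by omega) (Nat.zero_le _)
    have h3 := h2 hik (h.alive hi)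
    have hik' : (i : ℤ) + k < n := by exact_mod_cast hik
    have h4 := h1.trans hB.two_le
    unfold tablePos at h3 h4
    push_cast at h3 h4
    simp [lookup, Cmd.wp, Expr.RegsIn, Expr.ReadsLe, Expr.eval, WordOp.eval, h.reg_i, h.reg_k,
      h.reg_v, h.reg_m, h.env.base, h.env.size, hik, hik', h3, h4, RamState.setReg_setReg]
  · have hik' : ¬ (i : ℤ) + k < n := by exact_mod_cast hik
    simp [lookup, Cmd.wp, Expr.RegsIn, Expr.ReadsLe, Expr.eval, WordOp.eval, h.reg_i, h.reg_k,
      h.env.size, hik, hik']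

theorem Building.congr {τ : St} (h : Building s S a e V σ i d k v m p)
    (hr : ∀ r ∈ [rI, rK, rV, rM, rD, rE, .size, .num, .den, rBase, .len s, .swt s, rCnt],
      τ.reg r = σ.reg r) (ha : τ.arr = σ.arr) : Building s S a e V τ i d k v m p := by
  simp only [List.mem_cons, List.not_mem_nil, or_false, forall_eq_or_imp, forall_eq] at hr
  obtain ⟨r1, r2, r3, r4, r5, r0, r6, r7, r8, r9, r10, r11, r12⟩ := hr
  obtain ⟨a1, a2, a3, a4, a5, a6, a7, a8, a0, a9, a10, a11, a12, a13, a14⟩ := h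
  refine ⟨a1.congr ?_ ?_, a2.congr ?_ ?_, a3.congr ?_ ha, by rwa [r1], by rwa [r2], by rwa [r3],
    by rwa [r4], by rwa [r5], by rwa [r0], a9, a10, a11, a12, a13, by rwa [r10]⟩
  · simp [r6, r7, r8, r9]
  · simp [ha]
  · rw [ha]
  · rw [ha]
  · simp [r10, r11, r12]

def placeCost (s : Fin 2) (n : ℕ) : ℕ :=
  20 * (13 * n) + 20 + (6 + (leafTail s).maxCost + (masterTail s).maxCost)

theorem masterTail_keeps : (∀ r ∈ [rV, rD, rE, Reg.size, .num, .den, rBase], (masterTail s).KeepsReg r) ∧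
    ∀ x ∈ [Arr.weight, aSuffix, aTable, aChoice], (masterTail s).KeepsArr x := by
  simp only [List.mem_cons, List.not_mem_nil, or_false]
  constructor
  · rintro r (rfl | rfl | rfl | rfl | rfl | rfl | rfl) <;>
      simp [masterTail, newNode, assignSymbol, Cmd.block, Cmd.KeepsReg] <;>
      split_ifs <;> simp [Cmd.KeepsReg]
  · rintro r (rfl | rfl | rfl | rfl) <;>
      simp [masterTail, newNode, assignSymbol, Cmd.block, Cmd.KeepsArr] <;>
      split_ifs <;> simp [Cmd.KeepsArr]

theorem leafTail_keeps : (∀ r ∈ [rV, rD, rE, Reg.size, .num, .den, rBase], (leafTail s).KeepsReg r) ∧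
    ∀ x ∈ [Arr.weight, aSuffix, aTable, aChoice], (leafTail s).KeepsArr x := by
  simp only [List.mem_cons, List.not_mem_nil, or_false]
  constructor
  · rintro r (rfl | rfl | rfl | rfl | rfl | rfl | rfl) <;>
      simp [leafTail, newNode, assignSymbol, Cmd.block, Cmd.KeepsReg] <;>
      split_ifs <;> simp [Cmd.KeepsReg]
  · rintro r (rfl | rfl | rfl | rfl) <;>
      simp [leafTail, newNode, assignSymbol, Cmd.block, Cmd.KeepsArr] <;>
      split_ifs <;> simp [Cmd.KeepsArr]

theorem placeSymbol_halts (hB : BuildBounds S a e M V)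
    (hw : ∀ c ∈ buildPieces s, M ^ c.growth < 2 ^ w)
    (h : Building s S a e V σ i d (k + 1) v m p) (hi : i < n)
    (hc : (σ.reg rChoice = 1 ∧ m < n ∧
        S.opt a e i (k + 1) v m = a * S.wt i + S.opt a e (i + 1) k v (m + 1)) ∨
      (σ.reg rChoice = 2 ∧ (i + 1 < n → 0 < k + v + m) ∧
        S.opt a e i (k + 1) v m = S.opt a e (i + 1) k v m)) :
    Halts w (placeSymbol s) σ (placeCost s n) (fun τ =>
      ∃ m' p', Building s S a e V τ (i + 1) d k v m' p') := by
  obtain ⟨hdV, hlV⟩ := h.depth_le hB hi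
  have hV := hB.value
  have hM := hB.mul_le
  have hmi := h.le_m
  have hvn := h.le_v
  have hk3 := h.le_k
  refine (findPending_keeping hB hw h.tree h.reg_d hdV hi.le (by omega)).seq fun τ hτ => ?_
  obtain ⟨⟨T, φ, pend, q1, rfl, u, hu, hud, hH⟩, q2, q3⟩ := hτ
  have hb : ∀ r ∈ buildRegs s, |τ.reg r| ≤ M := by
    refine buildRegs_le (k' := k + 1) (v' := v) (m' := m) hB ⟨T, φ, pend, q1, rfl⟩ ?_ ?_ ?_ ?_ ?_
      ?_ hi.le (by omega) hvn (by omega) (by omega) (by linarith) ?_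
    · rw [q3 _ (by simp), h.reg_i]
    · rw [q3 _ (by simp), h.reg_k]
    · rw [q3 _ (by simp), h.reg_v]
    · rw [q3 _ (by simp), h.reg_m]
    · rw [q3 _ (by simp), h.reg_d]
    · rw [q3 _ (by simp), h.reg_e]; simp; linarith [hB.two_le]
    · rw [q3 _ (by simp)]; linarith
  have hwt : τ.arr .weight i = S.wt i := by rw [q2, h.env.weight i hi]
  have env : ∀ {υ : St}, (∀ r ∈ [rV, rD, rE, Reg.size, .num, .den, rBase], υ.reg r = τ.reg r) →
      (∀ x ∈ [Arr.weight, aSuffix, aTable, aChoice], υ.arr x = τ.arr x) →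
      Env S a e υ ∧ TableFrom S a e υ 0 ∧ υ.reg rV = v ∧ υ.reg rD = d ∧ υ.reg rE = 0 := by
    intro υ h1 h2
    simp only [List.mem_cons, List.not_mem_nil, or_false, forall_eq_or_imp, forall_eq] at h1 h2
    obtain ⟨r1, r2, r3, r4, r5, r6, r7⟩ := h1
    obtain ⟨x1, x2, x3, x4⟩ := h2
    rw [q2] at x1 x2 x3 x4
    rw [q3 _ (by simp)] at r1 r2 r3 r4 r5 r6 r7
    refine ⟨h.env.congr (by simp [r4, r5, r6, r7]) (by simp [x1, x2]), h.table.congr x3 x4,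
      by rw [r1, h.reg_v], by rw [r2, h.reg_d], by rw [r3, h.reg_e]⟩
  have hfit : (Expr.eq (.reg rChoice) (.const 1) : Expr Reg Arr).Fits w τ := by
    refine Expr.fits_of_pow_cost_lt hB.two_le (P := [rChoice]) ?_ (by simp [Expr.RegsIn])
      (by simp [Expr.ReadsLe]) (pow_lt_of_growth hB hw (by simp [Expr.cost]))
    simp only [List.mem_cons, List.not_mem_nil, or_false, forall_eq]
    rw [q3 _ (by simp)]
    rcases hc with ⟨hc, -⟩ | ⟨hc, -⟩ <;> rw [hc] <;> norm_num <;> linarith [hB.two_le]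
  have hch : τ.reg rChoice = σ.reg rChoice := q3 _ (by simp)
  have hlen : τ.reg (.len s) = σ.reg (.len s) := q3 _ (by simp)
  have hsuf := S.suffix_succ i
  have hcost := h.cost
  refine (Halts.ite (T := (leafTail s).maxCost + (masterTail s).maxCost) hfit (fun h0 => ?_)
    (fun h0 => ?_)).mono (by simp only [Expr.cost]; omega) fun _ => id
  · rcases hc with ⟨-, hmn, hopt⟩ | ⟨hc, -⟩
    swap
    · simp [Expr.eval, WordOp.eval, hch, hc] at h0
    refine (masterTail_halts hB.two_le (hw _ (by simp [buildPieces])) q1 hi hb hwt (hB.wt i)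
      (by rw [q3 _ (by simp), h.reg_i]) (by rw [q3 _ (by simp), h.reg_k])
      (by rw [q3 _ (by simp), h.reg_d]) (by rw [q3 _ (by simp), h.reg_m]) hu hud hH).keeping.mono
      (by omega) ?_
    rintro υ ⟨⟨p1, p2, p3, p4, p5⟩, p6, p7⟩
    obtain ⟨e1, e2, e3, e4, e5⟩ := env (fun r hr => p6 r (masterTail_keeps.1 r hr))
      fun x hx => p7 x (masterTail_keeps.2 x hx)
    -- The grandchild of the new master is pending, so free nodes remain in any case.
    · refine ⟨m + 1, T.partMas S i + S.wt i, e1, e2, p1, p2, p3, e3, p4, e4, e5, hi, by omega, hvn,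
        by omega, fun _ => by omega, ?_⟩
      rw [p5, hlen]
      rw [hopt, hsuf] at hcost
      linarith
  · rcases hc with ⟨hc, -⟩ | ⟨hc, hal, hopt⟩
    · simp [Expr.eval, WordOp.eval, hch, hc] at h0
    refine (leafTail_halts hB.two_le (hw _ (by simp [buildPieces])) q1 hi hb hwt (hB.wt i)
      (by rw [q3 _ (by simp), h.reg_i]) (by rw [q3 _ (by simp), h.reg_k])
      (by rw [q3 _ (by simp), h.reg_d]) hu hud hH).keeping.mono
      (by omega) ?_
    rintro υ ⟨⟨p1, p2, p3, p5⟩, p6, p7⟩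
    obtain ⟨e1, e2, e3, e4, e5⟩ := env (fun r hr => p6 r (leafTail_keeps.1 r hr))
      fun x hx => p7 x (leafTail_keeps.2 x hx)
    · refine ⟨m, T.partMas S i, e1, e2, p1, p2, p3, e3, ?_, e4, e5, hi, by omega, hvn,
        by omega, hal, ?_⟩
      · rw [p6 rM, q3 _ (by simp), h.reg_m]
        simp [leafTail, newNode, assignSymbol, Cmd.block, Cmd.KeepsReg]
        split_ifs <;> simp [Cmd.KeepsReg]
      rw [p5, hlen]
      rw [hopt, hsuf] at hcost
      linarith

def levelCost (s : Fin 2) (n : ℕ) : ℕ :=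
  levelStart.maxCost + (n * (20 * (13 * n) + 20 + (expandTail s).maxCost + 2) +
    (levelEnd.maxCost + 1))

/-- Number of steps left. -/
def stepsLeft (n i k v : ℕ) : ℕ := (n - i) * (n + 1) ^ 2 + (n - k) * (n + 1) + (n - v)

/-- The weights `(n + 1) ^ 2`, `n + 1` and `1` turn the lexicographic order behind the termination
of `opt` into a number; truncated subtraction takes care of `k > n`. -/
theorem stepsLeft_succ_lt (hi : i < n) (k' : ℕ) : stepsLeft n (i + 1) k' v < stepsLeft n i k v := by
  unfold stepsLeft
  obtain ⟨j, hj⟩ : ∃ j, n - i = j + 1 := ⟨n - i - 1, by omega⟩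
  rw [hj, show n - (i + 1) = j by omega, add_mul, one_mul]
  have h1 : (n - k') * (n + 1) ≤ n * (n + 1) := Nat.mul_le_mul_right _ (Nat.sub_le _ _)
  have h2 : n * (n + 1) + n < (n + 1) ^ 2 := by nlinarith
  omega

theorem stepsLeft_level_lt (hk : k < n) (hm : m ≤ n) (h : 0 < k + v + m) :
    stepsLeft n i (2 * k + v) m < stepsLeft n i k v := by
  unfold stepsLeft
  by_cases h0 : k + v = 0
  · obtain ⟨rfl, rfl⟩ : k = 0 ∧ v = 0 := by omega
    simp; omega
  · obtain ⟨j, hj⟩ : ∃ j, n - k = j + 1 := ⟨n - k - 1, by omega⟩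
    have h1 : (n - (2 * k + v)) * (n + 1) ≤ j * (n + 1) := Nat.mul_le_mul_right _ (by omega)
    rw [hj, add_mul, one_mul]
    omega

theorem buildLoop_halts (hB : BuildBounds S a e M V)
    (hw : ∀ c ∈ buildPieces s, M ^ c.growth < 2 ^ w) (h : Building s S a e V σ i d k v m p) :
    Halts w (buildLoop s) σ ((stepsLeft n i k v + 1) *
        (lookup.maxCost + (2 + (placeCost s n + levelCost s n)) + 4))
      (fun τ => ∃ d k v m p, Building s S a e V τ n d k v m p) := by
  have hnM := hB.mul_le
  refine (Halts.loop (T := lookup.maxCost + (2 + (placeCost s n + levelCost s n)))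
    (I := fun N τ => ∃ i d k v m p, N = stepsLeft n i k v ∧ Building s S a e V τ i d k v m p)
    ?_ ?_ _ ⟨i, d, k, v, m, p, rfl, h⟩).mono (le_of_eq (by simp [Expr.cost, add_assoc])) ?_
  · rintro N τ ⟨i, d, k, v, m, p, -, h⟩
    have := h.le_i
    refine Expr.fits_of_pow_cost_lt hB.two_le (P := [rI, .size]) ?_ (by simp [Expr.RegsIn])
      (by simp [Expr.ReadsLe]) (pow_lt_of_growth hB hw (by simp [Expr.cost]))
    simp only [List.mem_cons, List.not_mem_nil, or_false, forall_eq_or_imp, forall_eq]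
    rw [h.reg_i, h.env.size]
    constructor <;> exact abs_natCast_le (by omega)
  · rintro N τ ⟨i, d, k, v, m, p, rfl, h⟩ hne
    have hi : i < n := by
      simpa [Expr.eval, WordOp.eval, h.reg_i, h.env.size] using hne
    have hmi := h.le_m
    refine (lookup_halts hB hw h hi).seq fun υ hυ => ?_
    obtain ⟨⟨c, rfl⟩, hc⟩ := hυ
    simp only [RamState.setReg_reg_same] at hc
    have h' : Building s S a e V (τ.setReg rChoice c) i d k v m p := h.congr (by simp) rfl
    -- Each case carries the equation for `opt` that preserves the cost invariant. Outside the table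
    -- the decision is a leaf, and both sides of its equation vanish.
    have hcases : (c = 0 ∧ k < n ∧
        S.opt a e i k v m = e * S.suffix i + S.opt a e i (2 * k + v) m 0) ∨
        (c ≠ 0 ∧ ∃ k', k = k' + 1 ∧ ((c = 1 ∧ m < n ∧
          S.opt a e i (k' + 1) v m = a * S.wt i + S.opt a e (i + 1) k' v (m + 1)) ∨
        (c = 2 ∧ (i + 1 < n → 0 < k' + v + m) ∧
          S.opt a e i (k' + 1) v m = S.opt a e (i + 1) k' v m))) := by
      split_ifs at hc with hik
      · cases hc with
        | level h1 => exact .inl ⟨rfl, by omega, h1⟩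
        | master h1 h2 h3 =>
          obtain ⟨k, rfl⟩ := Nat.exists_eq_succ_of_ne_zero h1.ne'
          exact .inr ⟨by norm_num, k, rfl, .inl ⟨rfl, h2, h3⟩⟩
        | leaf h1 h2 h3 =>
          obtain ⟨k, rfl⟩ := Nat.exists_eq_succ_of_ne_zero h1.ne'
          exact .inr ⟨by norm_num, k, rfl, .inr ⟨rfl, fun _ => by omega, h3⟩⟩
      · obtain ⟨k, rfl⟩ := Nat.exists_eq_succ_of_ne_zero (show k ≠ 0 by omega)
        refine .inr ⟨by rw [hc]; norm_num, k, rfl, .inr ⟨hc, fun _ => by omega, ?_⟩⟩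
        rw [Source.opt_of_le (by omega), Source.opt_of_le (by omega)]
    have hfit : (Expr.reg rChoice : Expr Reg Arr).Fits w (τ.setReg rChoice c) := by
      refine Expr.reg_fits (M := M) (by simpa using pow_lt_of_growth hB hw (show 1 ≤ 10 by norm_num)) ?_
      rw [RamState.setReg_reg_same]
      have := hB.two_le
      rcases hcases with ⟨rfl, -⟩ | ⟨-, k', -, ⟨rfl, -⟩ | ⟨rfl, -⟩⟩ <;> norm_num <;> omega
    refine (Halts.ite (T := placeCost s n + levelCost s n) hfit (fun h0 => ?_) (fun h0 => ?_)).mono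
      (by simp only [Expr.cost]; omega) fun _ => id
    · simp only [Expr.eval, RamState.setReg_reg_same] at h0
      rcases hcases with ⟨rfl, -⟩ | ⟨-, k, rfl, hc'⟩
      · exact absurd rfl h0
      refine (placeSymbol_halts hB hw h' hi (by simpa using hc')).mono (by omega) ?_
      rintro ρ ⟨m', p', hρ⟩
      exact ⟨_, stepsLeft_succ_lt hi _, _, _, _, _, _, _, rfl, hρ⟩
    · simp only [Expr.eval, RamState.setReg_reg_same] at h0
      rcases hcases with ⟨-, hk, hc⟩ | ⟨hne, -⟩
      swap
      · exact absurd h0 hne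
      refine (expandLevel_halts hB hw h' hi hk hc).mono (by unfold levelCost; omega) ?_
      intro ρ hρ
      exact ⟨_, stepsLeft_level_lt hk (by omega) (h.alive hi), _, _, _, _, _, _, rfl, hρ⟩
  · rintro τ ⟨⟨N, i, d, k, v, m, p, -, h⟩, h0⟩
    have : i = n := by
      have h1 := h.le_i
      simp [Expr.eval, WordOp.eval, h.reg_i, h.env.size] at h0
      omega
    subst this
    exact ⟨d, k, v, m, p, h⟩

end

end

/-! ### Initial trees, word length and running time of the tree builder. -/

section

open CodeTree Cmd
variable {n b : ℕ} {S : Source n b} {s : Fin 2}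

namespace Source

/-- The weights are at least `1` and have sum `2 ^ b`; this is how the number of bits controls `n`.
-/
theorem le_two_pow (S : Source n b) : n ≤ 2 ^ b := by
  rw [← S.weight_sum]
  calc n = ∑ _i : Fin n, 1 := by simp
    _ ≤ _ := sum_le_sum fun i _ => S.weight_pos i

theorem bits_pos (S : Source n b) (hn : 2 ≤ n) : 1 ≤ b := by
  have := S.le_two_pow
  rcases Nat.eq_zero_or_pos b with rfl | h
  · simp at this; omega
  · exact h

theorem two_pow_mul_prob (S : Source n b) (i : Fin n) : 2 ^ b * S.prob i = S.weight i := by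
  unfold prob; field_simp

theorem sum_prob (S : Source n b) : ∑ i, S.prob i = 1 := by
  have : (2 : ℝ) ^ b * ∑ i, S.prob i = 2 ^ b * 1 := by
    rw [mul_sum, sum_congr rfl fun i _ => S.two_pow_mul_prob i]
    exact_mod_cast (by simpa using S.weight_sum)
  exact mul_left_cancel₀ (by positivity) this

theorem prob_pos (S : Source n b) (i : Fin n) : 0 < S.prob i := by
  have := S.weight_pos i
  unfold prob; positivity

end Source

section Lines

variable {T : CodeTree n}

theorem two_pow_mul_avgLen (S : Source n b) (T : CodeTree n) :
    2 ^ b * avgLen S.prob T = T.totalLen S := by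
  unfold avgLen totalLen
  rw [mul_sum]; push_cast
  exact sum_congr rfl fun i _ => by rw [← S.two_pow_mul_prob]; ring

theorem two_pow_mul_masterProb (S : Source n b) (T : CodeTree n) :
    2 ^ b * masterProb S.prob T = T.masterWeight S := by
  unfold masterProb masterWeight
  rw [mul_sum, sum_filter]; push_cast
  refine sum_congr rfl fun i _ => ?_
  split_ifs <;> simp [S.two_pow_mul_prob]

theorem leafProb_add_masterProb (S : Source n b) (h : T ∈ treeSet n s) :
    leafProb S.prob T + masterProb S.prob T = 1 := by
  classical
  have h' := admissible_of_mem h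
  rw [← S.sum_prob, leafProb, masterProb, ← sum_filter_add_sum_filter_not univ
    (fun i => T.IsLeaf (T.code i))]
  congr 1
  refine sum_congr ?_ fun _ _ => rfl
  ext i
  simp [h'.leaf_iff]

/-- Since `q_0 + q_1 = 1`, the line `L - q_0 x` equals `L + q_1 x - x`. Up to a constant, both
families thus minimize `e * totalLen + a * masterWeight`. -/
theorem line_mul (S : Source n b) (h : T ∈ treeSet n s) {a e : ℤ} (he : 1 ≤ e) :
    line S.prob s T ((a : ℝ) / e) * (2 ^ b * e) =
      ((e * T.totalLen S + a * T.masterWeight S - a * ((s : ℕ) * 2 ^ b) : ℤ) : ℝ) := by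
  have he' : (e : ℝ) ≠ 0 := by exact_mod_cast (by omega : e ≠ 0)
  have h1 := two_pow_mul_avgLen S T
  have h2 := two_pow_mul_masterProb S T
  have h3 := leafProb_add_masterProb S h
  have hs : s = 0 ∨ s = 1 := by omega
  push_cast
  rw [← h1, ← h2]
  rcases hs with rfl | rfl
  · simp only [line, if_true]; simp; field_simp
  · simp only [line, one_ne_zero, if_false]
    rw [← eq_sub_iff_add_eq] at h3
    rw [h3]; simp; field_simp; ring

theorem isArgmin_of_cost_eq {a e : ℤ} (ha : 0 ≤ a) (hae : a ≤ e) (he : 1 ≤ e)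
    (hT : T ∈ treeSet n s)
    (h : e * T.totalLen S + a * T.masterWeight S = e * (s : ℕ) * 2 ^ b + S.opt a e 0 1 s 0) :
    IsArgmin S.prob s ((a : ℝ) / e) T := by
  refine ⟨hT, fun U hU => ?_⟩
  have he' : (0 : ℝ) < e := by exact_mod_cast he
  have hpos : (0 : ℝ) < 2 ^ b * e := by positivity
  rw [← mul_le_mul_iff_left₀ hpos, line_mul S hT he, line_mul S hU he]
  have := opt_le_cost S ha hae hU
  exact_mod_cast (by linarith)

end Lines

namespace Cmd

open Expr

/-- In `T_1` the root, numbered `0`, and the exceptional node, numbered `1`, are finished. Pending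
are `[true]` of depth `1` and `[false, true]` of depth `2`, so the construction starts at depth `1`
with `k = v = 1`. -/
def initNodes (s : Fin 2) : Prg :=
  if s = 0 then
    .block [.assign rCnt (.const 0), newNode s (.const 0), .assign rD (.const 0),
      .assign rV (.const 0)]
  else
    .block [.assign rCnt (.const 0), newNode s (.const (-1)), newNode s (.const (-1)),
      newNode s (.const 1), newNode s (.const 2),
      .store (.tree s .left) (.const 0) (.const 1), .store (.tree s .right) (.const 0) (.const 2),
      .store (.tree s .right) (.const 1) (sub (.reg rCnt) (.const 1)),
      .assign rD (.const 1), .assign rV (.const 1)]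

def initTree (s : Fin 2) : Prg :=
  .block [initNodes s, .assign rI (.const 0), .assign rK (.const 1), .assign rM (.const 0),
    .assign rE (.const 0), .assign (.len s) (.const 0), .assign (.swt s) (.const 0)]

/-- Construct a tree of minimal cost. -/
def buildTree (s : Fin 2) : Prg := .seq prepare (.seq (initTree s) (buildLoop s))

def treePieces (s : Fin 2) : List Prg := initTree s :: (preparePieces ++ buildPieces s)

end Cmd

/-- No symbol is assigned yet; the values of `code` are placeholders, here and in `forkTree`. -/
def rootTree (n : ℕ) : CodeTree n := ⟨{[]}, ∅, fun _ => []⟩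

def forkTree (n : ℕ) : CodeTree n := ⟨{[], [false], [true], [false, true]}, ∅, fun _ => []⟩

theorem rootTree_isPartial : IsPartial 0 (rootTree n) {[]} 0 := by
  refine ⟨?_, ?_, ?_, ?_, ?_, ?_, ?_, ?_, ?_, ?_⟩ <;> simp [rootTree, IsLeaf]

theorem forkTree_isPartial : IsPartial 1 (forkTree n) {[true], [false, true]} 0 := by
  refine ⟨?_, ?_, ?_, ?_, ?_, ?_, ?_, ?_, ?_, ?_⟩ <;> simp [forkTree, IsLeaf]
  · intro w
    constructor <;> rcases w with _ | ⟨x, _ | ⟨y, w⟩⟩ <;> simp +contextual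
  · intro w hw
    rcases w with _ | ⟨x, _ | ⟨y, w⟩⟩ <;> simp at hw ⊢
    exact hw

def forkNumber (w : List Bool) : ℤ :=
  if w = [false] then 1 else if w = [true] then 2 else if w = [false, true] then 3 else 0

theorem holdsTree_root {σ : St} (h1 : σ.reg rCnt = 1) (h2 : σ.arr (.tree 0 .left) 0 = -1)
    (h3 : σ.arr (.tree 0 .right) 0 = -1) (h4 : σ.arr (.tree 0 .master) 0 = 0)
    (h5 : σ.arr aKey 0 = 0) (h6 : σ.reg (.len 0) = 0) (h7 : σ.reg (.swt 0) = 0) :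
    HoldsTree 0 S σ 0 0 1 0 0 0 := by
  refine ⟨rootTree n, fun _ => 0, {[]}, ⟨rootTree_isPartial, ?_, ?_, ?_, ?_, ?_, ?_, ?_, ?_, ?_,
    ?_⟩, ?_⟩
  · refine ⟨?_, ?_, ?_, ?_, ?_, ?_, ?_⟩ <;> simp [rootTree, h1, h2, h3, h4]
  · refine ⟨by simp [h5], fun z h0 hz => .inr ⟨[], by simp, by rw [h1] at hz; omega⟩⟩
  all_goals simp [h6, h7, partLen, partMas, h1, filter_singleton]

theorem holdsTree_fork {σ : St} (h1 : σ.reg rCnt = 4)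
    (h2 : σ.arr (.tree 1 .left) 0 = 1 ∧ σ.arr (.tree 1 .left) 1 = -1 ∧
      σ.arr (.tree 1 .left) 2 = -1 ∧ σ.arr (.tree 1 .left) 3 = -1)
    (h3 : σ.arr (.tree 1 .right) 0 = 2 ∧ σ.arr (.tree 1 .right) 1 = 3 ∧
      σ.arr (.tree 1 .right) 2 = -1 ∧ σ.arr (.tree 1 .right) 3 = -1)
    (h4 : σ.arr (.tree 1 .master) 0 = 0 ∧ σ.arr (.tree 1 .master) 1 = 0 ∧
      σ.arr (.tree 1 .master) 2 = 0 ∧ σ.arr (.tree 1 .master) 3 = 0)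
    (h5 : σ.arr aKey 0 = -1 ∧ σ.arr aKey 1 = -1 ∧ σ.arr aKey 2 = 1 ∧ σ.arr aKey 3 = 2)
    (h6 : σ.reg (.len 1) = 0) (h7 : σ.reg (.swt 1) = 0) :
    HoldsTree 1 S σ 0 1 1 1 0 0 := by
  refine ⟨forkTree n, forkNumber, {[true], [false, true]}, ⟨forkTree_isPartial, ?_, ?_, ?_, ?_, ?_,
    ?_, ?_, ?_, ?_, ?_⟩, ?_⟩
  · refine ⟨?_, ?_, ?_, ?_, ?_, ?_, ?_⟩
    · simp [forkNumber]
    · simp [Set.InjOn, forkNumber, forkTree]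
    all_goals simp [forkNumber, forkTree, h1, h2, h3, h4]
  · refine ⟨by simp [forkNumber, h5], fun z h0 hz => ?_⟩
    rw [h1] at hz
    rcases (show z = 0 ∨ z = 1 ∨ z = 2 ∨ z = 3 by omega) with rfl | rfl | rfl | rfl
    · exact .inl h5.1
    · exact .inl h5.2.1
    · exact .inr ⟨[true], by simp, rfl⟩
    · exact .inr ⟨[false, true], by simp, rfl⟩
  all_goals simp [h6, h7, partLen, partMas, h1, filter_singleton, filter_insert, S.suffix_zero]

section
variable {w : ℕ} {M V : ℤ} {σ : St} {a e : ℤ}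

theorem initTree_halts (hM : 2 ≤ M) (hw : M ^ (initTree s).growth < 2 ^ w)
    (hn : 2 ≤ n) (hE : Env S a e σ) (hT : TableFrom S a e σ 0) :
    Halts w (initTree s) σ (initTree s).maxCost (fun τ =>
      Building s S a e (e * (s : ℕ) * 2 ^ b + S.opt a e 0 1 s 0) τ 0 s 1 s 0 0) := by
  refine Cmd.wp.halts hM [] (by simp) hw ?_
  have hs : s = 0 ∨ s = 1 := by omega
  rcases hs with rfl | rfl
  · simp [initTree, initNodes, newNode, Cmd.block, Cmd.wp, Expr.RegsIn, Expr.ReadsLe, Expr.eval,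
      WordOp.eval]
    refine ⟨hE.congr (by simp) (by simp), hT.congr (by simp) (by simp), ?_, by simp, by simp,
      by simp, by simp, by simp, by simp, by simp, by omega, by simp, by simp, by simp, by simp⟩
    apply holdsTree_root <;> simp
  · simp [initTree, initNodes, newNode, Cmd.block, Cmd.wp, Expr.RegsIn, Expr.ReadsLe, Expr.eval,
      WordOp.eval]
    refine ⟨hE.congr (by simp) (by simp), hT.congr (by simp) (by simp), ?_, by simp, by simp,
      by simp, by simp, by simp, by simp, by simp, by omega, by omega, by simp, by simp,
      by simp [S.suffix_zero]⟩
    apply holdsTree_fork <;> simp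

/-- Put `y = 2 ^ b`. Then `y ≥ 2`, `n + 2 ≤ y ^ 2` and `e ≤ y ^ 4`, where `b ≥ 1` enters. All costs
are at most `(n + 2) * e * y ≤ y ^ 7`, the number of table entries is at most `y ^ 8`, and `y ^ 8 =
2 ^ (8 * b)` covers everything. -/
theorem bounds (hn : 2 ≤ n) (ha : 0 ≤ a) (hae : a ≤ e) (he : 1 ≤ e) (heb : e ≤ 2 ^ (2 * (b + 1))) :
    BuildBounds S a e (2 ^ (8 * b)) (e * (s : ℕ) * 2 ^ b + S.opt a e 0 1 s 0) := by
  have hb := S.bits_pos hn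
  have hnb : (n : ℤ) ≤ 2 ^ b := by exact_mod_cast S.le_two_pow
  obtain ⟨y, hy⟩ : ∃ y : ℤ, y = 2 ^ b := ⟨_, rfl⟩
  have hy2 : 2 ≤ y := by rw [hy]; exact le_self_pow₀ (by norm_num) (by omega)
  have hey : e ≤ y ^ 4 := by
    rw [hy, ← pow_mul]
    exact heb.trans (pow_le_pow_right₀ (by norm_num) (by omega))
  have hM : (2 : ℤ) ^ (8 * b) = y ^ 8 := by rw [hy, ← pow_mul, mul_comm]
  have hn1 : (n : ℤ) + 2 ≤ y ^ 2 := by rw [← hy] at hnb; nlinarith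
  have h0 : (n + 2 : ℤ) * (e * 2 ^ b) ≤ y ^ 7 := by
    rw [← hy]
    calc (n + 2 : ℤ) * (e * y) ≤ y ^ 2 * (y ^ 4 * y) := by gcongr
      _ = y ^ 7 := by ring
  have h78 : y ^ 7 + 2 ≤ y ^ 8 := by
    have : 2 ≤ y ^ 7 := hy2.trans (le_self_pow₀ (by linarith) (by norm_num))
    have : y ^ 8 = y * y ^ 7 := by ring
    nlinarith
  have hez : (0 : ℤ) ≤ e * 2 ^ b := by positivity
  have hopt : ∀ i k v m, 0 ≤ S.opt a e i k v m ∧ S.opt a e i k v m ≤ (n + 1) * (e * 2 ^ b) :=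
    fun i k v m => ⟨Source.opt_nonneg ha (by linarith), Source.opt_le_mul (by linarith)⟩
  have hsuf : ∀ i, 0 ≤ S.suffix i ∧ S.suffix i ≤ 2 ^ b := fun i => ⟨S.suffix_nonneg i, S.suffix_le i⟩
  have hy8 : y ≤ y ^ 8 := le_self_pow₀ (by linarith) (by norm_num)
  have hy48 : y ^ 4 ≤ y ^ 8 := pow_le_pow_right₀ (by linarith) (by norm_num)
  rw [hM]
  refine ⟨⟨by linarith, fun i j k v m => ?_, fun i k v m => ?_, fun i => ?_, fun i => ?_, ?_, ?_, ?_⟩,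
    ?_, by rw [← hy]; exact hy8, hn, ha, he⟩
  · have h1 := hopt i k v m
    have h2 : e * S.suffix j ≤ e * 2 ^ b := mul_le_mul_of_nonneg_left (hsuf j).2 (by linarith)
    have h3 : 0 ≤ e * S.suffix j := mul_nonneg (by linarith) (hsuf j).1
    rw [abs_of_nonneg (by linarith)]; linarith
  · have h1 := hopt i k v m
    rw [abs_of_nonneg h1.1]; linarith
  · rw [abs_of_nonneg (hsuf i).1]; rw [← hy] at hsuf; linarith [(hsuf i).2]
  · rw [abs_of_nonneg (S.wt_nonneg i)]; have := S.wt_le i; rw [← hy] at this; linarith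
  · rw [abs_of_nonneg ha]; linarith
  · rw [abs_of_nonneg (by linarith)]; linarith
  · calc ((n : ℤ) + 1) ^ 4 ≤ (y ^ 2) ^ 4 := by gcongr; linarith
      _ = y ^ 8 := by ring
  · have h1 := (hopt 0 1 s 0).2
    have h2 : e * (s : ℕ) * 2 ^ b ≤ e * 2 ^ b := by
      have : ((s : ℕ) : ℤ) ≤ 1 := by omega
      nlinarith
    linarith

/-- With all symbols placed, the remaining terms of the cost invariant vanish and it becomes the
cost of the tree. -/
theorem Building.finish (h : ∃ d k v m p, Building s S a e V σ n d k v m p) :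
    ∃ T ∈ treeSet n s, e * T.totalLen S + a * T.masterWeight S = V ∧ Represents σ s T ∧
      HoldsLine S σ s (.len s) (.swt s) T := by
  obtain ⟨d, k, v, m, p, h⟩ := h
  have hcost := h.cost
  obtain ⟨T, φ, pend, hT, rfl⟩ := h.tree
  have hmem := hT.isPartial.admissible le_rfl
  have hlen := hT.len_eq
  have hswt := hT.swt_eq
  rw [partLen_of_le le_rfl] at hlen
  rw [partMas_of_le le_rfl] at hcost hswt
  rw [S.suffix_of_le le_rfl] at hcost hswt
  rw [Source.opt_of_le (by omega), hlen] at hcost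
  have hP := hT.pointers
  refine ⟨T, hmem, by linarith, ⟨φ, hP.root, hP.inj, fun w hw => ⟨hP.nonneg w hw, hP.left w hw,
    hP.right w hw, hP.master w hw⟩, fun j => hT.symbol j j.2⟩, ?_, ?_⟩
  · rw [two_pow_mul_avgLen, hlen]
  · have h1 := two_pow_mul_masterProb S T
    have h2 := leafProb_add_masterProb S hmem
    rw [hswt, switchProb]
    split_ifs
    · exact h1.symm
    · push_cast
      rw [← h1, eq_sub_iff_add_eq.2 h2]; ring


theorem buildTree_halts (hB : BuildBounds S a e M (e * (s : ℕ) * 2 ^ b + S.opt a e 0 1 s 0))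
    (hw : ∀ c ∈ treePieces s, M ^ c.growth < 2 ^ w) (hn : σ.reg .size = n)
    (hnum : σ.reg .num = a) (hden : σ.reg .den = e) (hwt : ∀ i < n, σ.arr .weight i = S.wt i) :
    Halts w (buildTree s) σ ((n + 1) ^ 4 *
        (suffixInit.maxCost + suffixStep.maxCost + tableInit.maxCost + 2 * tableStep.maxCost + 20) +
        ((initTree s).maxCost + (stepsLeft n 0 1 s + 1) *
        (lookup.maxCost + (2 + (placeCost s n + levelCost s n)) + 4)))
      (fun τ => ∃ T ∈ treeSet n s, e * T.totalLen S + a * T.masterWeight S =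
        e * (s : ℕ) * 2 ^ b + S.opt a e 0 1 s 0 ∧ Represents τ s T ∧
        HoldsLine S τ s (.len s) (.swt s) T) := by
  refine (prepare_halts hB.toBounds (fun c hc => hw c ?_) hB.num_nonneg (by linarith [hB.den_pos])
    hn hnum hden hwt).seq fun τ hτ => ?_
  · simp only [treePieces, List.mem_cons, List.mem_append]; exact .inr (.inl hc)
  refine (initTree_halts hB.two_le (hw _ (by simp [treePieces])) hB.two_le_n hτ.1 hτ.2).seq
    fun υ hυ => ?_
  refine (buildLoop_halts hB (fun c hc => hw c ?_) hυ).mono le_rfl fun ρ hρ => ?_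
  · simp only [treePieces, List.mem_cons, List.mem_append]; exact .inr (.inr hc)
  exact Building.finish hρ

end

/-- A factor for the running time of `buildTree`. -/
def buildFactor (s : Fin 2) : ℕ :=
  16 * (suffixInit.maxCost + suffixStep.maxCost + tableInit.maxCost + 2 * tableStep.maxCost + 20) +
    (initTree s).maxCost + 8 * (lookup.maxCost + (6 + (20 * 13 + 20 +
      (6 + (leafTail s).maxCost + (masterTail s).maxCost) + (levelStart.maxCost +
      (20 * 13 + 20 + (expandTail s).maxCost + 2 + (levelEnd.maxCost + 1))))))

/-- The table costs O(n^4). The construction makes at most `8 * n ^ 3` steps; each costs O(n^2),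
because fewer than `n` nodes are expanded on a level and each of them is found by a linear scan. -/
theorem buildTree_time_le (hn : 2 ≤ n) : (n + 1) ^ 4 *
      (suffixInit.maxCost + suffixStep.maxCost + tableInit.maxCost + 2 * tableStep.maxCost + 20) +
      ((initTree s).maxCost + (stepsLeft n 0 1 s + 1) *
      (lookup.maxCost + (2 + (placeCost s n + levelCost s n)) + 4)) ≤ buildFactor s * n ^ 5 := by
  have h1 : (n + 1) ^ 4 ≤ 16 * n ^ 5 := by
    calc (n + 1) ^ 4 ≤ (2 * n) ^ 4 := Nat.pow_le_pow_left (by omega) 4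
      _ = 16 * n ^ 4 := by ring
      _ ≤ 16 * n ^ 5 := Nat.mul_le_mul_left _ (Nat.pow_le_pow_right (by omega) (by norm_num))
  have h2 : stepsLeft n 0 1 s + 1 ≤ 8 * n ^ 3 := by
    have : stepsLeft n 0 1 s + 1 ≤ (n + 1) ^ 3 := by
      unfold stepsLeft
      have h3 : (n - 1) * (n + 1) ≤ n * (n + 1) := Nat.mul_le_mul_right _ (Nat.sub_le _ _)
      have h4 : (n + 1) ^ 3 = n * (n + 1) ^ 2 + n * (n + 1) + (n + 1) := by ring
      rw [h4, Nat.sub_zero]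
      omega
    refine this.trans ((Nat.pow_le_pow_left (show n + 1 ≤ 2 * n by omega) 3).trans (le_of_eq ?_))
    ring
  have h5 : 1 ≤ n ^ 5 := Nat.one_le_pow _ _ (by omega)
  have h6 : n ≤ n ^ 2 := Nat.le_self_pow (by norm_num) _
  have h7 : 1 ≤ n ^ 2 := Nat.one_le_pow _ _ (by omega)
  unfold buildFactor placeCost levelCost
  generalize suffixInit.maxCost + suffixStep.maxCost + tableInit.maxCost + 2 * tableStep.maxCost +
    20 = x
  generalize (initTree s).maxCost = y
  generalize lookup.maxCost = z
  generalize (leafTail s).maxCost = z₀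
  generalize (masterTail s).maxCost = z₁
  generalize (expandTail s).maxCost = z₂
  generalize levelStart.maxCost = z₃
  generalize levelEnd.maxCost = z₄
  set K := z + (6 + (20 * 13 + 20 + (6 + z₀ + z₁) + (z₃ + (20 * 13 + 20 + z₂ + 2 + (z₄ + 1))))) with hK
  have h8 : z + (2 + (20 * (13 * n) + 20 + (6 + z₀ + z₁) + (z₃ + (n * (20 * (13 * n) + 20 + z₂ + 2) +
      (z₄ + 1))))) + 4 ≤ K * n ^ 2 := by
    have e1 := Nat.mul_le_mul_left z h7
    have e2 := Nat.mul_le_mul_left z₀ h7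
    have e3 := Nat.mul_le_mul_left z₁ h7
    have e4 := Nat.mul_le_mul_left z₂ h6
    have e5 := Nat.mul_le_mul_left z₃ h7
    have e6 := Nat.mul_le_mul_left z₄ h7
    rw [hK]
    nlinarith
  have h9 := Nat.mul_le_mul h2 h8
  have h10 : 8 * n ^ 3 * (K * n ^ 2) = 8 * K * n ^ 5 := by ring
  rw [h10] at h9
  have h11 := Nat.mul_le_mul_right x h1
  have h12 := Nat.mul_le_mul_left y h5
  nlinarith

/-- A factor for the word length of `buildTree`. -/
def buildWord (s : Fin 2) : ℕ := 8 * ((treePieces s).map growth).sum + 1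

theorem treePieces_growth (S : Source n b) (hn : 2 ≤ n) {C : ℕ} (hC : buildWord s ≤ C) :
    ∀ c ∈ treePieces s, ((2 : ℤ) ^ (8 * b)) ^ c.growth < 2 ^ (C * b) := by
  intro c hc
  have hb := S.bits_pos hn
  have : c.growth ≤ ((treePieces s).map growth).sum :=
    List.single_le_sum (by simp) _ (List.mem_map_of_mem hc)
  rw [← pow_mul]
  refine pow_lt_pow_right₀ (by norm_num) ?_
  unfold buildWord at hC
  calc 8 * b * c.growth = 8 * c.growth * b := by ring
    _ < C * b := Nat.mul_lt_mul_of_pos_right (by omega) hb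

/-- The correctness of the program proves that the lower bound `opt_le_cost` is attained: it
suffices to run it from some memory that holds the input. -/
theorem exists_tree_cost_eq (S : Source n b) (s : Fin 2) (hn : 2 ≤ n) {a e : ℤ} (ha : 0 ≤ a)
    (hae : a ≤ e) (he : 1 ≤ e) (heb : e ≤ 2 ^ (2 * (b + 1))) :
    ∃ T ∈ treeSet n s, e * T.totalLen S + a * T.masterWeight S =
      e * (s : ℕ) * 2 ^ b + S.opt a e 0 1 s 0 := by
  classical
  obtain ⟨t, τ, -, -, T, h1, h2, -⟩ := buildTree_halts (s := s)
    (σ := ⟨fun r => if r = .size then n else if r = .num then a else if r = .den then e else 0,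
      fun _ i => S.wt i.toNat⟩)
    (bounds (S := S) hn ha hae he heb) (treePieces_growth S hn le_rfl) (by simp) (by simp) (by simp)
    (by simp)
  exact ⟨T, h1, h2⟩

/-- `BuildsTree` with separate constants for the word length and the running time. -/
def BuildsTreeWithin (K C : ℕ) (s : Fin 2) (dp : Prg) : Prop :=
  ∀ (n b : ℕ) (S : Source n b) (σ : St), 2 ≤ n → Loaded S σ →
    0 ≤ σ.reg .num → σ.reg .num ≤ σ.reg .den →
    1 ≤ σ.reg .den → σ.reg .den ≤ 2 ^ (2 * (b + 1)) →
    ∃ (t : ℕ) (τ : St), Exec (C * b) dp σ t τ ∧ t ≤ K * n ^ 5 ∧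
      (∀ r : Reg, r ≠ .len s → r ≠ .swt s → (∀ i, r ≠ .scratch i) → τ.reg r = σ.reg r) ∧
      (∀ a : Arr, (∀ f, a ≠ .tree s f) → (∀ i, a ≠ .scratch i) → τ.arr a = σ.arr a) ∧
      ∃ T : CodeTree n, IsArgmin S.prob s ((σ.reg .num : ℝ) / σ.reg .den) T ∧
        Represents τ s T ∧ HoldsLine S τ s (.len s) (.swt s) T

theorem BuildsTreeWithin.buildsTree {K C : ℕ} {s : Fin 2} {dp : Prg}
    (h : BuildsTreeWithin K C s dp) (hKC : K ≤ C) : BuildsTree C s dp := by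
  intro n b S σ hn hL h0 h1 h2 h3
  obtain ⟨t, τ, e1, e2, e3⟩ := h n b S σ hn hL h0 h1 h2 h3
  exact ⟨t, τ, e1, e2.trans (Nat.mul_le_mul_right _ hKC), e3⟩

/-- The subroutine constructs an optimal tree, provided that the words are long enough. -/
theorem buildTree_buildsTreeWithin (s : Fin 2) {C : ℕ} (hC : buildWord s ≤ C) :
    BuildsTreeWithin (buildFactor s) C s (buildTree s) := by
  intro n b S σ hn hL h0 h1 h2 h3
  obtain ⟨l1, l2, l3⟩ := hL
  obtain ⟨t, τ, e1, e2, T, e3, e4, e5⟩ := buildTree_halts (σ := σ) (s := s)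
    (bounds (S := S) hn h0 h1 h2 h3) (treePieces_growth S hn hC) l1 rfl rfl
    (fun i hi => by rw [l3 ⟨i, hi⟩, ← S.wt_val])
  refine ⟨t, τ, e1, e2.trans (buildTree_time_le hn),
    fun r r1 r2 r3 => e1.reg_eq ?_, fun x x1 x2 => e1.arr_eq ?_, T,
    isArgmin_of_cost_eq h0 h1 h2 e3 e4, e5⟩
  · have hs : s = 0 ∨ s = 1 := by omega
    rcases hs with rfl | rfl <;>
    simp [buildTree, prepare, fillSuffix, suffixInit, suffixStep, fillTable, tableInit, tableStep,
      decodePos, computeEntry, initEntry, bestEntry, tryLevel, tryChoice, storeEntry, initTree,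
      initNodes, buildLoop, buildStep, lookup, placeSymbol, findPending, masterTail, leafTail,
      newNode, assignSymbol, expandLevel, levelStart, expandStep, expandTail, levelEnd, Cmd.block,
      Cmd.KeepsReg, r1, r2, r3]
  · have hs : s = 0 ∨ s = 1 := by omega
    rcases hs with rfl | rfl <;>
    simp [buildTree, prepare, fillSuffix, suffixInit, suffixStep, fillTable, tableInit, tableStep,
      decodePos, computeEntry, initEntry, bestEntry, tryLevel, tryChoice, storeEntry, initTree,
      initNodes, buildLoop, buildStep, lookup, placeSymbol, findPending, masterTail, leafTail,
      newNode, assignSymbol, expandLevel, levelStart, expandStep, expandTail, levelEnd, Cmd.block,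
      Cmd.KeepsArr, x1, x2]

end

section

open CodeTree
variable {n b : ℕ}

namespace CodeTree

/-! ## Pruning and contracting trees -/

variable {T : CodeTree n}

/-- Remove everything below `u`. -/
def prune (T : CodeTree n) (u : List Bool) : CodeTree n where
  nodes := T.nodes.filter fun w => u <+: w → w = u
  masters := T.masters.filter fun w => ¬ u <+: w
  code := T.code

theorem prefix_append_singleton {u w : List Bool} {x : Bool} :
    u <+: w ++ [x] ↔ u = w ++ [x] ∨ u <+: w := List.prefix_concat_iff

theorem not_prefix_self_append {u : List Bool} {x : Bool} : ¬ u ++ [x] <+: u := fun h => by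
  have := h.length_le; simp at this

theorem treeSet_one_root (h : T ∈ treeSet n 1) : [false] ∈ T.nodes ∧ [true] ∈ T.nodes ∧
    [false, true] ∈ T.nodes ∧ [false, false] ∉ T.nodes := by
  simp only [treeSet, one_ne_zero, if_false, Set.mem_ofPred_eq] at h
  exact h.2.2

theorem not_master_of_root (h : T ∈ treeSet n 1) : [] ∉ T.masters ∧ [false] ∉ T.masters := by
  obtain ⟨h1, h2, h3, h4⟩ := treeSet_one_root h
  have hA := admissible_of_mem h
  exact ⟨fun hm => (hA.master_incomplete _ hm).1.2.2 h2,
    fun hm => (hA.master_incomplete _ hm).1.2.2 h3⟩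

/-- Cutting below a master turns it into a leaf. No symbol is lost, as none lies strictly below `u`;
the exceptional part at the root survives, as neither the root nor `[false]` is a master. -/
theorem prune_mem (h : T ∈ treeSet n 1) {u : List Bool} (hu : u ∈ T.masters)
    (hcode : ∀ j, T.code j ∈ T.masters ∧ (u <+: T.code j → T.code j = u)) :
    T.prune u ∈ treeSet n 1 ∧ (T.prune u).IsLeaf u := by
  have hA := admissible_of_mem h
  obtain ⟨h1, h2, h3, h4⟩ := treeSet_one_root h
  obtain ⟨hu0, hu1⟩ := not_master_of_root h
  have hne0 : u ≠ [] := fun h' => hu0 (h' ▸ hu)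
  have hne1 : u ≠ [false] := fun h' => hu1 (h' ▸ hu)
  have hmem : ∀ w, w ∈ (T.prune u).nodes ↔ w ∈ T.nodes ∧ (u <+: w → w = u) := fun w => mem_filter
  have hmas : ∀ w, w ∈ (T.prune u).masters ↔ w ∈ T.masters ∧ ¬ u <+: w := fun w => mem_filter
  have hun := (hA.master_incomplete u hu).1.1
  have hchild : ∀ {w x}, ¬ u <+: w → (w ++ [x] ∈ (T.prune u).nodes ↔ w ++ [x] ∈ T.nodes) := by
    intro w x hw
    rw [hmem, and_iff_left]
    rw [prefix_append_singleton]
    rintro (h | h)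
    · exact h.symm
    · exact absurd h hw
  have hleaf : (T.prune u).IsLeaf u := by
    refine ⟨(hmem _).2 ⟨hun, fun _ => rfl⟩, fun x hx => ?_⟩
    have := ((hmem _).1 hx).2 (List.prefix_append _ _)
    simp at this
  have hinc : ∀ {w}, ¬ u <+: w → T.IsIncomplete w → (T.prune u).IsIncomplete w := by
    rintro w hw ⟨a1, a2, a3⟩
    exact ⟨(hmem _).2 ⟨a1, fun h => absurd h hw⟩, (hchild hw).2 a2, fun h' => a3 ((hchild hw).1 h')⟩
  refine ⟨?_, hleaf⟩
  simp only [treeSet, one_ne_zero, if_false, Set.mem_ofPred_eq] at h ⊢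
  refine ⟨⟨(hmem _).2 ⟨hA.root_mem, fun h => by simpa using h⟩, fun w x hw => ?_, fun w hw => ?_,
    fun w hw h' => ?_, hA.code_injective, fun j => ?_⟩, fun w hw hw' => ?_, ?_, ?_, ?_, ?_⟩
  · obtain ⟨a1, a2⟩ := (hmem _).1 hw
    refine (hmem _).2 ⟨hA.parent_mem _ _ a1, fun h' => ?_⟩
    have := a2 (h'.trans (List.prefix_append _ _))
    rw [← this] at h'
    exact absurd h' not_prefix_self_append
  · obtain ⟨a1, a2⟩ := (hmas _).1 hw
    obtain ⟨b1, b2⟩ := hA.master_incomplete w a1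
    refine ⟨hinc a2 b1, hinc (fun h' => ?_) b2⟩
    rcases prefix_append_singleton.1 h' with h' | h'
    · exact hA.master_child w a1 (h' ▸ hu)
    · exact a2 h'
  · exact hA.master_child w ((hmas _).1 hw).1 ((hmas _).1 h').1
  · obtain ⟨a1, a2⟩ := hcode j
    by_cases hj : u <+: T.code j
    · left
      rw [show (T.prune u).code j = u from a2 hj]
      exact hleaf
    · right
      exact (hmas _).2 ⟨a1, hj⟩
  · obtain ⟨a1, a2⟩ := (hmem _).1 hw'
    have hnu : ¬ u <+: w := fun h' => by
      have := a2 (h'.trans (List.prefix_append _ _))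
      rw [← this] at h'
      exact absurd h' not_prefix_self_append
    exact (hchild hnu).2 (h.2.1 w hw a1)
  · refine (hmem _).2 ⟨h1, fun h' => ?_⟩
    rcases (prefix_append_singleton (w := [])).1 h' with h' | h'
    · exact h'.symm
    · exact absurd (List.prefix_nil.1 h') hne0
  · refine (hmem _).2 ⟨h2, fun h' => ?_⟩
    rcases (prefix_append_singleton (w := [])).1 h' with h' | h'
    · exact h'.symm
    · exact absurd (List.prefix_nil.1 h') hne0
  · refine (hmem _).2 ⟨h3, fun h' => ?_⟩
    rcases (prefix_append_singleton (w := [false])).1 h' with h' | h'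
    · exact h'.symm
    · rcases (prefix_append_singleton (w := [])).1 h' with h' | h'
      · exact absurd h' hne1
      · exact absurd (List.prefix_nil.1 h') hne0
  · exact fun h' => h4 ((hmem _).1 h').1

/-- If all symbols are at masters, one of maximal depth becomes a leaf by pruning, with all
codewords unchanged. A single symbol contributes at least `2 ^ (-b)`. -/
theorem exists_leafProb_ge (S : Source n b) (hn : 0 < n) (h : T ∈ treeSet n 1) :
    ∃ U ∈ treeSet n 1, avgLen S.prob U = avgLen S.prob T ∧
      leafProb S.prob T ≤ leafProb S.prob U ∧ 1 / 2 ^ b ≤ leafProb S.prob U := by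
  classical
  have hprob : ∀ j, 1 / 2 ^ b ≤ S.prob j := by
    intro j
    have : (1 : ℝ) ≤ S.weight j := by exact_mod_cast S.weight_pos j
    unfold Source.prob; gcongr
  have hsum : ∀ {U : CodeTree n} {j}, U.IsLeaf (U.code j) → 1 / 2 ^ b ≤ leafProb S.prob U := by
    intro U j hj
    refine (hprob j).trans ?_
    unfold leafProb
    exact single_le_sum (f := S.prob) (fun i _ => (S.prob_pos i).le) (mem_filter.2 ⟨mem_univ _, hj⟩)
  by_cases hl : ∃ j, T.IsLeaf (T.code j)
  · obtain ⟨j, hj⟩ := hl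
    exact ⟨T, h, rfl, le_rfl, hsum hj⟩
  push Not at hl
  have hcode := fun j => ((admissible_of_mem h).code_mem j).resolve_left (hl j)
  have : Nonempty (Fin n) := ⟨⟨0, hn⟩⟩
  obtain ⟨j, hj⟩ := Finite.exists_max fun j => (T.code j).length
  obtain ⟨g1, g2⟩ := prune_mem h (hcode j) fun i =>
    ⟨hcode i, fun hp => (hp.eq_of_length_le (hj i)).symm⟩
  refine ⟨_, g1, rfl, ?_, hsum (j := j) g2⟩
  have : leafProb S.prob T = 0 := by
    unfold leafProb
    rw [filter_false_of_mem (by simpa using hl), sum_empty]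
  rw [this]
  exact sum_nonneg fun i _ => (S.prob_pos i).le

/-- Pull nodes back along an injective map of words. -/
def pull (T : CodeTree n) (N : Finset (List Bool)) (f g : List Bool → List Bool) : CodeTree n where
  nodes := N
  masters := N.filter fun w => f w ∈ T.masters
  code := fun j => g (T.code j)

/-- Identify the exceptional node with the root. -/
def embed : List Bool → List Bool
  | [] => []
  | false :: w => false :: true :: w
  | true :: w => true :: w

def contractWord : List Bool → List Bool
  | false :: _ :: w => false :: w
  | w => w

theorem embed_append {w : List Bool} (hw : w ≠ []) (v : List Bool) :
    embed (w ++ v) = embed w ++ v := by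
  rcases w with _ | ⟨_ | _, w⟩ <;> simp_all [embed]

theorem contractWord_embed (w : List Bool) : contractWord (embed w) = w := by
  rcases w with _ | ⟨_ | _, w⟩ <;> rfl

/-- If `f` maps the words of `N` to nodes of `T`, compatibly with children, and all symbols are
reached, then `T` can be pulled back. -/
theorem pull_mem {N : Finset (List Bool)} {f g : List Bool → List Bool} (hT : T ∈ treeSet n 1)
    (hN : ∀ w, w ∈ N ↔ f w ∈ T.nodes) (hroot : [] ∈ N)
    (happ : ∀ w x, w ≠ [] → f (w ++ [x]) = f w ++ [x])
    (hbase : (f [] ∉ T.masters ∧ (∀ j, T.code j ≠ f []) ∧ ∀ x, [x] ∈ N) ∨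
      ∀ x, f [x] = f [] ++ [x])
    (hexc : ∀ w, f w ≠ [false]) (hg : ∀ j, f (g (T.code j)) = T.code j) :
    T.pull N f g ∈ treeSet n 0 := by
  have hA := admissible_of_mem hT
  simp only [treeSet, one_ne_zero, if_false, if_true, Set.mem_ofPred_eq] at hT ⊢
  have hinc : ∀ w, (w ≠ [] ∨ ∀ x, f [x] = f [] ++ [x]) →
      ∀ x, w ++ [x] ∈ N ↔ f w ++ [x] ∈ T.nodes := by
    intro w hw x
    rw [hN]
    rcases hw with hw | hw
    · rw [happ w x hw]
    · rcases eq_or_ne w [] with rfl | hw'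
      · rw [← hw x]; rfl
      · rw [happ w x hw']
  have hmas : ∀ w, w ∈ (T.pull N f g).masters ↔ f w ∈ T.masters := by
    intro w
    refine mem_filter.trans (and_iff_right_of_imp fun h => ?_)
    exact (hN w).2 (hA.master_incomplete _ h).1.1
  -- Only at the root may `f` fail to commute with children, and then `hbase` says that the image of
  -- the root is no master.
  have hok : ∀ w, f w ∈ T.masters → (w ≠ [] ∨ ∀ x, f [x] = f [] ++ [x]) := by
    rintro w hw
    rcases hbase with h | h
    · left; rintro rfl; exact h.1 hw
    · exact .inr h
  refine ⟨⟨hroot, fun w x hw => ?_, fun w hw => ?_, fun w hw h' => ?_, fun i j hij => ?_,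
    fun j => ?_⟩, fun w hw => ?_⟩
  · rcases eq_or_ne w [] with rfl | hw'
    · exact hroot
    · exact (hN w).2 (hA.parent_mem _ x ((happ w x hw') ▸ (hN _).1 hw))
  · rw [hmas] at hw
    have hw1 := hok w hw
    obtain ⟨⟨a1, a2, a3⟩, c1, c2, c3⟩ := hA.master_incomplete _ hw
    have e1 : f (w ++ [false]) = f w ++ [false] := by
      rcases hw1 with h | h
      · exact happ _ _ h
      · rcases eq_or_ne w [] with rfl | hw'
        · exact h false
        · exact happ _ _ hw'
    refine ⟨⟨(hN _).2 a1, (hinc w hw1 _).2 a2, fun h => a3 ((hinc w hw1 _).1 h)⟩, ?_, ?_, ?_⟩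
    · exact (hinc w hw1 _).2 a2
    · refine (hinc _ (.inl (by simp)) _).2 ?_
      rw [e1]; exact c2
    · intro h
      have := (hinc _ (.inl (by simp)) _).1 h
      rw [e1] at this
      exact c3 this
  · rw [hmas] at hw h'
    have e1 : f (w ++ [false]) = f w ++ [false] := by
      rcases hok w hw with h | h
      · exact happ _ _ h
      · rcases eq_or_ne w [] with rfl | hw'
        · exact h false
        · exact happ _ _ hw'
    exact hA.master_child _ hw (e1 ▸ h')
  · refine hA.code_injective ?_
    rw [← hg i, ← hg j]
    exact congrArg f hij
  · have hj := hg j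
    refine (hA.code_mem j).imp (fun hl => ?_) fun hm => ?_
    · have hne : g (T.code j) ≠ [] ∨ ∀ x, f [x] = f [] ++ [x] := by
        rcases hbase with h | h
        · left; intro h0; rw [h0] at hj; exact h.2.1 j hj.symm
        · exact .inr h
      refine ⟨(hN _).2 (hj.symm ▸ hl.1), fun x hx => ?_⟩
      have := (hinc _ hne x).1 hx
      rw [hj] at this
      exact hl.2 x this
    · exact (hmas _).2 (hj.symm ▸ hm)
  · rcases eq_or_ne w [] with rfl | hw'
    · rcases hbase with h | h
      · exact h.2.2 false
      · refine (hinc [] (.inr h) false).2 (hT.2.1 _ (hexc _) ((hinc [] (.inr h) true).1 hw))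
    · exact (hinc w (.inl hw') false).2 (hT.2.1 _ (hexc _) ((hinc w (.inl hw') true).1 hw))

/-- If some codeword starts with `01`, contract the exceptional edge: no codeword grows, and this
one loses a letter. Otherwise all codewords start with `1`, and the subtree at `[true]` shortens
each of them. A letter of one codeword is worth at least `2 ^ (-b)`. -/
theorem exists_shorter (S : Source n b) (hn : 0 < n) (hT : T ∈ treeSet n 1) :
    ∃ U ∈ treeSet n 0, avgLen S.prob U + 1 / 2 ^ b ≤ avgLen S.prob T := by
  have hA := admissible_of_mem hT
  obtain ⟨h1, h2, h3, h4⟩ := treeSet_one_root hT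
  obtain ⟨hm1, hm2⟩ := not_master_of_root hT
  have hprob : ∀ j, 1 / 2 ^ b ≤ S.prob j := by
    intro j
    have : (1 : ℝ) ≤ S.weight j := by exact_mod_cast S.weight_pos j
    unfold Source.prob; gcongr
  have hroot : ∀ j, T.code j ≠ [] := fun j hj => by
    rcases hA.code_mem j with h | h
    · exact h.2 false (by rw [hj]; exact h1)
    · exact hm1 (hj ▸ h)
  have hfalse : ∀ j, T.code j ≠ [false] := fun j hj => by
    rcases hA.code_mem j with h | h
    · exact h.2 true (by rw [hj]; exact h3)
    · exact hm2 (hj ▸ h)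
  have hff : ∀ j w, T.code j ≠ false :: false :: w := fun j w hj => by
    have := hA.take_mem (hA.code_mem_nodes j) 2
    rw [hj] at this
    exact h4 this
  have hdec : ∀ (g : List Bool → List Bool) (i : Fin n),
      (∀ j, (g (T.code j)).length ≤ (T.code j).length) →
      (g (T.code i)).length + 1 ≤ (T.code i).length →
      ∑ j, ((g (T.code j)).length : ℝ) * S.prob j + 1 / 2 ^ b ≤ avgLen S.prob T := by
    intro g i hg hi
    unfold avgLen
    rw [← add_sum_erase _ _ (mem_univ i),
      ← add_sum_erase univ (fun j => ((T.code j).length : ℝ) * S.prob j) (mem_univ i)]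
    have e1 : ∑ j ∈ univ.erase i, ((g (T.code j)).length : ℝ) * S.prob j ≤
        ∑ j ∈ univ.erase i, ((T.code j).length : ℝ) * S.prob j :=
      sum_le_sum fun j _ => mul_le_mul_of_nonneg_right (by exact_mod_cast hg j) (S.prob_pos j).le
    have e2 : (((g (T.code i)).length : ℝ) + 1) * S.prob i ≤ (T.code i).length * S.prob i :=
      mul_le_mul_of_nonneg_right (by exact_mod_cast hi) (S.prob_pos i).le
    have := hprob i
    linarith
  by_cases hex : ∃ i w, T.code i = false :: true :: w
  · obtain ⟨i, w₀, hi⟩ := hex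
    -- The preimage of the node set under `embed`, obtained as a `Finset` by filtering the image
    -- under a left inverse.
    set N : Finset (List Bool) := (T.nodes.image contractWord).filter fun w => embed w ∈ T.nodes
      with hNdef
    have hN : ∀ w, w ∈ N ↔ embed w ∈ T.nodes := fun w => by
      rw [hNdef, mem_filter, mem_image]
      exact and_iff_right_of_imp fun h => ⟨_, h, contractWord_embed w⟩
    refine ⟨T.pull N embed contractWord, pull_mem hT hN ((hN _).2 hA.root_mem)
      (fun w x hw => embed_append hw _) (.inl ⟨hm1, hroot, ?_⟩) ?_ ?_, ?_⟩
    · rintro (_ | _)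
      · exact (hN _).2 h3
      · exact (hN _).2 h2
    · rintro (_ | ⟨_ | _, w⟩) <;> simp [embed]
    · intro j
      rcases hj : T.code j with _ | ⟨_ | _, _ | ⟨_ | _, w⟩⟩
      · rfl
      · exact absurd hj (hfalse j)
      · exact absurd hj (hff j w)
      all_goals rfl
    · refine hdec contractWord i (fun j => ?_) ?_
      · rcases T.code j with _ | ⟨_ | _, _ | ⟨_ | _, w⟩⟩ <;> simp [contractWord]
      · rw [hi]; simp [contractWord]
  · push Not at hex
    have htail : ∀ j, true :: (T.code j).tail = T.code j := by
      intro j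
      rcases hj : T.code j with _ | ⟨_ | _, _ | ⟨_ | _, w⟩⟩
      · exact absurd hj (hroot j)
      · exact absurd hj (hfalse j)
      · exact absurd hj (hff j w)
      · exact absurd hj (hex j w)
      all_goals rfl
    set N : Finset (List Bool) := (T.nodes.image List.tail).filter fun w => true :: w ∈ T.nodes
      with hNdef
    have hN : ∀ w, w ∈ N ↔ true :: w ∈ T.nodes := fun w => by
      rw [hNdef, mem_filter, mem_image]
      exact and_iff_right_of_imp fun h => ⟨_, h, rfl⟩
    refine ⟨T.pull N (true :: ·) List.tail, pull_mem hT hN ((hN _).2 h2) (fun w x hw => rfl)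
      (.inr fun x => rfl) (by simp) htail, hdec List.tail ⟨0, hn⟩ (fun j => by simp) ?_⟩
    have := congrArg List.length (htail ⟨0, hn⟩)
    simp only [List.length_cons] at this
    omega

end CodeTree

end

section

open CodeTree
variable {n b : ℕ} {S : Source n b} {s : Fin 2}

/-! ## The lower envelopes -/

section Envelope

variable {T T₀ T₁ : CodeTree n} {x y : ℝ}

theorem avgLen_nonneg (S : Source n b) (T : CodeTree n) : 0 ≤ avgLen S.prob T :=
  sum_nonneg fun i _ => mul_nonneg (by positivity) (S.prob_pos i).le

theorem masterProb_nonneg (S : Source n b) (T : CodeTree n) : 0 ≤ masterProb S.prob T :=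
  sum_nonneg fun i _ => (S.prob_pos i).le

theorem leafProb_nonneg (S : Source n b) (T : CodeTree n) : 0 ≤ leafProb S.prob T :=
  sum_nonneg fun i _ => (S.prob_pos i).le

theorem line_zero (p : Fin n → ℝ) : line p 0 T x = avgLen p T + masterProb p T * x := if_pos rfl

theorem line_one (p : Fin n → ℝ) : line p 1 T x = avgLen p T - leafProb p T * x := if_neg (by simp)

/-- Some lower bound for all lines at `x`, so that the infimum in `envelope` is a genuine one. -/
theorem line_ge (S : Source n b) (hT : T ∈ treeSet n s) (x : ℝ) : -|x| ≤ line S.prob s T x := by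
  have h1 := avgLen_nonneg S T
  have h2 := masterProb_nonneg S T
  have h3 := leafProb_nonneg S T
  have h4 := leafProb_add_masterProb S hT
  have h5 := neg_abs_le x
  have h6 := le_abs_self x
  have h7 := abs_nonneg x
  have hs : s = 0 ∨ s = 1 := by omega
  rcases hs with rfl | rfl
  · rw [line_zero]; nlinarith
  · rw [line_one]; nlinarith

theorem envelope_le (S : Source n b) (hT : T ∈ treeSet n s) (x : ℝ) :
    envelope S.prob s x ≤ line S.prob s T x :=
  ciInf_le (f := fun T : treeSet n s => line S.prob s T.1 x)
    ⟨-|x|, by rintro _ ⟨U, rfl⟩; exact line_ge S U.2 x⟩ ⟨T, hT⟩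

theorem le_envelope {c : ℝ} (hne : (treeSet n s).Nonempty)
    (h : ∀ T ∈ treeSet n s, c ≤ line S.prob s T x) : c ≤ envelope S.prob s x := by
  have := hne.to_subtype
  exact le_ciInf fun T => h T.1 T.2

theorem IsArgmin.envelope_eq (h : IsArgmin S.prob s x T) :
    envelope S.prob s x = line S.prob s T x :=
  (envelope_le S h.1 x).antisymm (le_envelope ⟨T, h.1⟩ h.2)

theorem isArgmin_of_le (hT : T ∈ treeSet n s) (h : line S.prob s T x ≤ envelope S.prob s x) :
    IsArgmin S.prob s x T :=
  ⟨hT, fun _ hU => h.trans (envelope_le S hU x)⟩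

theorem treeSet_nonempty (S : Source n b) (s : Fin 2) (hn : 2 ≤ n) : (treeSet n s).Nonempty := by
  obtain ⟨T, hT, -⟩ := exists_tree_cost_eq S s hn (a := 0) (e := 1) le_rfl (by norm_num) le_rfl
    (one_le_pow₀ (by norm_num))
  exact ⟨T, hT⟩

theorem envelope_zero_mono (S : Source n b) (hn : 2 ≤ n) (h : x ≤ y) :
    envelope S.prob 0 x ≤ envelope S.prob 0 y := by
  refine le_envelope (treeSet_nonempty S 0 hn) fun T hT => (envelope_le S hT x).trans ?_
  rw [line_zero, line_zero]
  gcongr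
  exact masterProb_nonneg S T

theorem envelope_one_anti (S : Source n b) (hn : 2 ≤ n) (h : x ≤ y) :
    envelope S.prob 1 y ≤ envelope S.prob 1 x := by
  refine le_envelope (treeSet_nonempty S 1 hn) fun T hT => (envelope_le S hT y).trans ?_
  rw [line_one, line_one]
  gcongr
  exact leafProb_nonneg S T

/-- At `x ≥ 0` every tree can be replaced by one that is no worse and has `q_0 ≥ 2 ^ (-b)`; hence
the envelope falls at least at this rate. -/
theorem envelope_one_lt (S : Source n b) (hn : 2 ≤ n) (hx : 0 ≤ x) (h : x < y) :
    envelope S.prob 1 y < envelope S.prob 1 x := by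
  have key : envelope S.prob 1 y + 1 / 2 ^ b * (y - x) ≤ envelope S.prob 1 x := by
    refine le_envelope (treeSet_nonempty S 1 hn) fun T hT => ?_
    obtain ⟨U, hU, h1, h2, h3⟩ := exists_leafProb_ge S (by omega) hT
    have h4 := envelope_le S hU y
    rw [line_one] at h4 ⊢
    have h5 := mul_le_mul_of_nonneg_right h2 hx
    have h6 := mul_le_mul_of_nonneg_right h3 (sub_nonneg.2 h.le)
    linarith
  have : 0 < 1 / 2 ^ b * (y - x) := mul_pos (by positivity) (sub_pos.2 h)
  linarith

theorem envelope_lt_at_zero (S : Source n b) (hn : 2 ≤ n) :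
    envelope S.prob 0 0 < envelope S.prob 1 0 := by
  have key : envelope S.prob 0 0 + 1 / 2 ^ b ≤ envelope S.prob 1 0 := by
    refine le_envelope (treeSet_nonempty S 1 hn) fun T hT => ?_
    obtain ⟨U, hU, h1⟩ := exists_shorter S (by omega) hT
    have h4 := envelope_le S hU 0
    rw [line_zero, mul_zero] at h4
    rw [line_one, mul_zero]
    linarith
  have : (0 : ℝ) < 1 / 2 ^ b := by positivity
  linarith

/-- At `x = 1` the cost `e * 2 ^ b` of the top edges of `T_1` cancels against the constant by which
the two kinds of lines differ. The states `(0, 1, 1, 0)` and `(0, 1, 0, 0)` remain to be compared,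
and an additional node cannot hurt. -/
theorem envelope_le_at_one (S : Source n b) (hn : 2 ≤ n) :
    envelope S.prob 1 1 ≤ envelope S.prob 0 1 := by
  obtain ⟨U, hU, h1⟩ := exists_tree_cost_eq S 1 hn (a := 1) (e := 1) (by norm_num) le_rfl le_rfl
    (one_le_pow₀ (by norm_num))
  refine le_envelope (treeSet_nonempty S 0 hn) fun T hT => (envelope_le S hU 1).trans ?_
  have h2 := opt_le_cost S (a := 1) (e := 1) (by norm_num) le_rfl hT
  have h3 := Source.opt_antitone (S := S) (a := 1) (e := 1) (i := 0) (k := 1) (k' := 1) (v := 0)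
    (v' := 1) (m := 0) (by norm_num) (by norm_num) le_rfl (by norm_num) (by simp)
  have h4 := line_mul S hU (a := 1) (e := 1) le_rfl
  have h5 := line_mul S hT (a := 1) (e := 1) le_rfl
  have hpos : (0 : ℝ) < 2 ^ b * (1 : ℤ) := by positivity
  simp only [Int.cast_one, div_one] at h4 h5 hpos
  rw [← mul_le_mul_iff_left₀ hpos, h4, h5]
  simp at h1 h2 h3
  refine Int.cast_le.2 ?_
  simp
  linarith

/-- A tree without symbols at leaves would lose against one of the same length with `q_0 > 0`.
Consequently the two lines that cross at `x*` have different slopes. -/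
theorem IsArgmin.leafProb_pos (hn : 2 ≤ n) (hx : 0 < x) (h : IsArgmin S.prob 1 x T) :
    0 < leafProb S.prob T := by
  obtain ⟨U, hU, h1, h2, h3⟩ := exists_leafProb_ge S (by omega) h.1
  have h4 := h.2 U hU
  rw [line_one, line_one, h1] at h4
  have h5 : (0 : ℝ) < 1 / 2 ^ b := by positivity
  nlinarith

theorem pos_of_envelope_eq (hn : 2 ≤ n) (hx : 0 ≤ x)
    (h : envelope S.prob 0 x = envelope S.prob 1 x) : 0 < x := by
  refine lt_of_le_of_ne hx ?_
  rintro rfl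
  exact (envelope_lt_at_zero S hn).ne h

/-- Strict monotonicity of `E_1` is available only on the nonnegative reals; for negative `y` a
comparison with `0`, where `E_0 < E_1`, decides. -/
theorem envelope_eq_iff (hn : 2 ≤ n) (hx : 0 ≤ x)
    (h : envelope S.prob 0 x = envelope S.prob 1 x) :
    envelope S.prob 0 y = envelope S.prob 1 y ↔ y = x := by
  refine ⟨fun hy => ?_, by rintro rfl; exact h⟩
  rcases lt_trichotomy y x with hlt | rfl | hlt
  · exfalso
    rcases lt_or_ge y 0 with h0 | h0
    · have h1 := envelope_zero_mono S hn h0.le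
      have h2 := envelope_one_anti S hn h0.le
      linarith [envelope_lt_at_zero S hn]
    · linarith [envelope_zero_mono S hn hlt.le, envelope_one_lt S hn h0 hlt]
  · rfl
  · exfalso
    linarith [envelope_zero_mono S hn hlt.le, envelope_one_lt S hn hx hlt]

theorem stationary_add (p : Fin n → ℝ) :
    stationary p T₀ T₁ 0 + stationary p T₀ T₁ 1 = 1 := by
  unfold stationary
  by_cases h : masterProb p T₀ + leafProb p T₁ = 0
  · simp [h]
  · rw [if_neg h, if_neg h, if_pos rfl, if_neg (by simp), ← add_div, add_comm, div_self h]

theorem stationary_nonneg (S : Source n b) (T₀ T₁ : CodeTree n) (s : Fin 2) :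
    0 ≤ stationary S.prob T₀ T₁ s := by
  have h1 := masterProb_nonneg S T₀
  have h2 := leafProb_nonneg S T₁
  unfold stationary
  split_ifs <;> positivity

/-- In the degenerate case both switching probabilities vanish, being nonnegative with sum zero. -/
theorem stationary_balance (S : Source n b) (T₀ T₁ : CodeTree n) :
    stationary S.prob T₀ T₁ 0 * masterProb S.prob T₀ =
      stationary S.prob T₀ T₁ 1 * leafProb S.prob T₁ := by
  have h1 := masterProb_nonneg S T₀
  have h2 := leafProb_nonneg S T₁
  unfold stationary
  by_cases h : masterProb S.prob T₀ + leafProb S.prob T₁ = 0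
  · simp [h]; linarith
  · rw [if_neg h, if_neg h, if_pos rfl, if_neg (by simp)]; ring

/-- The average length is an average of the values of the two lines at any point. -/
theorem aifvLen_eq (S : Source n b) (T₀ T₁ : CodeTree n) (x : ℝ) :
    aifvLen S.prob T₀ T₁ = stationary S.prob T₀ T₁ 0 * line S.prob 0 T₀ x +
      stationary S.prob T₀ T₁ 1 * line S.prob 1 T₁ x := by
  have h := stationary_balance S T₀ T₁
  rw [aifvLen, line_zero, line_one]
  linear_combination -x * h

/-- The length of any code is a weighted average of two numbers that are at least the common value
of the envelopes; for minimizers both are equal to it. -/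
theorem isOptimalCode_of_argmin (h : envelope S.prob 0 x = envelope S.prob 1 x)
    (h₀ : IsArgmin S.prob 0 x T₀) (h₁ : IsArgmin S.prob 1 x T₁) : IsOptimalCode S.prob T₀ T₁ := by
  refine ⟨h₀.1, h₁.1, fun U₀ hU₀ U₁ hU₁ => ?_⟩
  have e1 := stationary_add (T₀ := T₀) (T₁ := T₁) S.prob
  have e2 := stationary_add (T₀ := U₀) (T₁ := U₁) S.prob
  rw [aifvLen_eq S T₀ T₁ x, aifvLen_eq S U₀ U₁ x, ← h₀.envelope_eq, ← h₁.envelope_eq, ← h,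
    ← add_mul, e1, one_mul]
  have h3 := mul_le_mul_of_nonneg_left (envelope_le S hU₀ x) (stationary_nonneg S U₀ U₁ 0)
  have h4 := mul_le_mul_of_nonneg_left (envelope_le S hU₁ x) (stationary_nonneg S U₀ U₁ 1)
  rw [← h] at h4
  calc envelope S.prob 0 x = (stationary S.prob U₀ U₁ 0 + stationary S.prob U₀ U₁ 1) *
        envelope S.prob 0 x := by rw [e2, one_mul]
    _ ≤ _ := by rw [add_mul]; exact add_le_add h3 h4

/-- Comparison with the tree of the dynamic program. It ensures that the data of an arbitrary
minimizer, not only of one built by the program, fit into words. -/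
theorem IsArgmin.totalLen_le {a e : ℤ} (hn : 2 ≤ n) (ha : 0 ≤ a) (hae : a ≤ e) (he : 1 ≤ e)
    (heb : e ≤ 2 ^ (2 * (b + 1))) (h : IsArgmin S.prob s ((a : ℝ) / e) T) :
    T.totalLen S ≤ (n + 2) * 2 ^ b := by
  obtain ⟨U, hU, h1⟩ := exists_tree_cost_eq S s hn ha hae he heb
  have he' : (0 : ℝ) < e := by exact_mod_cast he
  have hpos : (0 : ℝ) < 2 ^ b * e := by positivity
  have h2 := h.2 U hU
  rw [← mul_le_mul_iff_left₀ hpos, line_mul S h.1 he, line_mul S hU he] at h2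
  have h3 : e * T.totalLen S + a * T.masterWeight S ≤ e * U.totalLen S + a * U.masterWeight S := by
    have h2' : e * T.totalLen S + a * T.masterWeight S - a * ((s : ℕ) * 2 ^ b) ≤
      e * U.totalLen S + a * U.masterWeight S - a * ((s : ℕ) * 2 ^ b) := by exact_mod_cast h2
    linarith
  have h4 : 0 ≤ T.masterWeight S := sum_nonneg fun j _ => by split_ifs <;> positivity
  have h5 := Source.opt_le_mul (S := S) (a := a) (e := e) (i := 0) (k := 1) (v := s) (m := 0)
    (by linarith)
  have h6 : ((s : ℕ) : ℤ) ≤ 1 := by omega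
  have h7 : (0 : ℤ) ≤ e * 2 ^ b := by positivity
  have h8 : e * T.totalLen S ≤ e * ((n + 2) * 2 ^ b) := by nlinarith
  exact le_of_mul_le_mul_left h8 (by linarith)

end Envelope

/-- Between two points whose distance is small compared with the differences of slopes, the
minimum of a family of lines with integer coefficients is attained by the lines that are minimal
at one of the two points. -/
theorem min_line_le {a₀ b₀ a₁ b₁ a c K : ℤ} {l r x : ℝ} (hlr : (r - l) * K ^ 2 < 1)
    (hlx : l ≤ x) (hxr : x ≤ r) (h0 : b₀ - c ≤ K) (h1 : c - b₁ ≤ K) (hl : a₀ + b₀ * l ≤ a + c * l)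
    (hr : a₁ + b₁ * r ≤ a + c * r) : min (a₀ + b₀ * x) (a₁ + b₁ * x) ≤ a + c * x := by
  by_contra hlt
  rw [not_le, lt_min_iff] at hlt
  obtain ⟨g0, g1⟩ := hlt
  have p0 : (0 : ℝ) < b₀ - c := by
    by_contra hneg
    nlinarith
  have p1 : (0 : ℝ) < c - b₁ := by
    by_contra hneg
    nlinarith
  have q0 : (b₀ - c : ℝ) ≤ K := by exact_mod_cast h0
  have q1 : (c - b₁ : ℝ) ≤ K := by exact_mod_cast h1
  -- This integer is the distance between the crossings of the third line with the other two,
  -- multiplied by the two slope differences. It is positive because the third line is strictly the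
  -- lowest at `x`; but both crossings lie in `[l, r]`, so it is at most `(r - l) * K ^ 2 < 1`.
  have hint : (1 : ℤ) ≤ (a₁ - a) * (b₀ - c) - (a - a₀) * (c - b₁) := by
    have : (0 : ℝ) < (a₁ - a) * (b₀ - c) - (a - a₀) * (c - b₁) := by nlinarith
    have : (0 : ℤ) < (a₁ - a) * (b₀ - c) - (a - a₀) * (c - b₁) := by exact_mod_cast this
    omega
  have hint' : (1 : ℝ) ≤ (a₁ - a) * (b₀ - c) - (a - a₀) * (c - b₁) := by exact_mod_cast hint
  have hup : ((a₁ - a) * (b₀ - c) - (a - a₀) * (c - b₁) : ℝ) ≤ (b₀ - c) * (c - b₁) * (r - l) := by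
    nlinarith
  have hK : ((b₀ - c) * (c - b₁) : ℝ) ≤ K ^ 2 := by
    rw [sq]; exact mul_le_mul q0 q1 p1.le (by linarith)
  have hrl : 0 ≤ r - l := by linarith
  nlinarith

end

section

open CodeTree
variable {n b : ℕ} {S : Source n b} {s : Fin 2}

/-! ## The intersection of the envelopes -/

namespace CodeTree

/-- The slope of the line of `T`, multiplied by `2 ^ b`. -/
def lineSlope (S : Source n b) (s : Fin 2) (T : CodeTree n) : ℤ := T.masterWeight S - (s : ℕ) * 2 ^ b

variable {T : CodeTree n}

theorem masterWeight_nonneg (S : Source n b) (T : CodeTree n) : 0 ≤ T.masterWeight S :=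
  sum_nonneg fun j _ => by split_ifs <;> positivity

theorem masterWeight_le (S : Source n b) (T : CodeTree n) : T.masterWeight S ≤ 2 ^ b := by
  have : (2 : ℤ) ^ b = ∑ j, (S.weight j : ℤ) := by exact_mod_cast S.weight_sum.symm
  rw [this]
  exact sum_le_sum fun j _ => by split_ifs <;> simp

theorem two_pow_mul_line (S : Source n b) (hT : T ∈ treeSet n s) (x : ℝ) :
    2 ^ b * line S.prob s T x = T.totalLen S + T.lineSlope S s * x := by
  have h1 := two_pow_mul_avgLen S T
  have h2 := two_pow_mul_masterProb S T
  have h3 := eq_sub_iff_add_eq.2 (leafProb_add_masterProb S hT)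
  have hs : s = 0 ∨ s = 1 := by omega
  rw [lineSlope]; push_cast
  rw [← h1, ← h2]
  rcases hs with rfl | rfl
  · rw [line_zero]; simp; ring
  · rw [line_one, h3]; simp; ring

end CodeTree

/-- The sign of the slopes of the lines of `T_s`. -/
def slopeSign (s : Fin 2) : ℤ := if s = 0 then 1 else -1

theorem HoldsLine.eq {σ : St} {rL rS : Reg} {T : CodeTree n} (hT : T ∈ treeSet n s)
    (h : HoldsLine S σ s rL rS T) :
    σ.reg rL = T.totalLen S ∧ slopeSign s * σ.reg rS = T.lineSlope S s ∧ 0 ≤ σ.reg rS ∧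
      σ.reg rS ≤ 2 ^ b := by
  obtain ⟨h1, h2⟩ := h
  have h3 := eq_sub_iff_add_eq.2 (leafProb_add_masterProb S hT)
  have h4 := two_pow_mul_masterProb S T
  have h5 := masterWeight_nonneg S T
  have h6 := masterWeight_le S T
  have hs : s = 0 ∨ s = 1 := by omega
  rw [two_pow_mul_avgLen] at h1
  refine ⟨by exact_mod_cast h1, ?_⟩
  rcases hs with rfl | rfl
  · rw [switchProb, if_pos rfl, h4] at h2
    have h7 : σ.reg rS = T.masterWeight S := by exact_mod_cast h2
    rw [h7]
    simp [slopeSign, lineSlope, h5, h6]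
  · rw [switchProb, if_neg (by simp), h3, mul_sub, h4, mul_one] at h2
    have h7 : σ.reg rS = 2 ^ b - T.masterWeight S := by exact_mod_cast h2
    rw [h7]
    simp [slopeSign, lineSlope, h5, h6]

/-- On a short interval the envelope is the minimum of the two lines that are minimal at its
ends. -/
theorem envelope_eq_min {T U : CodeTree n} {l r x : ℝ} (hn : 2 ≤ n)
    (hlr : r - l = 1 / 2 ^ (2 * (b + 1))) (hlx : l ≤ x) (hxr : x ≤ r)
    (hT : IsArgmin S.prob s l T) (hU : IsArgmin S.prob s r U) :
    envelope S.prob s x = min (line S.prob s T x) (line S.prob s U x) := by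
  refine le_antisymm (le_min (envelope_le S hT.1 x) (envelope_le S hU.1 x))
    (le_envelope (treeSet_nonempty S s hn) fun V hV => ?_)
  have hpos : (0 : ℝ) < 2 ^ b := by positivity
  have h1 := mul_le_mul_of_nonneg_left (hT.2 V hV) hpos.le
  have h2 := mul_le_mul_of_nonneg_left (hU.2 V hV) hpos.le
  rw [← mul_le_mul_iff_right₀ hpos, mul_min_of_nonneg _ _ hpos.le]
  rw [two_pow_mul_line S hT.1, two_pow_mul_line S hV] at *
  rw [two_pow_mul_line S hU.1] at *
  have m1 := masterWeight_nonneg S T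
  have m2 := masterWeight_le S T
  have m3 := masterWeight_nonneg S U
  have m4 := masterWeight_le S U
  have m5 := masterWeight_nonneg S V
  have m6 := masterWeight_le S V
  -- Scaled slopes of one family differ by at most `2 ^ b`, and `(r - l) * (2 ^ b) ^ 2 = 1 / 4`.
  refine min_line_le (K := 2 ^ b) ?_ hlx hxr ?_ ?_ h1 h2
  · rw [hlr]; push_cast
    have : (2 : ℝ) ^ (2 * (b + 1)) = 4 * (2 ^ b) ^ 2 := by ring
    rw [this]
    field_simp; norm_num
  · simp only [lineSlope]; linarith
  · simp only [lineSlope]; linarith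

namespace Cmd

open Expr

/-- The lines `A₀ + q₀ x` and `A₁ - q₁ x` meet at `x = (A₁ - A₀) / (q₀ + q₁)`. -/
def crossNum (i j : Fin 2) : Expr Reg Arr := sub (.reg (.endLen 1 j)) (.reg (.endLen 0 i))

def crossDen (i j : Fin 2) : Expr Reg Arr := add (.reg (.endSwt 0 i)) (.reg (.endSwt 1 j))

/-- Values of the two families of lines at `scratch 0 / scratch 1`, multiplied by `scratch 1`. -/
def valueZero (i : Fin 2) : Expr Reg Arr :=
  add (mul (.reg (.endLen 0 i)) (.reg (.scratch 1))) (mul (.reg (.endSwt 0 i)) (.reg (.scratch 0)))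

def valueOne (j : Fin 2) : Expr Reg Arr :=
  sub (mul (.reg (.endLen 1 j)) (.reg (.scratch 1))) (mul (.reg (.endSwt 1 j)) (.reg (.scratch 0)))

/-- The number of violated conditions. -/
def violations (i j : Fin 2) : Expr Reg Arr :=
  add (add (add (add
    (lt (.reg (.scratch 1)) (.const 1))
    (lt (mul (.reg (.scratch 0)) (.reg .grid)) (mul (.reg .lo) (.reg (.scratch 1)))))
    (lt (mul (.reg .hi) (.reg (.scratch 1))) (mul (.reg (.scratch 0)) (.reg .grid))))
    -- In `Fin 2`, `1 - i` is the other end: each chosen line has to be the lower one of its family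
    -- at the crossing.
    (lt (valueZero (1 - i)) (valueZero i)))
    (lt (valueOne (1 - j)) (valueOne j))

/-- Intersect a line of `T_0` with a line of `T_1`, and record the result if it is the intersection
of the envelopes. -/
def tryPair (i j : Fin 2) : Prg :=
  .block [.assign (.scratch 0) (crossNum i j), .assign (.scratch 1) (crossDen i j),
    .ite (violations i j) .skip
      (.block [.assign .xnum (.reg (.scratch 0)), .assign .xden (.reg (.scratch 1))])]

def intersect : Prg := .block [tryPair 0 0, tryPair 0 1, tryPair 1 0, tryPair 1 1]

end Cmd

open Cmd

/-- The intersection `N / D` of line `i` of `T_0` and line `j` of `T_1` is the intersection of the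
envelopes. -/
structure IsCross (σ : St) (i j : Fin 2) (N D : ℤ) : Prop where
  num_eq : N = σ.reg (.endLen 1 j) - σ.reg (.endLen 0 i)
  den_eq : D = σ.reg (.endSwt 0 i) + σ.reg (.endSwt 1 j)
  pos : 1 ≤ D
  lo_le : σ.reg .lo * D ≤ N * σ.reg .grid
  le_hi : N * σ.reg .grid ≤ σ.reg .hi * D
  zero_le : σ.reg (.endLen 0 i) * D + σ.reg (.endSwt 0 i) * N ≤
    σ.reg (.endLen 0 (1 - i)) * D + σ.reg (.endSwt 0 (1 - i)) * N
  one_le : σ.reg (.endLen 1 j) * D - σ.reg (.endSwt 1 j) * N ≤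
    σ.reg (.endLen 1 (1 - j)) * D - σ.reg (.endSwt 1 (1 - j)) * N

def crossRegs : List Reg :=
  [.lo, .hi, .grid, .endLen 0 0, .endLen 0 1, .endLen 1 0, .endLen 1 1, .endSwt 0 0, .endSwt 0 1,
    .endSwt 1 0, .endSwt 1 1]

theorem mem_crossRegs (i j : Fin 2) : .endLen i j ∈ crossRegs ∧ .endSwt i j ∈ crossRegs := by
  fin_cases i <;> fin_cases j <;> simp [crossRegs]

theorem sum_ite_eq_zero {p₁ p₂ p₃ p₄ p₅ : Prop} [Decidable p₁] [Decidable p₂] [Decidable p₃]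
    [Decidable p₄] [Decidable p₅] :
    ((if p₁ then 1 else 0) + (if p₂ then 1 else 0) + (if p₃ then 1 else 0) +
      (if p₄ then 1 else 0) + (if p₅ then 1 else 0) : ℤ) = 0 ↔ ¬ p₁ ∧ ¬ p₂ ∧ ¬ p₃ ∧ ¬ p₄ ∧ ¬ p₅ := by
  split_ifs <;> simp [*]

/-- The last two clauses allow the four attempts to be chained: a successful attempt records a
crossing, and a later one can at most replace it by another crossing. -/
theorem tryPair_halts {w : ℕ} {M : ℤ} (hM : 2 ≤ M) {σ τ : St} (i j : Fin 2)
    (hw : M ^ (tryPair i j).growth < 2 ^ w)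
    (hb : ∀ r ∈ crossRegs, |σ.reg r| ≤ M) (hr : ∀ r ∈ crossRegs, τ.reg r = σ.reg r) :
    Halts w (tryPair i j) τ (tryPair i j).maxCost (fun υ => (∀ r ∈ crossRegs, υ.reg r = σ.reg r) ∧
      ((∃ N D, IsCross σ i j N D) → ∃ i j, IsCross σ i j (υ.reg .xnum) (υ.reg .xden)) ∧
      ((∃ i j, IsCross σ i j (τ.reg .xnum) (τ.reg .xden)) →
        ∃ i j, IsCross σ i j (υ.reg .xnum) (υ.reg .xden))) := by
  refine Cmd.wp.halts hM crossRegs (fun r h => by rw [hr r h]; exact hb r h) hw ?_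
  have hm := mem_crossRegs
  have hl : .lo ∈ crossRegs ∧ .hi ∈ crossRegs ∧ .grid ∈ crossRegs := by simp [crossRegs]
  have hx : ∀ r ∈ crossRegs, r ≠ .xnum ∧ r ≠ .xden ∧ r ≠ .scratch 0 ∧ r ≠ .scratch 1 := by
    simp [crossRegs]
  simp only [tryPair, Cmd.block, Cmd.wp]
  refine ⟨by simp [crossNum, Expr.RegsIn, hm], by simp [crossNum, Expr.ReadsLe],
    by simp [crossDen, Expr.RegsIn, hm], by simp [crossDen, Expr.ReadsLe],
    ⟨by simp [violations, valueZero, valueOne, Expr.RegsIn, hm, hl],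
      by simp [violations, valueZero, valueOne, Expr.ReadsLe]⟩, ?_⟩
  have hl' := fun s k => hr (.endLen s k) (hm s k).1
  have hs' := fun s k => hr (.endSwt s k) (hm s k).2
  have hlo := hr _ hl.1
  have hhi := hr _ hl.2.1
  have hgr := hr _ hl.2.2
  set N := σ.reg (.endLen 1 j) - σ.reg (.endLen 0 i) with hN
  set D := σ.reg (.endSwt 0 i) + σ.reg (.endSwt 1 j) with hD
  have hviol : (violations i j).eval ((τ.setReg (.scratch 0) N).setReg (.scratch 1) D) = 0 ↔
      IsCross σ i j N D := by
    have h0 : (Reg.scratch 0) ≠ .scratch 1 := by simp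
    simp only [violations, valueZero, valueOne, Expr.eval, WordOp.eval, RamState.setReg_reg_same,
      RamState.setReg_reg_ne _ _ h0, RamState.setReg_reg_ne _ _ (hx _ (hm _ _).1).2.2.1,
      RamState.setReg_reg_ne _ _ (hx _ (hm _ _).1).2.2.2,
      RamState.setReg_reg_ne _ _ (hx _ (hm _ _).2).2.2.1,
      RamState.setReg_reg_ne _ _ (hx _ (hm _ _).2).2.2.2,
      RamState.setReg_reg_ne _ _ (hx _ hl.1).2.2.1, RamState.setReg_reg_ne _ _ (hx _ hl.1).2.2.2,
      RamState.setReg_reg_ne _ _ (hx _ hl.2.1).2.2.1,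
      RamState.setReg_reg_ne _ _ (hx _ hl.2.1).2.2.2,
      RamState.setReg_reg_ne _ _ (hx _ hl.2.2).2.2.1,
      RamState.setReg_reg_ne _ _ (hx _ hl.2.2).2.2.2, hl', hs', hlo, hhi, hgr]
    rw [sum_ite_eq_zero]
    simp only [not_lt]
    exact ⟨fun ⟨h1, h2, h3, h4, h5⟩ => ⟨rfl, rfl, h1, h2, h3, h4, h5⟩,
      fun ⟨_, _, h1, h2, h3, h4, h5⟩ => ⟨h1, h2, h3, h4, h5⟩⟩
  have e1 : (crossNum i j).eval τ = N := by simp [crossNum, Expr.eval, WordOp.eval, hl', hN]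
  have e2 : (crossDen i j).eval (τ.setReg (.scratch 0) N) = D := by
    simp [crossDen, Expr.eval, WordOp.eval, hs', hD]
  rw [e1, e2]
  constructor
  · intro h0
    refine ⟨fun r h => ?_, fun ⟨N', D', h⟩ => ?_, fun ⟨i', j', h⟩ => ⟨i', j', by simpa using h⟩⟩
    · obtain ⟨h1, h2, h3, h4⟩ := hx r h
      simp [h3, h4, hr r h]
    · obtain rfl : N' = N := h.num_eq
      obtain rfl : D' = D := h.den_eq
      exact absurd (hviol.2 h) h0
  · intro h0
    simp only [Expr.RegsIn, Expr.ReadsLe, Expr.eval]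
    refine ⟨by simp, trivial, by simp, trivial, fun r h => ?_, fun _ => ⟨i, j, ?_⟩,
      fun _ => ⟨i, j, ?_⟩⟩
    · obtain ⟨h1, h2, h3, h4⟩ := hx r h
      simp [h1, h2, h3, h4, hr r h]
    · simpa using hviol.1 h0
    · simpa using hviol.1 h0

theorem intersect_halts {w : ℕ} {M : ℤ} (hM : 2 ≤ M) {σ : St}
    (hw : ∀ i j, M ^ (tryPair i j).growth < 2 ^ w) (hb : ∀ r ∈ crossRegs, |σ.reg r| ≤ M)
    (hc : ∃ i j N D, IsCross σ i j N D) :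
    Halts w intersect σ intersect.maxCost
      (fun τ => ∃ i j, IsCross σ i j (τ.reg .xnum) (τ.reg .xden)) := by
  obtain ⟨i, j, hc⟩ := hc
  refine (tryPair_halts hM 0 0 (hw _ _) hb fun _ _ => rfl).block_cons fun τ₁ h1 =>
    (tryPair_halts hM 0 1 (hw _ _) hb h1.1).block_cons fun τ₂ h2 =>
    (tryPair_halts hM 1 0 (hw _ _) hb h2.1).block_cons fun τ₃ h3 =>
    (tryPair_halts hM 1 1 (hw _ _) hb h3.1).block_cons fun τ₄ h4 => Halts.block_nil ?_
  have hi : i = 0 ∨ i = 1 := by omega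
  have hj : j = 0 ∨ j = 1 := by omega
  rcases hi with rfl | rfl <;> rcases hj with rfl | rfl
  · exact h4.2.2 (h3.2.2 (h2.2.2 (h1.2.1 hc)))
  · exact h4.2.2 (h3.2.2 (h2.2.1 hc))
  · exact h4.2.2 (h3.2.1 hc)
  · exact h4.2.1 hc

end

/-! ### Correctness of the intersection step. -/

section

open CodeTree Cmd
variable {n b : ℕ} {S : Source n b} {s : Fin 2}

/-- A word length that suffices for all numbers met, up to the growth of single commands. -/
theorem HoldsLine.abs_le {σ : St} {rL rS : Reg} {T : CodeTree n} {a e : ℤ} (hn : 2 ≤ n)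
    (ha : 0 ≤ a) (hae : a ≤ e) (he : 1 ≤ e) (heb : e ≤ 2 ^ (2 * (b + 1)))
    (hT : IsArgmin S.prob s ((a : ℝ) / e) T) (h : HoldsLine S σ s rL rS T) :
    |σ.reg rL| ≤ 2 ^ (8 * b) ∧ |σ.reg rS| ≤ 2 ^ (8 * b) := by
  obtain ⟨h1, -, h3, h4⟩ := h.eq hT.1
  have h5 : 0 ≤ T.totalLen S := sum_nonneg fun j _ => by positivity
  have h6 := hT.totalLen_le hn ha hae he heb
  have hb := S.bits_pos hn
  have hnb : (n : ℤ) ≤ 2 ^ b := by exact_mod_cast S.le_two_pow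
  obtain ⟨y, hy⟩ : ∃ y : ℤ, y = 2 ^ b := ⟨_, rfl⟩
  have hy2 : 2 ≤ y := by rw [hy]; exact le_self_pow₀ (by norm_num) (by omega)
  have hM : (2 : ℤ) ^ (8 * b) = y ^ 8 := by rw [hy, ← pow_mul, mul_comm]
  rw [← hy] at h4 h6 hnb
  have h3' : y ^ 3 ≤ y ^ 8 := pow_le_pow_right₀ (by linarith) (by norm_num)
  have h1' : y ≤ y ^ 8 := le_self_pow₀ (by linarith) (by norm_num)
  have h7 : (n + 2 : ℤ) * y ≤ y ^ 3 := by
    have : (n + 2 : ℤ) ≤ y * y := by nlinarith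
    calc (n + 2 : ℤ) * y ≤ (y * y) * y := by gcongr
      _ = y ^ 3 := by ring
  rw [hM, h1, abs_of_nonneg h5, abs_of_nonneg h3]
  constructor <;> linarith

section Crossing

variable {σ : St} {A q : Fin 2 → Fin 2 → ℤ}

theorem exists_fin_two_le (f : Fin 2 → ℝ) : ∃ i, f i ≤ f (1 - i) ∧ f i = min (f 0) (f 1) := by
  rcases le_total (f 0) (f 1) with h | h
  · exact ⟨0, h, (min_eq_left h).symm⟩
  · exact ⟨1, h, (min_eq_right h).symm⟩

theorem eq_min_of_le {f : Fin 2 → ℝ} {i : Fin 2} (h : f i ≤ f (1 - i)) :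
    min (f 0) (f 1) = f i := by
  have hi : i = 0 ∨ i = 1 := by omega
  rcases hi with rfl | rfl
  · exact min_eq_left h
  · exact min_eq_right h

/-- The four lines of the trees at the ends of an interval that contains the intersection of the
envelopes. -/
structure EndLines (S : Source n b) (σ : St) (l r : ℝ) : Prop where
  two_le : 2 ≤ n
  grid_eq : σ.reg .grid = 2 ^ (2 * (b + 1))
  lo_nonneg : 0 ≤ σ.reg .lo
  hi_eq : σ.reg .hi = σ.reg .lo + 1
  hi_le : σ.reg .hi ≤ σ.reg .grid
  left_eq : l = (σ.reg .lo : ℝ) / σ.reg .grid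
  right_eq : r = (σ.reg .hi : ℝ) / σ.reg .grid
  left_le : envelope S.prob 0 l ≤ envelope S.prob 1 l
  right_le : envelope S.prob 1 r ≤ envelope S.prob 0 r
  lines : ∀ s : Fin 2,
    (∃ T, IsArgmin S.prob s l T ∧ HoldsLine S σ s (.endLen s 0) (.endSwt s 0) T) ∧
    (∃ T, IsArgmin S.prob s r T ∧ HoldsLine S σ s (.endLen s 1) (.endSwt s 1) T)

/-- The lines, multiplied by `2 ^ b`. -/
def endLine (σ : St) (s side : Fin 2) (x : ℝ) : ℝ :=
  σ.reg (.endLen s side) + (slopeSign s * σ.reg (.endSwt s side) : ℤ) * x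

variable {l r x : ℝ}

theorem EndLines.length (h : EndLines S σ l r) : r - l = 1 / 2 ^ (2 * (b + 1)) := by
  rw [h.left_eq, h.right_eq, h.hi_eq, h.grid_eq]; push_cast; ring

theorem EndLines.grid_pos (h : EndLines S σ l r) : (0 : ℝ) < σ.reg .grid := by
  rw [h.grid_eq]; positivity

theorem EndLines.left_lt (h : EndLines S σ l r) : l < r := by
  have h1 := h.length
  have : (0 : ℝ) < 1 / 2 ^ (2 * (b + 1)) := by positivity
  linarith

theorem EndLines.left_nonneg (h : EndLines S σ l r) : 0 ≤ l := by
  rw [h.left_eq]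
  have h1 := h.grid_pos
  have h2 : (0 : ℝ) ≤ σ.reg .lo := by exact_mod_cast h.lo_nonneg
  positivity

theorem EndLines.exists_tree (h : EndLines S σ l r) (s side : Fin 2) : ∃ T ∈ treeSet n s,
    HoldsLine S σ s (.endLen s side) (.endSwt s side) T ∧
    ∀ x, endLine σ s side x = 2 ^ b * line S.prob s T x := by
  have : ∃ T ∈ treeSet n s, HoldsLine S σ s (.endLen s side) (.endSwt s side) T := by
    obtain ⟨⟨T, h1, h2⟩, U, h3, h4⟩ := h.lines s
    have hs : side = 0 ∨ side = 1 := by omega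
    rcases hs with rfl | rfl
    · exact ⟨T, h1.1, h2⟩
    · exact ⟨U, h3.1, h4⟩
  obtain ⟨T, h1, h2⟩ := this
  refine ⟨T, h1, h2, fun x => ?_⟩
  obtain ⟨e1, e2, -⟩ := h2.eq h1
  rw [endLine, e1, e2, two_pow_mul_line S h1]

theorem EndLines.envelope_eq (h : EndLines S σ l r) (s : Fin 2) (hl : l ≤ x) (hr : x ≤ r) :
    2 ^ b * envelope S.prob s x = min (endLine σ s 0 x) (endLine σ s 1 x) := by
  obtain ⟨⟨T, h1, h2⟩, U, h3, h4⟩ := h.lines s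
  obtain ⟨e1, e2, -⟩ := h2.eq h1.1
  obtain ⟨e3, e4, -⟩ := h4.eq h3.1
  rw [envelope_eq_min h.two_le h.length hl hr h1 h3, mul_min_of_nonneg _ _ (by positivity),
    two_pow_mul_line S h1.1, two_pow_mul_line S h3.1, endLine, endLine, e1, e2, e3, e4]

/-- The intermediate value theorem is applied to the minima of two lines each, which agree with the
scaled envelopes on `[l, r]`; continuity of the envelopes themselves is not needed. -/
theorem EndLines.exists_eq (h : EndLines S σ l r) :
    ∃ x, l ≤ x ∧ x ≤ r ∧ envelope S.prob 0 x = envelope S.prob 1 x := by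
  have hpos : (0 : ℝ) < 2 ^ b := by positivity
  set φ : ℝ → ℝ := fun x => min (endLine σ 0 0 x) (endLine σ 0 1 x) -
    min (endLine σ 1 0 x) (endLine σ 1 1 x) with hφ
  have hcont : Continuous φ := by
    have : ∀ s side, Continuous (endLine σ s side) := by
      intro s side; unfold endLine; fun_prop
    exact ((this 0 0).min (this 0 1)).sub ((this 1 0).min (this 1 1))
  have hval : ∀ x, l ≤ x → x ≤ r →
      φ x = 2 ^ b * (envelope S.prob 0 x - envelope S.prob 1 x) := by
    intro x h1 h2
    rw [hφ, mul_sub, h.envelope_eq 0 h1 h2, h.envelope_eq 1 h1 h2]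
  have hlr := h.left_lt.le
  obtain ⟨x, ⟨hx1, hx2⟩, hx⟩ := intermediate_value_Icc hlr hcont.continuousOn
    (show (0 : ℝ) ∈ Set.Icc (φ l) (φ r) from ⟨by
      rw [hval l le_rfl hlr]; exact mul_nonpos_of_nonneg_of_nonpos hpos.le (by linarith [h.left_le]),
      by rw [hval r hlr le_rfl]; exact mul_nonneg hpos.le (by linarith [h.right_le])⟩)
  refine ⟨x, hx1, hx2, ?_⟩
  rw [hval x hx1 hx2] at hx
  rcases mul_eq_zero.1 hx with h0 | h0
  · exact absurd h0 hpos.ne'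
  · linarith

theorem endLine_zero (side : Fin 2) (x : ℝ) :
    endLine σ 0 side x = σ.reg (.endLen 0 side) + σ.reg (.endSwt 0 side) * x := by
  simp [endLine, slopeSign]

theorem endLine_one (side : Fin 2) (x : ℝ) :
    endLine σ 1 side x = σ.reg (.endLen 1 side) - σ.reg (.endSwt 1 side) * x := by
  simp [endLine, slopeSign]; ring

theorem EndLines.swt_nonneg (h : EndLines S σ l r) (s side : Fin 2) :
    0 ≤ σ.reg (.endSwt s side) ∧ σ.reg (.endSwt s side) ≤ 2 ^ b := by
  obtain ⟨T, h1, h2, -⟩ := h.exists_tree s side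
  exact (h2.eq h1).2.2

/-- The pair is formed by the lines that attain the envelopes at their crossing point `x`. As `x >
0`, the line of `T_1` has nonzero slope there, which makes the denominator positive. -/
theorem EndLines.exists_cross (h : EndLines S σ l r) : ∃ i j N D, IsCross σ i j N D := by
  obtain ⟨x, hl, hr, hx⟩ := h.exists_eq
  have hpos : (0 : ℝ) < 2 ^ b := by positivity
  have hx0 := pos_of_envelope_eq h.two_le (h.left_nonneg.trans hl) hx
  obtain ⟨i, hi, hi'⟩ := exists_fin_two_le fun i => endLine σ 0 i x
  obtain ⟨j, hj, hj'⟩ := exists_fin_two_le fun j => endLine σ 1 j x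
  rw [← h.envelope_eq 0 hl hr] at hi'
  rw [← h.envelope_eq 1 hl hr] at hj'
  have heq : endLine σ 0 i x = endLine σ 1 j x := by rw [hi', hj', hx]
  have hswt : 0 < σ.reg (.endSwt 1 j) := by
    obtain ⟨T, h1, h2, h3⟩ := h.exists_tree 1 j
    rw [h3] at hj'
    have hmin : IsArgmin S.prob 1 x T :=
      isArgmin_of_le h1 (mul_left_cancel₀ hpos.ne' hj').le
    have h4 := mul_pos hpos (hmin.leafProb_pos h.two_le hx0)
    have h5 := h2.2
    rw [switchProb, if_neg (by simp)] at h5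
    rw [← h5] at h4
    exact_mod_cast h4
  have hq := (h.swt_nonneg 0 i).1
  set N := σ.reg (.endLen 1 j) - σ.reg (.endLen 0 i) with hN
  set D := σ.reg (.endSwt 0 i) + σ.reg (.endSwt 1 j) with hD
  have hD1 : 1 ≤ D := by omega
  have hD' : (0 : ℝ) < D := by exact_mod_cast hD1
  have hND : (N : ℝ) = x * D := by
    rw [endLine_zero, endLine_one] at heq
    rw [hN, hD]; push_cast; linarith
  have hg := h.grid_pos
  rw [h.left_eq, div_le_iff₀ hg] at hl
  rw [h.right_eq, le_div_iff₀ hg] at hr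
  refine ⟨i, j, N, D, rfl, rfl, hD1, ?_, ?_, ?_, ?_⟩
  · have : (σ.reg .lo * D : ℝ) ≤ N * σ.reg .grid := by rw [hND]; nlinarith
    exact_mod_cast this
  · have : (N * σ.reg .grid : ℝ) ≤ σ.reg .hi * D := by rw [hND]; nlinarith
    exact_mod_cast this
  · rw [endLine_zero, endLine_zero] at hi
    have := mul_le_mul_of_nonneg_right hi hD'.le
    have : (σ.reg (.endLen 0 i) * D + σ.reg (.endSwt 0 i) * N : ℝ) ≤
        σ.reg (.endLen 0 (1 - i)) * D + σ.reg (.endSwt 0 (1 - i)) * N := by rw [hND]; linarith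
    exact_mod_cast this
  · rw [endLine_one, endLine_one] at hj
    have := mul_le_mul_of_nonneg_right hj hD'.le
    have : (σ.reg (.endLen 1 j) * D - σ.reg (.endSwt 1 j) * N : ℝ) ≤
        σ.reg (.endLen 1 (1 - j)) * D - σ.reg (.endSwt 1 (1 - j)) * N := by rw [hND]; linarith
    exact_mod_cast this

/-- The point lies where each envelope is the minimum of its two lines, and the chosen lines attain
these minima. The denominator is a sum of two slopes of size at most `2 ^ b`, hence small enough for
the tree builders. -/
theorem EndLines.of_cross (h : EndLines S σ l r) {i j : Fin 2} {N D : ℤ}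
    (hc : IsCross σ i j N D) : 0 ≤ N ∧ N ≤ D ∧ 1 ≤ D ∧ D ≤ 2 ^ (2 * (b + 1)) ∧
      l ≤ (N : ℝ) / D ∧ (N : ℝ) / D ≤ r ∧
      envelope S.prob 0 ((N : ℝ) / D) = envelope S.prob 1 ((N : ℝ) / D) := by
  obtain ⟨c1, c2, c3, c4, c5, c6, c7⟩ := hc
  have hD' : (0 : ℝ) < D := by exact_mod_cast c3
  have hg := h.grid_pos
  have hg' : 0 < σ.reg .grid := by exact_mod_cast hg
  have hl : l ≤ (N : ℝ) / D := by
    rw [h.left_eq, div_le_div_iff₀ hg hD']; exact_mod_cast c4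
  have hr : (N : ℝ) / D ≤ r := by
    rw [h.right_eq, div_le_div_iff₀ hD' hg]; exact_mod_cast c5
  have hN : (N : ℝ) / D * D = N := div_mul_cancel₀ _ hD'.ne'
  refine ⟨?_, ?_, c3, ?_, hl, hr, ?_⟩
  · have h1 := mul_nonneg h.lo_nonneg (by omega : 0 ≤ D)
    by_contra hneg
    nlinarith
  · have h1 := mul_le_mul_of_nonneg_right h.hi_le (by omega : 0 ≤ D)
    by_contra hneg
    nlinarith
  · have h1 := (h.swt_nonneg 0 i).2
    have h2 := (h.swt_nonneg 1 j).2
    have h3 : (2 : ℤ) ^ (b + 1) ≤ 2 ^ (2 * (b + 1)) := pow_le_pow_right₀ (by norm_num) (by omega)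
    rw [pow_succ] at h3
    linarith
  · have hpos : (0 : ℝ) < 2 ^ b := by positivity
    refine mul_left_cancel₀ hpos.ne' ?_
    rw [h.envelope_eq 0 hl hr, h.envelope_eq 1 hl hr]
    rw [eq_min_of_le (f := fun i => endLine σ 0 i ((N : ℝ) / D)) (i := i),
      eq_min_of_le (f := fun j => endLine σ 1 j ((N : ℝ) / D)) (i := j)]
    · refine mul_right_cancel₀ hD'.ne' ?_
      rw [endLine_zero, endLine_one, add_mul, sub_mul, mul_assoc, mul_assoc, hN, c1, c2]
      push_cast; ring
    · rw [← mul_le_mul_iff_left₀ hD', endLine_one, endLine_one, sub_mul, sub_mul, mul_assoc,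
        mul_assoc, hN]
      exact_mod_cast c7
    · rw [← mul_le_mul_iff_left₀ hD', endLine_zero, endLine_zero, add_mul, add_mul, mul_assoc,
        mul_assoc, hN]
      exact_mod_cast c6

theorem EndLines.abs_le (h : EndLines S σ l r) : ∀ r ∈ crossRegs, |σ.reg r| ≤ 2 ^ (8 * b) := by
  have hn := h.two_le
  have hb := S.bits_pos hn
  have hg : σ.reg .grid ≤ 2 ^ (8 * b) := by
    rw [h.grid_eq]; exact pow_le_pow_right₀ (by norm_num) (by omega)
  have hg1 : 1 ≤ σ.reg .grid := by rw [h.grid_eq]; exact one_le_pow₀ (by norm_num)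
  have hlo := h.lo_nonneg
  have hhi := h.hi_eq
  have hle := h.hi_le
  have key : ∀ s, (|σ.reg (.endLen s 0)| ≤ 2 ^ (8 * b) ∧ |σ.reg (.endSwt s 0)| ≤ 2 ^ (8 * b)) ∧
      |σ.reg (.endLen s 1)| ≤ 2 ^ (8 * b) ∧ |σ.reg (.endSwt s 1)| ≤ 2 ^ (8 * b) := by
    intro s
    obtain ⟨⟨T, h1, h2⟩, U, h3, h4⟩ := h.lines s
    rw [h.left_eq] at h1
    rw [h.right_eq] at h3
    exact ⟨h2.abs_le hn hlo (by omega) hg1 h.grid_eq.le h1,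
      h4.abs_le hn (by omega) hle hg1 h.grid_eq.le h3⟩
  simp only [crossRegs, List.mem_cons, List.not_mem_nil, or_false, forall_eq_or_imp, forall_eq]
  refine ⟨?_, ?_, ?_, (key 0).1.1, (key 0).2.1, (key 1).1.1, (key 1).2.1, (key 0).1.2, (key 0).2.2,
    (key 1).1.2, (key 1).2.2⟩
  all_goals rw [abs_of_nonneg (by omega)]; omega

end Crossing

theorem pow_growth_lt (S : Source n b) (hn : 2 ≤ n) {C g : ℕ} (hC : 8 * g < C) :
    ((2 : ℤ) ^ (8 * b)) ^ g < 2 ^ (C * b) := by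
  rw [← pow_mul]
  refine pow_lt_pow_right₀ (by norm_num) ?_
  calc 8 * b * g = 8 * g * b := by ring
    _ < C * b := Nat.mul_lt_mul_of_pos_right hC (S.bits_pos hn)

theorem intersect_findsIntersection : ∃ C₀, ∀ C ≥ C₀, FindsIntersection C intersect := by
  refine ⟨intersect.maxCost + 8 * (tryPair 0 0).growth + 1, fun C hC n b S σ hn hL hgrid hlo hhi hle
    l r hl hr h1 h2 h3 => ?_⟩
  have hE : EndLines S σ l r := ⟨hn, hgrid, hlo, hhi, hle, hl, hr, h1, h2, h3⟩
  have hb := S.bits_pos hn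
  obtain ⟨t, τ, e1, e2, i, j, e3⟩ := intersect_halts (w := C * b)
    (le_self_pow₀ (by norm_num) (by omega) : (2 : ℤ) ≤ 2 ^ (8 * b))
    (fun i j => pow_growth_lt S hn (g := (tryPair i j).growth) (by
      have : (tryPair i j).growth = (tryPair 0 0).growth := rfl
      omega)) hE.abs_le hE.exists_cross
  refine ⟨t, τ, e1, by omega, fun r r1 r2 r3 => e1.reg_eq ?_, fun x x1 => e1.arr_eq ?_,
    hE.of_cross e3⟩
  · simp [intersect, tryPair, Cmd.block, Cmd.KeepsReg, r1, r2, r3]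
  · simp [intersect, tryPair, Cmd.block, Cmd.KeepsArr]

end

section

open CodeTree Cmd
variable {n b : ℕ} {S : Source n b} {s : Fin 2}

/-! ## The binary search -/

/-- `r` is not changed by the tree-building subroutines. -/
def IsOuter (r : Reg) : Prop :=
  r ≠ .num ∧ r ≠ .den ∧ (∀ s, r ≠ .len s) ∧ (∀ s, r ≠ .swt s) ∧ ∀ i, r ≠ .scratch i

/-- `τ` results from `σ` by calling both tree-building subroutines at `a / e`. -/
structure Called (S : Source n b) (σ τ : St) (a e : ℤ) : Prop where
  reg_eq : ∀ r, IsOuter r → τ.reg r = σ.reg r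
  weight_eq : τ.arr .weight = σ.arr .weight
  trees : ∀ s, ∃ T, IsArgmin S.prob s ((a : ℝ) / e) T ∧ Represents τ s T ∧
    HoldsLine S τ s (.len s) (.swt s) T

theorem Represents.congr {σ τ : St} {T : CodeTree n} (h : Represents σ s T)
    (ha : ∀ f, τ.arr (.tree s f) = σ.arr (.tree s f)) : Represents τ s T := by
  unfold Represents at *
  simpa only [ha] using h

theorem HoldsLine.congr {σ τ : St} {T : CodeTree n} {r₁ r₂ r₃ r₄ : Reg}
    (h : HoldsLine S σ s r₁ r₂ T) (h1 : τ.reg r₃ = σ.reg r₁) (h2 : τ.reg r₄ = σ.reg r₂) :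
    HoldsLine S τ s r₃ r₄ T := by
  unfold HoldsLine at *
  rwa [h1, h2]

theorem Loaded.congr {σ τ : St} (h : Loaded S σ) (h1 : τ.reg .size = σ.reg .size)
    (h2 : τ.reg .bits = σ.reg .bits) (h3 : τ.arr .weight = σ.arr .weight) : Loaded S τ := by
  unfold Loaded at *
  rwa [h1, h2, h3]

variable {K C : ℕ} {dp : Fin 2 → Prg} {σ : St}

theorem den_le_word (hn : 2 ≤ n) (S : Source n b) {x : ℤ} (h0 : 0 ≤ x)
    (h : x ≤ 2 ^ (2 * (b + 1))) : |x| ≤ 2 ^ (8 * b) := by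
  have := S.bits_pos hn
  rw [abs_of_nonneg h0]
  exact h.trans (pow_le_pow_right₀ (by norm_num) (by omega))

theorem two_le_word (hn : 2 ≤ n) (S : Source n b) : (2 : ℤ) ≤ 2 ^ (8 * b) :=
  le_self_pow₀ (by norm_num) (by have := S.bits_pos hn; omega)

/-- `num` is overwritten before `r₂` is read, whence `hr₂`. The second call spares the result of the
first, because the two subroutines write to different result registers and tree arrays. -/
theorem callTrees_halts (hdp : ∀ s, BuildsTreeWithin K C s (dp s)) (hC : 100 ≤ C) (hn : 2 ≤ n)
    (hL : Loaded S σ) {r₁ r₂ : Reg} (hr₂ : r₂ ≠ .num) (h0 : 0 ≤ σ.reg r₁)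
    (h1 : σ.reg r₁ ≤ σ.reg r₂) (h2 : 1 ≤ σ.reg r₂) (h3 : σ.reg r₂ ≤ 2 ^ (2 * (b + 1))) :
    Halts (C * b) (callTrees dp (.reg r₁) (.reg r₂)) σ (2 * (K * n ^ 5) + 5)
      (fun τ => Called S σ τ (σ.reg r₁) (σ.reg r₂)) := by
  have hM := two_le_word hn S
  have hw := fun (g : ℕ) (hg : 8 * g < 100) => pow_growth_lt S hn (g := g) (hg.trans_le hC)
  set σ' := (σ.setReg .num (σ.reg r₁)).setReg .den (σ.reg r₂) with hσ'
  have hnum : σ'.reg .num = σ.reg r₁ := by simp [hσ']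
  have hden : σ'.reg .den = σ.reg r₂ := by simp [hσ']
  have hL' : Loaded S σ' := hL.congr (by simp [hσ']) (by simp [hσ']) rfl
  obtain ⟨t₀, τ₀, e1, e2, e3, e4, T₀, e5, e6, e7⟩ := hdp 0 n b S σ' hn hL' (by rwa [hnum])
    (by rwa [hnum, hden]) (by rwa [hden]) (by rwa [hden])
  have hL₀ : Loaded S τ₀ := hL'.congr (e3 _ (by simp) (by simp) (by simp))
    (e3 _ (by simp) (by simp) (by simp)) (e4 _ (by simp) (by simp))
  have hnum₀ : τ₀.reg .num = σ.reg r₁ := by rw [e3 _ (by simp) (by simp) (by simp), hnum]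
  have hden₀ : τ₀.reg .den = σ.reg r₂ := by rw [e3 _ (by simp) (by simp) (by simp), hden]
  obtain ⟨t₁, τ₁, f1, f2, f3, f4, T₁, f5, f6, f7⟩ := hdp 1 n b S τ₀ hn hL₀ (by rwa [hnum₀])
    (by rwa [hnum₀, hden₀]) (by rwa [hden₀]) (by rwa [hden₀])
  rw [hnum, hden] at e5
  rw [hnum₀, hden₀] at f5
  have a1 : Halts (C * b) (.assign .num (.reg r₁)) σ 2 (fun τ => τ = σ.setReg .num (σ.reg r₁)) :=
    Cmd.wp.halts hM [r₁] (by simpa using den_le_word hn S h0 (h1.trans h3))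
      (hw 1 (by norm_num)) (by simp [Cmd.wp, Expr.RegsIn, Expr.ReadsLe, Expr.eval])
  have a2 : Halts (C * b) (.assign .den (.reg r₂)) (σ.setReg .num (σ.reg r₁)) 2
      (fun τ => τ = σ') :=
    Cmd.wp.halts hM [r₂] (by simpa [hr₂] using den_le_word hn S (h0.trans h1) h3)
      (hw 1 (by norm_num)) (by simp [Cmd.wp, Expr.RegsIn, Expr.ReadsLe, Expr.eval, hσ', hr₂])
  refine (a1.block_cons (T₂ := 2 + (K * n ^ 5 + (K * n ^ 5 + 1))) fun τ hτ => ?_).mono (by omega)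
    fun _ => id
  subst hτ
  refine a2.block_cons fun τ hτ => ?_
  subst hτ
  refine Halts.block_cons (Q := fun τ => τ = τ₀) ⟨t₀, τ₀, e1, e2, rfl⟩ fun τ hτ => ?_
  subst hτ
  refine Halts.block_cons (Q := fun τ => τ = τ₁) ⟨t₁, τ₁, f1, f2, rfl⟩ fun τ' hτ => ?_
  subst hτ
  refine Halts.block_nil ⟨fun r hr => ?_, ?_, fun s => ?_⟩
  · obtain ⟨o1, o2, o3, o4, o5⟩ := hr
    rw [f3 r (o3 1) (o4 1) o5, e3 r (o3 0) (o4 0) o5]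
    simp [hσ', o1, o2]
  · rw [f4 _ (by simp) (by simp), e4 _ (by simp) (by simp)]; rfl
  · have hs : s = 0 ∨ s = 1 := by omega
    rcases hs with rfl | rfl
    · refine ⟨T₀, e5, e6.congr fun f => f4 _ (by simp) (by simp), e7.congr ?_ ?_⟩
      · exact f3 _ (by simp) (by simp) (by simp)
      · exact f3 _ (by simp) (by simp) (by simp)
    · exact ⟨T₁, f5, f6, f7⟩

/-- The state after `k` halving steps. -/
structure Search (S : Source n b) (σ : St) (k : ℕ) : Prop where
  loaded : Loaded S σ
  le : k ≤ 2 * (b + 1)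
  grid_eq : σ.reg .grid = 2 ^ (2 * (b + 1))
  lo_nonneg : 0 ≤ σ.reg .lo
  hi_eq : σ.reg .hi = σ.reg .lo + 2 ^ (2 * (b + 1) - k)
  hi_le : σ.reg .hi ≤ σ.reg .grid
  steps_eq : σ.reg .steps = k
  interval_eq : ((σ.reg .lo : ℝ) / 2 ^ (2 * (b + 1)), (σ.reg .hi : ℝ) / 2 ^ (2 * (b + 1))) =
    searchInterval S.prob k
  left_le : envelope S.prob 0 ((σ.reg .lo : ℝ) / 2 ^ (2 * (b + 1))) ≤
    envelope S.prob 1 ((σ.reg .lo : ℝ) / 2 ^ (2 * (b + 1)))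
  right_le : envelope S.prob 1 ((σ.reg .hi : ℝ) / 2 ^ (2 * (b + 1))) ≤
    envelope S.prob 0 ((σ.reg .hi : ℝ) / 2 ^ (2 * (b + 1)))

theorem Search.grid_pos {k : ℕ} (h : Search S σ k) : 1 ≤ σ.reg .grid := by
  rw [h.grid_eq]; exact one_le_pow₀ (by norm_num)

/-- The comparison is made after multiplication by `2 ^ b * e`, which turns both envelope values
into integers. -/
theorem Called.val_lt_iff {τ : St} {a e : ℤ} (h : Called S σ τ a e) (he : 1 ≤ e) :
    e * τ.reg (.len 0) + a * τ.reg (.swt 0) < e * τ.reg (.len 1) - a * τ.reg (.swt 1) ↔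
      envelope S.prob 0 ((a : ℝ) / e) < envelope S.prob 1 ((a : ℝ) / e) := by
  obtain ⟨T₀, h1, -, h2, h3⟩ := h.trees 0
  obtain ⟨T₁, h4, -, h5, h6⟩ := h.trees 1
  have he' : (0 : ℝ) < e := by exact_mod_cast he
  have hpos : (0 : ℝ) < 2 ^ b * e := by positivity
  rw [h1.envelope_eq, h4.envelope_eq, ← mul_lt_mul_iff_left₀ hpos, line_zero, line_one]
  have e1 : (avgLen S.prob T₀ + masterProb S.prob T₀ * (a / e)) * (2 ^ b * e) =
      ((e * τ.reg (.len 0) + a * τ.reg (.swt 0) : ℤ) : ℝ) := by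
    push_cast; rw [h2, h3, switchProb, if_pos rfl]; field_simp
  have e2 : (avgLen S.prob T₁ - leafProb S.prob T₁ * (a / e)) * (2 ^ b * e) =
      ((e * τ.reg (.len 1) - a * τ.reg (.swt 1) : ℤ) : ℝ) := by
    push_cast; rw [h5, h6, switchProb, if_neg (by simp)]; field_simp
  rw [e1, e2, Int.cast_lt]

/-- The part of a halving step after the calls of the subroutines. -/
def halvingTail : Prg :=
  .block [
    .assign (.val 0) (.op .add (.op .mul (.reg .grid) (.reg (.len 0)))
      (.op .mul (.reg .mid) (.reg (.swt 0)))),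
    .assign (.val 1) (.op .sub (.op .mul (.reg .grid) (.reg (.len 1)))
      (.op .mul (.reg .mid) (.reg (.swt 1)))),
    .ite (.op .lt (.reg (.val 0)) (.reg (.val 1)))
      (.assign .lo (.reg .mid)) (.assign .hi (.reg .mid)),
    .assign .steps (.op .add (.reg .steps) (.const 1))]

/-- A bound for the words needed outside of the subroutines. -/
def searchWord : ℕ := 8 * halvingTail.growth + 100

theorem halvingStep_halts (hdp : ∀ s, BuildsTreeWithin K C s (dp s)) (hC : searchWord ≤ C)
    (hn : 2 ≤ n) {k : ℕ} (h : Search S σ k) (hk : k < 2 * (b + 1)) :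
    Halts (C * b) (halvingStep dp) σ (2 * (K * n ^ 5) + 100) (fun τ => Search S τ (k + 1)) := by
  have hM := two_le_word hn S
  have hC100 : 100 ≤ C := by unfold searchWord at hC; omega
  have hw := fun (g : ℕ) (hg : 8 * g < 100) => pow_growth_lt S hn (g := g) (hg.trans_le hC100)
  have hg := h.grid_eq
  have hg1 := h.grid_pos
  have hlo := h.lo_nonneg
  have hhi := h.hi_eq
  have hle := h.hi_le
  obtain ⟨j, hj⟩ : ∃ j, 2 * (b + 1) - k = j + 1 := ⟨2 * (b + 1) - k - 1, by omega⟩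
  have hj' : 2 * (b + 1) - (k + 1) = j := by omega
  have hpj : (1 : ℤ) ≤ 2 ^ j := one_le_pow₀ (by norm_num)
  rw [hj, pow_succ] at hhi
  set mid := σ.reg .lo + 2 ^ j with hmid
  -- In grid units the interval has length `2 ^ (j + 1)`, so the division by `2` is exact.
  have hdiv : (σ.reg .lo + σ.reg .hi) / 2 = mid := by omega
  have a1 : Halts (C * b) (.assign .mid (.op .div (.op .add (.reg .lo) (.reg .hi)) (.const 2))) σ 6
      (fun τ => τ = σ.setReg .mid mid) := by
    refine Cmd.wp.halts hM [.lo, .hi] ?_ (hw 5 (by norm_num)) ?_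
    · simp only [List.mem_cons, List.not_mem_nil, or_false, forall_eq_or_imp, forall_eq]
      exact ⟨den_le_word hn S hlo (by omega), den_le_word hn S (by omega) (by omega)⟩
    · simp [Cmd.wp, Expr.RegsIn, Expr.ReadsLe, Expr.eval, WordOp.eval, hdiv]
  refine (a1.block_cons (T₂ := (2 * (K * n ^ 5) + 5) + halvingTail.maxCost) fun τ hτ => ?_).mono ?_
    fun _ => id
  swap
  · have : halvingTail.maxCost ≤ 80 := by decide
    omega
  subst hτ
  have hmidg : mid ≤ σ.reg .grid := by omega
  have hL' : Loaded S (σ.setReg .mid mid) := h.loaded.congr (by simp) (by simp) rfl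
  refine (callTrees_halts hdp hC100 hn hL' (r₁ := .mid) (r₂ := .grid) (by simp) (by simp; omega)
    (by simpa using hmidg) (by simpa using hg1) (by simpa using hg.le)).block_cons fun τ hτ => ?_
  simp only [RamState.setReg_reg_same, RamState.setReg_reg_ne _ _ (show Reg.grid ≠ .mid by simp),
    hg] at hτ
  have hτr : ∀ r, IsOuter r → r ≠ .mid → τ.reg r = σ.reg r := by
    intro r hr hr'
    rw [hτ.reg_eq r hr, RamState.setReg_reg_ne _ _ hr']
  have hτmid : τ.reg .mid = mid := by rw [hτ.reg_eq _ (by simp [IsOuter])]; simp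
  have hτlo := hτr .lo (by simp [IsOuter]) (by simp)
  have hτhi := hτr .hi (by simp [IsOuter]) (by simp)
  have hτgr := hτr .grid (by simp [IsOuter]) (by simp)
  have hτst := hτr .steps (by simp [IsOuter]) (by simp)
  have hτL : Loaded S τ := h.loaded.congr (hτr _ (by simp [IsOuter]) (by simp))
    (hτr _ (by simp [IsOuter]) (by simp)) hτ.weight_eq
  have hpow1 : (1 : ℤ) ≤ 2 ^ (2 * (b + 1)) := one_le_pow₀ (by norm_num)
  have hiff := hτ.val_lt_iff hpow1
  have hline : ∀ s, |τ.reg (.len s)| ≤ 2 ^ (8 * b) ∧ |τ.reg (.swt s)| ≤ 2 ^ (8 * b) := by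
    intro s
    obtain ⟨T, t1, t2, t3⟩ := hτ.trees s
    exact t3.abs_le hn (by omega) (by omega) hpow1 le_rfl t1
  have hgrow : ((2 : ℤ) ^ (8 * b)) ^ halvingTail.growth < 2 ^ (C * b) :=
    pow_growth_lt S hn (by unfold searchWord at hC; omega)
  refine Cmd.wp.halts hM [.grid, .mid, .steps, .len 0, .len 1, .swt 0, .swt 1] ?_ hgrow ?_
  · simp only [List.mem_cons, List.not_mem_nil, or_false, forall_eq_or_imp, forall_eq]
    refine ⟨?_, ?_, ?_, (hline 0).1, (hline 1).1, (hline 0).2, (hline 1).2⟩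
    · rw [hτgr]; exact den_le_word hn S (by omega) hg.le
    · rw [hτmid]; exact den_le_word hn S (by omega) (by omega)
    · rw [hτst, h.steps_eq]
      refine den_le_word hn S (by positivity) ?_
      have : k < 2 ^ (2 * (b + 1)) := hk.trans (Nat.lt_two_pow_self)
      exact_mod_cast this.le
  have hinterval := h.interval_eq
  have hmidR : ((mid : ℤ) : ℝ) / 2 ^ (2 * (b + 1)) = ((σ.reg .lo : ℝ) / 2 ^ (2 * (b + 1)) +
      (σ.reg .hi : ℝ) / 2 ^ (2 * (b + 1))) / 2 := by
    rw [hhi, hmid]; push_cast; ring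
  have hsucc : searchInterval S.prob (k + 1) =
      if envelope S.prob 0 ((mid : ℝ) / 2 ^ (2 * (b + 1))) <
        envelope S.prob 1 ((mid : ℝ) / 2 ^ (2 * (b + 1)))
      then ((mid : ℝ) / 2 ^ (2 * (b + 1)), (σ.reg .hi : ℝ) / 2 ^ (2 * (b + 1)))
      else ((σ.reg .lo : ℝ) / 2 ^ (2 * (b + 1)), (mid : ℝ) / 2 ^ (2 * (b + 1))) := by
    rw [searchInterval, ← hinterval, hmidR]
  push_cast at hiff
  rw [lt_sub_iff_add_lt] at hiff
  simp [halvingTail, Cmd.block, Cmd.wp, Expr.RegsIn, Expr.ReadsLe, Expr.eval, WordOp.eval, hτmid,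
    hτgr, hτst, hg]
  constructor
  · intro hlt
    rw [hiff] at hlt
    rw [if_pos hlt] at hsucc
    refine ⟨hτL.congr (by simp) (by simp) rfl, hk, ?_, ?_, ?_, ?_, ?_, ?_, ?_, ?_⟩
    · simp [hτgr, hg]
    · simp; omega
    · simp [hτhi, hj', hhi]; omega
    · simp [hτhi, hτgr, hle]
    · simp [h.steps_eq]
    · simp [hτhi, hsucc]
    · simpa using hlt.le
    · simpa [hτhi] using h.right_le
  · intro hge
    rw [← not_lt, hiff] at hge
    rw [if_neg hge] at hsucc
    refine ⟨hτL.congr (by simp) (by simp) rfl, hk, ?_, ?_, ?_, ?_, ?_, ?_, ?_, ?_⟩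
    · simp [hτgr, hg]
    · simp [hτlo, hlo]
    · simp [hτlo, hj', hmid]
    · simp [hτgr, hmidg]
    · simp [h.steps_eq]
    · simp [hτlo, hsucc]
    · simpa [hτlo] using h.left_le
    · simpa using not_lt.1 hge

end

/-! ### The complete search: grid, halving loop, end points, final trees. -/

section

open CodeTree Cmd
variable {n b : ℕ} {S : Source n b} {s : Fin 2}
variable {K C : ℕ} {dp : Fin 2 → Prg} {σ : St}

theorem Search.congr {τ : St} {k : ℕ} (h : Search S σ k)
    (hr : ∀ r ∈ [Reg.size, .bits, .grid, .lo, .hi, .steps], τ.reg r = σ.reg r)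
    (ha : τ.arr .weight = σ.arr .weight) : Search S τ k := by
  simp only [List.mem_cons, List.not_mem_nil, or_false, forall_eq_or_imp, forall_eq] at hr
  obtain ⟨h1, h2, h3, h4, h5, h6⟩ := hr
  obtain ⟨a1, a2, a3, a4, a5, a6, a7, a8, a9, a10⟩ := h
  exact ⟨a1.congr h1 h2 ha, a2, by rw [h3, a3], by rw [h4]; exact a4, by rw [h5, h4, a5],
    by rw [h5, h3]; exact a6, by rw [h6, a7], by rw [h4, h5]; exact a8, by rw [h4]; exact a9,
    by rw [h5]; exact a10⟩

def gridStep : Prg :=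
  .block [
    .assign .grid (.op .mul (.const 2) (.reg .grid)),
    .assign .count (.op .add (.reg .count) (.const 1))]

theorem bits_le_word (hn : 2 ≤ n) (S : Source n b) {k : ℕ} (h : k ≤ 2 * (b + 1)) :
    |(k : ℤ)| ≤ 2 ^ (8 * b) := by
  refine den_le_word hn S (by positivity) ?_
  have : k < 2 ^ (2 * (b + 1)) := h.trans_lt Nat.lt_two_pow_self
  exact_mod_cast this.le

theorem gridLoop_halts (hC : 100 ≤ C) (hn : 2 ≤ n) (hL : Loaded S σ) (hg : σ.reg .grid = 1)
    (hc : σ.reg .count = 0) :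
    Halts (C * b) (.loop (.op .lt (.reg .count) (.op .mul (.const 2)
      (.op .add (.reg .bits) (.const 1)))) gridStep) σ ((2 * (b + 1) + 1) * 17)
      (fun τ => Loaded S τ ∧ τ.reg .grid = 2 ^ (2 * (b + 1))) := by
  have hM := two_le_word hn S
  have hw := fun (g : ℕ) (hg : 8 * g < 100) => pow_growth_lt S hn (g := g) (hg.trans_le hC)
  refine (Halts.loop (T := 9) (I := fun j τ => ∃ k, j + k = 2 * (b + 1) ∧ Loaded S τ ∧
    τ.reg .grid = 2 ^ k ∧ τ.reg .count = k) ?_ ?_ (2 * (b + 1)) ⟨0, rfl, hL, by simpa using hg,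
      by simpa using hc⟩).mono (by simp [Expr.cost]) ?_
  · rintro j τ ⟨k, h1, h2, h3, h4⟩
    refine Expr.fits_of_pow_cost_lt hM (P := [.count, .bits]) ?_ (by simp [Expr.RegsIn])
      (by simp [Expr.ReadsLe]) (hw 7 (by norm_num))
    simp only [List.mem_cons, List.not_mem_nil, or_false, forall_eq_or_imp, forall_eq]
    rw [h4, h2.2.1]
    exact ⟨bits_le_word hn S (by omega), bits_le_word hn S (by omega)⟩
  · rintro j τ ⟨k, h1, h2, h3, h4⟩ hne
    have hk : k < 2 * (b + 1) := by
      by_contra hk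
      refine hne ?_
      simp [Expr.eval, WordOp.eval, h4, h2.2.1]
      omega
    refine (Cmd.wp.halts hM [.grid, .count] ?_ (hw 9 (by norm_num)) ?_).mono (by decide)
      fun _ => id
    · simp only [List.mem_cons, List.not_mem_nil, or_false, forall_eq_or_imp, forall_eq]
      rw [h3, h4]
      exact ⟨den_le_word hn S (by positivity) (pow_le_pow_right₀ (by norm_num) (by omega)),
        bits_le_word hn S hk.le⟩
    · simp only [gridStep, Cmd.block, Cmd.wp, Expr.RegsIn, Expr.ReadsLe]
      refine ⟨by simp, by simp, by simp, by simp, j - 1, by omega, k + 1, by omega,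
        h2.congr (by simp) (by simp) rfl, ?_, ?_⟩
      · simp [Expr.eval, WordOp.eval, h3]; ring
      · simp [Expr.eval, WordOp.eval, h4]
  · rintro τ ⟨⟨j, k, h1, h2, h3, h4⟩, h0⟩
    have : ¬ (k < 2 * (b + 1)) := by
      intro hk
      simp [Expr.eval, WordOp.eval, h4, h2.2.1] at h0
      omega
    obtain rfl : k = 2 * (b + 1) := by omega
    exact ⟨h2, h3⟩

/-- The bracketing inequalities hold initially by `E_0(0) < E_1(0)` and `E_1(1) ≤ E_0(1)`. -/
theorem Search.start (hn : 2 ≤ n) (hL : Loaded S σ) (hg : σ.reg .grid = 2 ^ (2 * (b + 1)))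
    (hlo : σ.reg .lo = 0) (hhi : σ.reg .hi = σ.reg .grid) (hst : σ.reg .steps = 0) :
    Search S σ 0 := by
  have hone : (σ.reg .hi : ℝ) / 2 ^ (2 * (b + 1)) = 1 := by
    rw [hhi, hg]; push_cast; exact div_self (by positivity)
  have hzero : (σ.reg .lo : ℝ) / 2 ^ (2 * (b + 1)) = 0 := by rw [hlo]; simp
  refine ⟨hL, Nat.zero_le _, hg, hlo.ge, by rw [hhi, hlo, hg]; simp, hhi.le, by simpa using hst,
    ?_, ?_, ?_⟩
  · rw [hone, hzero]; rfl
  · rw [hzero]; exact (envelope_lt_at_zero S hn).le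
  · rw [hone]; exact envelope_le_at_one S hn

theorem halvingLoop_halts (hdp : ∀ s, BuildsTreeWithin K C s (dp s)) (hC : searchWord ≤ C)
    (hn : 2 ≤ n) (h : Search S σ 0) :
    Halts (C * b) (.loop (.op .sub (.op .sub (.reg .hi) (.reg .lo)) (.const 1)) (halvingStep dp)) σ
      ((2 * (b + 1) + 1) * (2 * (K * n ^ 5) + 106)) (fun τ => Search S τ (2 * (b + 1))) := by
  have hM := two_le_word hn S
  have hC100 : 100 ≤ C := by unfold searchWord at hC; omega
  have hw := fun (g : ℕ) (hg : 8 * g < 100) => pow_growth_lt S hn (g := g) (hg.trans_le hC100)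
  -- After `k` steps the length in grid units is `2 ^ (2 * (b + 1) - k)`, which equals `1` only at
  -- the last step.
  have hcond : ∀ {τ : St} {k}, Search S τ k →
      ((Expr.op .sub (.op .sub (.reg .hi) (.reg .lo)) (.const 1) : Expr Reg Arr).eval τ = 0 ↔
        k = 2 * (b + 1)) := by
    intro τ k hk
    have h1 := hk.hi_eq
    have h2 := hk.le
    have : (Expr.op .sub (.op .sub (.reg .hi) (.reg .lo)) (.const 1) : Expr Reg Arr).eval τ =
        2 ^ (2 * (b + 1) - k) - 1 := by
      simp [Expr.eval, WordOp.eval, h1]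
    rw [this, sub_eq_zero]
    constructor
    · intro h3
      by_contra hne
      obtain ⟨j, hj⟩ : ∃ j, 2 * (b + 1) - k = j + 1 := ⟨2 * (b + 1) - k - 1, by omega⟩
      rw [hj, pow_succ] at h3
      omega
    · rintro rfl; simp
  refine (Halts.loop (T := 2 * (K * n ^ 5) + 100) (I := fun j τ => ∃ k, j + k = 2 * (b + 1) ∧
    Search S τ k) ?_ ?_ (2 * (b + 1)) ⟨0, rfl, h⟩).mono (by simp [Expr.cost]) ?_
  · rintro j τ ⟨k, -, hk⟩
    refine Expr.fits_of_pow_cost_lt hM (P := [.hi, .lo]) ?_ (by simp [Expr.RegsIn])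
      (by simp [Expr.ReadsLe]) (hw 5 (by norm_num))
    have h1 := hk.grid_eq
    have h2 := hk.hi_le
    have h3 := hk.lo_nonneg
    have h4 := hk.hi_eq
    have h5 : (0 : ℤ) < 2 ^ (2 * (b + 1) - k) := by positivity
    simp only [List.mem_cons, List.not_mem_nil, or_false, forall_eq_or_imp, forall_eq]
    exact ⟨den_le_word hn S (by omega) (by omega), den_le_word hn S (by omega) (by omega)⟩
  · rintro j τ ⟨k, hjk, hk⟩ hne
    have hlt : k < 2 * (b + 1) := lt_of_le_of_ne hk.le fun h => hne ((hcond hk).2 h)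
    refine (halvingStep_halts hdp hC hn hk hlt).mono le_rfl fun υ hυ => ?_
    exact ⟨j - 1, by omega, k + 1, by omega, hυ⟩
  · rintro τ ⟨⟨j, k, -, hk⟩, h0⟩
    obtain rfl := (hcond hk).1 h0
    exact hk

/-- `saveLines side` leaves `r` unchanged. -/
def NotSaved (side : Fin 2) (r : Reg) : Prop := ∀ s, r ≠ .endLen s side ∧ r ≠ .endSwt s side

theorem saveLines_halts (hC : 100 ≤ C) (hn : 2 ≤ n) (S : Source n b) (side : Fin 2)
    (hb : ∀ s, |σ.reg (.len s)| ≤ 2 ^ (8 * b) ∧ |σ.reg (.swt s)| ≤ 2 ^ (8 * b)) :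
    Halts (C * b) (saveLines side) σ 9 (fun τ =>
      (∀ s, τ.reg (.endLen s side) = σ.reg (.len s) ∧ τ.reg (.endSwt s side) = σ.reg (.swt s)) ∧
      (∀ r, NotSaved side r → τ.reg r = σ.reg r) ∧ τ.arr = σ.arr) := by
  have hM := two_le_word hn S
  have hw := pow_growth_lt S hn (g := 1) (lt_of_lt_of_le (by norm_num) hC)
  refine (Cmd.wp.halts hM [.len 0, .len 1, .swt 0, .swt 1] (by simp [hb]) hw ?_).mono (by decide +revert)
    fun _ => id
  simp [saveLines, Cmd.block, Cmd.wp, Expr.RegsIn, Expr.ReadsLe, Expr.eval]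
  intro r hr
  have h0 := hr 0
  have h1 := hr 1
  simp [h0, h1]

theorem Called.line_le {τ : St} {a e : ℤ} (hn : 2 ≤ n) (h : Called S σ τ a e) (ha : 0 ≤ a)
    (hae : a ≤ e) (he : 1 ≤ e) (heb : e ≤ 2 ^ (2 * (b + 1))) (s : Fin 2) :
    |τ.reg (.len s)| ≤ 2 ^ (8 * b) ∧ |τ.reg (.swt s)| ≤ 2 ^ (8 * b) := by
  obtain ⟨T, t1, t2, t3⟩ := h.trees s
  exact t3.abs_le hn ha hae he heb t1

/-- The registers of the given end hold lines that are minimal at `a / e`. -/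
def Saved (S : Source n b) (σ : St) (side : Fin 2) (a e : ℤ) : Prop :=
  ∀ s : Fin 2, ∃ T, IsArgmin S.prob s ((a : ℝ) / e) T ∧
    HoldsLine S σ s (.endLen s side) (.endSwt s side) T

theorem Saved.congr {τ : St} {side : Fin 2} {a e : ℤ} (h : Saved S σ side a e)
    (hr : ∀ s, τ.reg (.endLen s side) = σ.reg (.endLen s side) ∧
      τ.reg (.endSwt s side) = σ.reg (.endSwt s side)) : Saved S τ side a e := by
  intro s
  obtain ⟨T, h1, h2⟩ := h s
  exact ⟨T, h1, h2.congr (hr s).1 (hr s).2⟩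

/-- The remaining commands `cs` appear as a continuation, so that both ends can be treated one after
the other; the lines saved for the opposite end survive. -/
theorem saveEnd_halts (hdp : ∀ s, BuildsTreeWithin K C s (dp s)) (hC : 100 ≤ C)
    (hn : 2 ≤ n) {k : ℕ} (h : Search S σ k) (side : Fin 2) {r : Reg} (hr : r = .lo ∨ r = .hi)
    {cs : List Prg} {T : ℕ} {Q : St → Prop}
    (hcs : ∀ τ, Search S τ k → Saved S τ side (τ.reg r) (τ.reg .grid) →
      (∀ s, τ.reg (.endLen s (1 - side)) = σ.reg (.endLen s (1 - side)) ∧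
        τ.reg (.endSwt s (1 - side)) = σ.reg (.endSwt s (1 - side))) →
      (τ.reg .lo = σ.reg .lo) → (τ.reg .grid = σ.reg .grid) → Halts (C * b) (.block cs) τ T Q) :
    Halts (C * b) (.block (callTrees dp (.reg r) (.reg .grid) :: saveLines side :: cs)) σ
      (2 * (K * n ^ 5) + 5 + (9 + T)) Q := by
  have hg := h.grid_eq
  have hg1 := h.grid_pos
  have hlo := h.lo_nonneg
  have hhi := h.hi_eq
  have hle := h.hi_le
  have hp : (0 : ℤ) < 2 ^ (2 * (b + 1) - k) := by positivity
  have hr0 : 0 ≤ σ.reg r ∧ σ.reg r ≤ σ.reg .grid := by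
    rcases hr with rfl | rfl <;> constructor <;> omega
  refine (callTrees_halts hdp hC hn h.loaded (by simp) hr0.1 hr0.2 hg1 hg.le).block_cons
    fun τ hτ => (saveLines_halts hC hn S side fun s => hτ.line_le hn hr0.1 hr0.2 hg1 hg.le s).block_cons
    fun υ hυ => ?_
  obtain ⟨u1, u2, u3⟩ := hυ
  have hreg : ∀ r, IsOuter r → NotSaved side r → υ.reg r = σ.reg r := by
    intro r h1 h2
    rw [u2 r h2, hτ.reg_eq r h1]
  have hlist : ∀ r ∈ [Reg.size, .bits, .grid, .lo, .hi, .steps], υ.reg r = σ.reg r := by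
    intro r hr
    simp only [List.mem_cons, List.not_mem_nil, or_false] at hr
    rcases hr with rfl | rfl | rfl | rfl | rfl | rfl <;>
      exact hreg _ (by simp [IsOuter]) (by simp [NotSaved])
  have hrr : υ.reg r = σ.reg r := hlist r (by rcases hr with rfl | rfl <;> simp)
  refine hcs υ (h.congr hlist (by rw [u3, hτ.weight_eq])) ?_ (fun s => ⟨?_, ?_⟩)
    (hlist _ (by simp)) (hlist _ (by simp))
  · rw [hrr, hlist .grid (by simp)]
    intro s
    obtain ⟨T, t1, t2, t3⟩ := hτ.trees s
    exact ⟨T, t1, t3.congr (u1 s).1 (u1 s).2⟩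
  all_goals
    refine hreg _ (by simp [IsOuter]) ?_
    intro s'
    simp
    intro _
    omega

/-- The final state of the binary search. -/
structure Finished (S : Source n b) (τ : St) : Prop where
  steps_eq : τ.reg .steps = ((2 * (b + 1) : ℕ) : ℤ)
  interval_eq : ((τ.reg .lo : ℝ) / 2 ^ (2 * (b + 1)), (τ.reg .hi : ℝ) / 2 ^ (2 * (b + 1))) =
    searchInterval S.prob (2 * (b + 1))
  hi_eq : τ.reg .hi = τ.reg .lo + 1
  lo_nonneg : 0 ≤ τ.reg .lo
  den_pos : 0 < τ.reg .xden
  mem_Icc : (τ.reg .xnum : ℝ) / τ.reg .xden ∈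
    Set.Icc ((τ.reg .lo : ℝ) / 2 ^ (2 * (b + 1))) ((τ.reg .hi : ℝ) / 2 ^ (2 * (b + 1)))
  envelope_eq : envelope S.prob 0 ((τ.reg .xnum : ℝ) / τ.reg .xden) =
    envelope S.prob 1 ((τ.reg .xnum : ℝ) / τ.reg .xden)
  trees : ∀ s, ∃ T, IsArgmin S.prob s ((τ.reg .xnum : ℝ) / τ.reg .xden) T ∧ Represents τ s T

theorem finish_halts {isect : Prg} (hdp : ∀ s, BuildsTreeWithin K C s (dp s))
    (hint : FindsIntersection C isect) (hC : 100 ≤ C) (hn : 2 ≤ n)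
    (h : Search S σ (2 * (b + 1))) (h0 : Saved S σ 0 (σ.reg .lo) (σ.reg .grid))
    (h1 : Saved S σ 1 (σ.reg .hi) (σ.reg .grid)) :
    Halts (C * b) (.block [isect, callTrees dp (.reg .xnum) (.reg .xden)]) σ
      (C + (2 * (K * n ^ 5) + 5 + 1)) (Finished S) := by
  have hg := h.grid_eq
  have hgR : (σ.reg .grid : ℝ) = 2 ^ (2 * (b + 1)) := by rw [hg]; push_cast; rfl
  have hhi : σ.reg .hi = σ.reg .lo + 1 := by have := h.hi_eq; simpa using this
  obtain ⟨t, τ, e1, e2, e3, e4, e5, e6, e7, e8, e9, e10, e11⟩ := hint n b S σ hn h.loaded hg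
    h.lo_nonneg hhi h.hi_le _ _ rfl rfl (by rw [hgR]; exact h.left_le)
    (by rw [hgR]; exact h.right_le) (fun s => ⟨h0 s, h1 s⟩)
  refine Halts.block_cons (Q := fun υ => υ = τ) ⟨t, τ, e1, e2, rfl⟩ fun υ hυ => ?_
  subst hυ
  have hL : Loaded S υ := h.loaded.congr (e3 _ (by simp) (by simp) (by simp))
    (e3 _ (by simp) (by simp) (by simp)) (e4 _ (by simp))
  refine (callTrees_halts hdp hC hn hL (by simp) e5 e6 e7 e8).block_cons fun ρ hρ =>
    Halts.block_nil ?_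
  have hr : ∀ r, IsOuter r → r ≠ .xnum → r ≠ .xden → ρ.reg r = σ.reg r := by
    intro r h1 h2 h3
    rw [hρ.reg_eq r h1, e3 r h2 h3 h1.2.2.2.2]
  have r1 := hr .steps (by simp [IsOuter]) (by simp) (by simp)
  have r2 := hr .lo (by simp [IsOuter]) (by simp) (by simp)
  have r3 := hr .hi (by simp [IsOuter]) (by simp) (by simp)
  have r4 := hρ.reg_eq .xnum (by simp [IsOuter])
  have r5 := hρ.reg_eq .xden (by simp [IsOuter])
  rw [hgR] at e9 e10
  refine ⟨by rw [r1, h.steps_eq], by rw [r2, r3, h.interval_eq], by rw [r2, r3, hhi],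
    by rw [r2]; exact h.lo_nonneg, by rw [r5]; omega, ?_, ?_, ?_⟩
  · rw [r2, r3, r4, r5]; exact ⟨e9, e10⟩
  · rw [r4, r5]; exact e11
  · rw [r4, r5]
    intro s
    obtain ⟨T, t1, t2, -⟩ := hρ.trees s
    exact ⟨T, t1, t2⟩

theorem binarySearch_halts {isect : Prg} (hdp : ∀ s, BuildsTreeWithin K C s (dp s))
    (hint : FindsIntersection C isect) (hC : searchWord ≤ C) (hK : 2 * (16 * K + 700) ≤ C)
    (hn : 2 ≤ n) (hL : Loaded S σ) :
    Halts (C * b) (binarySearch dp isect) σ (C * (n ^ 5 * b)) (Finished S) := by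
  have hM := two_le_word hn S
  have hb := S.bits_pos hn
  have hC100 : 100 ≤ C := by omega
  have hw := fun (g : ℕ) (hg : 8 * g < 100) => pow_growth_lt S hn (g := g) (hg.trans_le hC100)
  have assign : ∀ {τ : St} {r : Reg} {z : ℤ}, |z| ≤ 2 →
      Halts (C * b) (.assign r (.const z)) τ 2 (fun υ => υ = τ.setReg r z) := by
    intro τ r z hz
    exact Cmd.wp.halts hM [] (by simp) (hw 1 (by norm_num))
      (by simp [Cmd.wp, Expr.RegsIn, Expr.ReadsLe, Expr.eval, hz])
  refine ((assign (by norm_num)).block_cons fun τ₁ h1 => (assign (by norm_num)).block_cons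
    fun τ₂ h2 => (gridLoop_halts hC100 hn (S := S) ?_ ?_ ?_).block_cons fun τ₃ ⟨h3, h3'⟩ =>
    (assign (by norm_num)).block_cons fun τ₄ h4 =>
    Halts.block_cons (Q := fun υ => υ = τ₄.setReg .hi (τ₄.reg .grid)) (T₁ := 2) ?_ fun τ₅ h5 =>
    (assign (by norm_num)).block_cons fun τ₆ h6 =>
    (halvingLoop_halts hdp hC hn (S := S) (Search.start hn ?_ ?_ ?_ ?_ ?_)).block_cons fun τ₇ h7 =>
    saveEnd_halts hdp hC100 hn h7 0 (.inl rfl) fun τ₈ h8 h8' _ _ _ =>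
    saveEnd_halts hdp hC100 hn h8 1 (.inr rfl) fun τ₉ h9 h9' h9'' h10 h11 =>
    finish_halts hdp hint hC100 hn h9 ?_ h9').mono ?_ fun _ => id
  · subst h2; subst h1
    exact hL.congr (by simp) (by simp) rfl
  · subst h2; subst h1; simp
  · subst h2; simp
  · refine Cmd.wp.halts hM [.grid] ?_ (hw 1 (by norm_num))
      (by simp [Cmd.wp, Expr.RegsIn, Expr.ReadsLe, Expr.eval])
    subst h4
    simp [h3']
    exact pow_le_pow_right₀ (by norm_num) (by omega)
  · subst h6; subst h5; subst h4
    exact h3.congr (by simp) (by simp) rfl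
  · subst h6; subst h5; subst h4; simp [h3']
  · subst h6; subst h5; subst h4; simp
  · subst h6; subst h5; subst h4; simp
  · subst h6; simp
  · rw [h10, h11]
    exact h8'.congr h9''
  -- One half of `C` pays for the intersection, whose cost `C` is at most `C * (n ^ 5 * b) / 2`. The
  -- other half pays for the rest: `2 * (b + 1) + 1 ≤ 5 * b` rounds and three further evaluations
  -- call each tree builder, which costs at most `16 * K * (n ^ 5 * b)`; the bookkeeping is covered
  -- by `700`.
  · have hq : 2 ≤ n ^ 5 := hn.trans (Nat.le_self_pow (by norm_num) _)
    generalize n ^ 5 = q at hq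
    have h1 : 1 ≤ q * b := Nat.mul_pos (by omega) hb
    have h2 : 2 ≤ q * b := by nlinarith
    have h3 : b ≤ q * b := Nat.le_mul_of_pos_left _ (by omega)
    have h4 : q ≤ q * b := Nat.le_mul_of_pos_right _ hb
    have h5 : K * q ≤ K * (q * b) := Nat.mul_le_mul_left _ h4
    have h6 : K * q * b = K * (q * b) := by ring
    have h7 : 2 * (16 * K + 700) * (q * b) ≤ C * (q * b) := Nat.mul_le_mul_right _ hK
    have h8 : C * 2 ≤ C * (q * b) := Nat.mul_le_mul_left _ h2
    nlinarith

end

/-! ### The theorem. -/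

section

theorem BuildsTreeWithin.mono {K K' C : ℕ} {s : Fin 2} {dp : Prg}
    (h : BuildsTreeWithin K C s dp) (hK : K ≤ K') : BuildsTreeWithin K' C s dp := by
  intro n b S σ hn hL h0 h1 h2 h3
  obtain ⟨t, τ, e1, e2, e3⟩ := h n b S σ hn hL h0 h1 h2 h3
  exact ⟨t, τ, e1, e2.trans (Nat.mul_le_mul_right _ hK), e3⟩

theorem mainTheorem1 :
    ∃ (C : ℕ) (dp : Fin 2 → Prg) (isect : Prg),
      (∀ s, BuildsTree C s (dp s)) ∧ FindsIntersection C isect ∧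
      ∀ (n b : ℕ) (S : Source n b) (σ : St), 2 ≤ n → Loaded S σ →
        ∃ (t : ℕ) (τ : St) (l r x : ℝ) (T₀ T₁ : CodeTree n),
          Exec (C * b) (binarySearch dp isect) σ t τ ∧
          t ≤ C * (n ^ 5 * b) ∧
          τ.reg .steps = 2 * (b + 1) ∧
          l = (τ.reg .lo : ℝ) / 2 ^ (2 * (b + 1)) ∧
          r = (τ.reg .hi : ℝ) / 2 ^ (2 * (b + 1)) ∧
          (l, r) = searchInterval S.prob (2 * (b + 1)) ∧
          r - l = 1 / 2 ^ (2 * (b + 1)) ∧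
          x = (τ.reg .xnum : ℝ) / τ.reg .xden ∧
          0 < τ.reg .xden ∧
          x ∈ Set.Icc l r ∧
          (∀ y : ℝ, envelope S.prob 0 y = envelope S.prob 1 y ↔ y = x) ∧
          (∀ U₀ U₁ : CodeTree n, IsArgmin S.prob 0 x U₀ → IsArgmin S.prob 1 x U₁ →
            IsOptimalCode S.prob U₀ U₁) ∧
          Represents τ 0 T₀ ∧ Represents τ 1 T₁ ∧
          IsArgmin S.prob 0 x T₀ ∧ IsArgmin S.prob 1 x T₁ ∧
          IsOptimalCode S.prob T₀ T₁ := by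
  obtain ⟨C₀, hC₀⟩ := intersect_findsIntersection
  -- The time constant `K` of the tree builders is fixed first. `C` has to be large compared with
  -- `K`, and longer words do not change the running time of the subroutines.
  let K := buildFactor 0 + buildFactor 1
  let C := C₀ + buildWord 0 + buildWord 1 + searchWord + 2 * (16 * K + 700)
  have hword : ∀ s, buildWord s ≤ C := by
    refine Fin.forall_fin_two.2 ⟨?_, ?_⟩ <;> omega
  have hfactor : ∀ s, buildFactor s ≤ K := by
    refine Fin.forall_fin_two.2 ⟨?_, ?_⟩ <;> omega
  have hdp : ∀ s, BuildsTreeWithin K C s (Cmd.buildTree s) := fun s =>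
    (buildTree_buildsTreeWithin s (hword s)).mono (hfactor s)
  have hint : FindsIntersection C Cmd.intersect := hC₀ C (by omega)
  refine ⟨C, Cmd.buildTree, Cmd.intersect, fun s => (hdp s).buildsTree (by omega), hint, ?_⟩
  intro n b S σ hn hL
  obtain ⟨t, τ, hexec, htime, h⟩ := binarySearch_halts (S := S) hdp hint (by omega) (by omega) hn hL
  obtain ⟨T₀, hT₀, hr₀⟩ := h.trees 0
  obtain ⟨T₁, hT₁, hr₁⟩ := h.trees 1
  have hlo : (0 : ℝ) ≤ (τ.reg .lo : ℝ) / 2 ^ (2 * (b + 1)) :=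
    div_nonneg (by exact_mod_cast h.lo_nonneg) (by positivity)
  refine ⟨t, τ, _, _, _, T₀, T₁, hexec, htime, ?_, rfl, rfl, h.interval_eq, ?_, rfl, h.den_pos,
    h.mem_Icc, fun y => envelope_eq_iff hn (hlo.trans h.mem_Icc.1) h.envelope_eq,
    fun U₀ U₁ hU₀ hU₁ => isOptimalCode_of_argmin h.envelope_eq hU₀ hU₁, hr₀, hr₁, hT₀, hT₁,
    isOptimalCode_of_argmin h.envelope_eq hT₀ hT₁⟩
  · rw [h.steps_eq]; push_cast; ring
  · rw [h.hi_eq]; push_cast; ring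

end
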